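/- **Setting.** Let $(\Omega,\mathscr F,\mathbb Q)$ be a complete probability space with a filtration $(\mathscr F_t)_{t\ge 0}$ satisfying the usual hypotheses and $\mathscr F=\bigvee_t\mathscr F_t$. Let $U$ be a locally compact Hausdorff space with countable basis, $\nu$ a finite Borel measure on $U$ with $\nu(U)>0$, and $\Pi(\mathrm du,\mathrm dt)$ an adapted point measure on $U\times\mathbb R_+$ which under $\mathbb Q$ is a Poisson point process with intensity $\nu(\mathrm du)\,\mathrm dt$; $\xi$ is an extra noise, and for every $t$ the restriction of $\Pi$ to $U\times(t,\infty)$ is $\mathbb Q$-independent of $\mathscr F_t\vee\sigma(\xi)$. Put $N(t)=\Pi(U\times[0,t])$. Let $\mathscr H$ be a separable complex Hilbert space. The random bounded operators $H(t)=H(t)^\dagger$, $J_j(u,t)$, $L_k(t)$ (countably many $j,k$) are measurable functions of $\xi$ and of the trajectory of $\Pi$ in $[0,t)$; they are adapted, strongly left continuous with right limits in $t$, and $(u,t)\mapsto J_j(u,t)$ is jointly measurable. Let $$R(t)=\sum_j\int_U\nu(\mathrm du)\,J_j(u,t)^\dagger J_j(u,t),\qquad R_0(t)=\sum_k L_k(t)^\dagger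 L_k(t)$$ be strongly convergent. Assume that for every $t$ the integrals $\int_0^t\|H(s)\|\mathrm ds$, $\int_0^t\|R(s)\|\mathrm ds$, $\int_0^t\|R_0(s)\|\mathrm ds$ are $\mathbb Q$-essentially bounded and $\|J_j(u,s)\|$ is bounded uniformly in $j$, $u$, $s\le t$ and the random arguments. Put $\mathcal J(u,t)[\rho]=\sum_j J_j(u,t)\rho J_j(u,t)^\dagger$ and $$\mathcal L_0(t)[\rho]=-\mathrm i[H(t),\rho]+\sum_k L_k(t)\rho L_k(t)^\dagger-\tfrac12\{R_0(t),\rho\}.$$ Let $\rho_0$ and $\sigma_v$ be statistical operators, and let $\sigma(t)$ be the trace class valued solution, adapted and right continuous with left limits in trace norm, of the linear stochastic master equation $$\mathrm d\sigma(t)=\mathcal L_0(t)[\sigma(t_-)]\mathrm dt-\tfrac12\{R(t)-\nu(U),\sigma(t_-)\}\mathrm dt+\int_U\big(\mathcal J(u,t)[\sigma(t_-)]-\sigma(t_-)\big)\Pi(\mathrm du,\mathrm dt),\quad\sigma(0)=\rho_0 ,$$ understood weakly (tested with all bounded operators). Put $p(t)=\operatorname{Tr}\sigma(t)$, $\rho(t)=\sigma(t)/p(t)$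 if $p(t)\ne0$ and $\rho(t)=\sigma_v$ otherwise, and $\lambda(t)=\operatorname{Tr}\{R(t)\rho(t_-)\}$. For a time horizon $\mathsf T$ let $\mathbb P=\mathbb P_{\mathsf T}$ be the measure with density $p(\mathsf T)$ with respect to $\mathbb Q$. Let $\mathcal L_0(t|t_0)$, $R(t|t_0)$ be $\mathcal L_0(t)$, $R(t)$ given no jump after $t_0$, i.e. evaluated at $\xi$ and at the trajectory that keeps only the jumps of $\Pi$ in $[0,t_0]$. The random no-jump propagator $S(t,t_0)$ is defined on trace class operators by $$\frac{\mathrm d}{\mathrm dt}S(t,t_0)[\rho]=\mathcal L_0(t|t_0)\big[S(t,t_0)[\rho]\big]-\tfrac12\big\{R(t|t_0),S(t,t_0)[\rho]\big\},\qquad S(t_0,t_0)=\mathrm{id}$$ (in integrated form, tested with all bounded operators, and continuous in trace norm). Finally let $$\lambda(t|0)=\operatorname{Tr}\Big\{R(t|0)\,\frac{S(t,0)[\rho_0]}{\operatorname{Tr}S(t,0)[\rho_0]}\Big\}$$ be the intensity under the condition of no jump up to $t$. **Claim.** (a) For every $\mathsf T$, $\mathbb P_{\mathsf T}$ is a probability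 measure, and $\mathbb P_{\mathsf T}(F)=\mathbb E_{\mathbb Q}[p(t)1_F]$ for all $F\in\mathscr F_t$, $t\le\mathsf T$. (b) For $t\le\mathsf T$, $\operatorname{Tr}S(t,0)[\rho_0]$ is $\mathbb Q$-integrable and $\mathbb P[N(t)=0]=\mathbb E_{\mathbb Q}\big[\operatorname{Tr}\{S(t,0)[\rho_0]\}\big]$. (c) For $t_0\le t\le\mathsf T$, $\operatorname{Tr}\{S(t,t_0)[\rho(t_0)]\}$ is $\mathbb Q$-integrable and, $\mathbb P$-almost surely, $$\mathbb P[N(t)-N(t_0)=0\mid\mathscr F_{t_0}]=\mathbb E_{\mathbb Q}\big[\operatorname{Tr}\{S(t,t_0)[\rho(t_0)]\}\mid\mathscr F_{t_0}\big].$$ (d) Let $T=\inf\{t:N(t)>0\}\in[0,\infty]$ be the waiting time of the next jump, starting at time $0$. For each $t$, $\lambda(t)=\lambda(t|0)$ $\mathbb Q$-almost surely on $\{N(t)=0\}$. For almost every $t$, $\lambda(t|0)\operatorname{Tr}\{S(t,0)[\rho_0]\}$ is $\mathbb Q$-integrable; let $$p_T(t)=\mathbb E_{\mathbb Q}\big[\lambda(t|0)\operatorname{Tr}\{S(t,0)[\rho_0]\}\big].$$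 For all $t\le\mathsf T$, $p_T$ is integrable on $(0,t]$ and $$\mathbb P[T\le t]=1-\mathbb P[N(t)=0]=\int_0^t p_T(s)\,\mathrm ds ,$$ and $\frac{\mathrm d}{\mathrm dt}\mathbb P[T\le t]=p_T(t)$ for almost every $t\in(0,\mathsf T)$. -/

import Mathlib

open MeasureTheory ProbabilityTheory Filter Topology Set
open scoped NNReal ENNReal

namespace JumpSME

/-! ### Trace class operators -/

section Trace

variable {H : Type*} [NormedAddCommGroup H] [InnerProductSpace ℂ H]

/-- The trace norm of a bounded operator `T` (with value `∞` if `T` is not of trace class), as the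
infimum of `∑ ‖xₙ‖ ‖yₙ‖` over all representations `T = ∑ |xₙ⟩⟨yₙ|`. -/
noncomputable def traceNorm (T : H →L[ℂ] H) : ℝ≥0∞ :=
  ⨅ (x : ℕ → H) (y : ℕ → H) (_ : ∀ z, HasSum (fun n => (inner ℂ (y n) z : ℂ) • x n) (T z)),
    ∑' n, ‖x n‖ₑ * ‖y n‖ₑ

/-- Trace class operators. -/
def IsTraceClass (T : H →L[ℂ] H) : Prop := traceNorm T < ∞

variable [CompleteSpace H]

/-- The trace `∑ ⟨bᵢ, T bᵢ⟩` along a Hilbert basis (independent of the basis when `T` is of trace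
class). -/
noncomputable def trace (T : H →L[ℂ] H) : ℂ :=
  ∑' i, inner ℂ ((exists_hilbertBasis ℂ H).choose_spec.choose i)
    (T ((exists_hilbertBasis ℂ H).choose_spec.choose i))

/-- Statistical operators: positive trace class operators with trace one. -/
def IsStatOp (ρ : H →L[ℂ] H) : Prop := ρ.IsPositive ∧ IsTraceClass ρ ∧ trace ρ = 1

/-- Normalization of an unnormalized state, with the fixed value `σv` when its trace vanishes. -/
noncomputable def normalize (σv x : H →L[ℂ] H) : H →L[ℂ] H :=
  open Classical in if (trace x).re ≠ 0 then (((trace x).re)⁻¹ : ℝ) • x else σv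

end Trace

/-! ### Trajectories of point measures on `ℝ₊ × U` -/

/-- Lebesgue measure on the time half line. -/
noncomputable def leb : Measure ℝ≥0 := Measure.comap ((↑) : ℝ≥0 → ℝ) volume

/-- A trajectory: an integer valued measure on `ℝ₊ × U` (times and types of the jumps) with
finitely many jumps in bounded time intervals. -/
def Trajectory (U : Type*) [MeasurableSpace U] : Type _ :=
  {π : Measure (ℝ≥0 × U) //
    (∀ B, MeasurableSet B → ∃ n : ℕ∞, π B = (n : ℝ≥0∞)) ∧ ∀ t : ℝ≥0, π (Iic t ×ˢ univ) < ∞}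

section Trajectory

variable {U : Type*} [MeasurableSpace U]

instance : MeasurableSpace (Trajectory U) :=
  Subtype.instMeasurableSpace

/-- The measure underlying a trajectory. -/
def Trajectory.meas (π : Trajectory U) : Measure (ℝ≥0 × U) := π.1

/-- The jumps of a trajectory whose times belong to `I`. -/
noncomputable def Trajectory.restrictTime (π : Trajectory U) (I : Set ℝ≥0)
    (hI : MeasurableSet I) : Trajectory U :=
  ⟨π.1.restrict (I ×ˢ univ), fun B hB => by
      rw [Measure.restrict_apply hB]
      exact π.2.1 _ (hB.inter (hI.prod MeasurableSet.univ)),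
    fun t => (Measure.restrict_apply_le _ _).trans_lt (π.2.2 t)⟩

/-- The part of a trajectory in `[0, t]`. -/
noncomputable def Trajectory.upTo (π : Trajectory U) (t : ℝ≥0) : Trajectory U :=
  π.restrictTime (Iic t) measurableSet_Iic

/-- The part of a trajectory in `[0, t)`. -/
noncomputable def Trajectory.before (π : Trajectory U) (t : ℝ≥0) : Trajectory U :=
  π.restrictTime (Iio t) measurableSet_Iio

/-- The part of a trajectory in `(t, ∞)`. -/
noncomputable def Trajectory.after (π : Trajectory U) (t : ℝ≥0) : Trajectory U :=
  π.restrictTime (Ioi t) measurableSet_Ioi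

/-- The number of jumps (of any type) in `[0, t]`. -/
noncomputable def Trajectory.count (π : Trajectory U) (t : ℝ≥0) : ℝ :=
  (π.meas (Iic t ×ˢ univ)).toReal

/-- The time of the first jump (`∞` if there is none). -/
noncomputable def Trajectory.firstJump (π : Trajectory U) : ℝ≥0∞ :=
  ⨅ (t : ℝ≥0) (_ : π.count t ≠ 0), (t : ℝ≥0∞)

end Trajectory

/-! ### The reference probability -/

/-- The usual hypotheses on a filtered probability space. -/
structure UsualHypotheses {Ω : Type*} [mΩ : MeasurableSpace Ω] (Q : Measure Ω)
    (𝓕 : Filtration ℝ≥0 mΩ) : Prop where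
  complete : Q.IsComplete
  generates : mΩ = ⨆ t, 𝓕 t
  rightContinuous : ∀ t, 𝓕 t = ⨅ r > t, 𝓕 r
  null : ∀ F, MeasurableSet F → Q F = 0 → MeasurableSet[𝓕 0] F

/-- `Pi` is, under `Q`, an adapted time-homogeneous Poisson point process on `ℝ₊ × U` with
intensity `dt ν(du)`. Its jumps after any time `t` are independent of the past `𝓕 t` and of the
extra noise `ξ`. -/
structure IsPoissonPointProcess {Ω U E : Type*} [mΩ : MeasurableSpace Ω] [MeasurableSpace U]
    [MeasurableSpace E] (Q : Measure Ω) (𝓕 : Filtration ℝ≥0 mΩ) (ν : Measure U)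
    (ξ : Ω → E) (Pi : Ω → Trajectory U) : Prop where
  adapted : ∀ t, Measurable[𝓕 t] (fun ω => (Pi ω).upTo t)
  law : ∀ B, MeasurableSet B → (leb.prod ν) B < ∞ → ∀ n : ℕ,
    Q {ω | (Pi ω).meas B = n} = poissonMeasure ((leb.prod ν) B).toNNReal {n}
  indep_sets : ∀ (n : ℕ) (B : Fin n → Set (ℝ≥0 × U)), (∀ i, MeasurableSet (B i)) →
    Pairwise (Function.onFun Disjoint B) → iIndepFun (fun i ω => (Pi ω).meas (B i)) Q
  indep_past : ∀ t, Indep (𝓕 t ⊔ MeasurableSpace.comap ξ inferInstance)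
    (MeasurableSpace.comap (fun ω => (Pi ω).after t) inferInstance) Q

/-! ### The random operators and the generators -/

/-- The random operators `H(t)`, `J_j(u,t)`, `L_k(t)`, `R(t)`, `R₀(t)`, given as functions of the
value `e` of the extra noise and of the trajectory `π` of the point process. -/
structure Coefficients (U E H ι₁ ι₂ : Type*) [MeasurableSpace U] [NormedAddCommGroup H]
    [InnerProductSpace ℂ H] where
  ham : ℝ≥0 → E → Trajectory U → (H →L[ℂ] H)
  jump : ι₁ → U → ℝ≥0 → E → Trajectory U → (H →L[ℂ] H)
  lind : ι₂ → ℝ≥0 → E → Trajectory U → (H →L[ℂ] H)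
  R : ℝ≥0 → E → Trajectory U → (H →L[ℂ] H)
  R₀ : ℝ≥0 → E → Trajectory U → (H →L[ℂ] H)

/-- Left continuity with right limits. -/
def LeftContRightLim {H : Type*} [TopologicalSpace H] (f : ℝ≥0 → H) : Prop :=
  ∀ t, ContinuousWithinAt f (Iic t) t ∧ ∃ l, Tendsto f (𝓝[>] t) (𝓝 l)

section Coefficients

variable {U E H ι₁ ι₂ : Type*} [MeasurableSpace U] [NormedAddCommGroup H]
  [InnerProductSpace ℂ H] [CompleteSpace H]

/-- Regularity of the operators: selfadjointness of the Hamiltonian, dependence on the trajectory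
only through the jumps before the current time, strong left continuity with right limits,
measurability, strong convergence of the integral and the series which define `R` and `R₀`,
and uniform boundedness of the jump operators. -/
structure Coefficients.Regular [MeasurableSpace E] (C : Coefficients U E H ι₁ ι₂)
    (ν : Measure U) : Prop where
  ham_selfAdjoint : ∀ t e π, IsSelfAdjoint (C.ham t e π)
  ham_past : ∀ t e π, C.ham t e π = C.ham t e (π.before t)
  jump_past : ∀ j u t e π, C.jump j u t e π = C.jump j u t e (π.before t)
  lind_past : ∀ k t e π, C.lind k t e π = C.lind k t e (π.before t)
  ham_rlc : ∀ e π x, LeftContRightLim (fun t => C.ham t e π x)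
  jump_rlc : ∀ j u e π x, LeftContRightLim (fun t => C.jump j u t e π x)
  lind_rlc : ∀ k e π x, LeftContRightLim (fun t => C.lind k t e π x)
  ham_meas : ∀ t x, StronglyMeasurable (fun q : E × Trajectory U => C.ham t q.1 q.2 x)
  jump_meas : ∀ j x, StronglyMeasurable
    (fun q : U × ℝ≥0 × E × Trajectory U => C.jump j q.1 q.2.1 q.2.2.1 q.2.2.2 x)
  lind_meas : ∀ k t x, StronglyMeasurable (fun q : E × Trajectory U => C.lind k t q.1 q.2 x)
  R_hasSum : ∀ t e π x, HasSum
    (fun j => ∫ u, (C.jump j u t e π).adjoint (C.jump j u t e π x) ∂ν) (C.R t e π x)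
  R₀_hasSum : ∀ t e π x, HasSum
    (fun k => (C.lind k t e π).adjoint (C.lind k t e π x)) (C.R₀ t e π x)
  jump_bdd : ∀ t, ∃ M : ℝ, ∀ j u s e π, s ≤ t → ‖C.jump j u s e π‖ ≤ M

/-- The operators, evaluated on the noise and on the point process, are adapted and have norms
whose time integrals are essentially bounded. -/
structure Coefficients.Admissible {Ω : Type*} [mΩ : MeasurableSpace Ω]
    (C : Coefficients U E H ι₁ ι₂) (Q : Measure Ω) (𝓕 : Filtration ℝ≥0 mΩ)
    (ξ : Ω → E) (Pi : Ω → Trajectory U) : Prop where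
  ham_adapted : ∀ t x, StronglyMeasurable[𝓕 t] (fun ω => C.ham t (ξ ω) (Pi ω) x)
  jump_adapted : ∀ j u t x, StronglyMeasurable[𝓕 t] (fun ω => C.jump j u t (ξ ω) (Pi ω) x)
  lind_adapted : ∀ k t x, StronglyMeasurable[𝓕 t] (fun ω => C.lind k t (ξ ω) (Pi ω) x)
  R_bdd : ∀ t, ∃ M : ℝ≥0, ∀ᵐ ω ∂Q, ∫⁻ s in Iic t, ‖C.R s (ξ ω) (Pi ω)‖ₑ ∂leb ≤ M
  R₀_bdd : ∀ t, ∃ M : ℝ≥0, ∀ᵐ ω ∂Q, ∫⁻ s in Iic t, ‖C.R₀ s (ξ ω) (Pi ω)‖ₑ ∂leb ≤ M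
  ham_bdd : ∀ t, ∃ M : ℝ≥0, ∀ᵐ ω ∂Q, ∫⁻ s in Iic t, ‖C.ham s (ξ ω) (Pi ω)‖ₑ ∂leb ≤ M

/-- `𝒥(u,t)[ρ] = ∑ⱼ Jⱼ ρ Jⱼ†`. -/
noncomputable def Coefficients.jumpMap (C : Coefficients U E H ι₁ ι₂) (u : U) (t : ℝ≥0) (e : E)
    (π : Trajectory U) (ρ : H →L[ℂ] H) : H →L[ℂ] H :=
  ∑' j, C.jump j u t e π * ρ * (C.jump j u t e π).adjoint

/-- `ℒ₀(t)[ρ] = -i[H,ρ] + ∑ₖ Lₖ ρ Lₖ† - {R₀,ρ}/2`. -/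
noncomputable def Coefficients.free (C : Coefficients U E H ι₁ ι₂) (t : ℝ≥0) (e : E)
    (π : Trajectory U) (ρ : H →L[ℂ] H) : H →L[ℂ] H :=
  -Complex.I • (C.ham t e π * ρ - ρ * C.ham t e π)
    + ∑' k, C.lind k t e π * ρ * (C.lind k t e π).adjoint
    - (1 / 2 : ℂ) • (C.R₀ t e π * ρ + ρ * C.R₀ t e π)

/-- `ℒ₀(t)[ρ] - {R(t),ρ}/2`. -/
noncomputable def Coefficients.noJumpGen (C : Coefficients U E H ι₁ ι₂) (t : ℝ≥0) (e : E)
    (π : Trajectory U) (ρ : H →L[ℂ] H) : H →L[ℂ] H :=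
  C.free t e π ρ - (1 / 2 : ℂ) • (C.R t e π * ρ + ρ * C.R t e π)

/-! ### The linear stochastic master equation -/

/-- `σ` is an adapted trace class valued process, right continuous with left limits in trace
norm, which solves the linear stochastic master equation
`dσ(t) = ℒ₀(t)[σ(t-)] dt - {R(t) - ν(U), σ(t-)}/2 dt + ∫ (𝒥(u,t)[σ(t-)] - σ(t-)) Π(du,dt)`
with `σ(0) = ρ₀`, tested against all bounded operators `a`. -/
structure IsSolution {Ω : Type*} [mΩ : MeasurableSpace Ω]
    (C : Coefficients U E H ι₁ ι₂) (Q : Measure Ω) (𝓕 : Filtration ℝ≥0 mΩ) (ν : Measure U)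
    (ξ : Ω → E) (Pi : Ω → Trajectory U) (ρ₀ : H →L[ℂ] H)
    (σ : ℝ≥0 → Ω → (H →L[ℂ] H)) : Prop where
  traceClass : ∀ t ω, IsTraceClass (σ t ω)
  adapted : ∀ t a, StronglyMeasurable[𝓕 t] (fun ω => trace (a * σ t ω))
  rightCont : ∀ t ω, Tendsto (fun r => traceNorm (σ r ω - σ t ω)) (𝓝[>] t) (𝓝 0)
  leftLim : ∀ t ω, ∃ l, IsTraceClass l ∧
    Tendsto (fun r => traceNorm (σ r ω - l)) (𝓝[<] t) (𝓝 0)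
  equation : ∀ᵐ ω ∂Q, ∀ t a,
    let σm : ℝ≥0 → (H →L[ℂ] H) := Function.leftLim (fun r => σ r ω)
    let drift : ℝ≥0 → ℂ := fun s => trace (a *
      (C.noJumpGen s (ξ ω) (Pi ω) (σm s) + (ν.real univ) • σm s))
    let kick : ℝ≥0 × U → ℂ := fun q =>
      trace (a * C.jumpMap q.2 q.1 (ξ ω) (Pi ω) (σm q.1)) - trace (a * σm q.1)
    IntegrableOn drift (Ioc 0 t) leb ∧ IntegrableOn kick (Ioc 0 t ×ˢ univ) (Pi ω).meas ∧
    trace (a * σ t ω) = trace (a * ρ₀) + ∫ s in Ioc 0 t, drift s ∂leb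
      + ∫ q in Ioc 0 t ×ˢ univ, kick q ∂(Pi ω).meas

/-- `S t t₀` is the random no-jump propagator: `S(t₀,t₀) = id` and
`(d/dt) S(t,t₀)[ρ] = 𝒜(t|t₀)[S(t,t₀)[ρ]]` in integrated form, tested against all bounded
operators `a`. Here `𝒜(t|t₀)` is `ℒ₀(t) - {R(t),·}/2` under the condition of no jump after `t₀`,
that is, evaluated on the trajectory which keeps only the jumps up to `t₀`. -/
def IsNoJumpPropagator {Ω : Type*} [MeasurableSpace Ω]
    (C : Coefficients U E H ι₁ ι₂) (Q : Measure Ω) (ξ : Ω → E) (Pi : Ω → Trajectory U)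
    (S : ℝ≥0 → ℝ≥0 → Ω → (H →L[ℂ] H) → (H →L[ℂ] H)) : Prop :=
  ∀ t₀, ∀ᵐ ω ∂Q, ∀ ρ, IsTraceClass ρ → ∀ t, t₀ ≤ t →
    IsTraceClass (S t t₀ ω ρ) ∧
    Tendsto (fun r => traceNorm (S r t₀ ω ρ - S t t₀ ω ρ)) (𝓝[Ici t₀] t) (𝓝 0) ∧
    ∀ a : H →L[ℂ] H,
      IntegrableOn (fun s => trace (a *
        C.noJumpGen s (ξ ω) ((Pi ω).upTo t₀) (S s t₀ ω ρ))) (Ioc t₀ t) leb ∧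
      trace (a * S t t₀ ω ρ) = trace (a * ρ) + ∫ s in Ioc t₀ t, trace (a *
        C.noJumpGen s (ξ ω) ((Pi ω).upTo t₀) (S s t₀ ω ρ)) ∂leb

/-! ### Physical probability, conditional states, intensities -/

/-- The density `p(t) = Tr σ(t)`. -/
noncomputable def density {Ω : Type*} (σ : ℝ≥0 → Ω → (H →L[ℂ] H)) (t : ℝ≥0) (ω : Ω) : ℝ :=
  (trace (σ t ω)).re

/-- The physical probability up to the time horizon `T`, with density `p(T)` with respect to the
reference probability. -/
noncomputable def physProb {Ω : Type*} [MeasurableSpace Ω] (Q : Measure Ω)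
    (σ : ℝ≥0 → Ω → (H →L[ℂ] H)) (T : ℝ≥0) : Measure Ω :=
  Q.withDensity (fun ω => ENNReal.ofReal (density σ T ω))

/-- The conditional state `ρ(t) = σ(t) / p(t)`. -/
noncomputable def condState {Ω : Type*} (σv : H →L[ℂ] H) (σ : ℝ≥0 → Ω → (H →L[ℂ] H))
    (t : ℝ≥0) (ω : Ω) : H →L[ℂ] H :=
  normalize σv (σ t ω)

/-- The stochastic intensity `λ(t) = Tr (R(t) ρ(t-))` of the jumps. -/
noncomputable def intensity {Ω : Type*} (C : Coefficients U E H ι₁ ι₂) (ξ : Ω → E)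
    (Pi : Ω → Trajectory U) (σv : H →L[ℂ] H) (σ : ℝ≥0 → Ω → (H →L[ℂ] H))
    (t : ℝ≥0) (ω : Ω) : ℝ :=
  (trace (C.R t (ξ ω) (Pi ω) * Function.leftLim (fun r => condState σv σ r ω) t)).re

/-- The intensity `λ(t)` under the condition of no jump in `(0, t)`: both `R(t)` and the
conditional state are evaluated without jumps after time zero. -/
noncomputable def noJumpIntensity {Ω : Type*} (C : Coefficients U E H ι₁ ι₂) (ξ : Ω → E)
    (Pi : Ω → Trajectory U) (S : ℝ≥0 → ℝ≥0 → Ω → (H →L[ℂ] H) → (H →L[ℂ] H))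
    (σv ρ₀ : H →L[ℂ] H) (t : ℝ≥0) (ω : Ω) : ℝ :=
  (trace (C.R t (ξ ω) ((Pi ω).upTo 0) * normalize σv (S t 0 ω ρ₀))).re

end Coefficients

end JumpSME

/-! The starting point is duality. With `G = -iH - (R₀ + R)/2` the no-jump generator is `X ↦ G X + X
G† + ∑ Lₖ X Lₖ†`, and `Tr(a · 𝒜ₛ[X]) = Tr(𝒜ₛ*(a) X)` with `𝒜ₛ*(a) = G† a + a G + ∑ Lₖ† a Lₖ`. So the
no-jump equation, and between jumps also the stochastic equation after removal of a factor
`exp(-ν(U)t)`, becomes `yₜ(a) = y_{t₀}(a) + ∫ yₛ(𝒜ₛ* a) ds` for functionals `y` on bounded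
operators, where `‖𝒜ₛ*‖ ≤ κ(s)` with `κ` locally integrable (`IsWeakSol`). Picard iterates converge
to every bounded solution (`IsWeakSol.tendsto_picard`). This gives uniqueness, and also
measurability: the propagator is only given for almost every `ω`, but its traces are limits of
iterates that are jointly measurable in the noise and the trajectory. Positivity
(`IsWeakSol.nonneg`) comes from Euler steps, since `a + θ 𝒜*(a)` is positive up to the term `-θ² G†
a G`. Since `𝒜*(1) = -R`, the trace decreases at the rate `Tr(R S)`, and it never reaches zero.

For (a), `σ(t)` is positive: between jumps by the above, at jumps because almost surely at most one
occurs at a time. Then `p = Tr σ` solves `dp = (ν(U) p₋ - r) dt + ∫ (j - p₋) dΠ`, where the rate `j`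
of the jump map satisfies `∫ j dν = r = Tr(R σ₋) ≤ ‖R‖ p₋`. By the compensation formula for
predictable integrands (`IsPoissonPointProcess.lintegral_jump`) all terms cancel in mean, once they
are integrable. Integrability comes from localization at the times when `p` exceeds `n`: the stopped
masses are martingales of mean one, and an essential bound `M` of `∫ ‖R‖` yields `E ∫ ‖R‖ p₋ ≤ M`
uniformly in `n`. Everything is done for the filtration enlarged by `ξ`, because the coefficients
depend on the noise while the future jumps are independent of `𝓕 t ∨ σ(ξ)`.

For (b) and (c), if no jump falls in `(t₀, t]`, then freezing the trajectory at `t₀` does not change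
the coefficients there, and uniqueness gives `S(t,t₀)[σ(t₀)] = exp(-ν(U)(t-t₀)) σ(t)`. The left side
is measurable with respect to the past at `t₀`, and the absence of jumps is independent of that past
with probability `exp(-ν(U)(t-t₀))`, so the exponentials cancel: `E[p(t); F, no jump] = E[Tr
S(t,t₀)[σ(t₀)]; F]` (`IsSolution.setLIntegral_density_noJump`). Dividing out `p(t₀)` gives the
conditional form.

For (d), `λ(t|0) Tr S(t,0)[ρ₀] = Tr(R(t|0) S(t,0)[ρ₀])` is minus the derivative of the survival
trace; Tonelli and the Lebesgue differentiation theorem conclude. -/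

namespace JumpSME

set_option linter.unusedSectionVars false

/-! ### Representations of trace class operators -/

section TraceClass

variable {H : Type*} [NormedAddCommGroup H] [InnerProductSpace ℂ H]

/-- `X = ∑ |xₙ⟩⟨yₙ|` with `∑ ‖xₙ‖ ‖yₙ‖ < ∞`. -/
structure IsRep {ι : Type*} (x y : ι → H) (X : H →L[ℂ] H) : Prop where
  summable : Summable fun n => ‖x n‖ * ‖y n‖
  hasSum : ∀ z, HasSum (fun n => (inner ℂ (y n) z : ℂ) • x n) (X z)

theorem tsum_enorm_mul_ne_top_iff {ι : Type*} (x y : ι → H) :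
    ∑' n, ‖x n‖ₑ * ‖y n‖ₑ ≠ ∞ ↔ Summable fun n => ‖x n‖ * ‖y n‖ := by
  have : ∀ n, ‖x n‖ₑ * ‖y n‖ₑ = ((‖x n‖₊ * ‖y n‖₊ : ℝ≥0) : ℝ≥0∞) := fun n => by
    simp [enorm_eq_nnnorm]
  simp only [this, ENNReal.tsum_coe_ne_top_iff_summable]
  rw [← NNReal.summable_coe]
  simp

theorem IsTraceClass.exists_isRep {X : H →L[ℂ] H} (h : IsTraceClass X) :
    ∃ x y : ℕ → H, IsRep x y X := by
  simp only [IsTraceClass, traceNorm, iInf_lt_iff] at h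
  obtain ⟨x, y, hxy, hs⟩ := h
  exact ⟨x, y, (tsum_enorm_mul_ne_top_iff x y).1 hs.ne, hxy⟩

theorem IsRep.isTraceClass {x y : ℕ → H} {X : H →L[ℂ] H} (h : IsRep x y X) :
    IsTraceClass X := by
  exact lt_of_le_of_lt (iInf₂_le_of_le x y (iInf_le _ h.hasSum))
    ((tsum_enorm_mul_ne_top_iff x y).2 h.summable).lt_top

theorem IsRep.smul {ι : Type*} {x y : ι → H} {X : H →L[ℂ] H} (h : IsRep x y X) (c : ℂ) :
    IsRep (fun n => c • x n) y (c • X) := by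
  refine ⟨?_, fun z => ?_⟩
  · simpa [norm_smul, mul_assoc] using h.summable.mul_left ‖c‖
  · simpa [smul_comm c] using (h.hasSum z).const_smul c

theorem IsTraceClass.smul {X : H →L[ℂ] H} (h : IsTraceClass X) (c : ℂ) :
    IsTraceClass (c • X) := by
  obtain ⟨x, y, hr⟩ := h.exists_isRep
  exact (hr.smul c).isTraceClass

theorem IsRep.comp_left {ι : Type*} {x y : ι → H} {X : H →L[ℂ] H} (h : IsRep x y X)
    (a : H →L[ℂ] H) : IsRep (fun n => a (x n)) y (a * X) := by
  refine ⟨?_, fun z => ?_⟩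
  · refine Summable.of_nonneg_of_le (fun n => by positivity) (fun n => ?_)
      (h.summable.mul_left ‖a‖)
    rw [← mul_assoc]
    gcongr
    exact a.le_opNorm _
  · simpa using (h.hasSum z).mapL a

theorem IsRep.comp_right [CompleteSpace H] {ι : Type*} {x y : ι → H} {X : H →L[ℂ] H}
    (h : IsRep x y X) (a : H →L[ℂ] H) : IsRep x (fun n => a.adjoint (y n)) (X * a) := by
  refine ⟨?_, fun z => ?_⟩
  · refine Summable.of_nonneg_of_le (fun n => by positivity) (fun n => ?_)
      (h.summable.mul_left ‖a‖)
    calc ‖x n‖ * ‖a.adjoint (y n)‖ ≤ ‖x n‖ * (‖a‖ * ‖y n‖) := by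
          gcongr
          simpa using a.adjoint.le_opNorm (y n)
      _ = _ := by ring
  · simpa [ContinuousLinearMap.adjoint_inner_left] using h.hasSum (a z)

theorem IsRep.norm_apply_le {ι : Type*} {x y : ι → H} {X : H →L[ℂ] H} (h : IsRep x y X)
    (z : H) : ‖X z‖ ≤ (∑' n, ‖x n‖ * ‖y n‖) * ‖z‖ := by
  rw [← tsum_mul_right]
  refine (h.hasSum z).tsum_eq ▸ tsum_of_norm_bounded (h.summable.mul_right ‖z‖).hasSum fun n => ?_
  rw [norm_smul]
  calc ‖(inner ℂ (y n) z : ℂ)‖ * ‖x n‖ ≤ (‖y n‖ * ‖z‖) * ‖x n‖ := by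
        gcongr; exact norm_inner_le_norm _ _
    _ = _ := by ring

theorem IsRep.norm_le {ι : Type*} {x y : ι → H} {X : H →L[ℂ] H} (h : IsRep x y X) :
    ‖X‖ ≤ ∑' n, ‖x n‖ * ‖y n‖ :=
  X.opNorm_le_bound (tsum_nonneg fun _ => by positivity) h.norm_apply_le

variable [CompleteSpace H]

/-- The Hilbert basis along which traces are computed. -/
noncomputable def traceBasis (H : Type*) [NormedAddCommGroup H] [InnerProductSpace ℂ H]
    [CompleteSpace H] : HilbertBasis (exists_hilbertBasis ℂ H).choose ℂ H :=
  (exists_hilbertBasis ℂ H).choose_spec.choose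

theorem trace_eq_tsum (T : H →L[ℂ] H) :
    trace T = ∑' i, inner ℂ (traceBasis H i) (T (traceBasis H i)) := rfl

/-- Cauchy–Schwarz in `ℓ²` together with Bessel. The absolute form of Parseval is what permits
Fubini for the double sums that define traces. -/
theorem _root_.HilbertBasis.summable_norm_inner_mul_inner {ι : Type*} (b : HilbertBasis ι ℂ H)
    (x y : H) :
    Summable (fun i => ‖(inner ℂ x (b i) : ℂ) * inner ℂ (b i) y‖) ∧
      ∑' i, ‖(inner ℂ x (b i) : ℂ) * inner ℂ (b i) y‖ ≤ ‖x‖ * ‖y‖ := by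
  have h1 := b.orthonormal.inner_products_summable x
  have h2 := b.orthonormal.inner_products_summable y
  have h0 := Real.summable_mul_of_Lp_Lq_of_nonneg (p := 2) (q := 2)
    Real.HolderConjugate.two_two
    (f := fun i => ‖(inner ℂ (b i) x : ℂ)‖) (g := fun i => ‖(inner ℂ (b i) y : ℂ)‖)
    (fun _ => norm_nonneg _) (fun _ => norm_nonneg _) (by simpa using h1) (by simpa using h2)
  have h := Real.inner_le_Lp_mul_Lq_tsum_of_nonneg (p := 2) (q := 2)
    Real.HolderConjugate.two_two
    (f := fun i => ‖(inner ℂ (b i) x : ℂ)‖) (g := fun i => ‖(inner ℂ (b i) y : ℂ)‖)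
    (fun _ => norm_nonneg _) (fun _ => norm_nonneg _) (by simpa using h1) (by simpa using h2)
  have e : ∀ i, ‖(inner ℂ x (b i) : ℂ) * inner ℂ (b i) y‖
      = ‖(inner ℂ (b i) x : ℂ)‖ * ‖(inner ℂ (b i) y : ℂ)‖ := fun i => by
    rw [norm_mul, norm_inner_symm]
  simp only [e]
  refine ⟨h0, h.trans ?_⟩
  have key : ∀ z : H, (∑' i, ‖(inner ℂ (b i) z : ℂ)‖ ^ (2 : ℝ)) ^ (1 / (2 : ℝ)) ≤ ‖z‖ := by
    intro z
    rw [← Real.sqrt_eq_rpow]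
    refine Real.sqrt_le_iff.2 ⟨norm_nonneg _, ?_⟩
    simpa using b.orthonormal.tsum_inner_products_le z
  gcongr
  · exact key x
  · exact key y

/-- The double family `⟨yₙ, bᵢ⟩⟨bᵢ, xₙ⟩` is dominated in `i` by `‖xₙ‖‖yₙ‖`, so it may be summed in
either order. In particular the trace does not depend on the basis. -/
theorem IsRep.hasSum_trace {ι κ : Type*} (b : HilbertBasis κ ℂ H) {x y : ι → H} {X : H →L[ℂ] H}
    (h : IsRep x y X) :
    HasSum (fun i => (inner ℂ (b i) (X (b i)) : ℂ)) (∑' n, inner ℂ (y n) (x n)) := by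
  set F : ι × κ → ℂ := fun p => inner ℂ (y p.1) (b p.2) * inner ℂ (b p.2) (x p.1) with hF
  have hs : Summable F := by
    refine Summable.of_norm ?_
    refine (summable_prod_of_nonneg (fun p => norm_nonneg _)).2 ⟨fun n => ?_, ?_⟩
    · exact (b.summable_norm_inner_mul_inner (y n) (x n)).1
    · refine Summable.of_nonneg_of_le (fun n => tsum_nonneg fun _ => norm_nonneg _) (fun n => ?_)
        h.summable
      rw [mul_comm]
      exact (b.summable_norm_inner_mul_inner (y n) (x n)).2
  have h1 : HasSum (fun n => (inner ℂ (y n) (x n) : ℂ)) (∑' p, F p) :=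
    hs.hasSum.prod_fiberwise fun n => b.hasSum_inner_mul_inner (y n) (x n)
  rw [h1.tsum_eq]
  have hs' : HasSum (F ∘ (Equiv.prodComm κ ι)) (∑' p, F p) :=
    (Equiv.prodComm κ ι).hasSum_iff.2 hs.hasSum
  refine hs'.prod_fiberwise fun i => ?_
  have := (h.hasSum (b i)).mapL (innerSL ℂ (b i))
  simpa [hF, inner_smul_right] using this

theorem IsRep.hasSum_trace_mul {ι κ : Type*} (b : HilbertBasis κ ℂ H) {x y : ι → H}
    {X : H →L[ℂ] H} (h : IsRep x y X) (a : H →L[ℂ] H) :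
    HasSum (fun i => (inner ℂ (b i) (a (X (b i))) : ℂ)) (∑' n, inner ℂ (y n) (a (x n))) :=
  (h.comp_left a).hasSum_trace b

theorem IsRep.trace_mul {ι : Type*} {x y : ι → H} {X : H →L[ℂ] H} (h : IsRep x y X)
    (a : H →L[ℂ] H) : trace (a * X) = ∑' n, inner ℂ (y n) (a (x n)) :=
  (h.hasSum_trace_mul (traceBasis H) a).tsum_eq

theorem IsRep.summable_inner {ι : Type*} {x y : ι → H} {X : H →L[ℂ] H} (h : IsRep x y X)
    (a : H →L[ℂ] H) : Summable fun n => (inner ℂ (y n) (a (x n)) : ℂ) := by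
  refine Summable.of_norm_bounded (h.summable.mul_left ‖a‖) fun n => ?_
  calc ‖(inner ℂ (y n) (a (x n)) : ℂ)‖ ≤ ‖y n‖ * (‖a‖ * ‖x n‖) :=
        (norm_inner_le_norm _ _).trans (by gcongr; exact a.le_opNorm _)
    _ = _ := by ring

theorem IsRep.norm_trace_mul_le {ι : Type*} {x y : ι → H} {X : H →L[ℂ] H} (h : IsRep x y X)
    (a : H →L[ℂ] H) : ‖trace (a * X)‖ ≤ ‖a‖ * ∑' n, ‖x n‖ * ‖y n‖ := by
  rw [h.trace_mul, ← tsum_mul_left]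
  refine tsum_of_norm_bounded (h.summable.mul_left ‖a‖).hasSum fun n => ?_
  calc ‖(inner ℂ (y n) (a (x n)) : ℂ)‖ ≤ ‖y n‖ * (‖a‖ * ‖x n‖) :=
        (norm_inner_le_norm _ _).trans (by gcongr; exact a.le_opNorm _)
    _ = _ := by ring

theorem IsTraceClass.hasSum_trace_mul {X : H →L[ℂ] H} (h : IsTraceClass X) (a : H →L[ℂ] H) :
    HasSum (fun i => (inner ℂ (traceBasis H i) (a (X (traceBasis H i))) : ℂ))
      (trace (a * X)) := by
  obtain ⟨x, y, hr⟩ := h.exists_isRep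
  rw [hr.trace_mul]
  exact hr.hasSum_trace_mul _ a

/-- The infimum in `traceNorm` also runs over families whose sum of norms diverges; these contribute
`∞`, so only genuine representations matter. -/
theorem le_traceNorm_of_forall_isRep {X : H →L[ℂ] H} {c : ℝ}
    (h : ∀ x y : ℕ → H, IsRep x y X → c ≤ ∑' n, ‖x n‖ * ‖y n‖) :
    ENNReal.ofReal c ≤ traceNorm X := by
  refine le_iInf₂ fun x y => le_iInf fun hxy => ?_
  by_cases ht : ∑' n, ‖x n‖ₑ * ‖y n‖ₑ = ∞
  · simp [ht]
  have e : ∀ n, ‖x n‖ₑ * ‖y n‖ₑ = ENNReal.ofReal (‖x n‖ * ‖y n‖) := fun n => by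
    rw [ENNReal.ofReal_mul (norm_nonneg _), ofReal_norm, ofReal_norm]
  have hs := (tsum_enorm_mul_ne_top_iff x y).1 ht
  simp only [e]
  rw [← ENNReal.ofReal_tsum_of_nonneg (fun n => by positivity) hs]
  exact ENNReal.ofReal_le_ofReal (h x y ⟨hs, hxy⟩)

theorem IsTraceClass.norm_le {X : H →L[ℂ] H} (h : IsTraceClass X) :
    ‖X‖ ≤ (traceNorm X).toReal :=
  (ENNReal.ofReal_le_iff_le_toReal h.ne).1
    (le_traceNorm_of_forall_isRep fun _ _ hr => hr.norm_le)

theorem IsTraceClass.norm_trace_mul_le {X : H →L[ℂ] H} (h : IsTraceClass X) (a : H →L[ℂ] H) :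
    ‖trace (a * X)‖ ≤ ‖a‖ * (traceNorm X).toReal := by
  rcases eq_or_lt_of_le (norm_nonneg a) with ha | ha
  · rw [← ha, zero_mul, norm_eq_zero.1 ha.symm]
    simp [trace_eq_tsum]
  rw [mul_comm, ← div_le_iff₀ ha]
  refine (ENNReal.ofReal_le_iff_le_toReal h.ne).1 (le_traceNorm_of_forall_isRep fun _ _ hr => ?_)
  rw [div_le_iff₀ ha, mul_comm]
  exact hr.norm_trace_mul_le a

theorem IsTraceClass.trace_add_mul {X : H →L[ℂ] H} (h : IsTraceClass X) (a a' : H →L[ℂ] H) :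
    trace ((a + a') * X) = trace (a * X) + trace (a' * X) := by
  rw [trace_eq_tsum]
  refine HasSum.tsum_eq ?_
  simpa [inner_add_right] using (h.hasSum_trace_mul a).add (h.hasSum_trace_mul a')

theorem IsTraceClass.trace_smul_mul {X : H →L[ℂ] H} (a : H →L[ℂ] H) (c : ℂ) :
    trace ((c • a) * X) = c * trace (a * X) := by
  simp only [trace_eq_tsum, ← tsum_mul_left]
  exact tsum_congr fun i => by simp

theorem trace_smul (X : H →L[ℂ] H) (c : ℂ) : trace (c • X) = c * trace X := by
  simp only [trace_eq_tsum, ← tsum_mul_left]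
  exact tsum_congr fun i => by simp

theorem IsTraceClass.trace_mul_sub {X Y : H →L[ℂ] H} (hX : IsTraceClass X) (hY : IsTraceClass Y)
    (a : H →L[ℂ] H) : trace (a * (X - Y)) = trace (a * X) - trace (a * Y) := by
  rw [trace_eq_tsum]
  refine HasSum.tsum_eq ?_
  simpa [inner_sub_right] using (hX.hasSum_trace_mul a).sub (hY.hasSum_trace_mul a)

/-- The functional `a ↦ Tr (a X)` defined by a trace class operator `X`. -/
noncomputable def traceFunctional (X : H →L[ℂ] H) (h : IsTraceClass X) :
    (H →L[ℂ] H) →L[ℂ] ℂ :=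
  LinearMap.mkContinuous
    { toFun := fun a => trace (a * X)
      map_add' := h.trace_add_mul
      map_smul' := fun c a => IsTraceClass.trace_smul_mul a c }
    (traceNorm X).toReal fun a => by rw [mul_comm]; exact h.norm_trace_mul_le a

@[simp]
theorem traceFunctional_apply (X : H →L[ℂ] H) (h : IsTraceClass X) (a : H →L[ℂ] H) :
    traceFunctional X h a = trace (a * X) := rfl

/-- The trace against a rank one operator is a matrix element. -/
theorem trace_rankOne_mul (X : H →L[ℂ] H) (v w : H) :
    trace (InnerProductSpace.rankOne ℂ w v * X) = inner ℂ v (X w) := by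
  have := (traceBasis H).hasSum_inner_mul_inner (X.adjoint v) w
  rw [← X.adjoint_inner_left, ← this.tsum_eq, trace_eq_tsum]
  exact tsum_congr fun i => by
    simp [ContinuousLinearMap.adjoint_inner_left]

/-- This turns equations tested with bounded operators back into operator identities: rank one tests
already see every matrix element. -/
theorem eq_of_trace_rankOne_mul_eq {X Y : H →L[ℂ] H}
    (h : ∀ v w : H, trace (InnerProductSpace.rankOne ℂ w v * X)
      = trace (InnerProductSpace.rankOne ℂ w v * Y)) : X = Y := by
  ext w
  refine ext_inner_left ℂ fun v => ?_
  rw [← trace_rankOne_mul, h, trace_rankOne_mul]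

theorem rankOne_self_isPositive (v : H) : (InnerProductSpace.rankOne ℂ v v).IsPositive := by
  rw [ContinuousLinearMap.isPositive_iff_complex]
  intro x
  have : (inner ℂ (InnerProductSpace.rankOne ℂ v v x) x : ℂ)
      = ((‖(inner ℂ v x : ℂ)‖ ^ 2 : ℝ) : ℂ) := by
    rw [Complex.ofReal_pow, ← Complex.mul_conj']
    simp
  rw [this]
  constructor
  · simp only [RCLike.re_to_complex, Complex.ofReal_re]
  · simp only [RCLike.re_to_complex, Complex.ofReal_re]; positivity

/-! ### Positive trace class operators -/

/-- A positive operator with summable diagonal is `∑ |xₙ⟩⟨xₙ|` with `∑ ‖xₙ‖² < ∞`. -/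
theorem exists_isRep_self_of_isPositive {X : H →L[ℂ] H} (hp : X.IsPositive)
    (hs : Summable fun i => (inner ℂ (traceBasis H i) (X (traceBasis H i)) : ℂ)) :
    ∃ x : (exists_hilbertBasis ℂ H).choose → H, IsRep x x X := by
  have h0 : 0 ≤ X := (ContinuousLinearMap.nonneg_iff_isPositive X).2 hp
  set s := CFC.sqrt X with hsdef
  have hss : s * s = X := CFC.sqrt_mul_sqrt_self X h0
  have hsa : ∀ v w, (inner ℂ (s v) w : ℂ) = inner ℂ v (s w) := by
    have : s.IsPositive := (ContinuousLinearMap.nonneg_iff_isPositive s).1 (CFC.sqrt_nonneg X)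
    exact fun v w => this.isSymmetric v w
  have hX : ∀ z, X z = s (s z) := fun z => by rw [← hss]; rfl
  -- With `xᵢ = X^{1/2} bᵢ` the sum `∑ ‖xᵢ‖²` is the sum of the diagonal of `X`, and applying
  -- `X^{1/2}` to the basis expansion of `X^{1/2} z` gives the representation.
  refine ⟨fun i => s (traceBasis H i), ?_, fun z => ?_⟩
  · have := Complex.reCLM.summable hs
    refine this.congr fun i => ?_
    rw [hX, ← hsa]
    simp [inner_self_eq_norm_sq_to_K, ← pow_two]
    norm_cast
  · have := ((traceBasis H).hasSum_repr (s z)).mapL s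
    simpa [hX, HilbertBasis.repr_apply_apply, hsa] using this

theorem IsTraceClass.exists_isRep_self {X : H →L[ℂ] H} (h : IsTraceClass X)
    (hp : X.IsPositive) :
    ∃ x : (exists_hilbertBasis ℂ H).choose → H, IsRep x x X :=
  exists_isRep_self_of_isPositive hp (by simpa using (h.hasSum_trace_mul 1).summable)

theorem _root_.ContinuousLinearMap.IsPositive.inner_eq_re {a : H →L[ℂ] H} (ha : a.IsPositive)
    (x : H) : (inner ℂ x (a x) : ℂ) = ((inner ℂ x (a x) : ℂ).re : ℂ) ∧
      0 ≤ (inner ℂ x (a x) : ℂ).re := by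
  refine ⟨?_, ha.re_inner_nonneg_right x⟩
  have h1 : (inner ℂ (a x) x : ℂ) = inner ℂ x (a x) := ha.isSymmetric x x
  have h2 := (ContinuousLinearMap.isPositive_iff_complex a).1 ha x
  rw [← h1]
  exact h2.1.symm

/-- The trace of the product of two positive operators is nonnegative. -/
theorem IsTraceClass.trace_mul_nonneg {X a : H →L[ℂ] H} (h : IsTraceClass X)
    (hp : X.IsPositive) (ha : a.IsPositive) :
    trace (a * X) = ((trace (a * X)).re : ℂ) ∧ 0 ≤ (trace (a * X)).re := by
  obtain ⟨x, hr⟩ := h.exists_isRep_self hp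
  have h1 := (hr.summable_inner a).hasSum
  rw [← hr.trace_mul] at h1
  have h2 : HasSum (fun n => (inner ℂ (x n) (a (x n)) : ℂ).re) (trace (a * X)).re :=
    h1.mapL Complex.reCLM
  refine ⟨h1.unique ?_, h2.nonneg fun n => (ha.inner_eq_re (x n)).2⟩
  refine (Complex.hasSum_ofReal.2 h2).congr_fun fun n => ?_
  exact (ha.inner_eq_re (x n)).1

theorem IsTraceClass.trace_mul_le {X a b : H →L[ℂ] H} (h : IsTraceClass X)
    (hp : X.IsPositive) (hab : (b - a).IsPositive) :
    (trace (a * X)).re ≤ (trace (b * X)).re := by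
  have h1 := (h.trace_mul_nonneg hp hab).2
  have h2 := h.trace_add_mul a (b - a)
  rw [add_sub_cancel] at h2
  rw [h2, Complex.add_re]
  linarith

end TraceClass

/-! ### Strong measurability of random operators -/

section OperatorMeasurability

variable {H : Type*} [NormedAddCommGroup H] [InnerProductSpace ℂ H] [CompleteSpace H]
  [TopologicalSpace.SeparableSpace H]

/-- Distinct basis vectors are at distance `√2`, so balls of radius `1/2` around them are disjoint,
and a separable space holds only countably many. -/
instance countable_traceBasis : Countable (exists_hilbertBasis ℂ H).choose := by
  have ho := (traceBasis H).orthonormal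
  have hd : Pairwise (Function.onFun Disjoint fun i => Metric.ball (traceBasis H i) (1 / 2)) := by
    intro i j hij
    refine Metric.ball_disjoint_ball ?_
    have h2 : ‖traceBasis H i - traceBasis H j‖ ^ 2 = 2 := by
      rw [@norm_sub_sq ℂ, ho.1 i, ho.1 j, ho.2 hij]
      norm_num
    rw [dist_eq_norm]
    nlinarith [norm_nonneg (traceBasis H i - traceBasis H j)]
  exact hd.countable_of_isOpen_disjoint (fun i => Metric.isOpen_ball)
    (fun i => ⟨_, Metric.mem_ball_self (by norm_num)⟩)

theorem stronglyMeasurable_of_hasSum {X ι E : Type*} [MeasurableSpace X] [Countable ι]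
    [NormedAddCommGroup E] {f : ι → X → E} {g : X → E} (hf : ∀ i, StronglyMeasurable (f i))
    (h : ∀ x, HasSum (fun i => f i x) (g x)) : StronglyMeasurable g := by
  refine stronglyMeasurable_of_tendsto (f := fun (s : Finset ι) x => ∑ i ∈ s, f i x) atTop
    (fun s => ?_) (tendsto_pi_nhds.2 fun x => h x)
  exact Finset.stronglyMeasurable_fun_sum s fun i _ => hf i

theorem stronglyMeasurable_of_inner {X : Type*} [MeasurableSpace X] {f : X → H}
    (h : ∀ v, Measurable fun x => (inner ℂ v (f x) : ℂ)) : StronglyMeasurable f := by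
  refine stronglyMeasurable_of_hasSum
    (f := fun i x => (inner ℂ (traceBasis H i) (f x) : ℂ) • traceBasis H i)
    (fun i => (h _).stronglyMeasurable.smul_const _) fun x => ?_
  simpa [HilbertBasis.repr_apply_apply] using (traceBasis H).hasSum_repr (f x)

/-- Operator valued functions which are measurable in the strong operator topology. -/
def SOTMeasurable {X : Type*} [MeasurableSpace X] (B : X → (H →L[ℂ] H)) : Prop :=
  ∀ w, StronglyMeasurable fun x => B x w

variable {X : Type*} [MeasurableSpace X] {A B : X → (H →L[ℂ] H)}

theorem SOTMeasurable.of_inner (h : ∀ v w, Measurable fun x => (inner ℂ v (B x w) : ℂ)) :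
    SOTMeasurable B := fun w => stronglyMeasurable_of_inner fun v => h v w

theorem SOTMeasurable.const (a : H →L[ℂ] H) : SOTMeasurable (fun _ : X => a) :=
  fun _ => stronglyMeasurable_const

theorem SOTMeasurable.comp {Y : Type*} [MeasurableSpace Y] (h : SOTMeasurable B) {g : Y → X}
    (hg : Measurable g) : SOTMeasurable fun y => B (g y) :=
  fun w => (h w).comp_measurable hg

/-- Expanding `f` in the countable basis reduces the random vector to fixed ones, so strong
measurability survives products although multiplication is not jointly continuous in the strong
topology. -/
theorem SOTMeasurable.apply (h : SOTMeasurable B) {f : X → H} (hf : StronglyMeasurable f) :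
    StronglyMeasurable fun x => B x (f x) := by
  refine stronglyMeasurable_of_hasSum
    (f := fun i x => (inner ℂ (traceBasis H i) (f x) : ℂ) • B x (traceBasis H i))
    (fun i => (stronglyMeasurable_const.inner hf).smul (h _)) fun x => ?_
  simpa [HilbertBasis.repr_apply_apply] using ((traceBasis H).hasSum_repr (f x)).mapL (B x)

theorem SOTMeasurable.mul (hA : SOTMeasurable A) (hB : SOTMeasurable B) :
    SOTMeasurable fun x => A x * B x := fun w => hA.apply (hB w)

theorem SOTMeasurable.add (hA : SOTMeasurable A) (hB : SOTMeasurable B) :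
    SOTMeasurable fun x => A x + B x := fun w => (hA w).add (hB w)

theorem SOTMeasurable.smul (hA : SOTMeasurable A) (c : ℂ) :
    SOTMeasurable fun x => c • A x := fun w => (hA w).const_smul c

theorem SOTMeasurable.adjoint (hA : SOTMeasurable A) :
    SOTMeasurable fun x => (A x).adjoint := by
  refine .of_inner fun v w => ?_
  simp only [ContinuousLinearMap.adjoint_inner_right]
  exact ((hA v).inner stronglyMeasurable_const).measurable

theorem SOTMeasurable.measurable_inner (hA : SOTMeasurable A) {f g : X → H}
    (hf : StronglyMeasurable f) (hg : StronglyMeasurable g) :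
    Measurable fun x => (inner ℂ (f x) (A x (g x)) : ℂ) :=
  (hf.inner (hA.apply hg)).measurable

theorem SOTMeasurable.of_hasSum {ι : Type*} [Countable ι] {A : ι → X → (H →L[ℂ] H)}
    (hA : ∀ i, SOTMeasurable (A i)) (h : ∀ x w, HasSum (fun i => A i x w) (B x w)) :
    SOTMeasurable B := fun w => stronglyMeasurable_of_hasSum (fun i => hA i w) fun x => h x w

/-- The norm bound needs testing only on a dense sequence of vectors, so only countably many
measurable conditions occur. -/
theorem SOTMeasurable.measurable_norm (hA : SOTMeasurable A) : Measurable fun x => ‖A x‖ := by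
  refine measurable_of_Iic fun c => ?_
  rcases lt_or_ge c 0 with hc | hc
  · convert MeasurableSet.empty
    ext x
    simpa using hc.trans_le (norm_nonneg _)
  have : (fun x => ‖A x‖) ⁻¹' Iic c = ⋂ n : ℕ, {x | ‖A x (TopologicalSpace.denseSeq H n)‖
      ≤ c * ‖TopologicalSpace.denseSeq H n‖} := by
    ext x
    simp only [mem_preimage, mem_Iic, mem_iInter, mem_ofPred_eq]
    refine ⟨fun h n => (A x).le_of_opNorm_le h _, fun h => (A x).opNorm_le_bound hc fun z => ?_⟩
    have hcl : IsClosed {z | ‖A x z‖ ≤ c * ‖z‖} :=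
      isClosed_le (by fun_prop) (by fun_prop)
    have := hcl.closure_subset_iff.2 (show range (TopologicalSpace.denseSeq H) ⊆ _ by
      rintro _ ⟨n, rfl⟩; exact h n)
    exact this (TopologicalSpace.denseRange_denseSeq H z)
  rw [this]
  exact MeasurableSet.iInter fun n =>
    measurableSet_le (hA _).norm.measurable measurable_const

theorem SOTMeasurable.measurable_trace_mul (hA : SOTMeasurable A) (hB : SOTMeasurable B)
    (hT : ∀ x, IsTraceClass (B x)) : Measurable fun x => trace (A x * B x) := by
  refine (stronglyMeasurable_of_hasSum
    (f := fun i x => (inner ℂ (traceBasis H i) (A x (B x (traceBasis H i))) : ℂ)) (fun i => ?_)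
    fun x => (hT x).hasSum_trace_mul (A x)).measurable
  exact (hA.measurable_inner stronglyMeasurable_const (hB _)).stronglyMeasurable

end OperatorMeasurability

/-! ### The dual of a Kraus map -/

section Kraus

variable {H : Type*} [NormedAddCommGroup H] [InnerProductSpace ℂ H] [CompleteSpace H]
  {ι : Type*} {T : ι → (H →L[ℂ] H)} {R : H →L[ℂ] H}

theorem isPositive_of_inner {a : H →L[ℂ] H}
    (h : ∀ x, ∃ r : ℝ, (inner ℂ x (a x) : ℂ) = r ∧ 0 ≤ r) : a.IsPositive := by
  rw [ContinuousLinearMap.isPositive_iff_complex]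
  intro x
  obtain ⟨r, hr, h0⟩ := h x
  have : (inner ℂ (a x) x : ℂ) = r := by rw [← inner_conj_symm, hr, Complex.conj_ofReal]
  simp [this, h0]

/-- `a ↦ ∑ Tₖ† a Tₖ`, where the series converges strongly. -/
noncomputable def krausDual (T : ι → (H →L[ℂ] H)) (a : H →L[ℂ] H) : H →L[ℂ] H :=
  open Classical in
  if h : ∃ B : H →L[ℂ] H, ∀ x, HasSum (fun k => (T k).adjoint (a (T k x))) (B x)
    then h.choose else 0

/-- `∑ Tₖ† Tₖ = R` strongly. -/
def KrausSum (T : ι → (H →L[ℂ] H)) (R : H →L[ℂ] H) : Prop :=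
  ∀ x, HasSum (fun k => (T k).adjoint (T k x)) (R x)

theorem KrausSum.hasSum_inner (h : KrausSum T R) (x y : H) :
    HasSum (fun k => (inner ℂ (T k y) (T k x) : ℂ)) (inner ℂ y (R x)) := by
  simpa [ContinuousLinearMap.adjoint_inner_right] using (h x).mapL (innerSL ℂ y)

theorem KrausSum.hasSum_norm_sq (h : KrausSum T R) (x : H) :
    HasSum (fun k => ‖T k x‖ ^ 2) (inner ℂ x (R x) : ℂ).re := by
  have := (h.hasSum_inner x x).mapL Complex.reCLM
  simpa [inner_self_eq_norm_sq_to_K, ← Complex.ofReal_pow] using this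

theorem re_inner_le_opNorm (R : H →L[ℂ] H) (x : H) : (inner ℂ x (R x) : ℂ).re ≤ ‖R‖ * ‖x‖ ^ 2 := by
  calc (inner ℂ x (R x) : ℂ).re ≤ ‖x‖ * (‖R‖ * ‖x‖) :=
        ((Complex.re_le_norm _).trans (norm_inner_le_norm _ _)).trans
          (by gcongr; exact R.le_opNorm x)
    _ = _ := by ring

theorem KrausSum.sum_norm_sq_le (h : KrausSum T R) (x : H) (s : Finset ι) :
    ∑ k ∈ s, ‖T k x‖ ^ 2 ≤ ‖R‖ * ‖x‖ ^ 2 :=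
  (sum_le_hasSum s (fun _ _ => by positivity) (h.hasSum_norm_sq x)).trans (re_inner_le_opNorm R x)

/-- The row `(Tₖ†)` is the adjoint of the column `(Tₖ)`, whose norm squared is at most `‖R‖`.
Concretely, pair `w` with itself, apply Cauchy–Schwarz and cancel one factor `‖w‖²`. -/
theorem KrausSum.norm_sum_adjoint_le (h : KrausSum T R) (v : ι → H) (s : Finset ι) :
    ‖∑ k ∈ s, (T k).adjoint (v k)‖ ^ 2 ≤ ‖R‖ * ∑ k ∈ s, ‖v k‖ ^ 2 := by
  set w := ∑ k ∈ s, (T k).adjoint (v k) with hw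
  have h1 : ‖w‖ ^ 2 ≤ ∑ k ∈ s, ‖T k w‖ * ‖v k‖ := by
    have : ((‖w‖ ^ 2 : ℝ) : ℂ) = ∑ k ∈ s, (inner ℂ (T k w) (v k) : ℂ) := by
      rw [Complex.ofReal_pow, ← Complex.coe_algebraMap, ← inner_self_eq_norm_sq_to_K (𝕜 := ℂ)]
      nth_rewrite 2 [hw]
      simp [inner_sum, ContinuousLinearMap.adjoint_inner_right]
    have h2 := congrArg norm this
    rw [Complex.norm_real, Real.norm_of_nonneg (by positivity)] at h2
    rw [h2]
    exact (norm_sum_le _ _).trans (Finset.sum_le_sum fun k _ => norm_inner_le_norm _ _)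
  have h2 := (Finset.sum_mul_sq_le_sq_mul_sq s (fun k => ‖T k w‖) fun k => ‖v k‖)
  have h3 := h.sum_norm_sq_le w s
  have h4 : (0 : ℝ) ≤ ∑ k ∈ s, ‖v k‖ ^ 2 := by positivity
  have h5 : (‖w‖ ^ 2) ^ 2 ≤ (‖R‖ * ‖w‖ ^ 2) * ∑ k ∈ s, ‖v k‖ ^ 2 :=
    (pow_le_pow_left₀ (by positivity) h1 2).trans (h2.trans (by gcongr))
  rcases eq_or_lt_of_le (sq_nonneg ‖w‖) with h0 | h0
  · rw [← h0]; positivity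
  · refine le_of_mul_le_mul_right ?_ h0
    linarith

theorem KrausSum.summable_adjoint (h : KrausSum T R) {v : ι → H}
    (hv : Summable fun k => ‖v k‖ ^ 2) : Summable fun k => (T k).adjoint (v k) := by
  rw [summable_iff_vanishing_norm]
  intro ε hε
  obtain ⟨s, hs⟩ := summable_iff_vanishing_norm.1 hv (ε ^ 2 / (‖R‖ + 1)) (by positivity)
  refine ⟨s, fun t ht => ?_⟩
  have h1 := hs t ht
  rw [Real.norm_of_nonneg (by positivity), lt_div_iff₀ (by positivity)] at h1
  have h2 := h.norm_sum_adjoint_le v t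
  have h3 : (0 : ℝ) ≤ ∑ k ∈ t, ‖v k‖ ^ 2 := by positivity
  refine lt_of_pow_lt_pow_left₀ 2 hε.le ?_
  nlinarith

theorem KrausSum.norm_sum_adjoint_apply_le (h : KrausSum T R) (a : H →L[ℂ] H) (x : H)
    (s : Finset ι) : ‖∑ k ∈ s, (T k).adjoint (a (T k x))‖ ≤ ‖R‖ * ‖a‖ * ‖x‖ := by
  refine le_of_sq_le_sq ?_ (by positivity)
  refine (h.norm_sum_adjoint_le _ s).trans ?_
  calc ‖R‖ * ∑ k ∈ s, ‖a (T k x)‖ ^ 2 ≤ ‖R‖ * ∑ k ∈ s, ‖a‖ ^ 2 * ‖T k x‖ ^ 2 := by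
        gcongr with k
        rw [← mul_pow]
        gcongr
        exact a.le_opNorm _
    _ ≤ ‖R‖ * (‖a‖ ^ 2 * (‖R‖ * ‖x‖ ^ 2)) := by
        rw [← Finset.mul_sum]
        gcongr
        exact h.sum_norm_sq_le x s
    _ = _ := by ring

/-- The vectors `a Tₖ x` are square summable, so the row bound makes the series converge strongly to
a bounded operator; the junk branch in the definition of `krausDual` is therefore never taken. -/
theorem KrausSum.hasSum_krausDual (h : KrausSum T R) (a : H →L[ℂ] H) (x : H) :
    HasSum (fun k => (T k).adjoint (a (T k x))) (krausDual T a x) := by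
  have hv : ∀ x, Summable fun k => ‖a (T k x)‖ ^ 2 := fun x => by
    refine Summable.of_nonneg_of_le (fun _ => by positivity) (fun k => ?_)
      ((h.hasSum_norm_sq x).summable.mul_left (‖a‖ ^ 2))
    rw [← mul_pow]
    gcongr
    exact a.le_opNorm _
  have hs := fun x => h.summable_adjoint (hv x)
  have hex : ∃ B : H →L[ℂ] H, ∀ x, HasSum (fun k => (T k).adjoint (a (T k x))) (B x) := by
    refine ⟨LinearMap.mkContinuous
      { toFun := fun x => ∑' k, (T k).adjoint (a (T k x))
        map_add' := fun x y => by simp [(hs x).tsum_add (hs y)]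
        map_smul' := fun c x => by simp [(hs x).tsum_const_smul c] } (‖R‖ * ‖a‖) fun x => ?_,
      fun x => (hs x).hasSum⟩
    exact le_of_tendsto (hs x).hasSum.norm
      (Eventually.of_forall fun s => h.norm_sum_adjoint_apply_le a x s)
  rw [krausDual, dif_pos hex]
  exact hex.choose_spec x

theorem KrausSum.hasSum_inner_krausDual (h : KrausSum T R) (a : H →L[ℂ] H) (x y : H) :
    HasSum (fun k => (inner ℂ (T k y) (a (T k x)) : ℂ)) (inner ℂ y (krausDual T a x)) := by
  simpa [ContinuousLinearMap.adjoint_inner_right] using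
    (h.hasSum_krausDual a x).mapL (innerSL ℂ y)

theorem KrausSum.summable_norm_mul_norm (h : KrausSum T R) (x y : H) :
    Summable (fun k => ‖T k x‖ * ‖T k y‖) ∧
      ∑' k, ‖T k x‖ * ‖T k y‖ ≤ ‖R‖ * (‖x‖ * ‖y‖) := by
  have hb : ∀ s : Finset ι, ∑ k ∈ s, ‖T k x‖ * ‖T k y‖ ≤ ‖R‖ * (‖x‖ * ‖y‖) := fun s => by
    have h2 := (Finset.sum_mul_sq_le_sq_mul_sq s (fun k => ‖T k x‖) fun k => ‖T k y‖)
    refine le_of_sq_le_sq (h2.trans ?_) (by positivity)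
    calc _ ≤ (‖R‖ * ‖x‖ ^ 2) * (‖R‖ * ‖y‖ ^ 2) := by
          gcongr
          · exact h.sum_norm_sq_le x s
          · exact h.sum_norm_sq_le y s
      _ = _ := by ring
  have hs := summable_of_sum_le (fun _ => by positivity) hb
  exact ⟨hs, hs.tsum_le_of_sum_le hb⟩

theorem KrausSum.norm_krausDual_le (h : KrausSum T R) (a : H →L[ℂ] H) :
    ‖krausDual T a‖ ≤ ‖R‖ * ‖a‖ := by
  refine ContinuousLinearMap.opNorm_le_bound _ (by positivity) fun x => ?_
  exact le_of_tendsto (h.hasSum_krausDual a x).norm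
    (Eventually.of_forall fun s => h.norm_sum_adjoint_apply_le a x s)

theorem KrausSum.krausDual_adjoint (h : KrausSum T R) (a : H →L[ℂ] H) :
    krausDual T a.adjoint = (krausDual T a).adjoint := by
  ext x
  refine ext_inner_left ℂ fun y => ?_
  rw [ContinuousLinearMap.adjoint_inner_right, ← inner_conj_symm ((krausDual T a) y)]
  refine (h.hasSum_inner_krausDual a.adjoint x y).unique ?_
  have := (h.hasSum_inner_krausDual a y x).mapL Complex.conjCLE.toContinuousLinearMap
  refine this.congr_fun fun k => ?_
  simp [ContinuousLinearMap.adjoint_inner_right]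

theorem KrausSum.krausDual_isPositive (h : KrausSum T R) {a : H →L[ℂ] H} (ha : a.IsPositive) :
    (krausDual T a).IsPositive := by
  refine isPositive_of_inner fun x => ⟨_, ?_,
    (((h.hasSum_inner_krausDual a x x).mapL Complex.reCLM).nonneg fun k =>
      (ha.inner_eq_re (T k x)).2)⟩
  refine (h.hasSum_inner_krausDual a x x).unique ?_
  refine (Complex.hasSum_ofReal.2
    ((h.hasSum_inner_krausDual a x x).mapL Complex.reCLM)).congr_fun fun k => ?_
  exact (ha.inner_eq_re (T k x)).1

theorem KrausSum.krausDual_one (h : KrausSum T R) : krausDual T 1 = R := by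
  ext x
  exact (h.hasSum_krausDual 1 x).unique (h x)

theorem KrausSum.isPositive (h : KrausSum T R) : R.IsPositive := by
  rw [← h.krausDual_one]
  exact h.krausDual_isPositive ContinuousLinearMap.isPositive_one

/-- The Kraus map `X ↦ ∑ Tₖ X Tₖ†` on trace class operators. -/
theorem IsRep.tsum_conj {κ : Type*} {x y : κ → H} {X : H →L[ℂ] H} (hX : IsRep x y X)
    (hs : Summable fun p : ι × κ => ‖T p.1 (x p.2)‖ * ‖T p.1 (y p.2)‖) :
    Summable (fun k => T k * X * (T k).adjoint) ∧
    IsRep (fun p : ι × κ => T p.1 (x p.2)) (fun p => T p.1 (y p.2))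
      (∑' k, T k * X * (T k).adjoint) := by
  have hk : ∀ k, IsRep (fun n => T k (x n)) (fun n => T k (y n)) (T k * X * (T k).adjoint) :=
    fun k => by simpa using (hX.comp_left (T k)).comp_right (T k).adjoint
  have hsum : Summable fun k => T k * X * (T k).adjoint :=
    Summable.of_norm_bounded hs.prod fun k => (hk k).norm_le
  refine ⟨hsum, hs, fun z => ?_⟩
  have hz : Summable fun p : ι × κ =>
      (inner ℂ (T p.1 (y p.2)) z : ℂ) • T p.1 (x p.2) := by
    refine Summable.of_norm_bounded (hs.mul_right ‖z‖) fun p => ?_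
    rw [norm_smul]
    calc _ ≤ (‖T p.1 (y p.2)‖ * ‖z‖) * ‖T p.1 (x p.2)‖ := by
          gcongr; exact norm_inner_le_norm _ _
      _ = _ := by ring
  have h1 := hz.hasSum.prod_fiberwise fun k => (hk k).hasSum z
  have h2 := hsum.hasSum.mapL (ContinuousLinearMap.apply ℂ H z)
  rw [show (∑' k, T k * X * (T k).adjoint) z = _ from h2.unique h1]
  exact hz.hasSum

/-- Cauchy–Schwarz over `k` bounds `∑ₖ ‖Tₖ xₙ‖‖Tₖ yₙ‖` by `‖R‖‖xₙ‖‖yₙ‖`, which makes the family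
indexed by pairs `(k, n)` summable. -/
theorem KrausSum.isRep_tsum (h : KrausSum T R) {x y : ℕ → H} {X : H →L[ℂ] H}
    (hX : IsRep x y X) :
    Summable (fun k => T k * X * (T k).adjoint) ∧
    IsRep (fun p : ι × ℕ => T p.1 (x p.2)) (fun p => T p.1 (y p.2))
      (∑' k, T k * X * (T k).adjoint) := by
  refine hX.tsum_conj ?_
  refine (Equiv.prodComm ℕ ι).summable_iff.1 ?_
  refine (summable_prod_of_nonneg fun p => by simp; positivity).2 ⟨fun n => ?_, ?_⟩
  · exact (h.summable_norm_mul_norm (x n) (y n)).1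
  · refine Summable.of_nonneg_of_le (fun n => tsum_nonneg fun _ => by simp; positivity)
      (fun n => ?_) (hX.summable.mul_left ‖R‖)
    exact (h.summable_norm_mul_norm (x n) (y n)).2

/-- The same double sum over `(k, n)` is evaluated in the other order. The `HasSum` form along the
basis lets the pieces of the generator be added without first showing that each image is of trace
class. -/
theorem KrausSum.trace_mul_tsum (h : KrausSum T R) {X : H →L[ℂ] H} (hX : IsTraceClass X)
    (a : H →L[ℂ] H) :
    HasSum (fun i => (inner ℂ (traceBasis H i)
      (a ((∑' k, T k * X * (T k).adjoint) (traceBasis H i))) : ℂ))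
      (trace (krausDual T a * X)) := by
  obtain ⟨x, y, hr⟩ := hX.exists_isRep
  have h1 := (h.isRep_tsum hr).2
  convert h1.hasSum_trace_mul (traceBasis H) a using 1
  rw [hr.trace_mul]
  have hs := h1.summable_inner a
  rw [← (Equiv.prodComm ℕ ι).tsum_eq]
  have hs' := (Equiv.prodComm ℕ ι).summable_iff.2 hs
  refine (hs'.hasSum.prod_fiberwise fun n => ?_).tsum_eq
  exact h.hasSum_inner_krausDual a (x n) (y n)

end Kraus

/-! ### Regularity of the coefficients -/

section Coefficients

variable {U E H ι₁ ι₂ : Type*} [MeasurableSpace U] [MeasurableSpace E] [NormedAddCommGroup H]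
  [InnerProductSpace ℂ H] [CompleteSpace H]

/-- The grid points `⌊n t⌋ / n` approach `t` from the left without exceeding it, so left continuity
in time alone gives joint measurability. -/
theorem SOTMeasurable.of_leftCont [TopologicalSpace.SeparableSpace H]
    {Y : Type*} [MeasurableSpace Y] {B : ℝ≥0 → Y → (H →L[ℂ] H)}
    (hB : ∀ t, SOTMeasurable (B t))
    (hc : ∀ y x t, ContinuousWithinAt (fun s => B s y x) (Iic t) t) :
    SOTMeasurable fun p : ℝ≥0 × Y => B p.1 p.2 := by
  intro x
  have hfl : ∀ t : ℝ≥0, Tendsto (fun n : ℕ => (⌊(n : ℝ≥0) * t⌋₊ : ℝ≥0) / n) atTop (𝓝 t) :=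
    fun t => by
      have := (tendsto_nat_floor_mul_div_atTop (R := ℝ) (NNReal.coe_nonneg t)).comp
        (tendsto_natCast_atTop_atTop (R := ℝ))
      rw [← NNReal.tendsto_coe]
      refine this.congr fun n => ?_
      simp only [Function.comp, NNReal.coe_div, NNReal.coe_natCast]
      congr 2
      rw [mul_comm (n : ℝ≥0), ← NNReal.coe_natCast, ← NNReal.coe_mul]
      exact Nonneg.nat_floor_coe _
  refine stronglyMeasurable_of_tendsto
    (f := fun (n : ℕ) (p : ℝ≥0 × Y) => B ((⌊(n : ℝ≥0) * p.1⌋₊ : ℝ≥0) / n) p.2 x) atTop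
    (fun n => ?_) (tendsto_pi_nhds.2 fun p => ?_)
  · refine stronglyMeasurable_of_inner fun v => ?_
    have h1 : ∀ F : ℕ → Y → ℂ, (∀ k, Measurable (F k)) → ∀ g : ℝ≥0 → ℕ, Measurable g →
        Measurable fun p : ℝ≥0 × Y => F (g p.1) p.2 := fun F hF g hg =>
      (measurable_from_prod_countable_right (f := fun q : ℕ × Y => F q.1 q.2) hF).comp
        ((hg.comp measurable_fst).prodMk measurable_snd)
    exact h1 (fun k y => inner ℂ v (B ((k : ℝ≥0) / n) y x))
      (fun k => (stronglyMeasurable_const.inner (hB ((k : ℝ≥0) / n) x)).measurable)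
      (fun t => ⌊(n : ℝ≥0) * t⌋₊) (by fun_prop)
  · refine (hc p.2 x p.1).tendsto.comp (tendsto_nhdsWithin_iff.2 ⟨hfl p.1, ?_⟩)
    refine (eventually_gt_atTop 0).mono fun n hn => ?_
    have hn' : (0 : ℝ≥0) < n := by exact_mod_cast hn
    rw [mem_Iic, div_le_iff₀ hn', mul_comm p.1]
    exact Nat.floor_le (by positivity)

variable {C : Coefficients U E H ι₁ ι₂} {ν : Measure U}

theorem Coefficients.Regular.krausSum_lind (hC : C.Regular ν) (t : ℝ≥0) (e : E)
    (π : Trajectory U) : KrausSum (fun k => C.lind k t e π) (C.R₀ t e π) :=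
  hC.R₀_hasSum t e π

variable [TopologicalSpace.SeparableSpace H] [Countable ι₁] [Countable ι₂] [IsFiniteMeasure ν]

theorem Coefficients.Regular.sotMeasurable_jump (hC : C.Regular ν) (j : ι₁) :
    SOTMeasurable (fun q : U × ℝ≥0 × E × Trajectory U =>
      C.jump j q.1 q.2.1 q.2.2.1 q.2.2.2) := hC.jump_meas j

theorem Coefficients.Regular.sotMeasurable_ham (hC : C.Regular ν) :
    SOTMeasurable (fun q : ℝ≥0 × E × Trajectory U => C.ham q.1 q.2.1 q.2.2) :=
  SOTMeasurable.of_leftCont (B := fun t (q : E × Trajectory U) => C.ham t q.1 q.2)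
    (fun t => hC.ham_meas t) fun q x t => (hC.ham_rlc q.1 q.2 x t).1

theorem Coefficients.Regular.sotMeasurable_lind (hC : C.Regular ν) (k : ι₂) :
    SOTMeasurable (fun q : ℝ≥0 × E × Trajectory U => C.lind k q.1 q.2.1 q.2.2) :=
  SOTMeasurable.of_leftCont (B := fun t (q : E × Trajectory U) => C.lind k t q.1 q.2)
    (fun t => hC.lind_meas k t) fun q x t => (hC.lind_rlc k q.1 q.2 x t).1

theorem Coefficients.Regular.sotMeasurable_R₀ (hC : C.Regular ν) :
    SOTMeasurable (fun q : ℝ≥0 × E × Trajectory U => C.R₀ q.1 q.2.1 q.2.2) :=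
  SOTMeasurable.of_hasSum
    (A := fun k q => (C.lind k q.1 q.2.1 q.2.2).adjoint * C.lind k q.1 q.2.1 q.2.2)
    (fun k => (hC.sotMeasurable_lind k).adjoint.mul (hC.sotMeasurable_lind k))
    fun q x => hC.R₀_hasSum q.1 q.2.1 q.2.2 x

theorem Coefficients.Regular.sotMeasurable_R (hC : C.Regular ν) :
    SOTMeasurable (fun q : ℝ≥0 × E × Trajectory U => C.R q.1 q.2.1 q.2.2) := by
  intro x
  refine stronglyMeasurable_of_hasSum (fun j => ?_) fun q => hC.R_hasSum q.1 q.2.1 q.2.2 x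
  exact ((((hC.sotMeasurable_jump j).adjoint.mul (hC.sotMeasurable_jump j)) x)).integral_prod_left'

theorem Coefficients.Regular.integrable_jump (hC : C.Regular ν) (j : ι₁) (t : ℝ≥0) (e : E)
    (π : Trajectory U) (x : H) :
    Integrable (fun u => (C.jump j u t e π).adjoint (C.jump j u t e π x)) ν := by
  obtain ⟨M, hM⟩ := hC.jump_bdd t
  have hm : SOTMeasurable fun u => C.jump j u t e π :=
    (hC.sotMeasurable_jump j).comp (g := fun u => (u, t, e, π)) measurable_prodMk_right
  refine Integrable.of_bound ((hm.adjoint.mul hm) x).aestronglyMeasurable (M * (M * ‖x‖))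
    (ae_of_all _ fun u => ?_)
  have h1 := hM j u t e π le_rfl
  have h0 : 0 ≤ M := (norm_nonneg _).trans h1
  refine ((C.jump j u t e π).adjoint.le_opNorm _).trans ?_
  rw [LinearIsometryEquiv.norm_map]
  gcongr
  exact (C.jump j u t e π).le_of_opNorm_le h1 x

theorem Coefficients.Regular.hasSum_inner_R (hC : C.Regular ν) (t : ℝ≥0) (e : E)
    (π : Trajectory U) (x y : H) :
    HasSum (fun j => ∫ u, (inner ℂ (C.jump j u t e π y) (C.jump j u t e π x) : ℂ) ∂ν)
      (inner ℂ y (C.R t e π x)) := by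
  refine ((hC.R_hasSum t e π x).mapL (innerSL ℂ y)).congr_fun fun j => ?_
  rw [← (innerSL ℂ y).integral_comp_comm (hC.integrable_jump j t e π x)]
  simp [ContinuousLinearMap.adjoint_inner_right]

theorem Coefficients.Regular.R_isPositive (hC : C.Regular ν) (t : ℝ≥0) (e : E)
    (π : Trajectory U) : (C.R t e π).IsPositive := by
  refine isPositive_of_inner fun x => ?_
  have h := hC.hasSum_inner_R t e π x x
  have e1 : ∀ j, ∫ u, (inner ℂ (C.jump j u t e π x) (C.jump j u t e π x) : ℂ) ∂ν
      = ((∫ u, ‖C.jump j u t e π x‖ ^ 2 ∂ν : ℝ) : ℂ) := fun j => by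
    refine (integral_congr_ae (ae_of_all _ fun u => ?_)).trans integral_ofReal
    simp [inner_self_eq_norm_sq_to_K]
  simp only [e1] at h
  have h2 := h.mapL Complex.reCLM
  simp only [Complex.reCLM_apply, Complex.ofReal_re] at h2
  exact ⟨_, h.unique (Complex.hasSum_ofReal.2 h2),
    h2.nonneg fun j => integral_nonneg fun u => by positivity⟩

/-! ### The dual of the no-jump generator -/

/-- `-iH - (R₀ + R)/2`. -/
noncomputable def Coefficients.genOp (C : Coefficients U E H ι₁ ι₂) (t : ℝ≥0) (e : E)
    (π : Trajectory U) : H →L[ℂ] H :=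
  (-Complex.I) • C.ham t e π + (-(1 / 2) : ℂ) • (C.R₀ t e π + C.R t e π)

/-- The dual of the no-jump generator, acting on bounded operators. -/
noncomputable def Coefficients.noJumpDual (C : Coefficients U E H ι₁ ι₂) (t : ℝ≥0) (e : E)
    (π : Trajectory U) (a : H →L[ℂ] H) : H →L[ℂ] H :=
  (C.genOp t e π).adjoint * a + a * C.genOp t e π + krausDual (fun k => C.lind k t e π) a

/-- A bound on the norm of the no-jump generator. -/
noncomputable def Coefficients.genRate (C : Coefficients U E H ι₁ ι₂) (t : ℝ≥0) (e : E)
    (π : Trajectory U) : ℝ :=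
  1 + 2 * ‖C.ham t e π‖ + 2 * ‖C.R₀ t e π‖ + ‖C.R t e π‖

/-- The summand `1` in the rate makes its integral over a nondegenerate interval strictly positive
and lets positivity arguments divide by the rate. -/
theorem Coefficients.one_le_genRate (C : Coefficients U E H ι₁ ι₂) (t : ℝ≥0) (e : E)
    (π : Trajectory U) : 1 ≤ C.genRate t e π := by
  unfold Coefficients.genRate
  linarith [norm_nonneg (C.ham t e π), norm_nonneg (C.R₀ t e π), norm_nonneg (C.R t e π)]

/-- One copy of `‖R₀‖` pays for the anticommutator and one for the Kraus part; this is why `R₀`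
carries a factor `2` in `genRate` and `R` does not. -/
theorem Coefficients.two_mul_norm_genOp_add_le (C : Coefficients U E H ι₁ ι₂) (t : ℝ≥0) (e : E)
    (π : Trajectory U) : 2 * ‖C.genOp t e π‖ + ‖C.R₀ t e π‖ ≤ C.genRate t e π := by
  have h1 := norm_add_le ((-Complex.I) • C.ham t e π)
    ((-(1 / 2) : ℂ) • (C.R₀ t e π + C.R t e π))
  have h2 := norm_add_le (C.R₀ t e π) (C.R t e π)
  rw [norm_smul, norm_smul] at h1
  norm_num at h1
  unfold Coefficients.genRate Coefficients.genOp
  norm_num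
  linarith

theorem Coefficients.Regular.norm_noJumpDual_le (hC : C.Regular ν) (t : ℝ≥0) (e : E)
    (π : Trajectory U) (a : H →L[ℂ] H) :
    ‖C.noJumpDual t e π a‖ ≤ C.genRate t e π * ‖a‖ := by
  have h1 := (hC.krausSum_lind t e π).norm_krausDual_le a
  have h2 := norm_mul_le (C.genOp t e π).adjoint a
  have h3 := norm_mul_le a (C.genOp t e π)
  rw [LinearIsometryEquiv.norm_map] at h2
  have h4 := C.two_mul_norm_genOp_add_le t e π
  calc _ ≤ ‖(C.genOp t e π).adjoint * a‖ + ‖a * C.genOp t e π‖ + _ := norm_add₃_le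
    _ ≤ (2 * ‖C.genOp t e π‖ + ‖C.R₀ t e π‖) * ‖a‖ := by linarith
    _ ≤ _ := by gcongr

theorem Coefficients.Regular.noJumpDual_adjoint (hC : C.Regular ν) (t : ℝ≥0) (e : E)
    (π : Trajectory U) (a : H →L[ℂ] H) :
    C.noJumpDual t e π a.adjoint = (C.noJumpDual t e π a).adjoint := by
  simp only [Coefficients.noJumpDual, (hC.krausSum_lind t e π).krausDual_adjoint]
  simp only [← ContinuousLinearMap.star_eq_adjoint, star_add, star_mul, star_star]
  abel

theorem Coefficients.Regular.genOp_adjoint (hC : C.Regular ν) (t : ℝ≥0) (e : E)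
    (π : Trajectory U) : (C.genOp t e π).adjoint =
      Complex.I • C.ham t e π + (-(1 / 2) : ℂ) • (C.R₀ t e π + C.R t e π) := by
  have h1 : star (C.ham t e π) = C.ham t e π := hC.ham_selfAdjoint t e π
  have h2 : star (C.R₀ t e π) = C.R₀ t e π :=
    ((hC.krausSum_lind t e π).isPositive.isSelfAdjoint)
  have h3 : star (C.R t e π) = C.R t e π := (hC.R_isPositive t e π).isSelfAdjoint
  rw [Coefficients.genOp, ← ContinuousLinearMap.star_eq_adjoint, star_add, star_smul, star_smul,
    star_add, h1, h2, h3]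
  simp

/-- The Hamiltonian and `R₀` contributions cancel because the free evolution preserves the trace;
mass is lost only through `R`. -/
theorem Coefficients.Regular.noJumpDual_one (hC : C.Regular ν) (t : ℝ≥0) (e : E)
    (π : Trajectory U) : C.noJumpDual t e π 1 = -C.R t e π := by
  rw [Coefficients.noJumpDual, hC.genOp_adjoint, (hC.krausSum_lind t e π).krausDual_one,
    Coefficients.genOp, mul_one, one_mul]
  module

theorem Coefficients.Regular.noJumpGen_eq (hC : C.Regular ν) (t : ℝ≥0) (e : E)
    (π : Trajectory U) (X : H →L[ℂ] H) : C.noJumpGen t e π X =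
      C.genOp t e π * X + X * (C.genOp t e π).adjoint
        + ∑' k, C.lind k t e π * X * (C.lind k t e π).adjoint := by
  rw [hC.genOp_adjoint, Coefficients.noJumpGen, Coefficients.free, Coefficients.genOp]
  simp only [add_mul, mul_add, smul_mul_assoc, mul_smul_comm]
  module

theorem Coefficients.Regular.hasSum_trace_noJumpGen (hC : C.Regular ν) (t : ℝ≥0) (e : E)
    (π : Trajectory U) {X : H →L[ℂ] H} (hX : IsTraceClass X) (a : H →L[ℂ] H) :
    HasSum (fun i => (inner ℂ (traceBasis H i)
      (a (C.noJumpGen t e π X (traceBasis H i))) : ℂ)) (trace (C.noJumpDual t e π a * X)) := by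
  obtain ⟨x, y, hr⟩ := hX.exists_isRep
  have h1 := hX.hasSum_trace_mul (a * C.genOp t e π)
  have h2 := (hr.comp_right (C.genOp t e π).adjoint).hasSum_trace_mul (traceBasis H) a
  have e2 : ∑' n, (inner ℂ ((C.genOp t e π).adjoint.adjoint (y n)) (a (x n)) : ℂ)
      = trace ((C.genOp t e π).adjoint * a * X) := by
    rw [hr.trace_mul]
    exact tsum_congr fun n => by simp [ContinuousLinearMap.adjoint_inner_right]
  rw [e2] at h2
  have h3 := (hC.krausSum_lind t e π).trace_mul_tsum hX a
  have e3 : trace (C.noJumpDual t e π a * X) = trace (a * C.genOp t e π * X)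
      + trace ((C.genOp t e π).adjoint * a * X)
      + trace (krausDual (fun k => C.lind k t e π) a * X) := by
    rw [Coefficients.noJumpDual, hX.trace_add_mul, hX.trace_add_mul]
    ring
  rw [e3]
  refine ((h1.add h2).add h3).congr_fun fun i => ?_
  rw [hC.noJumpGen_eq]
  simp

theorem Coefficients.Regular.trace_mul_noJumpGen (hC : C.Regular ν) (t : ℝ≥0) (e : E)
    (π : Trajectory U) {X : H →L[ℂ] H} (hX : IsTraceClass X) (a : H →L[ℂ] H) :
    trace (a * C.noJumpGen t e π X) = trace (C.noJumpDual t e π a * X) :=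
  (hC.hasSum_trace_noJumpGen t e π hX a).tsum_eq

theorem Coefficients.Regular.trace_mul_noJumpGen_add (hC : C.Regular ν) (t : ℝ≥0) (e : E)
    (π : Trajectory U) {X : H →L[ℂ] H} (hX : IsTraceClass X) (a : H →L[ℂ] H) (c : ℝ) :
    trace (a * (C.noJumpGen t e π X + c • X))
      = trace (C.noJumpDual t e π a * X) + c * trace (a * X) := by
  rw [trace_eq_tsum]
  refine HasSum.tsum_eq ?_
  refine ((hC.hasSum_trace_noJumpGen t e π hX a).add
    ((hX.hasSum_trace_mul a).mul_left (c : ℂ))).congr_fun fun i => ?_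
  simp [Complex.real_smul]

theorem Coefficients.Regular.R_past (hC : C.Regular ν) (t : ℝ≥0) (e : E) (π : Trajectory U) :
    C.R t e π = C.R t e (π.before t) := by
  ext x
  refine (hC.R_hasSum t e π x).unique ?_
  simpa only [← hC.jump_past] using hC.R_hasSum t e (π.before t) x

theorem Coefficients.Regular.R₀_past (hC : C.Regular ν) (t : ℝ≥0) (e : E) (π : Trajectory U) :
    C.R₀ t e π = C.R₀ t e (π.before t) := by
  ext x
  refine (hC.R₀_hasSum t e π x).unique ?_
  simpa only [← hC.lind_past] using hC.R₀_hasSum t e (π.before t) x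

theorem Coefficients.Regular.R_congr (hC : C.Regular ν) {t : ℝ≥0} (e : E) {π π' : Trajectory U}
    (h : π.before t = π'.before t) : C.R t e π = C.R t e π' := by
  rw [hC.R_past, h, ← hC.R_past]

theorem Coefficients.Regular.genRate_congr (hC : C.Regular ν) {t : ℝ≥0} (e : E)
    {π π' : Trajectory U} (h : π.before t = π'.before t) : C.genRate t e π = C.genRate t e π' := by
  rw [Coefficients.genRate, hC.R_congr e h, hC.R₀_past, hC.ham_past, h, ← hC.R₀_past,
    ← hC.ham_past, Coefficients.genRate]

theorem Coefficients.Regular.noJumpDual_congr (hC : C.Regular ν) {t : ℝ≥0} (e : E)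
    {π π' : Trajectory U} (h : π.before t = π'.before t) (a : H →L[ℂ] H) :
    C.noJumpDual t e π a = C.noJumpDual t e π' a := by
  have h1 : C.ham t e π = C.ham t e π' := by rw [hC.ham_past, h, ← hC.ham_past]
  have h2 : C.R₀ t e π = C.R₀ t e π' := by rw [hC.R₀_past, h, ← hC.R₀_past]
  have h3 : ∀ k, C.lind k t e π = C.lind k t e π' := fun k => by
    rw [hC.lind_past, h, ← hC.lind_past]
  simp only [Coefficients.noJumpDual, Coefficients.genOp, h1, h2, h3, hC.R_congr e h]

section Measurability

variable {X : Type*} [MeasurableSpace X] {s : X → ℝ≥0} {e : X → E} {π : X → Trajectory U}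

theorem Coefficients.Regular.sotMeasurable_noJumpDual (hC : C.Regular ν) (hs : Measurable s)
    (he : Measurable e) (hπ : Measurable π) {a : X → (H →L[ℂ] H)} (ha : SOTMeasurable a) :
    SOTMeasurable fun x => C.noJumpDual (s x) (e x) (π x) (a x) := by
  have hg : Measurable fun x => (s x, e x, π x) := hs.prodMk (he.prodMk hπ)
  have hK : SOTMeasurable fun x => C.genOp (s x) (e x) (π x) :=
    ((hC.sotMeasurable_ham.comp hg).smul _).add
      (((hC.sotMeasurable_R₀.comp hg).add (hC.sotMeasurable_R.comp hg)).smul _)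
  refine ((hK.adjoint.mul ha).add (ha.mul hK)).add ?_
  refine SOTMeasurable.of_hasSum
    (A := fun k x => (C.lind k (s x) (e x) (π x)).adjoint *
      (a x * C.lind k (s x) (e x) (π x))) (fun k => ?_)
    fun x w => (hC.krausSum_lind (s x) (e x) (π x)).hasSum_krausDual (a x) w
  have hL := (hC.sotMeasurable_lind k).comp hg
  exact hL.adjoint.mul (ha.mul hL)

theorem Coefficients.Regular.measurable_genRate (hC : C.Regular ν) (hs : Measurable s)
    (he : Measurable e) (hπ : Measurable π) :
    Measurable fun x => C.genRate (s x) (e x) (π x) := by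
  have hg : Measurable fun x => (s x, e x, π x) := hs.prodMk (he.prodMk hπ)
  exact ((((hC.sotMeasurable_ham.comp hg).measurable_norm.const_mul 2).const_add 1).add
    ((hC.sotMeasurable_R₀.comp hg).measurable_norm.const_mul 2)).add
    (hC.sotMeasurable_R.comp hg).measurable_norm

end Measurability

end Coefficients

/-! ### Lebesgue measure on the half line -/

section Leb

theorem leb_apply (s : Set ℝ≥0) : leb s = volume ((↑) '' s : Set ℝ) :=
  (MeasurableEmbedding.subtype_coe measurableSet_Ici).comap_apply _ _

theorem map_coe_leb : leb.map ((↑) : ℝ≥0 → ℝ) = volume.restrict (Ici 0) := by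
  have := (MeasurableEmbedding.subtype_coe (measurableSet_Ici (a := (0 : ℝ)))).map_comap volume
  rw [Subtype.range_coe] at this
  exact this

theorem measurableEmbedding_nnreal_coe : MeasurableEmbedding ((↑) : ℝ≥0 → ℝ) :=
  MeasurableEmbedding.subtype_coe measurableSet_Ici

theorem leb_Ioc (s t : ℝ≥0) : leb (Ioc s t) = (t - s : ℝ≥0) := by
  rw [leb_apply, NNReal.image_coe_Ioc, Real.volume_Ioc, ENNReal.ofReal]
  rfl

theorem leb_singleton (t : ℝ≥0) : leb {t} = 0 := by
  rw [leb_apply, image_singleton, Real.volume_singleton]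

instance : NullSingletonClass leb := ⟨leb_singleton⟩

instance : IsLocallyFiniteMeasure leb := by
  refine ⟨fun x => ⟨Iio (x + 1), Iio_mem_nhds (by simp), ?_⟩⟩
  have : Iio (x + 1) ⊆ {0} ∪ Ioc 0 (x + 1) := fun y hy => by
    rcases eq_or_lt_of_le (zero_le : 0 ≤ y) with h | h
    · left; exact h.symm
    · right; exact ⟨h, (mem_Iio.1 hy).le⟩
  refine (measure_mono this).trans_lt ((measure_union_le _ _).trans_lt ?_)
  rw [leb_singleton, leb_Ioc]
  simp

variable {𝕜 : Type*} [RCLike 𝕜]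

theorem setIntegral_leb (f : ℝ → 𝕜) (s t : ℝ≥0) :
    ∫ r in Ioc s t, f r ∂leb = ∫ r in Ioc (s : ℝ) t, f r := by
  have h := measurableEmbedding_nnreal_coe.setIntegral_map (μ := leb) f (Ioc (s : ℝ) t)
  have e : ((↑) : ℝ≥0 → ℝ) ⁻¹' Ioc (s : ℝ) t = Ioc s t := by ext; simp
  rw [e, map_coe_leb, Measure.restrict_restrict measurableSet_Ioc] at h
  rw [← h]
  congr 2
  rw [inter_eq_left]
  exact fun x hx => s.2.trans hx.1.le

/-- The integral form of the product rule. -/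
theorem setIntegral_mul_setIntegral {f g : ℝ≥0 → 𝕜} {t₀ t : ℝ≥0}
    (hf : IntegrableOn f (Ioc t₀ t) leb) (hg : IntegrableOn g (Ioc t₀ t) leb) :
    IntegrableOn (fun r => f r * ∫ s in Ioc t₀ r, g s ∂leb) (Ioc t₀ t) leb ∧
    (∫ s in Ioc t₀ t, f s ∂leb) * (∫ s in Ioc t₀ t, g s ∂leb)
      = (∫ r in Ioc t₀ t, f r * ∫ s in Ioc t₀ r, g s ∂leb ∂leb)
        + ∫ s in Ioc t₀ t, (∫ r in Ioc t₀ s, f r ∂leb) * g s ∂leb := by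
  set μ := leb.restrict (Ioc t₀ t) with hμ
  have hfg : Integrable (fun p : ℝ≥0 × ℝ≥0 => f p.1 * g p.2) (μ.prod μ) := hf.mul_prod hg
  -- The square is cut along the diagonal. The strict half gives integrals over open intervals,
  -- which agree with the half-closed ones because `leb` has no atoms.
  set A : Set (ℝ≥0 × ℝ≥0) := {p | p.2 ≤ p.1} with hA
  have hAm : MeasurableSet A := measurableSet_le measurable_snd measurable_fst
  have h1 : ∀ r ∈ Ioc t₀ t, ∀ h : ℝ≥0 → 𝕜,
      ∫ s, (Iic r).indicator h s ∂μ = ∫ s in Ioc t₀ r, h s ∂leb := fun r hr h => by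
    rw [integral_indicator measurableSet_Iic, hμ, Measure.restrict_restrict measurableSet_Iic]
    congr 2
    ext s
    simp only [mem_inter_iff, mem_Iic, mem_Ioc]
    exact ⟨fun hs => ⟨hs.2.1, hs.1⟩, fun hs => ⟨hs.2, hs.1, hs.2.trans hr.2⟩⟩
  have h2 : ∀ r ∈ Ioc t₀ t, ∀ h : ℝ≥0 → 𝕜,
      ∫ s, (Iio r).indicator h s ∂μ = ∫ s in Ioc t₀ r, h s ∂leb := fun r hr h => by
    rw [← h1 r hr]
    refine integral_congr_ae ?_
    have : ∀ᵐ s ∂μ, s ≠ r := by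
      rw [ae_iff]
      simp only [not_not, hμ]
      exact Measure.absolutelyContinuous_of_le Measure.restrict_le_self
        (measure_mono_null (t := {r}) (by simp) (by simp))
    filter_upwards [this] with s hs
    simp only [indicator, mem_Iio, mem_Iic]
    rcases lt_trichotomy s r with h' | h' | h'
    · simp [h', h'.le]
    · exact absurd h' hs
    · simp [h'.not_gt, h'.not_ge]
  have hI1 := hfg.indicator hAm
  have hI2 := hfg.indicator hAm.compl
  have e1 : ∀ r s, A.indicator (fun p : ℝ≥0 × ℝ≥0 => f p.1 * g p.2) (r, s)
      = f r * (Iic r).indicator g s := fun r s => by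
    simp only [indicator, hA, mem_ofPred_eq, mem_Iic]
    split_ifs <;> simp
  have e2 : ∀ r s, Aᶜ.indicator (fun p : ℝ≥0 × ℝ≥0 => f p.1 * g p.2) (r, s)
      = (Iio s).indicator f r * g s := fun r s => by
    simp only [indicator, hA, mem_compl_iff, mem_ofPred_eq, mem_Iio, not_le]
    split_ifs <;> simp
  have k1 : ∀ r ∈ Ioc t₀ t, ∫ s, A.indicator (fun p : ℝ≥0 × ℝ≥0 => f p.1 * g p.2) (r, s) ∂μ
      = f r * ∫ s in Ioc t₀ r, g s ∂leb := fun r hr => by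
    simp only [e1, integral_const_mul, h1 r hr]
  have k2 : ∀ s ∈ Ioc t₀ t, ∫ r, Aᶜ.indicator (fun p : ℝ≥0 × ℝ≥0 => f p.1 * g p.2) (r, s) ∂μ
      = (∫ r in Ioc t₀ s, f r ∂leb) * g s := fun s hs => by
    simp only [e2, integral_mul_const, h2 s hs]
  refine ⟨?_, ?_⟩
  · refine hI1.integral_prod_left.congr ?_
    filter_upwards [ae_restrict_mem measurableSet_Ioc] with r hr using k1 r hr
  · rw [← integral_prod_mul, ← integral_add_compl hAm hfg, ← integral_indicator hAm,
      ← integral_indicator hAm.compl, integral_prod _ hI1, integral_prod_symm _ hI2]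
    congr 1
    · exact setIntegral_congr_fun measurableSet_Ioc k1
    · exact setIntegral_congr_fun measurableSet_Ioc k2

/-- `K(t)ⁿ⁺¹ = (n + 1) ∫ κ Kⁿ` for `K = ∫ κ`. -/
theorem setIntegral_mul_pow {κ : ℝ≥0 → ℝ} {t₀ T : ℝ≥0} (hκ : IntegrableOn κ (Ioc t₀ T) leb)
    (n : ℕ) : ∀ t ≤ T,
    IntegrableOn (fun s => κ s * (∫ r in Ioc t₀ s, κ r ∂leb) ^ n) (Ioc t₀ t) leb ∧
    (n + 1) * ∫ s in Ioc t₀ t, κ s * (∫ r in Ioc t₀ s, κ r ∂leb) ^ n ∂leb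
      = (∫ r in Ioc t₀ t, κ r ∂leb) ^ (n + 1) := by
  induction n with
  | zero =>
    intro t ht
    simpa using hκ.mono_set (Ioc_subset_Ioc_right ht)
  | succ n ih =>
    intro t ht
    have h := setIntegral_mul_setIntegral (𝕜 := ℝ) (hκ.mono_set (Ioc_subset_Ioc_right ht))
      ((ih t ht).1.const_mul ((n : ℝ) + 1))
    have e : ∀ s ∈ Ioc t₀ t, ∫ r in Ioc t₀ s,
        ((n : ℝ) + 1) * (κ r * (∫ q in Ioc t₀ r, κ q ∂leb) ^ n) ∂leb
        = (∫ r in Ioc t₀ s, κ r ∂leb) ^ (n + 1) := fun s hs => by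
      rw [integral_const_mul, (ih s (hs.2.trans ht)).2]
    have e0 : ∫ r in Ioc t₀ t,
        ((n : ℝ) + 1) * (κ r * (∫ q in Ioc t₀ r, κ q ∂leb) ^ n) ∂leb
        = (∫ r in Ioc t₀ t, κ r ∂leb) ^ (n + 1) := by
      rw [integral_const_mul, (ih t ht).2]
    refine ⟨h.1.congr_fun (fun s hs => by simp only [e s hs]) measurableSet_Ioc, ?_⟩
    have h2 := h.2
    have e4 : ∫ s in Ioc t₀ t, κ s * ∫ r in Ioc t₀ s,
        ((n : ℝ) + 1) * (κ r * (∫ q in Ioc t₀ r, κ q ∂leb) ^ n) ∂leb ∂leb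
        = ∫ s in Ioc t₀ t, κ s * (∫ r in Ioc t₀ s, κ r ∂leb) ^ (n + 1) ∂leb :=
      setIntegral_congr_fun measurableSet_Ioc fun s hs => by simp only [e s hs]
    rw [e0, e4] at h2
    have e3 : ∫ s in Ioc t₀ t, (∫ r in Ioc t₀ s, κ r ∂leb) *
        (((n : ℝ) + 1) * (κ s * (∫ q in Ioc t₀ s, κ q ∂leb) ^ n)) ∂leb
        = ((n : ℝ) + 1) * ∫ s in Ioc t₀ t, κ s * (∫ r in Ioc t₀ s, κ r ∂leb) ^ (n + 1) ∂leb := by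
      rw [← integral_const_mul]
      congr 1
      ext s
      ring
    rw [e3] at h2
    push_cast
    rw [pow_succ' _ (n + 1), h2]
    ring

theorem setIntegral_mono_right_leb {κ : ℝ≥0 → ℝ} (h0 : ∀ s, 0 ≤ κ s) {t₀ t T : ℝ≥0}
    (hκ : IntegrableOn κ (Ioc t₀ T) leb) (ht : t ≤ T) :
    ∫ s in Ioc t₀ t, κ s ∂leb ≤ ∫ s in Ioc t₀ T, κ s ∂leb :=
  setIntegral_mono_set hκ (ae_of_all _ h0) (Ioc_subset_Ioc_right ht).eventuallyLE

theorem setIntegral_Ioc_add {E : Type*} [NormedAddCommGroup E] [NormedSpace ℝ E]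
    {f : ℝ≥0 → E} {r s t : ℝ≥0} (hrs : r ≤ s) (hst : s ≤ t)
    (hf : IntegrableOn f (Ioc r t) leb) :
    ∫ q in Ioc r t, f q ∂leb = ∫ q in Ioc r s, f q ∂leb + ∫ q in Ioc s t, f q ∂leb := by
  rw [← Ioc_union_Ioc_eq_Ioc hrs hst, setIntegral_union (Ioc_disjoint_Ioc_of_le le_rfl)
    measurableSet_Ioc (hf.mono_set (Ioc_subset_Ioc_right hst))
    (hf.mono_set (Ioc_subset_Ioc_left hrs))]

end Leb

/-! ### The no-jump equation -/

section NoJumpEquation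

variable {U E H ι₁ ι₂ : Type*} [MeasurableSpace U] [MeasurableSpace E] [NormedAddCommGroup H]
  [InnerProductSpace ℂ H] [CompleteSpace H]

/-- Bounded solutions on `[t₀, T]` of the weak form of the no-jump equation. -/
structure IsWeakSol (C : Coefficients U E H ι₁ ι₂) (e : E) (π : Trajectory U) (t₀ T : ℝ≥0)
    (y : ℝ≥0 → ((H →L[ℂ] H) →L[ℂ] ℂ)) : Prop where
  bdd : ∃ B : ℝ, ∀ t ∈ Icc t₀ T, ‖y t‖ ≤ B
  integrable : ∀ a, IntegrableOn (fun s => y s (C.noJumpDual s e π a)) (Ioc t₀ T) leb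
  equation : ∀ t ∈ Icc t₀ T, ∀ a,
    y t a = y t₀ a + ∫ s in Ioc t₀ t, y s (C.noJumpDual s e π a) ∂leb

/-- Picard iterates for the no-jump equation. -/
noncomputable def picard (C : Coefficients U E H ι₁ ι₂) (e : E) (π : Trajectory U) (t₀ : ℝ≥0)
    (y₀ : (H →L[ℂ] H) → ℂ) : ℕ → ℝ≥0 → (H →L[ℂ] H) → ℂ
  | 0, _, a => y₀ a
  | n + 1, t, a => y₀ a + ∫ s in Ioc t₀ t, picard C e π t₀ y₀ n s (C.noJumpDual s e π a) ∂leb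

variable [TopologicalSpace.SeparableSpace H] [Countable ι₁] [Countable ι₂]
  {C : Coefficients U E H ι₁ ι₂} {ν : Measure U} [IsFiniteMeasure ν]

/-- The parameter space and the operator argument are quantified inside the induction: the next
iterate integrates the previous one over time, evaluated at the dual generator of `a`, so the
hypothesis is applied on the parameter space enlarged by the time variable. -/
theorem Coefficients.Regular.measurable_picard (hC : C.Regular ν) (t₀ : ℝ≥0) (n : ℕ) :
    ∀ {X : Type*} [MeasurableSpace X] {s : X → ℝ≥0} {e : X → E} {π : X → Trajectory U}
      {ρ a : X → (H →L[ℂ] H)}, Measurable s → Measurable e → Measurable π → SOTMeasurable ρ →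
      (∀ x, IsTraceClass (ρ x)) → SOTMeasurable a →
      Measurable fun x => picard C (e x) (π x) t₀ (fun b => trace (b * ρ x)) n (s x) (a x) := by
  induction n with
  | zero =>
    intro X _ s e π ρ a _ _ _ hρ hT ha
    exact ha.measurable_trace_mul hρ hT
  | succ n ih =>
    intro X _ s e π ρ a hs he hπ hρ hT ha
    refine (ha.measurable_trace_mul hρ hT).add ?_
    have h1 : Measurable fun q : X × ℝ≥0 => picard C (e q.1) (π q.1) t₀
        (fun b => trace (b * ρ q.1)) n q.2 (C.noJumpDual q.2 (e q.1) (π q.1) (a q.1)) :=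
      ih measurable_snd (he.comp measurable_fst) (hπ.comp measurable_fst)
        (hρ.comp measurable_fst) (fun q => hT q.1)
        (hC.sotMeasurable_noJumpDual measurable_snd (he.comp measurable_fst)
          (hπ.comp measurable_fst) (ha.comp measurable_fst))
    have h2 : MeasurableSet {q : X × ℝ≥0 | q.2 ∈ Ioc t₀ (s q.1)} :=
      (measurableSet_lt measurable_const measurable_snd).inter
        (measurableSet_le (f := fun q : X × ℝ≥0 => q.2) (g := fun q => s q.1) measurable_snd
          (hs.comp measurable_fst))
    have h3 := ((h1.indicator h2).stronglyMeasurable.integral_prod_right' (ν := leb)).measurable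
    convert h3 using 2 with x
    rw [← integral_indicator measurableSet_Ioc]
    rfl

variable {e : E} {π : Trajectory U} {t₀ T : ℝ≥0} {y : ℝ≥0 → ((H →L[ℂ] H) →L[ℂ] ℂ)}

theorem Coefficients.genRate_nonneg (C : Coefficients U E H ι₁ ι₂) (t : ℝ≥0) (e : E)
    (π : Trajectory U) : 0 ≤ C.genRate t e π := zero_le_one.trans (C.one_le_genRate t e π)

/-- Each iteration costs one factor of the rate inside the integral, and the iterated integrals of
the rate are `Kⁿ / n!`. Only boundedness of `y` is used, so the estimate contains uniqueness. -/
theorem IsWeakSol.norm_sub_picard_le (hC : C.Regular ν) (h : IsWeakSol C e π t₀ T y)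
    (hκ : IntegrableOn (fun s => C.genRate s e π) (Ioc t₀ T) leb) {ρ : H →L[ℂ] H}
    (hρ : IsTraceClass ρ) (h₀ : ∀ a, y t₀ a = trace (a * ρ)) {B : ℝ}
    (hB : ∀ t ∈ Icc t₀ T, ‖y t‖ ≤ B) (n : ℕ) :
    ∀ t ∈ Icc t₀ T, ∀ a, ‖y t a - picard C e π t₀ (fun b => trace (b * ρ)) n t a‖
      ≤ 2 * B * ‖a‖ * ((∫ s in Ioc t₀ t, C.genRate s e π ∂leb) ^ n / n.factorial) := by
  induction n with
  | zero =>
    intro t ht a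
    have h1 := (y t).le_of_opNorm_le (hB t ht) a
    have h2 := (y t₀).le_of_opNorm_le (hB t₀ ⟨le_rfl, ht.1.trans ht.2⟩) a
    simp only [picard, ← h₀, pow_zero, Nat.factorial_zero, Nat.cast_one, div_one, mul_one]
    exact (norm_sub_le _ _).trans (by linarith)
  | succ n ih =>
    intro t ht a
    set K : ℝ≥0 → ℝ := fun t => ∫ s in Ioc t₀ t, C.genRate s e π ∂leb with hK
    have hB0 : 0 ≤ B := (norm_nonneg _).trans (hB t ht)
    have hK0 : ∀ t, 0 ≤ K t := fun t => integral_nonneg fun s => C.genRate_nonneg s e π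
    obtain ⟨hi, hp⟩ := setIntegral_mul_pow hκ n t ht.2
    set bd : ℝ≥0 → ℝ := fun s => 2 * B * ‖a‖ / n.factorial * (C.genRate s e π * K s ^ n) with hbd
    have hbdi : IntegrableOn bd (Ioc t₀ t) leb := hi.const_mul _
    have hle : ∀ s ∈ Ioc t₀ t, ‖y s (C.noJumpDual s e π a)
        - picard C e π t₀ (fun b => trace (b * ρ)) n s (C.noJumpDual s e π a)‖ ≤ bd s := by
      intro s hs
      refine (ih s ⟨hs.1.le, hs.2.trans ht.2⟩ _).trans ?_
      have := hC.norm_noJumpDual_le s e π a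
      calc 2 * B * ‖C.noJumpDual s e π a‖ * (K s ^ n / n.factorial)
          ≤ 2 * B * (C.genRate s e π * ‖a‖) * (K s ^ n / n.factorial) := by
            gcongr
            exact div_nonneg (pow_nonneg (hK0 s) n) (by positivity)
        _ = bd s := by rw [hbd]; ring
    have hyi := (h.integrable a).mono_set (Ioc_subset_Ioc_right ht.2)
    have hm : Measurable fun s => picard C e π t₀ (fun b => trace (b * ρ)) n s
        (C.noJumpDual s e π a) :=
      hC.measurable_picard t₀ n measurable_id measurable_const measurable_const
        (SOTMeasurable.const ρ) (fun _ => hρ)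
        (hC.sotMeasurable_noJumpDual measurable_id measurable_const measurable_const
          (SOTMeasurable.const a))
    have hdi : IntegrableOn (fun s => y s (C.noJumpDual s e π a)
        - picard C e π t₀ (fun b => trace (b * ρ)) n s (C.noJumpDual s e π a))
        (Ioc t₀ t) leb :=
      hbdi.mono' (hyi.aestronglyMeasurable.sub hm.aestronglyMeasurable)
        ((ae_restrict_mem measurableSet_Ioc).mono hle)
    have hpi : IntegrableOn (fun s => picard C e π t₀ (fun b => trace (b * ρ)) n s
        (C.noJumpDual s e π a)) (Ioc t₀ t) leb := by
      refine (hyi.sub hdi).congr (ae_of_all _ fun s => ?_)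
      simp
    rw [h.equation t ht a, h₀, picard, add_sub_add_left_eq_sub, ← integral_sub hyi hpi]
    refine (norm_integral_le_of_norm_le hbdi
      ((ae_restrict_mem measurableSet_Ioc).mono hle)).trans_eq ?_
    rw [hbd, integral_const_mul, Nat.factorial_succ, ← hp]
    push_cast
    field_simp
    rfl

theorem IsWeakSol.tendsto_picard (hC : C.Regular ν) (h : IsWeakSol C e π t₀ T y)
    (hκ : IntegrableOn (fun s => C.genRate s e π) (Ioc t₀ T) leb) {ρ : H →L[ℂ] H}
    (hρ : IsTraceClass ρ) (h₀ : ∀ a, y t₀ a = trace (a * ρ)) {t : ℝ≥0} (ht : t ∈ Icc t₀ T)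
    (a : H →L[ℂ] H) :
    Tendsto (fun n => picard C e π t₀ (fun b => trace (b * ρ)) n t a) atTop (𝓝 (y t a)) := by
  obtain ⟨B, hB⟩ := h.bdd
  rw [tendsto_iff_norm_sub_tendsto_zero]
  simp_rw [norm_sub_rev _ (y t a)]
  have h1 := (FloorSemiring.tendsto_pow_div_factorial_atTop
    (∫ s in Ioc t₀ t, C.genRate s e π ∂leb)).const_mul (2 * B * ‖a‖)
  rw [mul_zero] at h1
  exact squeeze_zero (fun n => norm_nonneg _)
    (fun n => h.norm_sub_picard_le hC hκ hρ h₀ hB n t ht a) h1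

theorem Coefficients.Regular.picard_adjoint (hC : C.Regular ν) {y₀ : (H →L[ℂ] H) → ℂ}
    (h₀ : ∀ a, y₀ a.adjoint = starRingEnd ℂ (y₀ a)) (n : ℕ) :
    ∀ t a, picard C e π t₀ y₀ n t a.adjoint = starRingEnd ℂ (picard C e π t₀ y₀ n t a) := by
  induction n with
  | zero => exact fun t a => h₀ a
  | succ n ih =>
    intro t a
    simp only [picard, h₀, map_add, hC.noJumpDual_adjoint, ih, integral_conj]

/-- The dual generator commutes with adjoints, hence so do all iterates started from a hermitian
functional, and the property passes to the limit. -/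
theorem IsWeakSol.adjoint (hC : C.Regular ν) (h : IsWeakSol C e π t₀ T y)
    (hκ : IntegrableOn (fun s => C.genRate s e π) (Ioc t₀ T) leb) {ρ : H →L[ℂ] H}
    (hρ : IsTraceClass ρ) (h₀ : ∀ a, y t₀ a = trace (a * ρ))
    (hs : ∀ a, y t₀ a.adjoint = starRingEnd ℂ (y t₀ a)) {t : ℝ≥0} (ht : t ∈ Icc t₀ T)
    (a : H →L[ℂ] H) : y t a.adjoint = starRingEnd ℂ (y t a) := by
  have h1 := h.tendsto_picard hC hκ hρ h₀ ht a.adjoint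
  simp only [h₀] at hs
  simp only [hC.picard_adjoint (y₀ := fun b => trace (b * ρ)) hs] at h1
  exact tendsto_nhds_unique h1
    ((Complex.continuous_conj.tendsto _).comp (h.tendsto_picard hC hκ hρ h₀ ht a))

/-! ### Continuity of primitives -/

theorem continuousOn_setIntegral_Ioc {F : Type*} [NormedAddCommGroup F] [NormedSpace ℝ F]
    {f : ℝ≥0 → F} {t₀ T : ℝ≥0} (hf : IntegrableOn f (Ioc t₀ T) leb) :
    ContinuousOn (fun t => ∫ s in Ioc t₀ t, f s ∂leb) (Icc t₀ T) := by
  have e : ∀ t ∈ Icc t₀ T, ∫ s in Ioc t₀ t, f s ∂leb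
      = ∫ s in Ioc t₀ T, (Iic t).indicator f s ∂leb := fun t ht => by
    rw [integral_indicator measurableSet_Iic, Measure.restrict_restrict measurableSet_Iic]
    congr 2
    ext s
    simp only [mem_inter_iff, mem_Iic, mem_Ioc]
    exact ⟨fun hs => ⟨hs.2, hs.1, hs.2.trans ht.2⟩, fun hs => ⟨hs.2.1, hs.1⟩⟩
  refine ContinuousOn.congr (fun t ht => ContinuousAt.continuousWithinAt ?_) e
  refine continuousAt_of_dominated (bound := fun s => ‖f s‖)
    (Eventually.of_forall fun t => hf.aestronglyMeasurable.indicator measurableSet_Iic)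
    (Eventually.of_forall fun t => ae_of_all _ fun s => norm_indicator_le_norm_self _ _)
    hf.norm ?_
  have : ∀ᵐ s ∂(leb.restrict (Ioc t₀ T)), s ≠ t :=
    ae_restrict_of_ae (by rw [ae_iff]; simp)
  filter_upwards [this] with s hs
  rcases lt_or_gt_of_ne hs with h | h
  · refine (continuousAt_const (y := f s)).congr ?_
    filter_upwards [lt_mem_nhds h] with r hr
    rw [indicator_of_mem (mem_Iic.2 hr.le)]
  · refine (continuousAt_const (y := (0 : F))).congr ?_
    filter_upwards [gt_mem_nhds h] with r hr
    rw [indicator_of_notMem (by simpa using hr)]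

theorem IsWeakSol.continuousOn (h : IsWeakSol C e π t₀ T y) (a : H →L[ℂ] H) :
    ContinuousOn (fun t => y t a) (Icc t₀ T) :=
  (continuousOn_const.add (continuousOn_setIntegral_Ioc (h.integrable a))).congr
    fun t ht => h.equation t ht a

theorem IsWeakSol.equation_sub (h : IsWeakSol C e π t₀ T y) {s t : ℝ≥0} (hs : t₀ ≤ s)
    (hst : s ≤ t) (ht : t ≤ T) (a : H →L[ℂ] H) :
    y t a = y s a + ∫ r in Ioc s t, y r (C.noJumpDual r e π a) ∂leb := by
  rw [h.equation t ⟨hs.trans hst, ht⟩, h.equation s ⟨hs, hst.trans ht⟩, add_assoc,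
    ← setIntegral_Ioc_add hs hst ((h.integrable a).mono_set (Ioc_subset_Ioc_right ht))]

/-! ### Positivity -/

/-- The step estimate behind the preservation of positivity. -/
theorem IsWeakSol.neg_step (hC : C.Regular ν) (h : IsWeakSol C e π t₀ T y)
    (hκ : IntegrableOn (fun s => C.genRate s e π) (Ioc t₀ T) leb) {B : ℝ}
    (hB : ∀ t ∈ Icc t₀ T, ‖y t‖ ≤ B) {s t : ℝ≥0} (hs : t₀ ≤ s) (hst : s < t) (ht : t ≤ T)
    {δ η : ℝ} (hδ : ∫ r in Ioc s t, C.genRate r e π ∂leb = δ) (hδ0 : 0 < δ) (hδ1 : δ ≤ 1)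
    (hη : ∀ a : H →L[ℂ] H, a.IsPositive → -(η * ‖a‖) ≤ (y s a).re) (hη0 : 0 ≤ η)
    (a : H →L[ℂ] H) (ha : a.IsPositive) :
    -((η * (1 + 2 * δ) + 2 * B * δ ^ 2) * ‖a‖) ≤ (y t a).re := by
  have hB0 : 0 ≤ B := (norm_nonneg _).trans (hB s ⟨hs, hst.le.trans ht⟩)
  have hsub : Ioc s t ⊆ Ioc t₀ T := Ioc_subset_Ioc hs ht
  have hκ' := hκ.mono_set hsub
  -- Since the rate integrates to `δ`, the pointwise bound by `-(c/δ)` times the rate integrates to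
  -- `-c`, and `yₛ(a) - c` is exactly the claimed lower bound.
  set c : ℝ := (y s a).re + ‖a‖ * (η * (1 + 2 * δ) + 2 * B * δ ^ 2) with hc
  have key : ∀ r ∈ Ioc s t, -(c / δ) * C.genRate r e π ≤ (y r (C.noJumpDual r e π a)).re := by
    intro r hr
    set κ := C.genRate r e π with hκdef
    have hκ1 : 1 ≤ κ := C.one_le_genRate r e π
    have hκ0 : 0 < κ := zero_lt_one.trans_le hκ1
    set b := C.noJumpDual r e π a with hb
    have hbn : ‖b‖ ≤ κ * ‖a‖ := hC.norm_noJumpDual_le r e π a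
    -- Freezing the functional at time `s` has an error that integrates to `B δ² ‖a‖`; this is one
    -- half of the term `2 B δ²`.
    have h1 : ‖y r b - y s b‖ ≤ B * (κ * ‖a‖) * δ := by
      rw [h.equation_sub hs hr.1.le (hr.2.trans ht), add_sub_cancel_left]
      have hi : IntegrableOn (fun q => B * (κ * ‖a‖) * C.genRate q e π) (Ioc s r) leb :=
        (hκ'.mono_set (Ioc_subset_Ioc_right hr.2)).const_mul _
      refine (norm_integral_le_of_norm_le hi
        ((ae_restrict_mem measurableSet_Ioc).mono fun q hq => ?_)).trans ?_
      · have h2 := (y q).le_of_opNorm_le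
          (hB q ⟨hs.trans hq.1.le, hq.2.trans (hr.2.trans ht)⟩) (C.noJumpDual q e π b)
        refine h2.trans ?_
        calc B * ‖C.noJumpDual q e π b‖ ≤ B * (C.genRate q e π * (κ * ‖a‖)) := by
              gcongr
              refine (hC.norm_noJumpDual_le q e π b).trans ?_
              have := C.genRate_nonneg q e π
              gcongr
          _ = _ := by ring
      · rw [integral_const_mul]
        gcongr
        rw [← hδ]
        exact setIntegral_mono_right_leb (fun q => C.genRate_nonneg q e π) hκ' hr.2
    set θ : ℝ := δ / κ with hθ
    have hθ0 : 0 ≤ θ := by positivity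
    have hθκ : θ * κ = δ := by rw [hθ]; field_simp
    set G := C.genOp r e π with hG
    set L : H →L[ℂ] H := krausDual (fun k => C.lind k r e π) a with hL
    have hGκ : 2 * ‖G‖ + ‖C.R₀ r e π‖ ≤ κ := C.two_mul_norm_genOp_add_le r e π
    set V : H →L[ℂ] H := 1 + (θ : ℂ) • G with hV
    set b' : H →L[ℂ] H := V.adjoint * a * V + (θ : ℂ) • L with hb'
    -- The Euler step of length `θ = δ/κ` completes a square: `a + θ(G†a + aG + L) = (1 + θG)† a (1
    -- + θG) + θL - θ² G†aG`. The first two terms are positive; the last has norm at most `δ²‖a‖`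
    -- and supplies the other half of `2 B δ²`.
    have hid : a + (θ : ℂ) • b = b' - ((θ : ℂ) ^ 2) • (G.adjoint * a * G) := by
      rw [hb', hV, hb, Coefficients.noJumpDual, ← hG, ← hL]
      have : (1 + (θ : ℂ) • G).adjoint = 1 + (θ : ℂ) • G.adjoint := by
        simp only [← ContinuousLinearMap.star_eq_adjoint, star_add, star_smul, star_one]
        simp
      rw [this]
      simp only [add_mul, mul_add, smul_mul_assoc, mul_smul_comm, one_mul, mul_one, smul_add,
        smul_smul, pow_two]
      abel
    have hLp : L.IsPositive := (hC.krausSum_lind r e π).krausDual_isPositive ha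
    have hb'p : b'.IsPositive := by
      refine ContinuousLinearMap.IsPositive.add ?_ ?_
      · have := ha.conj_adjoint V.adjoint
        rw [ContinuousLinearMap.adjoint_adjoint] at this
        exact this
      · refine isPositive_of_inner fun x => ⟨θ * (inner ℂ x (L x) : ℂ).re, ?_,
          mul_nonneg hθ0 (hLp.inner_eq_re x).2⟩
        simp only [smul_apply, inner_smul_right]
        rw [Complex.ofReal_mul, ← (hLp.inner_eq_re x).1]
    have hVn : ‖V‖ ≤ 1 + θ * ‖G‖ := by
      refine (norm_add_le _ _).trans (add_le_add ContinuousLinearMap.norm_id_le ?_)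
      rw [norm_smul, Complex.norm_real, Real.norm_of_nonneg hθ0]
    have hGn : ‖G.adjoint‖ = ‖G‖ := LinearIsometryEquiv.norm_map _ _
    have hb'n : ‖b'‖ ≤ (1 + 2 * δ) * ‖a‖ := by
      have hLn : ‖L‖ ≤ ‖C.R₀ r e π‖ * ‖a‖ := (hC.krausSum_lind r e π).norm_krausDual_le a
      have h2 : ‖V.adjoint * a * V‖ ≤ (1 + θ * ‖G‖) * ‖a‖ * (1 + θ * ‖G‖) := by
        refine (norm_mul_le _ _).trans ?_
        gcongr
        refine (norm_mul_le _ _).trans ?_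
        rw [LinearIsometryEquiv.norm_map]
        gcongr
      have h3 : ‖(θ : ℂ) • L‖ ≤ θ * (‖C.R₀ r e π‖ * ‖a‖) := by
        rw [norm_smul, Complex.norm_real, Real.norm_of_nonneg hθ0]
        gcongr
      refine (norm_add_le _ _).trans ((add_le_add h2 h3).trans ?_)
      have h4 : 2 * (θ * ‖G‖) + θ * ‖C.R₀ r e π‖ ≤ δ := by
        rw [← hθκ]
        calc _ = θ * (2 * ‖G‖ + ‖C.R₀ r e π‖) := by ring
          _ ≤ _ := by gcongr
      have h5 : 0 ≤ θ * ‖G‖ := by positivity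
      have h6 : 0 ≤ θ * ‖C.R₀ r e π‖ := by positivity
      -- The first order terms add up to at most `δ`, and the square of `θ‖G‖ ≤ δ` is at most `δ`
      -- because `δ ≤ 1`.
      have h7 : (1 + θ * ‖G‖) * (1 + θ * ‖G‖) + θ * ‖C.R₀ r e π‖ ≤ 1 + 2 * δ := by nlinarith
      calc _ = ((1 + θ * ‖G‖) * (1 + θ * ‖G‖) + θ * ‖C.R₀ r e π‖) * ‖a‖ := by ring
        _ ≤ _ := by gcongr
    have hGa : ‖y s (((θ : ℂ) ^ 2) • (G.adjoint * a * G))‖ ≤ B * δ ^ 2 * ‖a‖ := by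
      refine ((y s).le_of_opNorm_le (hB s ⟨hs, hst.le.trans ht⟩) _).trans ?_
      have h2 : ‖G.adjoint * a * G‖ ≤ ‖G‖ * ‖a‖ * ‖G‖ := by
        refine (norm_mul_le _ _).trans ?_
        gcongr
        refine (norm_mul_le _ _).trans ?_
        rw [LinearIsometryEquiv.norm_map]
      rw [norm_smul, norm_pow, Complex.norm_real, Real.norm_of_nonneg hθ0]
      have h3 : θ * ‖G‖ ≤ δ := by
        rw [← hθκ]
        gcongr
        linarith [norm_nonneg G, norm_nonneg (C.R₀ r e π)]
      calc B * (θ ^ 2 * ‖G.adjoint * a * G‖) ≤ B * (θ ^ 2 * (‖G‖ * ‖a‖ * ‖G‖)) := by gcongr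
        _ = B * (θ * ‖G‖) ^ 2 * ‖a‖ := by ring
        _ ≤ _ := by gcongr
    have h8 : -(η * (1 + 2 * δ) * ‖a‖) - B * δ ^ 2 * ‖a‖ ≤ (y s a).re + θ * (y s b).re := by
      have h9 := congrArg (fun z => (y s z).re) hid
      simp only [map_add, map_sub, map_smul, Complex.add_re, Complex.sub_re, smul_eq_mul,
        Complex.re_ofReal_mul] at h9
      rw [h9]
      have h10 := hη b' hb'p
      have h11 : η * ‖b'‖ ≤ η * ((1 + 2 * δ) * ‖a‖) := by gcongr
      have h12 := (Complex.re_le_norm (y s (((θ : ℂ) ^ 2) • (G.adjoint * a * G)))).trans hGa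
      rw [map_smul, smul_eq_mul] at h12
      linarith
    have h13 : (y s b).re - B * (κ * ‖a‖) * δ ≤ (y r b).re := by
      have := (Complex.abs_re_le_norm (y r b - y s b)).trans h1
      rw [Complex.sub_re] at this
      linarith [(abs_le.1 this).1]
    have h14 : κ / δ * (-(η * (1 + 2 * δ) * ‖a‖) - B * δ ^ 2 * ‖a‖)
        ≤ κ / δ * (y s a).re + (y s b).re := by
      have := mul_le_mul_of_nonneg_left h8 (show 0 ≤ κ / δ by positivity)
      refine this.trans_eq ?_
      rw [hθ]
      field_simp
    have h15 : -(c / δ) * κ = κ / δ * (-(η * (1 + 2 * δ) * ‖a‖) - B * δ ^ 2 * ‖a‖)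
        - κ / δ * (y s a).re - B * (κ * ‖a‖) * δ := by
      rw [hc]
      field_simp
      ring
    linarith
  have hyi := (h.integrable a).mono_set hsub
  have hI : ∫ r in Ioc s t, -(c / δ) * C.genRate r e π ∂leb
      ≤ ∫ r in Ioc s t, (y r (C.noJumpDual r e π a)).re ∂leb :=
    setIntegral_mono_on (hκ'.const_mul _) hyi.re measurableSet_Ioc key
  rw [integral_const_mul, hδ] at hI
  have hre : ∫ r in Ioc s t, (y r (C.noJumpDual r e π a)).re ∂leb
      = (∫ r in Ioc s t, y r (C.noJumpDual r e π a) ∂leb).re := integral_re hyi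
  rw [hre] at hI
  rw [h.equation_sub hs hst.le ht, Complex.add_re]
  have : -(c / δ) * δ = -c := by field_simp
  rw [this, hc] at hI
  linarith

theorem Coefficients.setIntegral_genRate_pos
    {s t : ℝ≥0} (hst : s < t) (hκ : IntegrableOn (fun s => C.genRate s e π) (Ioc s t) leb) :
    0 < ∫ r in Ioc s t, C.genRate r e π ∂leb := by
  have h1 : ∫ r in Ioc s t, (1 : ℝ) ∂leb ≤ ∫ r in Ioc s t, C.genRate r e π ∂leb :=
    setIntegral_mono_on (integrableOn_const (by rw [leb_Ioc]; simp)) hκ measurableSet_Ioc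
      fun r _ => C.one_le_genRate r e π
  refine lt_of_lt_of_le ?_ h1
  rw [setIntegral_const, smul_eq_mul, mul_one, measureReal_def, leb_Ioc]
  rw [ENNReal.coe_toReal, NNReal.coe_pos]
  exact tsub_pos_of_lt hst

/-- For every `η > 0` the bound `-η k e^{2k} ‖a‖`, with `k` the integrated rate, holds initially and
is propagated by the step estimate as soon as `2Bδ ≤ η`: the quadratic error is absorbed by the
growth of the factor `k`, the relative error by the exponential. Continuous induction carries the
bound along the interval, and then `η → 0`. -/
theorem IsWeakSol.nonneg (hC : C.Regular ν) (h : IsWeakSol C e π t₀ T y)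
    (hκ : IntegrableOn (fun s => C.genRate s e π) (Ioc t₀ T) leb)
    (h₀ : ∀ a : H →L[ℂ] H, a.IsPositive → 0 ≤ (y t₀ a).re) {t : ℝ≥0} (ht : t ∈ Icc t₀ T)
    {a : H →L[ℂ] H} (ha : a.IsPositive) : 0 ≤ (y t a).re := by
  obtain ⟨B, hB⟩ := h.bdd
  have hB0 : 0 ≤ B := (norm_nonneg _).trans (hB t ht)
  set k : ℝ≥0 → ℝ := fun t => ∫ s in Ioc t₀ t, C.genRate s e π ∂leb with hk
  have hkc : ContinuousOn k (Icc t₀ T) := continuousOn_setIntegral_Ioc hκ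
  have hk0 : ∀ t, 0 ≤ k t := fun t => integral_nonneg fun s => C.genRate_nonneg s e π
  have main : ∀ η > 0, ∀ t ∈ Icc t₀ T, ∀ a : H →L[ℂ] H, a.IsPositive →
      -(η * k t * Real.exp (2 * k t) * ‖a‖) ≤ (y t a).re := by
    intro η hη
    refine IsClosed.Icc_subset_of_forall_mem_nhdsWithin
      (s := {t | ∀ a : H →L[ℂ] H, a.IsPositive →
        -(η * k t * Real.exp (2 * k t) * ‖a‖) ≤ (y t a).re}) ?_ ?_ ?_
    · have : {t | ∀ a : H →L[ℂ] H, a.IsPositive →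
          -(η * k t * Real.exp (2 * k t) * ‖a‖) ≤ (y t a).re} ∩ Icc t₀ T
          = ⋂ a : {a : H →L[ℂ] H // a.IsPositive}, {t | t ∈ Icc t₀ T ∧
            -(η * k t * Real.exp (2 * k t) * ‖a.1‖) ≤ (y t a.1).re} ∩ Icc t₀ T := by
        ext t
        simp only [mem_inter_iff, mem_ofPred_eq, mem_iInter, Subtype.forall]
        refine ⟨fun h b hb => ⟨⟨h.2, h.1 b hb⟩, h.2⟩, fun h => ⟨fun b hb => (h b hb).1.2, ?_⟩⟩
        -- The intersection over positive operators still yields membership in the interval because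
        -- its index type is nonempty.
        exact (h 1 ContinuousLinearMap.isPositive_one).2
      rw [this]
      refine isClosed_iInter fun b => ?_
      have hcl := isClosed_Icc.isClosed_le
        (f := fun t => -(η * k t * Real.exp (2 * k t) * ‖b.1‖)) (g := fun t => (y t b.1).re)
        (by fun_prop) (Complex.continuous_re.comp_continuousOn (h.continuousOn b.1))
      exact hcl.inter isClosed_Icc
    · intro b hb
      simpa [hk] using h₀ b hb
    · rintro s ⟨hs, hsI⟩
      have hlim : Tendsto (fun t => k t - k s) (𝓝[>] s) (𝓝 0) := by
        have h1 := (hkc s ⟨hsI.1, hsI.2.le⟩).mono_left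
          (nhdsWithin_le_of_mem (mem_of_superset (Ioc_mem_nhdsGT hsI.2)
            (fun q hq => ⟨hsI.1.trans hq.1.le, hq.2⟩)))
        simpa using h1.sub_const (k s)
      have hpos : 0 < min 1 (η / (2 * B + 1)) := lt_min one_pos (by positivity)
      filter_upwards [hlim.eventually (gt_mem_nhds hpos), Ioc_mem_nhdsGT hsI.2] with t ht htI b hb
      have hadd : k t = k s + ∫ r in Ioc s t, C.genRate r e π ∂leb :=
        setIntegral_Ioc_add hsI.1 htI.1.le (hκ.mono_set (Ioc_subset_Ioc_right htI.2))
      set δ := ∫ r in Ioc s t, C.genRate r e π ∂leb with hδ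
      have hδ0 : 0 < δ :=
        Coefficients.setIntegral_genRate_pos htI.1 (hκ.mono_set (Ioc_subset_Ioc hsI.1 htI.2))
      have hδ' : δ < min 1 (η / (2 * B + 1)) := by rw [hadd] at ht; linarith
      have hδ1 : δ ≤ 1 := (hδ'.trans_le (min_le_left _ _)).le
      have hδη : 2 * B * δ ≤ η := by
        have := (hδ'.trans_le (min_le_right _ _)).le
        rw [le_div_iff₀ (by positivity)] at this
        nlinarith
      have hst := h.neg_step hC hκ hB hsI.1 htI.1 htI.2 hδ.symm hδ0 hδ1
        (η := η * k s * Real.exp (2 * k s)) hs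
        (mul_nonneg (mul_nonneg hη.le (hk0 s)) (Real.exp_nonneg _)) b hb
      refine le_trans (neg_le_neg ?_) hst
      gcongr
      have hexp1 : 1 + 2 * δ ≤ Real.exp (2 * δ) := by linarith [Real.add_one_le_exp (2 * δ)]
      have hexp2 : 1 ≤ Real.exp (2 * (k s + δ)) :=
        Real.one_le_exp (by linarith [hk0 s])
      have e1 : Real.exp (2 * (k s + δ)) = Real.exp (2 * k s) * Real.exp (2 * δ) := by
        rw [← Real.exp_add]; ring_nf
      rw [hadd]
      have h1 : η * k s * Real.exp (2 * k s) * (1 + 2 * δ)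
          ≤ η * k s * Real.exp (2 * (k s + δ)) := by
        rw [e1, ← mul_assoc]
        have := hk0 s
        gcongr
      have h2 : 2 * B * δ ^ 2 ≤ η * δ * Real.exp (2 * (k s + δ)) := by
        calc 2 * B * δ ^ 2 = (2 * B * δ) * δ := by ring
          _ ≤ η * δ * 1 := by rw [mul_one]; gcongr
          _ ≤ _ := by gcongr
      calc _ ≤ η * k s * Real.exp (2 * (k s + δ)) + η * δ * Real.exp (2 * (k s + δ)) :=
            add_le_add h1 h2
        _ = _ := by ring
  by_contra hneg
  push Not at hneg
  set c := k t * Real.exp (2 * k t) * ‖a‖ with hc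
  have hc0 : 0 ≤ c := mul_nonneg (mul_nonneg (hk0 t) (Real.exp_nonneg _)) (norm_nonneg _)
  -- This `η` makes the lower bound at most half as negative as the value itself, which is absurd.
  have := main (-(y t a).re / (2 * (c + 1))) (div_pos (by linarith) (by positivity)) t ht a ha
  have h1 : -(y t a).re / (2 * (c + 1)) * k t * Real.exp (2 * k t) * ‖a‖
      = -(y t a).re * (c / (2 * (c + 1))) := by rw [hc]; field_simp
  rw [h1] at this
  have h2 : c / (2 * (c + 1)) ≤ 1 / 2 := by
    rw [div_le_div_iff₀ (by positivity) (by norm_num)]; linarith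
  nlinarith

/-! ### The total mass -/

theorem IsWeakSol.mass (hC : C.Regular ν) (h : IsWeakSol C e π t₀ T y) {s t : ℝ≥0}
    (hs : t₀ ≤ s) (hst : s ≤ t) (ht : t ≤ T) :
    IntegrableOn (fun r => y r (C.R r e π)) (Ioc s t) leb ∧
    y t 1 = y s 1 - ∫ r in Ioc s t, y r (C.R r e π) ∂leb := by
  have h1 := h.equation_sub hs hst ht 1
  have h2 := (h.integrable 1).mono_set (Ioc_subset_Ioc hs ht)
  simp only [hC.noJumpDual_one, map_neg] at h1 h2
  refine ⟨by simpa using h2.neg, ?_⟩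
  rw [h1, integral_neg]
  ring

theorem isPositive_opNorm_sub {a : H →L[ℂ] H} (ha : a.IsPositive) {c : ℝ} (hc : ‖a‖ ≤ c) :
    ((c : ℂ) • (1 : H →L[ℂ] H) - a).IsPositive := by
  refine isPositive_of_inner fun x => ⟨c * ‖x‖ ^ 2 - (inner ℂ x (a x) : ℂ).re, ?_, ?_⟩
  · rw [sub_apply, smul_apply, one_apply_eq_self, inner_sub_right, inner_smul_right,
      inner_self_eq_norm_sq_to_K, (ha.inner_eq_re x).1]
    simp
  · have := re_inner_le_opNorm a x
    nlinarith [sq_nonneg ‖x‖]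

theorem re_apply_le_of_nonneg {y : (H →L[ℂ] H) →L[ℂ] ℂ}
    (hy : ∀ a : H →L[ℂ] H, a.IsPositive → 0 ≤ (y a).re) {a : H →L[ℂ] H} (ha : a.IsPositive)
    {c : ℝ} (hc : ‖a‖ ≤ c) : (y a).re ≤ c * (y 1).re := by
  have := hy _ (isPositive_opNorm_sub ha hc)
  simp only [map_sub, map_smul, Complex.sub_re, smul_eq_mul, Complex.re_ofReal_mul] at this
  linarith

theorem Coefficients.norm_R_le_genRate (C : Coefficients U E H ι₁ ι₂) (t : ℝ≥0) (e : E)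
    (π : Trajectory U) : ‖C.R t e π‖ ≤ C.genRate t e π := by
  unfold Coefficients.genRate
  linarith [norm_nonneg (C.ham t e π), norm_nonneg (C.R₀ t e π)]

theorem IsWeakSol.mass_antitone (hC : C.Regular ν) (h : IsWeakSol C e π t₀ T y)
    (hκ : IntegrableOn (fun s => C.genRate s e π) (Ioc t₀ T) leb)
    (h₀ : ∀ a : H →L[ℂ] H, a.IsPositive → 0 ≤ (y t₀ a).re) {s t : ℝ≥0}
    (hs : t₀ ≤ s) (hst : s ≤ t) (ht : t ≤ T) : (y t 1).re ≤ (y s 1).re := by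
  obtain ⟨hi, hm⟩ := h.mass hC hs hst ht
  rw [hm, Complex.sub_re]
  have : ∫ r in Ioc s t, (y r (C.R r e π)).re ∂leb
      = (∫ r in Ioc s t, y r (C.R r e π) ∂leb).re := integral_re hi
  rw [← this]
  have : 0 ≤ ∫ r in Ioc s t, (y r (C.R r e π)).re ∂leb :=
    setIntegral_nonneg measurableSet_Ioc fun r hr =>
      h.nonneg hC hκ h₀ ⟨hs.trans hr.1.le, hr.2.trans ht⟩ (hC.R_isPositive r e π)
  linarith

/-- A Grönwall bound from below by continuous induction: since `R` is dominated by the rate and the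
mass decreases, a step loses at most the fraction `δ` of the mass, and `1 - δ ≥ e^{-2δ}` for small
`δ`. It guarantees that the no-jump state can always be normalized. -/
theorem IsWeakSol.mass_pos (hC : C.Regular ν) (h : IsWeakSol C e π t₀ T y)
    (hκ : IntegrableOn (fun s => C.genRate s e π) (Ioc t₀ T) leb)
    (h₀ : ∀ a : H →L[ℂ] H, a.IsPositive → 0 ≤ (y t₀ a).re) (h₁ : 0 < (y t₀ 1).re) {t : ℝ≥0}
    (ht : t ∈ Icc t₀ T) : 0 < (y t 1).re := by
  set k : ℝ≥0 → ℝ := fun t => ∫ s in Ioc t₀ t, C.genRate s e π ∂leb with hk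
  have hkc : ContinuousOn k (Icc t₀ T) := continuousOn_setIntegral_Ioc hκ
  have main : ∀ t ∈ Icc t₀ T, (y t₀ 1).re * Real.exp (-(2 * k t)) ≤ (y t 1).re := by
    refine IsClosed.Icc_subset_of_forall_mem_nhdsWithin
      (s := {t | (y t₀ 1).re * Real.exp (-(2 * k t)) ≤ (y t 1).re}) ?_ ?_ ?_
    · have hcl := isClosed_Icc.isClosed_le
        (f := fun t => (y t₀ 1).re * Real.exp (-(2 * k t))) (g := fun t => (y t 1).re)
        (by fun_prop) (Complex.continuous_re.comp_continuousOn (h.continuousOn 1))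
      convert hcl using 1
      ext t
      simp [and_comm]
    · simp [hk]
    · rintro s ⟨hs, hsI⟩
      have hlim : Tendsto (fun t => k t - k s) (𝓝[>] s) (𝓝 0) := by
        have h1 := (hkc s ⟨hsI.1, hsI.2.le⟩).mono_left
          (nhdsWithin_le_of_mem (mem_of_superset (Ioc_mem_nhdsGT hsI.2)
            (fun q hq => ⟨hsI.1.trans hq.1.le, hq.2⟩)))
        simpa using h1.sub_const (k s)
      filter_upwards [hlim.eventually (gt_mem_nhds (show (0 : ℝ) < 1 / 2 by norm_num)),
        Ioc_mem_nhdsGT hsI.2] with t ht htI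
      have hadd : k t = k s + ∫ r in Ioc s t, C.genRate r e π ∂leb :=
        setIntegral_Ioc_add hsI.1 htI.1.le (hκ.mono_set (Ioc_subset_Ioc_right htI.2))
      set δ := ∫ r in Ioc s t, C.genRate r e π ∂leb with hδ
      have hκ' := hκ.mono_set (Ioc_subset_Ioc hsI.1 htI.2)
      have hδ0 : 0 < δ := Coefficients.setIntegral_genRate_pos htI.1 hκ'
      have hδ' : δ < 1 / 2 := by rw [hadd] at ht; linarith
      have hs0 : 0 ≤ (y s 1).re := le_trans (by positivity) hs
      obtain ⟨hi, hm⟩ := h.mass hC hsI.1 htI.1.le htI.2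
      have hre : ∫ r in Ioc s t, (y r (C.R r e π)).re ∂leb
          = (∫ r in Ioc s t, y r (C.R r e π) ∂leb).re := integral_re hi
      have hle : ∫ r in Ioc s t, (y r (C.R r e π)).re ∂leb
          ≤ ∫ r in Ioc s t, (y s 1).re * C.genRate r e π ∂leb := by
        refine setIntegral_mono_on hi.re (hκ'.const_mul _) measurableSet_Ioc fun r hr => ?_
        have h1 := re_apply_le_of_nonneg
          (fun a ha => h.nonneg hC hκ h₀ ⟨hsI.1.trans hr.1.le, hr.2.trans htI.2⟩ ha)
          (hC.R_isPositive r e π) (C.norm_R_le_genRate r e π)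
        have h2 := h.mass_antitone hC hκ h₀ hsI.1 hr.1.le (hr.2.trans htI.2)
        have h3 := C.genRate_nonneg r e π
        calc _ ≤ _ := h1
          _ ≤ C.genRate r e π * (y s 1).re := by gcongr
          _ = _ := mul_comm _ _
      rw [integral_const_mul, ← hδ, hre] at hle
      -- Here `e^{-2δ} ≤ 1/(1 + 2δ)`, and `(1 + 2δ)(1 - δ) ≥ 1` for `0 ≤ δ ≤ 1/2`.
      have h4 : Real.exp (-(2 * δ)) ≤ 1 - δ := by
        rw [Real.exp_neg]
        refine (inv_anti₀ (by positivity) (Real.add_one_le_exp (2 * δ))).trans ?_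
        rw [inv_le_iff_one_le_mul₀ (by positivity)]
        nlinarith
      change (y t₀ 1).re * Real.exp (-(2 * k t)) ≤ (y t 1).re
      rw [hm, Complex.sub_re, hadd]
      have e1 : Real.exp (-(2 * (k s + δ))) = Real.exp (-(2 * k s)) * Real.exp (-(2 * δ)) := by
        rw [← Real.exp_add]; ring_nf
      rw [e1, ← mul_assoc]
      calc _ ≤ (y s 1).re * Real.exp (-(2 * δ)) := by gcongr; exact hs
        _ ≤ (y s 1).re * (1 - δ) := by gcongr
        _ ≤ _ := by linarith
  exact lt_of_lt_of_le (by positivity) (main t ht)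

/-! ### Rescaling -/

/-- A solution of the equation with the additional term `c y` is, up to an exponential factor, a
solution of the no-jump equation. -/
theorem IsWeakSol.of_rescaled {c : ℝ}
    (hb : ∃ B : ℝ, ∀ t ∈ Icc t₀ T, ‖y t‖ ≤ B)
    (hi : ∀ a, IntegrableOn (fun s => y s (C.noJumpDual s e π a) + c * y s a) (Ioc t₀ T) leb)
    (he : ∀ t ∈ Icc t₀ T, ∀ a, y t a = y t₀ a
      + ∫ s in Ioc t₀ t, (y s (C.noJumpDual s e π a) + c * y s a) ∂leb) :
    IsWeakSol C e π t₀ T (fun t => (Real.exp (-(c * (t - t₀))) : ℂ) • y t) := by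
  set Ex : ℝ≥0 → ℝ := fun t => Real.exp (-(c * (t - t₀))) with hEx
  set g : ℝ≥0 → ℂ := fun t => ((-c * Ex t : ℝ) : ℂ) with hg
  have hgc : Continuous g := by fun_prop
  have hgi : ∀ t, IntegrableOn g (Ioc t₀ t) leb := fun t =>
    (hgc.integrableOn_Icc (a := t₀) (b := t)).mono_set Ioc_subset_Icc_self
  have hQ : ∀ t, t₀ ≤ t → ∫ s in Ioc t₀ t, g s ∂leb = (Ex t : ℂ) - 1 := fun t ht => by
    have hre : ∫ r in Ioc (t₀ : ℝ) t, ((-c * Real.exp (-(c * (r - t₀))) : ℝ) : ℂ)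
        = ((∫ r in Ioc (t₀ : ℝ) t, -c * Real.exp (-(c * (r - t₀))) : ℝ) : ℂ) := integral_ofReal
    rw [setIntegral_leb (fun r : ℝ => ((-c * Real.exp (-(c * (r - t₀))) : ℝ) : ℂ)) t₀ t,
      hre, ← intervalIntegral.integral_of_le (by exact_mod_cast ht),
      intervalIntegral.integral_eq_sub_of_hasDerivAt
        (f := fun r => Real.exp (-(c * (r - t₀)))) (fun r _ => ?_)
        (Continuous.intervalIntegrable (by fun_prop) _ _)]
    · simp [hEx]
    · have h1 : HasDerivAt (fun r : ℝ => -(c * (r - t₀))) (-(c * 1)) r :=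
        (((hasDerivAt_id r).sub_const _).const_mul c).neg
      have h2 := h1.exp
      rwa [mul_one, mul_comm] at h2
  set f : (H →L[ℂ] H) → ℝ≥0 → ℂ := fun a s => y s (C.noJumpDual s e π a) + c * y s a with hf
  have hP : ∀ a, ∀ t ∈ Icc t₀ T, ∫ s in Ioc t₀ t, f a s ∂leb = y t a - y t₀ a :=
    fun a t ht => by rw [he t ht a]; ring
  have hdec : ∀ a, ∀ s ∈ Ioc t₀ T, f a s * ∫ r in Ioc t₀ s, g r ∂leb =
      f a s * ((Ex s : ℂ) - 1) := fun a s hs => by rw [hQ s hs.1.le]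
  have hdec' : ∀ a, ∀ s ∈ Ioc t₀ T, g s * ∫ r in Ioc t₀ s, f a r ∂leb =
      g s * (y s a - y t₀ a) := fun a s hs => by rw [hP a s ⟨hs.1.le, hs.2⟩]
  have hi1 : ∀ a, ∀ t ≤ T, IntegrableOn (fun s => f a s * ((Ex s : ℂ) - 1)) (Ioc t₀ t) leb :=
    fun a t ht => (setIntegral_mul_setIntegral ((hi a).mono_set (Ioc_subset_Ioc_right ht))
      (hgi t)).1.congr_fun (fun s hs => hdec a s ⟨hs.1, hs.2.trans ht⟩) measurableSet_Ioc
  have hi2 : ∀ a, ∀ t ≤ T, IntegrableOn (fun s => g s * (y s a - y t₀ a)) (Ioc t₀ t) leb :=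
    fun a t ht => (setIntegral_mul_setIntegral (hgi t)
      ((hi a).mono_set (Ioc_subset_Ioc_right ht))).1.congr_fun
      (fun s hs => hdec' a s ⟨hs.1, hs.2.trans ht⟩) measurableSet_Ioc
  -- The product rule is available only for primitives that vanish at `t₀`, that is for `Ex - 1` and
  -- `y - y t₀`; the integrand is split into its two terms and the two remainders.
  have hexp : ∀ a s, (Ex s : ℂ) * y s (C.noJumpDual s e π a)
      = (f a s * ((Ex s : ℂ) - 1) + f a s) + (g s * (y s a - y t₀ a) + g s * y t₀ a) := by
    intro a s
    simp only [hf, hg]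
    push_cast
    ring
  have hi12 : ∀ a, ∀ t ≤ T, IntegrableOn (fun s => f a s * ((Ex s : ℂ) - 1) + f a s)
      (Ioc t₀ t) leb := fun a t ht =>
    (hi1 a t ht).add ((hi a).mono_set (Ioc_subset_Ioc_right ht))
  have hi34 : ∀ a, ∀ t ≤ T, IntegrableOn (fun s => g s * (y s a - y t₀ a) + g s * y t₀ a)
      (Ioc t₀ t) leb := fun a t ht => (hi2 a t ht).add ((hgi t).mul_const _)
  refine ⟨?_, fun a => ?_, fun t ht a => ?_⟩
  · obtain ⟨B, hB⟩ := hb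
    have hc : ContinuousOn Ex (Icc t₀ T) := by fun_prop
    obtain ⟨M, hM⟩ := isCompact_Icc.exists_bound_of_continuousOn hc
    refine ⟨M * B, fun t ht => ?_⟩
    rw [norm_smul, Complex.norm_real]
    exact mul_le_mul (hM t ht) (hB t ht) (norm_nonneg _) ((norm_nonneg _).trans (hM t ht))
  · refine IntegrableOn.congr_fun ((hi12 a T le_rfl).add (hi34 a T le_rfl)) (fun s _ => ?_)
      measurableSet_Ioc
    exact (hexp a s).symm
  · have h1 := (setIntegral_mul_setIntegral ((hi a).mono_set (Ioc_subset_Ioc_right ht.2))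
      (hgi t)).2
    rw [setIntegral_congr_fun measurableSet_Ioc
      (fun s (hs : s ∈ Ioc t₀ t) => hdec a s ⟨hs.1, hs.2.trans ht.2⟩)] at h1
    have h2 : ∫ s in Ioc t₀ t, (∫ r in Ioc t₀ s, f a r ∂leb) * g s ∂leb
        = ∫ s in Ioc t₀ t, g s * (y s a - y t₀ a) ∂leb :=
      setIntegral_congr_fun measurableSet_Ioc fun s hs => by
        rw [hP a s ⟨hs.1.le, hs.2.trans ht.2⟩]; ring
    have h3 : ∫ s in Ioc t₀ t, (((Ex s : ℂ) • y s) (C.noJumpDual s e π a)) ∂leb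
        = (∫ s in Ioc t₀ t, f a s * ((Ex s : ℂ) - 1) ∂leb + ∫ s in Ioc t₀ t, f a s ∂leb)
          + (∫ s in Ioc t₀ t, g s * (y s a - y t₀ a) ∂leb
            + (∫ s in Ioc t₀ t, g s ∂leb) * y t₀ a) := by
      rw [← integral_mul_const, ← integral_add (hi1 a t ht.2)
        ((hi a).mono_set (Ioc_subset_Ioc_right ht.2)),
        ← integral_add (hi2 a t ht.2) ((hgi t).mul_const _),
        ← integral_add (hi12 a t ht.2) (hi34 a t ht.2)]
      exact integral_congr_ae (ae_of_all _ fun s => hexp a s)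
    rw [h2, hP a t ht, hQ t ht.1] at h1
    rw [h3, hP a t ht, hQ t ht.1]
    have h0 : Ex t₀ = 1 := by simp [hEx]
    simp only [smul_apply, smul_eq_mul]
    have h0' : ((Real.exp (-(c * ((t₀ : ℝ) - t₀))) : ℝ) : ℂ) = 1 := by simp
    rw [h0', show ((Real.exp (-(c * ((t : ℝ) - t₀))) : ℝ) : ℂ) = (Ex t : ℂ) from rfl]
    linear_combination h1

end NoJumpEquation

/-! ### Measurability of trajectories -/

section TrajectoryMeasurability

variable {U : Type*} [MeasurableSpace U] {X : Type*} [MeasurableSpace X]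

theorem measurable_meas {B : Set (ℝ≥0 × U)} (hB : MeasurableSet B) :
    Measurable fun π : Trajectory U => π.meas B :=
  (Measure.measurable_coe hB).comp measurable_subtype_coe

theorem measurable_trajectory {f : X → Trajectory U}
    (h : ∀ B, MeasurableSet B → Measurable fun x => (f x).meas B) : Measurable f :=
  Measurable.subtype_mk (Measure.measurable_of_measurable_coe _ h)

theorem Trajectory.restrictTime_meas (π : Trajectory U) (I : Set ℝ≥0) (hI : MeasurableSet I)
    {B : Set (ℝ≥0 × U)} (hB : MeasurableSet B) :
    (π.restrictTime I hI).meas B = π.meas (B ∩ I ×ˢ univ) := Measure.restrict_apply hB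

theorem Trajectory.ext_meas {π π' : Trajectory U} (h : π.meas = π'.meas) : π = π' :=
  Subtype.ext h

theorem Trajectory.meas_Iic_lt_top (π : Trajectory U) (t : ℝ≥0) :
    π.meas (Iic t ×ˢ univ) < ∞ := π.2.2 t

theorem Trajectory.exists_meas_eq (π : Trajectory U) {B : Set (ℝ≥0 × U)}
    (hB : MeasurableSet B) : ∃ n : ℕ∞, π.meas B = (n : ℝ≥0∞) := π.2.1 B hB

theorem Trajectory.restrictTime_restrictTime (π : Trajectory U) {I J : Set ℝ≥0}
    (hI : MeasurableSet I) (hJ : MeasurableSet J) :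
    (π.restrictTime I hI).restrictTime J hJ = π.restrictTime (J ∩ I) (hJ.inter hI) := by
  refine Trajectory.ext_meas ?_
  change (π.meas.restrict (I ×ˢ univ)).restrict (J ×ˢ univ) = π.meas.restrict _
  rw [Measure.restrict_restrict (hJ.prod .univ), prod_inter_prod, univ_inter]

theorem Trajectory.restrictTime_congr_of_null (π : Trajectory U) {I J : Set ℝ≥0}
    (hI : MeasurableSet I) (hJ : MeasurableSet J) (hIJ : I ⊆ J)
    (h : π.meas ((J \ I) ×ˢ univ) = 0) : π.restrictTime I hI = π.restrictTime J hJ := by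
  refine Trajectory.ext_meas (Measure.restrict_congr_set ?_)
  refine (LE.le.eventuallyLE (prod_mono_left hIJ)).antisymm ?_
  rw [ae_le_set]
  refine measure_mono_null (fun q hq => ?_) h
  exact ⟨⟨hq.1.1, fun hI => hq.2 ⟨hI, trivial⟩⟩, trivial⟩

/-- The strict past of a trajectory is not changed by jumps after `t₀` if there are none. -/
theorem Trajectory.before_upTo_of_null (π : Trajectory U) {t₀ t s : ℝ≥0}
    (h : π.meas (Ioc t₀ t ×ˢ univ) = 0) (hs : s ≤ t) : (π.upTo t₀).before s = π.before s := by
  rw [Trajectory.upTo, Trajectory.before, Trajectory.restrictTime_restrictTime]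
  refine Trajectory.restrictTime_congr_of_null _ _ _ inter_subset_left ?_
  refine measure_mono_null (prod_mono_left fun q hq => ?_) h
  simp only [Set.mem_sdiff, mem_Iio, mem_inter_iff, mem_Iic, not_and, not_le] at hq
  exact ⟨hq.2 hq.1, hq.1.le.trans hs⟩

theorem measurable_restrictTime {I : Set ℝ≥0} (hI : MeasurableSet I) :
    Measurable fun π : Trajectory U => π.restrictTime I hI :=
  measurable_trajectory fun B hB => by
    simp only [Trajectory.restrictTime_meas _ _ _ hB]
    exact measurable_meas (hB.inter (hI.prod .univ))

end TrajectoryMeasurability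

/-! ### The Poisson process -/

section Poisson

theorem lintegral_poisson_mean (r : ℝ≥0) :
    ∑' n : ℕ, (n : ℝ≥0∞) * poissonMeasure r {n} = r := by
  rw [tsum_eq_zero_add' ENNReal.summable]
  have h1 : ∀ n : ℕ, ((n + 1 : ℕ) : ℝ≥0∞) * poissonMeasure r {n + 1}
      = r * poissonMeasure r {n} := fun n => by
    rw [poissonMeasure_singleton, poissonMeasure_singleton, ← ENNReal.ofReal_natCast,
      ← ENNReal.ofReal_mul (by positivity), ← ENNReal.ofReal_coe_nnreal,
      ← ENNReal.ofReal_mul (by positivity)]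
    congr 1
    rw [Nat.factorial_succ, pow_succ]
    push_cast
    field_simp
  simp only [h1, ENNReal.tsum_mul_left, Nat.cast_zero, zero_mul, zero_add]
  have h2 : ∑' n, poissonMeasure r {n} = 1 := by
    rw [← measure_iUnion (fun i j h => by simpa using h) (fun _ => .of_discrete),
      iUnion_of_singleton, measure_univ]
  rw [h2, mul_one]

variable {Ω U E : Type*} [mΩ : MeasurableSpace Ω] [MeasurableSpace U] [MeasurableSpace E]
  {Q : Measure Ω} [IsProbabilityMeasure Q] {𝓕 : Filtration ℝ≥0 mΩ} {ν : Measure U}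
  [IsFiniteMeasure ν] {ξ : Ω → E} {Pi : Ω → Trajectory U}

/-- Adaptedness controls only the jumps up to a finite time; any set is the increasing union of its
parts before the integers. -/
theorem IsPoissonPointProcess.measurable (hPi : IsPoissonPointProcess Q 𝓕 ν ξ Pi) :
    Measurable Pi := by
  refine measurable_trajectory fun B hB => ?_
  have h : ∀ ω, (Pi ω).meas B = ⨆ n : ℕ, ((Pi ω).upTo n).meas B := fun ω => by
    have e : B = ⋃ n : ℕ, B ∩ Iic (n : ℝ≥0) ×ˢ univ := by
      rw [← inter_iUnion, eq_comm, inter_eq_left]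
      intro q _
      obtain ⟨n, hn⟩ := exists_nat_ge q.1
      exact mem_iUnion.2 ⟨n, hn, trivial⟩
    have hmono : Monotone fun n : ℕ => B ∩ Iic (n : ℝ≥0) ×ˢ (univ : Set U) := fun m n hmn =>
      inter_subset_inter_right _ (prod_mono_left (Iic_subset_Iic.2 (by exact_mod_cast hmn)))
    conv_lhs => rw [e, hmono.measure_iUnion]
    exact iSup_congr fun n => (Trajectory.restrictTime_meas _ _ _ hB).symm
  simp only [h]
  exact .iSup fun n => (measurable_meas hB).comp ((hPi.adapted n).mono (𝓕.le _) le_rfl)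

/-- The filtration enlarged by the extra noise. -/
def enlarge (𝓕 : Filtration ℝ≥0 mΩ) (ξ : Ω → E) (hξ : Measurable ξ) : Filtration ℝ≥0 mΩ where
  seq t := 𝓕 t ⊔ MeasurableSpace.comap ξ inferInstance
  mono' _ _ h := sup_le_sup_right (𝓕.mono h) _
  le' t := sup_le (𝓕.le t) hξ.comap_le

theorem le_enlarge (hξ : Measurable ξ) (t : ℝ≥0) : 𝓕 t ≤ enlarge 𝓕 ξ hξ t := le_sup_left

theorem measurable_noise_enlarge (hξ : Measurable ξ) (t : ℝ≥0) :
    Measurable[enlarge 𝓕 ξ hξ t] ξ :=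
  Measurable.of_comap_le le_sup_right

/-- The law is prescribed only on finite values, but these probabilities already add up to one, so
the value `∞` has probability zero and the mean is the Poisson mean. -/
theorem IsPoissonPointProcess.lintegral_meas (hPi : IsPoissonPointProcess Q 𝓕 ν ξ Pi)
    {B : Set (ℝ≥0 × U)} (hB : MeasurableSet B) (hf : (leb.prod ν) B < ∞) :
    ∫⁻ ω, (Pi ω).meas B ∂Q = (leb.prod ν) B := by
  set g : Ω → ℝ≥0∞ := fun ω => (Pi ω).meas B with hg
  have hgm : Measurable g := (measurable_meas hB).comp hPi.measurable
  have hlaw := hPi.law B hB hf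
  set r := ((leb.prod ν) B).toNNReal with hr
  have hms : ∀ n : ℕ, MeasurableSet {ω | g ω = n} := fun n => hgm (measurableSet_singleton _)
  have hdis : Pairwise (Function.onFun Disjoint fun n : ℕ => {ω | g ω = n}) := fun m n hmn =>
    disjoint_left.2 fun ω h1 h2 => hmn (by
      simp only [mem_ofPred_eq] at h1 h2
      exact_mod_cast h1.symm.trans h2)
  have hone : Q (⋃ n : ℕ, {ω | g ω = n}) = 1 := by
    rw [measure_iUnion hdis hms]
    calc ∑' n : ℕ, Q {ω | g ω = n} = ∑' n : ℕ, poissonMeasure r {n} := tsum_congr hlaw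
      _ = 1 := by
        rw [← measure_iUnion (fun i j h => by simpa using h) (fun _ => .of_discrete),
          iUnion_of_singleton, measure_univ]
  have hae : ∀ᵐ ω ∂Q, ω ∈ ⋃ n : ℕ, {ω | g ω = n} :=
    (prob_compl_eq_zero_iff (.iUnion hms)).2 hone
  have hrep : ∀ᵐ ω ∂Q, g ω = ∑' n : ℕ, {ω | g ω = n}.indicator (fun _ => (n : ℝ≥0∞)) ω := by
    filter_upwards [hae] with ω hω
    obtain ⟨n, hn⟩ := mem_iUnion.1 hω
    rw [tsum_eq_single n, indicator_of_mem hn]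
    · exact hn
    · intro m hm
      refine indicator_of_notMem (fun h => hm ?_) _
      simp only [mem_ofPred_eq] at hn h
      exact_mod_cast h.symm.trans hn
  rw [lintegral_congr_ae hrep, lintegral_tsum fun n =>
    (measurable_const.indicator (hms n)).aemeasurable]
  simp only [lintegral_indicator (hms _), lintegral_const, Measure.restrict_apply .univ,
    univ_inter]
  rw [show ∑' n : ℕ, (n : ℝ≥0∞) * Q {ω | g ω = n} = ∑' n : ℕ, (n : ℝ≥0∞) * poissonMeasure r {n}
    from tsum_congr fun n => by rw [hlaw n], lintegral_poisson_mean, hr,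
    ENNReal.coe_toNNReal hf.ne]

theorem prod_Ioc_lt_top (s t : ℝ≥0) (B : Set U) : (leb.prod ν) (Ioc s t ×ˢ B) < ∞ := by
  rw [Measure.prod_prod, leb_Ioc]
  exact ENNReal.mul_lt_top ENNReal.coe_lt_top (measure_lt_top _ _)

theorem Trajectory.after_meas (π : Trajectory U) {s t : ℝ≥0} {B : Set U}
    (hB : MeasurableSet B) :
    (π.after s).meas (Ioc s t ×ˢ B) = π.meas (Ioc s t ×ˢ B) := by
  rw [Trajectory.after, Trajectory.restrictTime_meas _ _ _ (measurableSet_Ioc.prod hB)]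
  congr 1
  rw [inter_eq_left]
  exact fun q hq => ⟨hq.1.1, trivial⟩

theorem IsPoissonPointProcess.measurable_after (s t : ℝ≥0) {B : Set U} (hB : MeasurableSet B) :
    Measurable[MeasurableSpace.comap (fun ω => (Pi ω).after s) inferInstance]
      fun ω => (Pi ω).meas (Ioc s t ×ˢ B) := by
  have h : Measurable[MeasurableSpace.comap (fun ω => (Pi ω).after s) inferInstance]
      fun ω => (Pi ω).after s := comap_measurable _
  have := (measurable_meas (measurableSet_Ioc (a := s) (b := t) |>.prod hB)).comp h
  simpa only [Function.comp_def, Trajectory.after_meas _ hB] using this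

/-- The weight may involve the noise as well as the past, because the independence assumption covers
the enlarged σ-algebra. -/
theorem IsPoissonPointProcess.lintegral_mul_after (hPi : IsPoissonPointProcess Q 𝓕 ν ξ Pi)
    (hξ : Measurable ξ) {s t : ℝ≥0} {B : Set U} (hB : MeasurableSet B) {X : Ω → ℝ≥0∞}
    (hX : Measurable[enlarge 𝓕 ξ hξ s] X) {φ : ℝ≥0∞ → ℝ≥0∞} (hφ : Measurable φ) :
    ∫⁻ ω, X ω * φ ((Pi ω).meas (Ioc s t ×ˢ B)) ∂Q
      = (∫⁻ ω, X ω ∂Q) * ∫⁻ ω, φ ((Pi ω).meas (Ioc s t ×ˢ B)) ∂Q :=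
  lintegral_mul_eq_lintegral_mul_lintegral_of_independent_measurableSpace
    ((enlarge 𝓕 ξ hξ).le s) (((measurable_restrictTime _).comp hPi.measurable).comap_le)
    (hPi.indep_past s) hX (hφ.comp (IsPoissonPointProcess.measurable_after s t hB))

/-- The probability of no jump in `(s, t]`, given the past. -/
theorem IsPoissonPointProcess.lintegral_mul_noJump (hPi : IsPoissonPointProcess Q 𝓕 ν ξ Pi)
    (hξ : Measurable ξ) {s t : ℝ≥0} (hst : s ≤ t) {X : Ω → ℝ≥0∞}
    (hX : Measurable[enlarge 𝓕 ξ hξ s] X) :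
    ∫⁻ ω in {ω | (Pi ω).meas (Ioc s t ×ˢ univ) = 0}, X ω ∂Q
      = (∫⁻ ω, X ω ∂Q) * ENNReal.ofReal (Real.exp (-(ν.real univ * (t - s)))) := by
  set A : Set Ω := {ω | (Pi ω).meas (Ioc s t ×ˢ univ) = 0} with hA
  have hAm : MeasurableSet A :=
    ((measurable_meas (measurableSet_Ioc.prod .univ)).comp hPi.measurable)
      (measurableSet_singleton 0)
  have hφ : Measurable (({0} : Set ℝ≥0∞).indicator fun _ => (1 : ℝ≥0∞)) :=
    measurable_const.indicator (measurableSet_singleton 0)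
  have h := hPi.lintegral_mul_after hξ (t := t) MeasurableSet.univ hX hφ
  have e : ∀ ω, ({0} : Set ℝ≥0∞).indicator (fun _ => (1 : ℝ≥0∞))
      ((Pi ω).meas (Ioc s t ×ˢ univ)) = A.indicator (fun _ => 1) ω := fun ω => rfl
  simp only [e, lintegral_indicator hAm, lintegral_const, Measure.restrict_apply .univ,
    univ_inter, one_mul] at h
  have hlaw := hPi.law (Ioc s t ×ˢ univ) (measurableSet_Ioc.prod .univ)
    (prod_Ioc_lt_top s t univ) 0
  rw [Nat.cast_zero] at hlaw
  rw [← lintegral_indicator hAm]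
  refine (lintegral_congr fun ω => ?_).trans (h.trans ?_)
  · by_cases hω : ω ∈ A <;> simp [hω]
  · rw [hlaw, poissonMeasure_singleton]
    congr 3
    rw [Measure.prod_prod, leb_Ioc]
    rw [ENNReal.coe_toNNReal_eq_toReal, ENNReal.toReal_mul, ENNReal.coe_toReal, NNReal.coe_sub hst]
    simp [measureReal_def, mul_comm]

theorem IsPoissonPointProcess.measurableSet_noJump (hPi : IsPoissonPointProcess Q 𝓕 ν ξ Pi)
    (s t : ℝ≥0) : MeasurableSet {ω | (Pi ω).meas (Ioc s t ×ˢ univ) = 0} :=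
  ((measurable_meas (measurableSet_Ioc.prod .univ)).comp hPi.measurable)
    (measurableSet_singleton 0)

/-- A property of the past which holds on the event of no further jump holds almost surely. -/
theorem IsPoissonPointProcess.measure_eq_zero_of_noJump
    (hPi : IsPoissonPointProcess Q 𝓕 ν ξ Pi) (hξ : Measurable ξ) {s t : ℝ≥0} (hst : s ≤ t)
    {A : Set Ω} (hA : MeasurableSet[enlarge 𝓕 ξ hξ s] A)
    (h : Q (A ∩ {ω | (Pi ω).meas (Ioc s t ×ˢ univ) = 0}) = 0) : Q A = 0 := by
  have hA' := (enlarge 𝓕 ξ hξ).le s A hA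
  have := hPi.lintegral_mul_noJump hξ hst (X := A.indicator fun _ => 1)
    (measurable_const.indicator hA)
  rw [lintegral_indicator hA', lintegral_indicator hA', Measure.restrict_restrict hA',
    lintegral_const, lintegral_const, Measure.restrict_apply .univ, Measure.restrict_apply .univ,
    univ_inter, univ_inter, one_mul, one_mul, h] at this
  rcases mul_eq_zero.1 this.symm with h0 | h0
  · exact h0
  · rw [ENNReal.ofReal_eq_zero] at h0
    exact absurd h0 (Real.exp_pos _).not_ge

theorem IsPoissonPointProcess.ae_meas_zero (hPi : IsPoissonPointProcess Q 𝓕 ν ξ Pi) :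
    ∀ᵐ ω ∂Q, (Pi ω).meas ({0} ×ˢ univ) = 0 := by
  have hm : MeasurableSet (({0} : Set ℝ≥0) ×ˢ (univ : Set U)) :=
    (measurableSet_singleton 0).prod .univ
  have h0 : (leb.prod ν) (({0} : Set ℝ≥0) ×ˢ univ) = 0 := by
    rw [Measure.prod_prod, leb_singleton, zero_mul]
  have h := hPi.lintegral_meas hm (by rw [h0]; simp)
  rw [h0] at h
  exact (lintegral_eq_zero_iff (f := fun ω => (Pi ω).meas ({0} ×ˢ univ))
    ((measurable_meas hm).comp hPi.measurable)).1 h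

/-- For a Poisson variable of mean `r` the probability is `1 - e^{-r}(1 + r)`, and `e^{-r} ≥ 1 - r`
bounds it by `r²`. -/
theorem IsPoissonPointProcess.measure_two_le (hPi : IsPoissonPointProcess Q 𝓕 ν ξ Pi)
    (s t : ℝ≥0) : Q {ω | 2 ≤ (Pi ω).meas (Ioc s t ×ˢ univ)}
      ≤ ENNReal.ofReal (((t - s : ℝ≥0) * ν.real univ) ^ 2) := by
  set g : Ω → ℝ≥0∞ := fun ω => (Pi ω).meas (Ioc s t ×ˢ univ) with hg
  have hm : MeasurableSet (Ioc s t ×ˢ (univ : Set U)) := measurableSet_Ioc.prod .univ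
  have hgm : Measurable g := (measurable_meas hm).comp hPi.measurable
  have hlaw := hPi.law _ hm (prod_Ioc_lt_top s t univ)
  set r := ((leb.prod ν) (Ioc s t ×ˢ univ)).toNNReal with hr
  have hr' : (r : ℝ) = (t - s : ℝ≥0) * ν.real univ := by
    rw [hr, Measure.prod_prod, leb_Ioc]
    rw [ENNReal.coe_toNNReal_eq_toReal, ENNReal.toReal_mul, ENNReal.coe_toReal, measureReal_def]
  have h0 := hlaw 0
  have h1 := hlaw 1
  rw [Nat.cast_zero] at h0
  rw [Nat.cast_one] at h1
  have hm0 : MeasurableSet {ω | g ω = 0} := hgm (measurableSet_singleton _)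
  have hm1 : MeasurableSet {ω | g ω = 1} := hgm (measurableSet_singleton _)
  have hd : Disjoint {ω | g ω = 0} {ω | g ω = 1} := disjoint_left.2 fun ω a b => by
    simp only [mem_ofPred_eq] at a b
    simp [a] at b
  have hsub : {ω | 2 ≤ g ω} ⊆ ({ω | g ω = 0} ∪ {ω | g ω = 1})ᶜ := by
    rintro ω hω (h | h) <;> simp only [mem_ofPred_eq] at h hω <;> rw [h] at hω
    · simp at hω
    · exact absurd hω (by norm_num)
  refine (measure_mono hsub).trans ?_
  rw [prob_compl_eq_one_sub (hm0.union hm1), measure_union hd hm1, h0, h1,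
    poissonMeasure_singleton, poissonMeasure_singleton,
    ← ENNReal.ofReal_add (by positivity) (by positivity), ← ENNReal.ofReal_one,
    ← ENNReal.ofReal_sub _ (by positivity), ← hr']
  refine ENNReal.ofReal_le_ofReal ?_
  have := Real.add_one_le_exp (-(r : ℝ))
  simp only [pow_zero, Nat.factorial_zero, Nat.cast_one, pow_one, Nat.factorial_one]
  nlinarith [r.2]

/-- Almost surely there are no simultaneous jumps. -/
theorem IsPoissonPointProcess.ae_simple (hPi : IsPoissonPointProcess Q 𝓕 ν ξ Pi) :
    ∀ᵐ ω ∂Q, ∀ t, (Pi ω).meas ({t} ×ˢ univ) ≤ 1 := by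
  have hM : ∀ M : ℕ, Q {ω | ∃ t ∈ Ioc (0 : ℝ≥0) M, 2 ≤ (Pi ω).meas ({t} ×ˢ univ)} = 0 := by
    -- Cut `(0, M]` into `M n` cells of length `1/n`. A double point lies in a single cell, which
    -- has two jumps with probability at most `(ν(U)/n)²`; the sum is `M ν(U)² / n`, which tends to
    -- zero.
    intro M
    set c : ℝ := M * (ν.real univ) ^ 2 with hc
    have hbound : ∀ n : ℕ, 0 < n →
        Q {ω | ∃ t ∈ Ioc (0 : ℝ≥0) M, 2 ≤ (Pi ω).meas ({t} ×ˢ univ)}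
          ≤ ENNReal.ofReal (c * (n : ℝ)⁻¹) := by
      intro n hn
      have hn' : (0 : ℝ≥0) < n := by exact_mod_cast hn
      have hsub : {ω | ∃ t ∈ Ioc (0 : ℝ≥0) M, 2 ≤ (Pi ω).meas ({t} ×ˢ univ)}
          ⊆ ⋃ k ∈ Finset.range (M * n),
            {ω | 2 ≤ (Pi ω).meas (Ioc ((k : ℝ≥0) / n) ((k + 1 : ℕ) / n) ×ˢ univ)} := by
        rintro ω ⟨t, ht, h2⟩
        have hpos : 0 < ⌈t * n⌉₊ := Nat.ceil_pos.2 (mul_pos ht.1 hn')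
        obtain ⟨k, hk⟩ : ∃ k, ⌈t * n⌉₊ = k + 1 := ⟨_, (Nat.succ_pred_eq_of_pos hpos).symm⟩
        have hle : ⌈t * n⌉₊ ≤ M * n := by
          refine Nat.ceil_le.2 ?_
          push_cast
          gcongr
          exact ht.2
        simp only [mem_iUnion, Finset.mem_range]
        refine ⟨k, by omega, h2.trans (measure_mono (prod_mono_left ?_))⟩
        rw [singleton_subset_iff]
        constructor
        · rw [div_lt_iff₀ hn']
          exact Nat.lt_ceil.1 (by omega)
        · rw [le_div_iff₀ hn', ← hk]
          exact Nat.le_ceil _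
      refine (measure_mono hsub).trans ((measure_biUnion_finset_le _ _).trans ?_)
      have hterm : ∀ k ∈ Finset.range (M * n),
          Q {ω | 2 ≤ (Pi ω).meas (Ioc ((k : ℝ≥0) / n) ((k + 1 : ℕ) / n) ×ˢ univ)}
            ≤ ENNReal.ofReal (((n : ℝ)⁻¹ * ν.real univ) ^ 2) := fun k _ => by
        refine (hPi.measure_two_le _ _).trans_eq ?_
        congr 3
        rw [← NNReal.sub_div, NNReal.coe_div]
        simp
      refine (Finset.sum_le_sum hterm).trans ?_
      rw [Finset.sum_const, Finset.card_range, nsmul_eq_mul, ← ENNReal.ofReal_natCast,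
        ← ENNReal.ofReal_mul (by positivity)]
      refine ENNReal.ofReal_le_ofReal (le_of_eq ?_)
      rw [hc]
      have : (n : ℝ) ≠ 0 := by positivity
      push_cast
      field_simp
    have hlim : Tendsto (fun n : ℕ => ENNReal.ofReal (c * (n : ℝ)⁻¹)) atTop (𝓝 0) := by
      have := (tendsto_inv_atTop_nhds_zero_nat (𝕜 := ℝ)).const_mul c
      rw [mul_zero] at this
      simpa using ENNReal.tendsto_ofReal this
    exact le_antisymm (ge_of_tendsto hlim ((eventually_gt_atTop 0).mono hbound)) zero_le
  have hall : ∀ᵐ ω ∂Q, ∀ M : ℕ,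
      ¬ ∃ t ∈ Ioc (0 : ℝ≥0) M, 2 ≤ (Pi ω).meas ({t} ×ˢ univ) :=
    ae_all_iff.2 fun M => by rw [ae_iff]; simp only [not_not]; exact hM M
  filter_upwards [hall, hPi.ae_meas_zero] with ω hω h0 t
  rcases eq_or_lt_of_le (zero_le : 0 ≤ t) with rfl | ht
  · rw [h0]; exact zero_le
  obtain ⟨M, hM⟩ := exists_nat_ge t
  have h1 := hω M
  push Not at h1
  have h2 := h1 t ⟨ht, hM⟩
  obtain ⟨n, hn⟩ := (Pi ω).exists_meas_eq
    ((measurableSet_singleton t).prod (MeasurableSet.univ (α := U)))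
  rw [hn] at h2 ⊢
  have h3 : n < 2 := by exact_mod_cast h2
  have : n ≤ 1 := Order.le_of_lt_add_one (by simpa [one_add_one_eq_two] using h3)
  exact_mod_cast this

end Poisson

/-! ### Predictable processes -/

section Predictable

variable {Ω : Type*} [mΩ : MeasurableSpace Ω] {𝓖 : Filtration ℝ≥0 mΩ}

/-- The product of the time half line and of `Ω`, with the predictable σ-algebra. -/
def PredSpace (_ : Filtration ℝ≥0 mΩ) : Type _ := ℝ≥0 × Ω

instance : MeasurableSpace (PredSpace 𝓖) := 𝓖.predictable

/-- The time coordinate. -/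
def PredSpace.time (x : PredSpace 𝓖) : ℝ≥0 := x.1

/-- The random coordinate. -/
def PredSpace.outcome (x : PredSpace 𝓖) : Ω := x.2

/-- The element of `PredSpace 𝓖` with the given coordinates. -/
def PredSpace.mk (𝓖 : Filtration ℝ≥0 mΩ) (s : ℝ≥0) (ω : Ω) : PredSpace 𝓖 := (s, ω)

namespace PredSpace

@[simp] theorem time_mk (s : ℝ≥0) (ω : Ω) : (mk 𝓖 s ω).time = s := rfl

@[simp] theorem outcome_mk (s : ℝ≥0) (ω : Ω) : (mk 𝓖 s ω).outcome = ω := rfl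

theorem measurableSet_Ioi {c : ℝ≥0} {F : Set Ω} (hF : MeasurableSet[𝓖 c] F) :
    MeasurableSet {x : PredSpace 𝓖 | c < x.time ∧ x.outcome ∈ F} :=
  measurableSet_predictable_Ioi_prod hF

theorem measurable_time : Measurable (time : PredSpace 𝓖 → ℝ≥0) :=
  measurable_of_Ioi fun c => by
    have := measurableSet_Ioi (𝓖 := 𝓖) (c := c) (F := univ) MeasurableSet.univ
    simpa only [mem_univ, and_true, preimage, mem_Ioi] using this

theorem measurableSet_initial {F : Set Ω} (hF : MeasurableSet[𝓖 0] F) :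
    MeasurableSet {x : PredSpace 𝓖 | x.outcome ∈ F} := by
  have h0 : MeasurableSet {x : PredSpace 𝓖 | x.time = 0 ∧ x.outcome ∈ F} :=
    measurableSet_predictable_singleton_bot_prod hF
  convert h0.union (measurableSet_Ioi (𝓖 := 𝓖) hF) using 1
  ext x
  rcases eq_or_lt_of_le (zero_le : 0 ≤ x.time) with h | h
  · simp [← h]
  · simp [h, h.ne']

theorem measurable_initial {β : Type*} [MeasurableSpace β] {f : Ω → β}
    (hf : Measurable[𝓖 0] f) : Measurable fun x : PredSpace 𝓖 => f x.outcome :=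
  fun _ hs => measurableSet_initial (hf hs)

theorem measurable_mk : Measurable fun p : ℝ≥0 × Ω => mk 𝓖 p.1 p.2 := by
  refine measurable_generateFrom ?_
  rintro - (⟨A, hA, rfl⟩ | ⟨i, A, hA, rfl⟩)
  · exact (measurableSet_singleton (0 : ℝ≥0)).prod (𝓖.le _ _ hA)
  · exact _root_.measurableSet_Ioi.prod (𝓖.le _ _ hA)

theorem measurable_indicator_Ioi {c : ℝ≥0} {f : Ω → ℝ≥0∞} (hf : Measurable[𝓖 c] f) :
    Measurable fun x : PredSpace 𝓖 => (Ioi c).indicator (fun _ => f x.outcome) x.time := by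
  refine measurable_of_Ioi fun a => ?_
  convert measurableSet_Ioi (𝓖 := 𝓖) (c := c) (hf (_root_.measurableSet_Ioi (a := a))) using 1
  ext x
  by_cases h : c < x.time <;> simp [h]

end PredSpace

/-- Points of a grid of mesh `1 / (n + 1)` strictly on the left of `s`. -/
noncomputable def leftGrid (n : ℕ) (s : ℝ≥0) : ℝ≥0 :=
  ((⌈((n : ℝ≥0) + 1) * s⌉₊ - 1 : ℕ) : ℝ≥0) / ((n : ℝ≥0) + 1)

-- Truncated subtraction keeps the grid point at `0`, in agreement with the convention that the left
-- limit at time zero is the value there.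
@[simp] theorem leftGrid_zero (n : ℕ) : leftGrid n 0 = 0 := by simp [leftGrid]

theorem leftGrid_lt (n : ℕ) {s : ℝ≥0} (hs : 0 < s) : leftGrid n s < s := by
  have hn : (0 : ℝ≥0) < (n : ℝ≥0) + 1 := by positivity
  rw [leftGrid, div_lt_iff₀ hn, mul_comm s]
  have : 0 < ⌈((n : ℝ≥0) + 1) * s⌉₊ := Nat.ceil_pos.2 (mul_pos hn hs)
  exact Nat.lt_ceil.1 (Nat.sub_lt this one_pos)

theorem le_leftGrid_add (n : ℕ) (s : ℝ≥0) : s ≤ leftGrid n s + 1 / ((n : ℝ≥0) + 1) := by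
  have hn : (0 : ℝ≥0) < (n : ℝ≥0) + 1 := by positivity
  rw [leftGrid, ← add_div, le_div_iff₀ hn, mul_comm]
  refine (Nat.le_ceil _).trans ?_
  have : ⌈((n : ℝ≥0) + 1) * s⌉₊ ≤ ⌈((n : ℝ≥0) + 1) * s⌉₊ - 1 + 1 := by omega
  exact_mod_cast this

theorem tendsto_leftGrid {s : ℝ≥0} (hs : 0 < s) :
    Tendsto (fun n => leftGrid n s) atTop (𝓝[<] s) := by
  refine tendsto_nhdsWithin_iff.2 ⟨?_, Eventually.of_forall fun n => leftGrid_lt n hs⟩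
  rw [← NNReal.tendsto_coe]
  have h1 : Tendsto (fun n : ℕ => (s : ℝ) - 1 / ((n : ℝ) + 1)) atTop (𝓝 (s - 0)) :=
    tendsto_const_nhds.sub tendsto_one_div_add_atTop_nhds_zero_nat
  rw [sub_zero] at h1
  refine tendsto_of_tendsto_of_tendsto_of_le_of_le h1 tendsto_const_nhds (fun n => ?_)
    fun n => NNReal.coe_le_coe.2 (leftGrid_lt n hs).le
  have := NNReal.coe_le_coe.2 (le_leftGrid_add n s)
  push_cast at this
  simp only
  linarith

/-- Only countably many grid points occur. On the cell of the `k`-th one, `k > 0`, the current time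
is strictly later, so an event known at the grid point becomes predictable; the cell `k = 0`
contains time zero and uses the initial σ-algebra. -/
theorem measurable_comp_leftGrid {β : Type*} [MeasurableSpace β] {h : ℝ≥0 → Ω → β}
    (hh : ∀ t, Measurable[𝓖 t] (h t)) (n : ℕ) :
    Measurable fun x : PredSpace 𝓖 => h (leftGrid n x.time) x.outcome := by
  intro B hB
  have hn : (0 : ℝ≥0) < (n : ℝ≥0) + 1 := by positivity
  set g : ℝ≥0 → ℕ := fun s => ⌈((n : ℝ≥0) + 1) * s⌉₊ - 1 with hg
  have hgm : Measurable g :=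
    (Measurable.of_discrete (f := fun k : ℕ => k - 1)).comp
      (Nat.measurable_ceil.comp (measurable_const.mul measurable_id))
  have e : (fun x : PredSpace 𝓖 => h (leftGrid n x.time) x.outcome) ⁻¹' B
      = ⋃ k : ℕ, {x | g x.time = k} ∩
        {x | (0 < k → ((k : ℝ≥0) / ((n : ℝ≥0) + 1)) < x.time)
          ∧ x.outcome ∈ h ((k : ℝ≥0) / ((n : ℝ≥0) + 1)) ⁻¹' B} := by
    ext x
    simp only [mem_preimage, mem_iUnion, mem_inter_iff, mem_ofPred_eq]
    constructor
    · intro hx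
      refine ⟨g x.time, rfl, fun hk => ?_, hx⟩
      refine leftGrid_lt n (pos_iff_ne_zero.2 fun h0 => ?_)
      simp [hg, h0] at hk
    · rintro ⟨k, rfl, -, hx⟩
      exact hx
  rw [e]
  refine .iUnion fun k => MeasurableSet.inter
    ((hgm.comp PredSpace.measurable_time) (measurableSet_singleton k)) ?_
  rcases Nat.eq_zero_or_pos k with rfl | hk
  · have h0 := hh 0 hB
    have := PredSpace.measurableSet_initial (𝓖 := 𝓖) h0
    simpa using this
  · simp only [hk, forall_const]
    exact PredSpace.measurableSet_Ioi (hh _ hB)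

end Predictable

/-! ### The compensation formula for predictable integrands -/

section Compensation

variable {Ω U E : Type*} [mΩ : MeasurableSpace Ω] [MeasurableSpace U] [MeasurableSpace E]
  {Q : Measure Ω} [IsProbabilityMeasure Q] {𝓕 : Filtration ℝ≥0 mΩ} {ν : Measure U}
  [IsFiniteMeasure ν] {ξ : Ω → E} {Pi : Ω → Trajectory U}

/-- The total masses are finite but not bounded in the parameter, so the kernel is sliced according
to their integer parts. The number of jumps up to a given time is of this kind. -/
theorem isSFiniteKernel_of_isFiniteMeasure {X Y : Type*} [MeasurableSpace X] [MeasurableSpace Y]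
    (κ : Kernel X Y) (h : ∀ x, IsFiniteMeasure (κ x)) : IsSFiniteKernel κ := by
  have hm : ∀ n : ℕ, MeasurableSet {x | ⌊(κ x univ).toNNReal⌋₊ = n} := fun n =>
    (Nat.measurable_floor.comp (κ.measurable_coe .univ).ennreal_toNNReal)
      (measurableSet_singleton n)
  classical
  refine ⟨⟨fun n => Kernel.piecewise (hm n) κ 0, fun n => ⟨⟨n + 1, by simp, fun x => ?_⟩⟩, ?_⟩⟩
  · rw [Kernel.piecewise_apply']
    split_ifs with hx
    · have h1 := (Nat.lt_floor_add_one (κ x univ).toNNReal).le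
      rw [show ⌊(κ x univ).toNNReal⌋₊ = n from hx] at h1
      rw [← ENNReal.coe_toNNReal (measure_ne_top (κ x) univ)]
      exact_mod_cast h1
    · simp
  · ext x s hs
    rw [Kernel.sum_apply' _ _ hs, tsum_eq_single ⌊(κ x univ).toNNReal⌋₊]
    · rw [Kernel.piecewise_apply', if_pos]
      rfl
    · intro n hn
      rw [Kernel.piecewise_apply', if_neg (fun h => hn h.symm)]
      simp

/-- The jumps in `(0, T]`, as a kernel. -/
noncomputable def jumpKernel (Pi : Ω → Trajectory U) (hPi : Measurable Pi) (T : ℝ≥0) :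
    Kernel Ω (ℝ≥0 × U) where
  toFun ω := (Pi ω).meas.restrict (Ioc 0 T ×ˢ univ)
  measurable' := by
    refine Measure.measurable_of_measurable_coe _ fun B hB => ?_
    simp only [Measure.restrict_apply hB]
    exact (measurable_meas (hB.inter (measurableSet_Ioc.prod .univ))).comp hPi

theorem jumpKernel_apply (hPi : Measurable Pi) (T : ℝ≥0) (ω : Ω) :
    jumpKernel Pi hPi T ω = (Pi ω).meas.restrict (Ioc 0 T ×ˢ univ) := rfl

theorem Trajectory.meas_Ioc_lt_top (π : Trajectory U) (s t : ℝ≥0) :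
    π.meas (Ioc s t ×ˢ univ) < ∞ :=
  (measure_mono (prod_mono_left fun _ h => h.2)).trans_lt (π.meas_Iic_lt_top t)

instance (hPi : Measurable Pi) (T : ℝ≥0) : IsSFiniteKernel (jumpKernel Pi hPi T) :=
  isSFiniteKernel_of_isFiniteMeasure _ fun ω => ⟨by
    rw [jumpKernel_apply, Measure.restrict_apply .univ, univ_inter]
    exact (Pi ω).meas_Ioc_lt_top 0 T⟩

theorem measurable_mark_mk (𝓖 : Filtration ℝ≥0 mΩ) :
    Measurable fun p : Ω × ℝ≥0 × U => (p.2.2, PredSpace.mk 𝓖 p.2.1 p.1) :=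
  (measurable_snd.comp measurable_snd).prodMk
    (PredSpace.measurable_mk.comp ((measurable_fst.comp measurable_snd).prodMk measurable_fst))

/-- It suffices to compare both measures on the rectangles that generate the predictable σ-algebra.
On `(r, ∞) × F` with `F` known at time `r`, the later jumps are independent of `F` and have mean `dt
ν(du)`; on `{0} × F` both measures vanish because the kernel starts strictly after zero. For a fixed
set of marks this is a comparison of finite measures on a π-system. -/
theorem IsPoissonPointProcess.map_jumpKernel_eq (hPi : IsPoissonPointProcess Q 𝓕 ν ξ Pi)
    (hξ : Measurable ξ) (T : ℝ≥0) :
    (Q ⊗ₘ jumpKernel Pi hPi.measurable T).map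
        (fun p => (p.2.2, PredSpace.mk (enlarge 𝓕 ξ hξ) p.2.1 p.1))
      = (Q.prod ((leb.restrict (Ioc 0 T)).prod ν)).map
        (fun p => (p.2.2, PredSpace.mk (enlarge 𝓕 ξ hξ) p.2.1 p.1)) := by
  set 𝓖 := enlarge 𝓕 ξ hξ with h𝓖
  set K := jumpKernel Pi hPi.measurable T with hK
  set m : Ω × ℝ≥0 × U → U × PredSpace 𝓖 := fun p => (p.2.2, PredSpace.mk 𝓖 p.2.1 p.1) with hm
  have hmm : Measurable m := measurable_mark_mk 𝓖
  have hval : ∀ (I : Set ℝ≥0) (B : Set U) (F : Set Ω), MeasurableSet I → MeasurableSet B →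
      MeasurableSet F → (Q ⊗ₘ K) (F ×ˢ I ×ˢ B)
        = ∫⁻ ω in F, (Pi ω).meas ((I ∩ Ioc 0 T) ×ˢ B) ∂Q := fun I B F hI hB hF => by
    rw [Measure.compProd_apply_prod hF (hI.prod hB)]
    refine lintegral_congr fun ω => ?_
    rw [hK, jumpKernel_apply, Measure.restrict_apply (hI.prod hB), prod_inter_prod, inter_univ]
  have hval' : ∀ (I : Set ℝ≥0) (B : Set U) (F : Set Ω), MeasurableSet I →
      (Q.prod ((leb.restrict (Ioc 0 T)).prod ν)) (F ×ˢ I ×ˢ B)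
        = Q F * (leb (I ∩ Ioc 0 T) * ν B) := fun I B F hI => by
    rw [Measure.prod_prod, Measure.prod_prod, Measure.restrict_apply hI]
  have hIoi : ∀ (r : ℝ≥0) (B : Set U) (F : Set Ω), MeasurableSet B → MeasurableSet[𝓖 r] F →
      (Q ⊗ₘ K) (F ×ˢ Ioi r ×ˢ B)
        = (Q.prod ((leb.restrict (Ioc 0 T)).prod ν)) (F ×ˢ Ioi r ×ˢ B) := by
    intro r B F hB hF
    have hF' := 𝓖.le r F hF
    have e : Ioi r ∩ Ioc 0 T = Ioc r T := by
      ext x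
      exact ⟨fun h => ⟨h.1, h.2.2⟩, fun h => ⟨h.1, zero_le.trans_lt h.1, h.2⟩⟩
    rw [hval _ _ _ measurableSet_Ioi hB hF', hval' _ _ _ measurableSet_Ioi, e]
    have h1 := hPi.lintegral_mul_after hξ (s := r) (t := T) hB
      (X := F.indicator fun _ => 1) (measurable_const.indicator hF) measurable_id
    have h2 := hPi.lintegral_meas (measurableSet_Ioc.prod hB) (prod_Ioc_lt_top r T B)
    simp only [id] at h1
    rw [h2, lintegral_indicator hF', lintegral_const, Measure.restrict_apply .univ, univ_inter,
      one_mul, Measure.prod_prod] at h1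
    rw [← h1, ← lintegral_indicator hF']
    refine lintegral_congr fun ω => ?_
    by_cases hω : ω ∈ F <;> simp [hω]
  have hbot : ∀ (B : Set U) (F : Set Ω), MeasurableSet B → MeasurableSet F →
      (Q ⊗ₘ K) (F ×ˢ {0} ×ˢ B)
        = (Q.prod ((leb.restrict (Ioc 0 T)).prod ν)) (F ×ˢ {0} ×ˢ B) := by
    intro B F hB hF
    have e : ({0} : Set ℝ≥0) ∩ Ioc 0 T = ∅ := by
      ext x
      simp only [mem_inter_iff, mem_singleton_iff, mem_Ioc, mem_empty_iff_false, iff_false]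
      rintro ⟨rfl, h, -⟩
      exact lt_irrefl _ h
    rw [hval _ _ _ (measurableSet_singleton 0) hB hF, hval' _ _ _ (measurableSet_singleton 0), e]
    simp
  have huniv : ∀ B : Set U, MeasurableSet B → (Q ⊗ₘ K) (univ ×ˢ univ ×ˢ B)
      = (Q.prod ((leb.restrict (Ioc 0 T)).prod ν)) (univ ×ˢ univ ×ˢ B) := by
    intro B hB
    have e : (univ : Set Ω) ×ˢ (univ : Set ℝ≥0) ×ˢ B
        = (univ ×ˢ {0} ×ˢ B) ∪ (univ ×ˢ Ioi 0 ×ˢ B) := by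
      ext ⟨ω, s, u⟩
      simp only [mem_prod, mem_univ, true_and, mem_union, mem_singleton_iff, mem_Ioi,
        ← or_and_right]
      exact ⟨fun h => ⟨(eq_or_lt_of_le (zero_le : 0 ≤ s)).imp Eq.symm id, h⟩, fun h => h.2⟩
    have hd : Disjoint ((univ : Set Ω) ×ˢ ({0} : Set ℝ≥0) ×ˢ B) (univ ×ˢ Ioi 0 ×ˢ B) := by
      refine disjoint_left.2 ?_
      rintro ⟨ω, s, u⟩ ⟨-, h1, -⟩ ⟨-, h2, -⟩
      exact (ne_of_gt h2) h1
    rw [e, measure_union hd (.prod .univ (measurableSet_Ioi.prod hB)),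
      measure_union hd (.prod .univ (measurableSet_Ioi.prod hB)), hbot B univ hB .univ,
      hIoi 0 B univ hB MeasurableSet.univ]
  have hfin : IsFiniteMeasure (Q.prod ((leb.restrict (Ioc 0 T)).prod ν)) := by
    refine ⟨?_⟩
    rw [← univ_prod_univ, ← univ_prod_univ, hval' _ _ _ .univ, univ_inter, leb_Ioc, measure_univ,
      one_mul]
    exact ENNReal.mul_lt_top ENNReal.coe_lt_top (measure_lt_top _ _)
  have hfin' : IsFiniteMeasure (Q ⊗ₘ K) := by
    refine ⟨?_⟩
    have := huniv univ .univ
    simp only [univ_prod_univ] at this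
    rw [this]
    exact measure_lt_top _ _
  refine Measure.ext_prod fun {B A} hB hA => ?_
  have hpre : ∀ μ : Measure (Ω × ℝ≥0 × U), ∀ A : Set (PredSpace 𝓖), MeasurableSet A →
      μ.map m (B ×ˢ A) = ((μ.map m).restrict (B ×ˢ univ)).map Prod.snd A := fun μ A hA => by
    rw [Measure.map_apply measurable_snd hA, Measure.restrict_apply (measurable_snd hA)]
    congr 1
    ext q
    simp [and_comm]
  rw [hpre _ A hA, hpre _ A hA]
  congr 1
  have hset : ∀ μ : Measure (Ω × ℝ≥0 × U), ∀ (I : Set ℝ≥0) (F : Set Ω),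
      MeasurableSet (α := PredSpace 𝓖) (I ×ˢ F) →
      ((μ.map m).restrict (B ×ˢ univ)).map Prod.snd (I ×ˢ F : Set (PredSpace 𝓖))
        = μ (F ×ˢ I ×ˢ B) := fun μ I F hIF => by
    rw [← hpre μ _ hIF, Measure.map_apply hmm (hB.prod hIF)]
    congr 1
    ext ⟨ω, s, u⟩
    change u ∈ B ∧ s ∈ I ∧ ω ∈ F ↔ ω ∈ F ∧ s ∈ I ∧ u ∈ B
    tauto
  refine ext_of_generate_finite _ rfl ?_ ?_ ?_
  -- Rectangles at time zero and rectangles after a later time are disjoint, so the mixed cases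
  -- contradict nonemptiness.
  · rintro - (⟨A, hA, rfl⟩ | ⟨i, A, hA, rfl⟩) - (⟨A', hA', rfl⟩ | ⟨j, A', hA', rfl⟩) hne
    · exact Or.inl ⟨A ∩ A', hA.inter hA', prod_inter_prod.trans (by rw [inter_self])⟩
    · obtain ⟨⟨s, ω⟩, ⟨h1, -⟩, h2, -⟩ := hne
      rw [mem_singleton_iff.1 h1] at h2
      exact (not_lt_bot (mem_Ioi.1 h2)).elim
    · obtain ⟨⟨s, ω⟩, ⟨h2, -⟩, h1, -⟩ := hne
      rw [mem_singleton_iff.1 h1] at h2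
      exact (not_lt_bot (mem_Ioi.1 h2)).elim
    · refine Or.inr ⟨max i j, A ∩ A', ?_, prod_inter_prod.trans (by rw [Ioi_inter_Ioi])⟩
      exact (𝓖.mono (le_max_left i j) _ hA).inter (𝓖.mono (le_max_right i j) _ hA')
  · rintro - (⟨A, hA, rfl⟩ | ⟨i, A, hA, rfl⟩)
    · have hs := measurableSet_predictable_singleton_bot_prod hA
      rw [hset _ _ _ hs, hset _ _ _ hs]
      exact hbot B A hB (𝓖.le _ _ hA)
    · have hs := measurableSet_predictable_Ioi_prod hA
      rw [hset _ _ _ hs, hset _ _ _ hs]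
      exact hIoi i B A hB hA
  · have hs : MeasurableSet (α := PredSpace 𝓖) ((univ : Set ℝ≥0) ×ˢ (univ : Set Ω)) := by
      rw [univ_prod_univ]
      exact MeasurableSet.univ
    have := (hset (Q ⊗ₘ K) univ univ hs).trans ((huniv B hB).trans (hset _ univ univ hs).symm)
    rwa [univ_prod_univ] at this

variable {𝓖 : Filtration ℝ≥0 mΩ}

theorem measurable_lintegral_jump (hPi : Measurable Pi) {g : U × PredSpace 𝓖 → ℝ≥0∞}
    (hg : Measurable g) (s t : ℝ≥0) : Measurable fun ω =>
      ∫⁻ q in Ioc s t ×ˢ univ, g (q.2, .mk 𝓖 q.1 ω) ∂(Pi ω).meas := by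
  have h1 : Measurable fun p : Ω × ℝ≥0 × U => (Ioc s t ×ˢ (univ : Set U)).indicator
      (fun q => g (q.2, .mk 𝓖 q.1 p.1)) p.2 :=
    (hg.comp (measurable_mark_mk 𝓖)).indicator
      (measurable_snd (measurableSet_Ioc.prod .univ))
  have h2 := Measurable.lintegral_kernel_prod_right' (κ := jumpKernel Pi hPi t) h1
  convert h2 using 2 with ω
  rw [jumpKernel_apply]
  simp only
  rw [lintegral_indicator (measurableSet_Ioc.prod .univ),
    Measure.restrict_restrict (measurableSet_Ioc.prod .univ), prod_inter_prod, univ_inter,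
    Ioc_inter_Ioc, max_eq_left zero_le, min_self]

theorem measurable_lintegral_leb {g : PredSpace 𝓖 → ℝ≥0∞}
    (hg : Measurable g) (s t : ℝ≥0) : Measurable fun ω =>
      ∫⁻ r in Ioc s t, g (.mk 𝓖 r ω) ∂leb := by
  have h1 : Measurable fun p : Ω × ℝ≥0 => g (.mk 𝓖 p.2 p.1) :=
    hg.comp (PredSpace.measurable_mk.comp measurable_swap)
  exact h1.lintegral_prod_right'

/-- The compensation formula. -/
theorem IsPoissonPointProcess.lintegral_jump (hPi : IsPoissonPointProcess Q 𝓕 ν ξ Pi)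
    (hξ : Measurable ξ) {s t : ℝ≥0} {X : Ω → ℝ≥0∞} (hX : Measurable[enlarge 𝓕 ξ hξ s] X)
    {g : U × PredSpace (enlarge 𝓕 ξ hξ) → ℝ≥0∞} (hg : Measurable g) :
    ∫⁻ ω, X ω * ∫⁻ q in Ioc s t ×ˢ univ, g (q.2, .mk _ q.1 ω) ∂(Pi ω).meas ∂Q
      = ∫⁻ ω, X ω * ∫⁻ r in Ioc s t, ∫⁻ u, g (u, .mk _ r ω) ∂ν ∂leb ∂Q := by
  -- The weight `X`, known at time `s`, becomes part of the predictable integrand through the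
  -- indicator of `(s, ∞)`.
  set G : U × PredSpace (enlarge 𝓕 ξ hξ) → ℝ≥0∞ := fun q =>
    (Ioi s).indicator (fun _ => X q.2.outcome) q.2.time * g q with hG
  have hGm : Measurable G :=
    ((PredSpace.measurable_indicator_Ioi hX).comp measurable_snd).mul hg
  have key := congrArg (fun μ => ∫⁻ q, G q ∂μ) (hPi.map_jumpKernel_eq hξ t)
  rw [lintegral_map hGm (measurable_mark_mk _), lintegral_map hGm (measurable_mark_mk _),
    Measure.lintegral_compProd (f := fun p : Ω × ℝ≥0 × U => G (p.2.2, .mk _ p.2.1 p.1))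
      (hGm.comp (measurable_mark_mk _)),
    lintegral_prod (fun p : Ω × ℝ≥0 × U => G (p.2.2, .mk _ p.2.1 p.1))
      (hGm.comp (measurable_mark_mk _)).aemeasurable] at key
  have e1 : Ioi s ∩ Ioc 0 t = Ioc s t := by
    ext x
    exact ⟨fun h => ⟨h.1, h.2.2⟩, fun h => ⟨h.1, zero_le.trans_lt h.1, h.2⟩⟩
  have hgω : ∀ ω, Measurable fun q : ℝ≥0 × U => g (q.2, .mk _ q.1 ω) := fun ω =>
    hg.comp ((measurable_mark_mk _).comp measurable_prodMk_left)
  have hGω : ∀ ω, Measurable fun q : ℝ≥0 × U => G (q.2, .mk _ q.1 ω) := fun ω =>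
    hGm.comp ((measurable_mark_mk _).comp measurable_prodMk_left)
  refine Eq.trans ?_ (key.trans ?_)
  · refine lintegral_congr fun ω => ?_
    simp only
    rw [jumpKernel_apply, ← lintegral_const_mul _ (hgω ω), ← e1, ← univ_inter (univ : Set U),
      ← prod_inter_prod, univ_inter, ← Measure.restrict_restrict (measurableSet_Ioi.prod .univ),
      ← lintegral_indicator (measurableSet_Ioi.prod .univ)]
    refine lintegral_congr fun q => ?_
    by_cases hq : s < q.1 <;> simp [hG, hq, indicator]
  · refine lintegral_congr fun ω => ?_
    simp only
    rw [lintegral_prod _ (hGω ω).aemeasurable,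
      ← lintegral_const_mul _ (hgω ω).lintegral_prod_right',
      ← e1, ← Measure.restrict_restrict measurableSet_Ioi,
      ← lintegral_indicator measurableSet_Ioi]
    refine lintegral_congr fun r => ?_
    by_cases hr : s < r
    · have := lintegral_const_mul (μ := ν) (X ω) ((hgω ω).comp measurable_prodMk_left :
        Measurable fun u => g (u, .mk _ r ω))
      simpa [hG, hr, indicator] using this
    · simp [hG, hr, indicator]

end Compensation

/-! ### Nonnegative solutions of linear jump equations are martingales -/

section Mass

variable {Ω U E : Type*} [mΩ : MeasurableSpace Ω] [MeasurableSpace U] [MeasurableSpace E]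

theorem PredSpace.measurable_mk_left {𝓖 : Filtration ℝ≥0 mΩ} (s : ℝ≥0) :
    Measurable[𝓖 s] fun ω => PredSpace.mk 𝓖 s ω := by
  refine @measurable_generateFrom _ _ (𝓖 s) _ _ ?_
  rintro - (⟨A, hA, rfl⟩ | ⟨i, A, hA, rfl⟩)
  · by_cases h : s = 0
    · rw [show (fun ω => PredSpace.mk 𝓖 s ω) ⁻¹' ({⊥} ×ˢ A) = A from
        ext fun ω => ⟨fun h' => h'.2, fun h' => ⟨h, h'⟩⟩]
      exact 𝓖.mono bot_le _ hA
    · rw [show (fun ω => PredSpace.mk 𝓖 s ω) ⁻¹' ({⊥} ×ˢ A) = ∅ from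
        ext fun ω => ⟨fun h' => h h'.1, fun h' => h'.elim⟩]
      exact @MeasurableSet.empty _ (𝓖 s)
  · by_cases h : i < s
    · rw [show (fun ω => PredSpace.mk 𝓖 s ω) ⁻¹' (Ioi i ×ˢ A) = A from
        ext fun ω => ⟨fun h' => h'.2, fun h' => ⟨h, h'⟩⟩]
      exact 𝓖.mono h.le _ hA
    · rw [show (fun ω => PredSpace.mk 𝓖 s ω) ⁻¹' (Ioi i ×ˢ A) = ∅ from
        ext fun ω => ⟨fun h' => h h'.1, fun h' => h'.elim⟩]
      exact @MeasurableSet.empty _ (𝓖 s)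

/-- `p` is a nonnegative process with left limits `m`, which solves
`dp = (ν(U) m - r) dt + ∫ (j - m) dΠ`, `p(0) = 1`, where `r` is the rate of the jumps `j`. -/
structure IsMassProcess (Q : Measure Ω) (𝓖 : Filtration ℝ≥0 mΩ) (ν : Measure U)
    (Pi : Ω → Trajectory U) (p : ℝ≥0 → Ω → ℝ≥0∞) (m r K : PredSpace 𝓖 → ℝ≥0∞)
    (j : U × PredSpace 𝓖 → ℝ≥0∞) (M : ℝ≥0 → ℝ≥0) : Prop where
  adapted : ∀ t, Measurable[𝓖 t] (p t)
  measurable_left : Measurable m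
  measurable_rate : Measurable r
  measurable_bound : Measurable K
  measurable_jump : Measurable j
  lintegral_jump : ∀ᵐ ω ∂Q, ∀ s, ∫⁻ u, j (u, .mk 𝓖 s ω) ∂ν = r (.mk 𝓖 s ω)
  rate_le : ∀ᵐ ω ∂Q, ∀ s, r (.mk 𝓖 s ω) ≤ K (.mk 𝓖 s ω) * m (.mk 𝓖 s ω)
  bound_le : ∀ t, ∀ᵐ ω ∂Q, ∫⁻ s in Ioc 0 t, K (.mk 𝓖 s ω) ∂leb ≤ M t
  initial : ∀ᵐ ω ∂Q, p 0 ω = 1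
  equation : ∀ᵐ ω ∂Q, ∀ s t, s ≤ t →
    p t ω + (∫⁻ v in Ioc s t, r (.mk 𝓖 v ω) ∂leb
      + ∫⁻ q in Ioc s t ×ˢ univ, m (.mk 𝓖 q.1 ω) ∂(Pi ω).meas)
    = p s ω + (∫⁻ v in Ioc s t, ν univ * m (.mk 𝓖 v ω) ∂leb
      + ∫⁻ q in Ioc s t ×ˢ univ, j (q.2, .mk 𝓖 q.1 ω) ∂(Pi ω).meas)
  bdd : ∀ ω t, ∃ B : ℝ≥0, ∀ s ≤ t, p s ω ≤ B
  left_le : ∀ ω s (c : ℝ≥0∞), 0 < s → (∀ q : ℚ≥0, (q : ℝ≥0) < s → p q ω ≤ c) →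
    m (.mk 𝓖 s ω) ≤ c
  left_eq : ∀ᵐ ω ∂Q, ∀ s, (Pi ω).meas ({s} ×ˢ univ) = 0 → m (.mk 𝓖 s ω) = p s ω

variable {Q : Measure Ω} [IsProbabilityMeasure Q] {𝓕 : Filtration ℝ≥0 mΩ} {ν : Measure U}
  [IsFiniteMeasure ν] {ξ : Ω → E} {Pi : Ω → Trajectory U} {hξ : Measurable ξ}
  {p : ℝ≥0 → Ω → ℝ≥0∞} {m r K : PredSpace (enlarge 𝓕 ξ hξ) → ℝ≥0∞}
  {j : U × PredSpace (enlarge 𝓕 ξ hξ) → ℝ≥0∞} {M : ℝ≥0 → ℝ≥0}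

/-- If two variables have the same expectation on the events of a σ-algebra, then they have
the same expectation with weights measurable with respect to that σ-algebra. -/
theorem lintegral_mul_eq_of_setLIntegral_eq {m' : MeasurableSpace Ω} (hm : m' ≤ mΩ) {f g : Ω → ℝ≥0∞}
    (hf : AEMeasurable f Q) (hg : AEMeasurable g Q)
    (h : ∀ F, MeasurableSet[m'] F → ∫⁻ ω in F, f ω ∂Q = ∫⁻ ω in F, g ω ∂Q) {X : Ω → ℝ≥0∞}
    (hX : Measurable[m'] X) : ∫⁻ ω, X ω * f ω ∂Q = ∫⁻ ω, X ω * g ω ∂Q := by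
  have hX' := hX.mono hm le_rfl
  have e : ∀ f : Ω → ℝ≥0∞, AEMeasurable f Q →
      ∫⁻ ω, X ω * f ω ∂Q = ∫⁻ ω, X ω ∂((Q.withDensity f).trim hm) := fun f hf => by
    rw [lintegral_trim hm hX, lintegral_withDensity_eq_lintegral_mul₀ hf hX'.aemeasurable]
    simp [mul_comm]
  rw [e f hf, e g hg]
  congr 1
  refine @Measure.ext _ m' _ _ fun F hF => ?_
  rw [trim_measurableSet_eq hm hF, trim_measurableSet_eq hm hF, withDensity_apply _ (hm _ hF),
    withDensity_apply _ (hm _ hF), h F hF]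

namespace IsMassProcess

variable (hp : IsMassProcess Q (enlarge 𝓕 ξ hξ) ν Pi p m r K j M)
  (hPi : IsPoissonPointProcess Q 𝓕 ν ξ Pi)

-- Compensation exchanges the sum of `m` over the jumps with `ν(U) ∫ m`, and the sum of `j` with `∫
-- r`, so the two sides of the equation carry the same mean corrections. No term is subtracted
-- before these means are known to be finite. The predictable set `D` serves both the localized
-- equation and, as the whole space, the final one.
include hp hPi in
theorem setLIntegral_eq {D : Set (PredSpace (enlarge 𝓕 ξ hξ))} (hD : MeasurableSet D)
    {s t : ℝ≥0} {f g : Ω → ℝ≥0∞}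
    (hfg : ∀ᵐ ω ∂Q, f ω + (∫⁻ v in Ioc s t, D.indicator r (.mk _ v ω) ∂leb
      + ∫⁻ q in Ioc s t ×ˢ univ, D.indicator m (.mk _ q.1 ω) ∂(Pi ω).meas)
      = g ω + (∫⁻ v in Ioc s t, ν univ * D.indicator m (.mk _ v ω) ∂leb
      + ∫⁻ q in Ioc s t ×ˢ univ, D.indicator (fun x => j (q.2, x)) (.mk _ q.1 ω) ∂(Pi ω).meas))
    (hr : ∫⁻ ω, ∫⁻ v in Ioc s t, D.indicator r (.mk _ v ω) ∂leb ∂Q ≠ ∞)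
    (hm : ∫⁻ ω, ∫⁻ v in Ioc s t, D.indicator m (.mk _ v ω) ∂leb ∂Q ≠ ∞)
    {F : Set Ω} (hF : MeasurableSet[enlarge 𝓕 ξ hξ s] F) :
    ∫⁻ ω in F, f ω ∂Q = ∫⁻ ω in F, g ω ∂Q := by
  have hF' := (enlarge 𝓕 ξ hξ).le s F hF
  have hmD : Measurable fun q : U × PredSpace (enlarge 𝓕 ξ hξ) => D.indicator m q.2 :=
    (hp.measurable_left.indicator hD).comp measurable_snd
  have hjD : Measurable fun q : U × PredSpace (enlarge 𝓕 ξ hξ) =>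
      D.indicator (fun x => j (q.1, x)) q.2 :=
    (hp.measurable_jump.indicator (measurable_snd hD) :
      Measurable ((Prod.snd ⁻¹' D).indicator j))
  set a : Ω → ℝ≥0∞ := fun ω => ∫⁻ v in Ioc s t, D.indicator r (.mk _ v ω) ∂leb with ha
  set b : Ω → ℝ≥0∞ := fun ω =>
    ∫⁻ q in Ioc s t ×ˢ univ, D.indicator m (.mk _ q.1 ω) ∂(Pi ω).meas with hb
  set c : Ω → ℝ≥0∞ := fun ω => ∫⁻ v in Ioc s t, ν univ * D.indicator m (.mk _ v ω) ∂leb with hc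
  set d : Ω → ℝ≥0∞ := fun ω =>
    ∫⁻ q in Ioc s t ×ˢ univ, D.indicator (fun x => j (q.2, x)) (.mk _ q.1 ω) ∂(Pi ω).meas with hd
  have ham : Measurable a := measurable_lintegral_leb (hp.measurable_rate.indicator hD) s t
  have hbm : Measurable b := measurable_lintegral_jump hPi.measurable hmD s t
  have hcm : Measurable c := measurable_lintegral_leb
    (g := fun x => ν univ * D.indicator m x)
    (measurable_const.mul (hp.measurable_left.indicator hD)) s t
  have hdm : Measurable d := measurable_lintegral_jump hPi.measurable hjD s t
  have hX : Measurable[enlarge 𝓕 ξ hξ s] (F.indicator fun _ => (1 : ℝ≥0∞)) :=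
    measurable_const.indicator hF
  have hset : ∀ φ : Ω → ℝ≥0∞, ∫⁻ ω, F.indicator (fun _ => (1 : ℝ≥0∞)) ω * φ ω ∂Q
      = ∫⁻ ω in F, φ ω ∂Q := fun φ => by
    rw [← lintegral_indicator hF']
    refine lintegral_congr fun ω => ?_
    by_cases h : ω ∈ F <;> simp [h]
  have hbc : ∫⁻ ω in F, b ω ∂Q = ∫⁻ ω in F, c ω ∂Q := by
    rw [← hset, ← hset, hPi.lintegral_jump hξ hX hmD]
    refine lintegral_congr fun ω => ?_
    congr 1
    refine lintegral_congr fun v => ?_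
    simp only
    rw [lintegral_const, mul_comm]
  have hda : ∫⁻ ω in F, d ω ∂Q = ∫⁻ ω in F, a ω ∂Q := by
    rw [← hset, ← hset, hPi.lintegral_jump hξ hX hjD]
    refine lintegral_congr_ae ?_
    filter_upwards [hp.lintegral_jump] with ω hω
    congr 1
    refine lintegral_congr fun v => ?_
    by_cases h : PredSpace.mk (enlarge 𝓕 ξ hξ) v ω ∈ D
    · simp only [indicator_of_mem h]
      exact hω v
    · simp [indicator_of_notMem h]
  have hsum : ∫⁻ ω in F, f ω ∂Q + (∫⁻ ω in F, a ω ∂Q + ∫⁻ ω in F, b ω ∂Q)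
      = ∫⁻ ω in F, g ω ∂Q + (∫⁻ ω in F, c ω ∂Q + ∫⁻ ω in F, d ω ∂Q) := by
    rw [← lintegral_add_left ham, ← lintegral_add_left hcm,
      ← lintegral_add_right _ (show Measurable fun ω => a ω + b ω from ham.add hbm),
      ← lintegral_add_right _ (show Measurable fun ω => c ω + d ω from hcm.add hdm)]
    exact lintegral_congr_ae (ae_restrict_of_ae hfg)
  rw [hda, ← hbc, add_comm (∫⁻ ω in F, b ω ∂Q)] at hsum
  refine (ENNReal.add_left_inj (ENNReal.add_ne_top.2 ⟨?_, ?_⟩)).1 hsum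
  · exact ((setLIntegral_le_lintegral F a).trans_lt (lt_top_iff_ne_top.2 hr)).ne
  · rw [hbc]
    refine ((setLIntegral_le_lintegral F c).trans_lt ?_).ne
    have e : ∀ ω, c ω = ν univ * ∫⁻ v in Ioc s t, D.indicator m (.mk _ v ω) ∂leb := fun ω =>
      lintegral_const_mul' _ _ (measure_ne_top _ _)
    simp only [e]
    rw [lintegral_const_mul' _ _ (measure_ne_top _ _)]
    exact ENNReal.mul_lt_top (measure_lt_top _ _) (lt_top_iff_ne_top.2 hm)

/-- The running supremum of `p` strictly before the current time. -/
noncomputable def runningSup (hξ : Measurable ξ) (p : ℝ≥0 → Ω → ℝ≥0∞)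
    (x : PredSpace (enlarge 𝓕 ξ hξ)) : ℝ≥0∞ :=
  ⨆ q : ℚ≥0, (Ioi (q : ℝ≥0)).indicator (fun _ => p q x.outcome) x.time

include hp in
theorem measurable_runningSup :
    Measurable (runningSup hξ p : PredSpace (enlarge 𝓕 ξ hξ) → ℝ≥0∞) :=
  .iSup fun q => PredSpace.measurable_indicator_Ioi (hp.adapted q)

theorem runningSup_le_iff (s : ℝ≥0) (ω : Ω) (c : ℝ≥0∞) :
    runningSup hξ p (.mk (enlarge 𝓕 ξ hξ) s ω) ≤ c
      ↔ ∀ q : ℚ≥0, (q : ℝ≥0) < s → p q ω ≤ c := by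
  simp only [runningSup, iSup_le_iff, PredSpace.time_mk, PredSpace.outcome_mk]
  refine forall_congr' fun q => ?_
  by_cases h : (q : ℝ≥0) < s <;> simp [h]

/-- The times at which `p` has not yet exceeded `n`. -/
def below (hξ : Measurable ξ) (p : ℝ≥0 → Ω → ℝ≥0∞) (n : ℕ) :
    Set (PredSpace (enlarge 𝓕 ξ hξ)) := {x | runningSup hξ p x ≤ n}

include hp in
theorem measurableSet_below (n : ℕ) : MeasurableSet (below (𝓕 := 𝓕) hξ p n) :=
  measurableSet_le hp.measurable_runningSup measurable_const

theorem below_anti {n : ℕ} {s t : ℝ≥0} {ω : Ω} (hst : s ≤ t)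
    (h : PredSpace.mk _ t ω ∈ below (𝓕 := 𝓕) hξ p n) :
    PredSpace.mk _ s ω ∈ below (𝓕 := 𝓕) hξ p n :=
  (runningSup_le_iff s ω n).2 fun q hq => (runningSup_le_iff t ω n).1 h q (hq.trans_le hst)

theorem below_mono (hξ : Measurable ξ) (p : ℝ≥0 → Ω → ℝ≥0∞) :
    Monotone (below (𝓕 := 𝓕) hξ p) := fun a b hab _ hx =>
  le_trans (α := ℝ≥0∞) hx (by exact_mod_cast hab)

include hp in
theorem exists_mem_below (ω : Ω) (t : ℝ≥0) :
    ∃ n, PredSpace.mk _ t ω ∈ below (𝓕 := 𝓕) hξ p n := by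
  obtain ⟨B, hB⟩ := hp.bdd ω t
  obtain ⟨n, hn⟩ := exists_nat_ge B
  refine ⟨n, (runningSup_le_iff t ω n).2 fun q hq => (hB q hq.le).trans ?_⟩
  exact_mod_cast hn

/-- The last time up to `t` at which `p` has not yet exceeded `n`. -/
noncomputable def lastBelow (hξ : Measurable ξ) (𝓕 : Filtration ℝ≥0 mΩ) (p : ℝ≥0 → Ω → ℝ≥0∞)
    (n : ℕ) (t : ℝ≥0) (ω : Ω) : ℝ≥0 :=
  sSup {s | s ≤ t ∧ PredSpace.mk _ s ω ∈ below (𝓕 := 𝓕) hξ p n}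

/-- Membership in `below` at time `v` involves `p` only strictly before `v`, so it persists at the
supremum of such times. The admissible times form a closed interval starting at zero, and the
equivalence plays the role of a stopping time. -/
theorem lastBelow_spec (n : ℕ) (t : ℝ≥0) (ω : Ω) (s : ℝ≥0) :
    s ≤ lastBelow hξ 𝓕 p n t ω ↔ s ≤ t ∧ PredSpace.mk _ s ω ∈ below (𝓕 := 𝓕) hξ p n := by
  have hb : BddAbove {s | s ≤ t ∧ PredSpace.mk _ s ω ∈ below (𝓕 := 𝓕) hξ p n} :=
    ⟨t, fun s hs => hs.1⟩
  have hne : {s | s ≤ t ∧ PredSpace.mk _ s ω ∈ below (𝓕 := 𝓕) hξ p n}.Nonempty :=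
    ⟨0, zero_le, (runningSup_le_iff 0 ω n).2 fun q hq => absurd hq not_lt_zero⟩
  constructor
  · intro h
    refine ⟨h.trans (csSup_le hne fun s hs => hs.1), below_anti h ?_⟩
    refine (runningSup_le_iff _ ω n).2 fun q hq => ?_
    obtain ⟨v, hv, hqv⟩ := exists_lt_of_lt_csSup hne hq
    exact (runningSup_le_iff v ω n).1 hv.2 q hqv
  · exact fun h => le_csSup hb h

/-- Thus restricting an integrand to `below` is the same as stopping both ends of the integration
interval. -/
theorem Ioc_lastBelow (s t : ℝ≥0) (n : ℕ) (ω : Ω) :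
    {v | PredSpace.mk _ v ω ∈ below (𝓕 := 𝓕) hξ p n} ∩ Ioc s t
      = Ioc (lastBelow hξ 𝓕 p n s ω) (lastBelow hξ 𝓕 p n t ω) := by
  ext v
  simp only [mem_inter_iff, mem_ofPred_eq, mem_Ioc, lastBelow_spec, ← not_le, not_and]
  constructor
  · rintro ⟨h1, h2, h3⟩
    exact ⟨fun h => absurd h h2, h3, h1⟩
  · rintro ⟨h1, h2, h3⟩
    exact ⟨h3, fun h => h1 h h3, h2⟩

theorem lastBelow_mono {s t : ℝ≥0} (hst : s ≤ t) (n : ℕ) (ω : Ω) :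
    lastBelow hξ 𝓕 p n s ω ≤ lastBelow hξ 𝓕 p n t ω := by
  rw [lastBelow_spec]
  have := (lastBelow_spec n s ω _).1 (le_refl (lastBelow hξ 𝓕 p n s ω))
  exact ⟨this.1.trans hst, this.2⟩

theorem lastBelow_eq {n : ℕ} {t : ℝ≥0} {ω : Ω}
    (h : PredSpace.mk _ t ω ∈ below (𝓕 := 𝓕) hξ p n) : lastBelow hξ 𝓕 p n t ω = t :=
  le_antisymm ((lastBelow_spec n t ω _).1 le_rfl).1 ((lastBelow_spec n t ω t).2 ⟨le_rfl, h⟩)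

-- The pathwise equation holds for all pairs of times outside one null set, so the random times
-- `lastBelow` may be inserted directly.
include hp in
theorem localized_equation (n : ℕ) : ∀ᵐ ω ∂Q, ∀ s t, s ≤ t →
    p (lastBelow hξ 𝓕 p n t ω) ω
      + (∫⁻ v in Ioc s t, (below hξ p n).indicator r (.mk _ v ω) ∂leb
      + ∫⁻ q in Ioc s t ×ˢ univ, (below hξ p n).indicator m (.mk _ q.1 ω) ∂(Pi ω).meas)
    = p (lastBelow hξ 𝓕 p n s ω) ω
      + (∫⁻ v in Ioc s t, ν univ * (below hξ p n).indicator m (.mk _ v ω) ∂leb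
      + ∫⁻ q in Ioc s t ×ˢ univ,
        (below hξ p n).indicator (fun x => j (q.2, x)) (.mk _ q.1 ω) ∂(Pi ω).meas) := by
  filter_upwards [hp.equation] with ω hω s t hst
  have h := hω _ _ (lastBelow_mono (hξ := hξ) (𝓕 := 𝓕) (p := p) hst n ω)
  set A : Set ℝ≥0 := {v | PredSpace.mk _ v ω ∈ below (𝓕 := 𝓕) hξ p n} with hA
  have hAm : MeasurableSet A :=
    (PredSpace.measurable_mk.comp measurable_prodMk_right : Measurable fun v =>
      PredSpace.mk (enlarge 𝓕 ξ hξ) v ω) (hp.measurableSet_below n)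
  rw [← Ioc_lastBelow s t n ω, ← Measure.restrict_restrict hAm, ← lintegral_indicator hAm,
    ← lintegral_indicator hAm, ← univ_inter (univ : Set U), ← prod_inter_prod, univ_inter,
    ← Measure.restrict_restrict (hAm.prod .univ), ← lintegral_indicator (hAm.prod .univ),
    ← lintegral_indicator (hAm.prod .univ)] at h
  rw [prod_univ (s := A)] at h
  have e1 : ∀ v, A.indicator (fun v => ν univ * m (.mk _ v ω)) v
      = ν univ * (below hξ p n).indicator m (.mk _ v ω) := fun v =>
    indicator_mul_right A (fun _ => ν univ) (fun v => m (.mk _ v ω))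
  simp only [e1] at h
  exact h

end IsMassProcess

end Mass

/-! ### Integrability, removal of the localization, and the true martingale property -/

section Mass

variable {Ω U E : Type*} [mΩ : MeasurableSpace Ω] [MeasurableSpace U] [MeasurableSpace E]
variable {Q : Measure Ω} [IsProbabilityMeasure Q] {𝓕 : Filtration ℝ≥0 mΩ} {ν : Measure U}
  [IsFiniteMeasure ν] {ξ : Ω → E} {Pi : Ω → Trajectory U} {hξ : Measurable ξ}
  {p : ℝ≥0 → Ω → ℝ≥0∞} {m r K : PredSpace (enlarge 𝓕 ξ hξ) → ℝ≥0∞}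
  {j : U × PredSpace (enlarge 𝓕 ξ hξ) → ℝ≥0∞} {M : ℝ≥0 → ℝ≥0}

/-- At a fixed time there is almost surely no jump. -/
theorem IsPoissonPointProcess.ae_meas_singleton (hPi : IsPoissonPointProcess Q 𝓕 ν ξ Pi)
    (t : ℝ≥0) : ∀ᵐ ω ∂Q, (Pi ω).meas ({t} ×ˢ univ) = 0 := by
  have hm : MeasurableSet (({t} : Set ℝ≥0) ×ˢ (univ : Set U)) :=
    (measurableSet_singleton t).prod .univ
  have h0 : (leb.prod ν) (({t} : Set ℝ≥0) ×ˢ univ) = 0 := by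
    rw [Measure.prod_prod, leb_singleton, zero_mul]
  have h := hPi.lintegral_meas hm (by rw [h0]; simp)
  rw [h0] at h
  exact (lintegral_eq_zero_iff (f := fun ω => (Pi ω).meas ({t} ×ˢ univ))
    ((measurable_meas hm).comp hPi.measurable)).1 h

namespace IsMassProcess

variable (hp : IsMassProcess Q (enlarge 𝓕 ξ hξ) ν Pi p m r K j M)
  (hPi : IsPoissonPointProcess Q 𝓕 ν ξ Pi)

include hp in
theorem indicator_left_le (n : ℕ) {s : ℝ≥0} (hs : 0 < s) (ω : Ω) :
    (below hξ p n).indicator m (.mk _ s ω) ≤ n := by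
  by_cases h : PredSpace.mk _ s ω ∈ below (𝓕 := 𝓕) hξ p n
  · rw [indicator_of_mem h]
    exact hp.left_le ω s n hs ((runningSup_le_iff s ω n).1 h)
  · rw [indicator_of_notMem h]
    exact zero_le

include hp in
theorem lintegral_indicator_left_ne_top (n : ℕ) (s t : ℝ≥0) :
    ∫⁻ ω, ∫⁻ v in Ioc s t, (below hξ p n).indicator m (.mk _ v ω) ∂leb ∂Q ≠ ∞ := by
  refine ((lintegral_mono fun ω => ?_).trans_lt
    (b := ∫⁻ _, (n : ℝ≥0∞) * leb (Ioc s t) ∂Q) ?_).ne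
  · rw [← setLIntegral_const]
    exact setLIntegral_mono measurable_const fun v hv =>
      hp.indicator_left_le n (zero_le.trans_lt hv.1) ω
  · rw [lintegral_const, measure_univ, mul_one, leb_Ioc]
    exact ENNReal.mul_lt_top (by simp) ENNReal.coe_lt_top

include hp in
theorem ae_lintegral_indicator_rate_le (n : ℕ) (s t : ℝ≥0) : ∀ᵐ ω ∂Q,
    ∫⁻ v in Ioc s t, (below hξ p n).indicator r (.mk _ v ω) ∂leb ≤ n * M t := by
  filter_upwards [hp.rate_le, hp.bound_le t] with ω h1 h2
  calc ∫⁻ v in Ioc s t, (below hξ p n).indicator r (.mk _ v ω) ∂leb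
      ≤ ∫⁻ v in Ioc s t, n * K (.mk _ v ω) ∂leb := by
        refine setLIntegral_mono ?_ fun v hv => ?_
        · exact measurable_const.mul (hp.measurable_bound.comp
            (PredSpace.measurable_mk.comp measurable_prodMk_right))
        · have h3 := hp.indicator_left_le n (zero_le.trans_lt hv.1) ω
          by_cases h : PredSpace.mk _ v ω ∈ below (𝓕 := 𝓕) hξ p n
          · rw [indicator_of_mem h] at h3 ⊢
            exact (h1 v).trans (by rw [mul_comm]; gcongr)
          · rw [indicator_of_notMem h]
            exact zero_le
    _ ≤ ∫⁻ v in Ioc 0 t, n * K (.mk _ v ω) ∂leb :=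
        lintegral_mono_set (Ioc_subset_Ioc_left zero_le)
    _ = n * ∫⁻ v in Ioc 0 t, K (.mk _ v ω) ∂leb := lintegral_const_mul' _ _ (by simp)
    _ ≤ n * M t := by gcongr

include hp in
theorem lintegral_indicator_rate_ne_top (n : ℕ) (s t : ℝ≥0) :
    ∫⁻ ω, ∫⁻ v in Ioc s t, (below hξ p n).indicator r (.mk _ v ω) ∂leb ∂Q ≠ ∞ := by
  refine ((lintegral_mono_ae (hp.ae_lintegral_indicator_rate_le n s t)).trans_lt ?_).ne
  rw [lintegral_const, measure_univ, mul_one]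
  exact ENNReal.mul_lt_top (by simp) ENNReal.coe_lt_top

include hp hPi in
theorem setLIntegral_lastBelow (n : ℕ) {s t : ℝ≥0} (hst : s ≤ t) {F : Set Ω}
    (hF : MeasurableSet[enlarge 𝓕 ξ hξ s] F) :
    ∫⁻ ω in F, p (lastBelow hξ 𝓕 p n t ω) ω ∂Q = ∫⁻ ω in F, p (lastBelow hξ 𝓕 p n s ω) ω ∂Q :=
  hp.setLIntegral_eq hPi (hp.measurableSet_below n)
    ((hp.localized_equation n).mono fun _ h => h s t hst)
    (hp.lintegral_indicator_rate_ne_top n s t) (hp.lintegral_indicator_left_ne_top n s t) hF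

theorem lastBelow_zero (n : ℕ) (ω : Ω) : lastBelow hξ 𝓕 p n 0 ω = 0 :=
  lastBelow_eq ((runningSup_le_iff 0 ω n).2 fun _ hq => absurd hq not_lt_zero)

include hp hPi in
theorem lintegral_lastBelow (n : ℕ) (t : ℝ≥0) :
    ∫⁻ ω, p (lastBelow hξ 𝓕 p n t ω) ω ∂Q = 1 := by
  have h := hp.setLIntegral_lastBelow hPi n (zero_le : 0 ≤ t) (F := univ) MeasurableSet.univ
  simp only [setLIntegral_univ, lastBelow_zero] at h
  rw [h, lintegral_congr_ae hp.initial]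
  simp

-- Measurability is read off from the localized equation started at zero, which expresses the
-- stopped mass through measurable integrals; the terms subtracted are almost surely finite.
include hp hPi in
theorem aemeasurable_lastBelow (n : ℕ) (t : ℝ≥0) :
    AEMeasurable (fun ω => p (lastBelow hξ 𝓕 p n t ω) ω) Q := by
  have hD := hp.measurableSet_below n
  have hmD : Measurable fun q : U × PredSpace (enlarge 𝓕 ξ hξ) =>
      (below hξ p n).indicator m q.2 :=
    (hp.measurable_left.indicator hD).comp measurable_snd
  have hjD : Measurable fun q : U × PredSpace (enlarge 𝓕 ξ hξ) =>
      (below hξ p n).indicator (fun x => j (q.1, x)) q.2 :=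
    (hp.measurable_jump.indicator (measurable_snd hD) :
      Measurable ((Prod.snd ⁻¹' (below hξ p n)).indicator j))
  have ham := measurable_lintegral_leb (hp.measurable_rate.indicator hD) 0 t
  have hbm := measurable_lintegral_jump hPi.measurable hmD 0 t
  have hcm := measurable_lintegral_leb
    (g := fun x => ν univ * (below hξ p n).indicator m x)
    (measurable_const.mul (hp.measurable_left.indicator hD)) 0 t
  have hdm := measurable_lintegral_jump hPi.measurable hjD 0 t
  refine AEMeasurable.congr ((((hp.adapted 0).mono ((enlarge 𝓕 ξ hξ).le 0) le_rfl).add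
    (hcm.add hdm)).sub (ham.add hbm)).aemeasurable ?_
  have hfin := ae_lt_top' (μ := Q) hbm.aemeasurable (by
    have := hPi.lintegral_jump hξ (s := 0) (t := t) (X := fun _ => 1) measurable_const hmD
    simp only [one_mul] at this
    rw [this]
    have e : ∀ ω v, ∫⁻ _ : U, (below hξ p n).indicator m (.mk _ v ω) ∂ν
        = ν univ * (below hξ p n).indicator m (.mk _ v ω) := fun ω v => by
      rw [lintegral_const, mul_comm]
    simp only [e]
    simp only [lintegral_const_mul' _ _ (measure_ne_top ν univ)]
    exact ENNReal.mul_ne_top (measure_ne_top _ _) (hp.lintegral_indicator_left_ne_top n 0 t))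
  filter_upwards [hp.localized_equation n, hp.ae_lintegral_indicator_rate_le n 0 t, hfin]
    with ω h1 h2 h3
  have h := h1 0 t zero_le
  rw [lastBelow_zero] at h
  refine (ENNReal.eq_sub_of_add_eq (ENNReal.add_ne_top.2 ⟨?_, h3.ne⟩) h).symm
  exact (h2.trans_lt (ENNReal.mul_lt_top (by simp) ENNReal.coe_lt_top)).ne

-- At a fixed time `v` there is almost surely no jump, so on `below` the left limit is the stopped
-- mass at `v`. The weight `K` at `v` is known at time `v`, so the martingale property replaces that
-- mass by its value at `t`. The time integral of `K` then meets a factor independent of `v`: it is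
-- at most `M t`, and the stopped mass has mean one. The bound does not depend on `n`.
include hp hPi in
theorem lintegral_indicator_bound_mul_left_le (n : ℕ) (t : ℝ≥0) :
    ∫⁻ ω, ∫⁻ v in Ioc 0 t, (below hξ p n).indicator (fun x => K x * m x) (.mk _ v ω) ∂leb ∂Q
      ≤ M t := by
  have hD := hp.measurableSet_below n
  have hKm : Measurable ((below hξ p n).indicator fun x => K x * m x) :=
    (hp.measurable_bound.mul hp.measurable_left).indicator hD
  have hθ := hp.aemeasurable_lastBelow hPi n t
  rw [lintegral_lintegral_swap
    (f := fun ω v => (below hξ p n).indicator (fun x => K x * m x) (.mk _ v ω)) (hKm.comp (PredSpace.measurable_mk.comp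
    measurable_swap)).aemeasurable]
  calc ∫⁻ v in Ioc 0 t, ∫⁻ ω, (below hξ p n).indicator (fun x => K x * m x) (.mk _ v ω) ∂Q ∂leb
      ≤ ∫⁻ v in Ioc 0 t, ∫⁻ ω, K (.mk _ v ω) * hθ.mk _ ω ∂Q ∂leb := by
        refine setLIntegral_mono' measurableSet_Ioc fun v hv => ?_
        have hK : Measurable[enlarge 𝓕 ξ hξ v] fun ω => K (.mk _ v ω) :=
          hp.measurable_bound.comp (PredSpace.measurable_mk_left v)
        calc _ ≤ ∫⁻ ω, K (.mk _ v ω) * p (lastBelow hξ 𝓕 p n v ω) ω ∂Q := by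
              refine lintegral_mono_ae ?_
              filter_upwards [hp.left_eq, hPi.ae_meas_singleton v] with ω h1 h2
              by_cases h : PredSpace.mk _ v ω ∈ below (𝓕 := 𝓕) hξ p n
              · rw [indicator_of_mem h, lastBelow_eq h, h1 v h2]
              · rw [indicator_of_notMem h]
                exact zero_le
          _ = ∫⁻ ω, K (.mk _ v ω) * p (lastBelow hξ 𝓕 p n t ω) ω ∂Q :=
              (lintegral_mul_eq_of_setLIntegral_eq ((enlarge 𝓕 ξ hξ).le v) hθ
                (hp.aemeasurable_lastBelow hPi n v)
                (fun F hF => hp.setLIntegral_lastBelow hPi n hv.2 hF) hK).symm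
          _ = ∫⁻ ω, K (.mk _ v ω) * hθ.mk _ ω ∂Q := lintegral_congr_ae (by
              filter_upwards [hθ.ae_eq_mk] with ω h
              rw [h])
    _ = ∫⁻ ω, ∫⁻ v in Ioc 0 t, K (.mk _ v ω) * hθ.mk _ ω ∂leb ∂Q :=
        lintegral_lintegral_swap ((hp.measurable_bound.comp PredSpace.measurable_mk).mul
          (hθ.measurable_mk.comp measurable_snd)).aemeasurable
    _ ≤ ∫⁻ ω, M t * p (lastBelow hξ 𝓕 p n t ω) ω ∂Q := by
        refine lintegral_mono_ae ?_
        filter_upwards [hθ.ae_eq_mk, hp.bound_le t] with ω h1 h2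
        rw [h1, lintegral_mul_const (f := fun v => K (.mk _ v ω)) _ (hp.measurable_bound.comp
            (PredSpace.measurable_mk.comp measurable_prodMk_right))]
        gcongr
    _ = M t := by
        rw [lintegral_const_mul' _ _ ENNReal.coe_ne_top, hp.lintegral_lastBelow hPi, mul_one]

include hp in
theorem iSup_indicator_below (f : PredSpace (enlarge 𝓕 ξ hξ) → ℝ≥0∞) (x) :
    ⨆ n, (below hξ p n).indicator f x = f x := by
  refine le_antisymm (iSup_le fun n => indicator_le_self _ _ _) ?_
  obtain ⟨n, hn⟩ := hp.exists_mem_below x.outcome x.time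
  exact le_iSup_of_le n (indicator_of_mem hn f).ge

include hp hPi in
theorem lintegral_bound_mul_left_le (t : ℝ≥0) :
    ∫⁻ ω, ∫⁻ v in Ioc 0 t, K (.mk _ v ω) * m (.mk _ v ω) ∂leb ∂Q ≤ M t := by
  have hKm : ∀ n, Measurable ((below hξ p n).indicator fun x => K x * m x) := fun n =>
    (hp.measurable_bound.mul hp.measurable_left).indicator (hp.measurableSet_below n)
  have hmono : ∀ x, Monotone fun n => (below hξ p n).indicator (fun x => K x * m x) x :=
    fun x a b hab => indicator_le_indicator_of_subset (below_mono hξ p hab) (fun _ => zero_le) x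
  have e : ∀ ω v, K (.mk _ v ω) * m (.mk _ v ω)
      = ⨆ n, (below hξ p n).indicator (fun x => K x * m x) (.mk _ v ω) := fun ω v =>
    (hp.iSup_indicator_below (fun x => K x * m x) _).symm
  have e2 : ∀ ω, ∫⁻ v in Ioc 0 t, K (.mk _ v ω) * m (.mk _ v ω) ∂leb
      = ⨆ n, ∫⁻ v in Ioc 0 t, (below hξ p n).indicator (fun x => K x * m x) (.mk _ v ω) ∂leb :=
    fun ω => by
      simp only [e]
      refine lintegral_iSup (fun n => (hKm n).comp
        (PredSpace.measurable_mk.comp measurable_prodMk_right)) fun a b hab v => hmono _ hab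
  simp only [e2]
  rw [lintegral_iSup (fun n => measurable_lintegral_leb (hKm n) 0 t)
    fun a b hab ω => lintegral_mono fun v => hmono _ hab]
  exact iSup_le fun n => hp.lintegral_indicator_bound_mul_left_le hPi n t

-- Where the level `n` has not been exceeded, `p t` is the stopped mass, of mean one; these events
-- increase to the whole space, and monotone convergence gives the inequality.
include hp hPi in
theorem lintegral_le_one (t : ℝ≥0) : ∫⁻ ω, p t ω ∂Q ≤ 1 := by
  have hpm : Measurable (p t) := (hp.adapted t).mono ((enlarge 𝓕 ξ hξ).le t) le_rfl
  have hA : ∀ n, MeasurableSet {ω | PredSpace.mk _ t ω ∈ below (𝓕 := 𝓕) hξ p n} := fun n =>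
    (PredSpace.measurable_mk.comp measurable_prodMk_left : Measurable fun ω =>
      PredSpace.mk (enlarge 𝓕 ξ hξ) t ω) (hp.measurableSet_below n)
  have e : ∀ ω, p t ω
      = ⨆ n, {ω | PredSpace.mk _ t ω ∈ below (𝓕 := 𝓕) hξ p n}.indicator (p t) ω := fun ω => by
    refine le_antisymm ?_ (iSup_le fun n => indicator_le_self _ _ _)
    obtain ⟨n, hn⟩ := hp.exists_mem_below ω t
    have hn' : ω ∈ {ω | PredSpace.mk _ t ω ∈ below (𝓕 := 𝓕) hξ p n} := hn
    exact le_iSup_of_le n (indicator_of_mem hn' (p t)).ge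
  rw [lintegral_congr e, lintegral_iSup (fun n => hpm.indicator (hA n)) fun a b hab =>
    indicator_le_indicator_of_subset (fun ω hω => below_mono hξ p hab hω) fun _ => zero_le]
  refine iSup_le fun n => ?_
  rw [← hp.lintegral_lastBelow hPi n t]
  refine lintegral_mono fun ω => ?_
  by_cases h : ω ∈ {ω | PredSpace.mk _ t ω ∈ below (𝓕 := 𝓕) hξ p n}
  · rw [indicator_of_mem h, lastBelow_eq h]
  · rw [indicator_of_notMem h]
    exact zero_le

include hp hPi in
/-- The martingale property. -/
theorem setLIntegral_eq_of_le {s t : ℝ≥0} (hst : s ≤ t) {F : Set Ω}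
    (hF : MeasurableSet[enlarge 𝓕 ξ hξ s] F) :
    ∫⁻ ω in F, p t ω ∂Q = ∫⁻ ω in F, p s ω ∂Q := by
  refine hp.setLIntegral_eq hPi MeasurableSet.univ (s := s) (t := t) ?_ ?_ ?_ hF
  · filter_upwards [hp.equation] with ω h
    simpa only [indicator_univ] using h s t hst
  -- The rate is at most `K m`, whose total mean is bounded uniformly in the localization.
  · simp only [indicator_univ]
    refine ((lintegral_mono_ae ?_).trans_lt ((hp.lintegral_bound_mul_left_le hPi t).trans_lt
      ENNReal.coe_lt_top)).ne
    filter_upwards [hp.rate_le] with ω h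
    exact (lintegral_mono fun v => h v).trans (lintegral_mono_set (Ioc_subset_Ioc_left zero_le))
  -- At each fixed time `m = p` almost surely and `p` has mean at most one, so the double integral
  -- is at most the length of the interval.
  · simp only [indicator_univ]
    rw [lintegral_lintegral_swap (f := fun ω v => m (.mk _ v ω)) (hp.measurable_left.comp (PredSpace.measurable_mk.comp
      measurable_swap)).aemeasurable]
    refine ((lintegral_mono fun v => ?_).trans_lt
      (b := ∫⁻ v in Ioc s t, 1 ∂leb) ?_).ne
    · refine le_trans (lintegral_mono_ae ?_) (hp.lintegral_le_one hPi v)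
      filter_upwards [hp.left_eq, hPi.ae_meas_singleton v] with ω h1 h2
      exact (h1 v h2).le
    · rw [setLIntegral_one, leb_Ioc]
      exact ENNReal.coe_lt_top

include hp hPi in
theorem lintegral_eq_one (t : ℝ≥0) : ∫⁻ ω, p t ω ∂Q = 1 := by
  have h := hp.setLIntegral_eq_of_le hPi (zero_le : 0 ≤ t) (F := univ) MeasurableSet.univ
  simp only [setLIntegral_univ] at h
  rw [h, lintegral_congr_ae hp.initial]
  simp

end IsMassProcess

end Mass

/-! ### Paths in the trace class -/

section Paths

variable {H : Type*} [NormedAddCommGroup H] [InnerProductSpace ℂ H] [CompleteSpace H]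

theorem IsTraceClass.norm_trace_mul_sub_le {X Y : H →L[ℂ] H} (hX : IsTraceClass X)
    (hY : IsTraceClass Y) (h : traceNorm (X - Y) < ∞) (a : H →L[ℂ] H) :
    ‖trace (a * X) - trace (a * Y)‖ ≤ ‖a‖ * (traceNorm (X - Y)).toReal := by
  rw [← hX.trace_mul_sub hY]
  exact IsTraceClass.norm_trace_mul_le h a

theorem tendsto_toReal_traceNorm {α : Type*} {l : Filter α} {f : α → (H →L[ℂ] H)}
    {X : H →L[ℂ] H} (h : Tendsto (fun r => traceNorm (f r - X)) l (𝓝 0)) :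
    Tendsto (fun r => (traceNorm (f r - X)).toReal) l (𝓝 0) := by
  have := (ENNReal.tendsto_toReal ENNReal.zero_ne_top).comp h
  rwa [ENNReal.toReal_zero] at this

theorem tendsto_of_traceNorm {α : Type*} {l : Filter α} {f : α → (H →L[ℂ] H)} {X : H →L[ℂ] H}
    (h : Tendsto (fun r => traceNorm (f r - X)) l (𝓝 0)) : Tendsto f l (𝓝 X) := by
  rw [tendsto_iff_norm_sub_tendsto_zero]
  refine squeeze_zero' (Eventually.of_forall fun _ => norm_nonneg _) ?_
    (tendsto_toReal_traceNorm h)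
  filter_upwards [h.eventually (gt_mem_nhds ENNReal.zero_lt_top)] with r hr
  exact IsTraceClass.norm_le hr

theorem tendsto_trace_mul {α : Type*} {l : Filter α} {f : α → (H →L[ℂ] H)} {X : H →L[ℂ] H}
    (hf : ∀ r, IsTraceClass (f r)) (hX : IsTraceClass X)
    (h : Tendsto (fun r => traceNorm (f r - X)) l (𝓝 0)) (a : H →L[ℂ] H) :
    Tendsto (fun r => trace (a * f r)) l (𝓝 (trace (a * X))) := by
  rw [tendsto_iff_norm_sub_tendsto_zero]
  have h1 := (tendsto_toReal_traceNorm h).const_mul ‖a‖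
  rw [mul_zero] at h1
  refine squeeze_zero' (Eventually.of_forall fun _ => norm_nonneg _) ?_ h1
  filter_upwards [h.eventually (gt_mem_nhds ENNReal.zero_lt_top)] with r hr
  exact (hf r).norm_trace_mul_sub_le hX hr a

/-- The functional norm of a trace class operator. -/
noncomputable def dualNorm (X : H →L[ℂ] H) : ℝ :=
  open Classical in if h : IsTraceClass X then ‖traceFunctional X h‖ else 0

theorem IsTraceClass.dualNorm_eq {X : H →L[ℂ] H} (h : IsTraceClass X) :
    dualNorm X = ‖traceFunctional X h‖ := dif_pos h

theorem IsTraceClass.norm_trace_mul_le_dualNorm {X : H →L[ℂ] H} (h : IsTraceClass X)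
    (a : H →L[ℂ] H) : ‖trace (a * X)‖ ≤ dualNorm X * ‖a‖ := by
  rw [h.dualNorm_eq]
  exact (traceFunctional X h).le_opNorm a

theorem dualNorm_le {X : H →L[ℂ] H} (h : IsTraceClass X) {B : ℝ} (hB : 0 ≤ B)
    (hb : ∀ a, ‖trace (a * X)‖ ≤ B * ‖a‖) : dualNorm X ≤ B := by
  rw [h.dualNorm_eq]
  exact ContinuousLinearMap.opNorm_le_bound _ hB hb

theorem dualNorm_nonneg (X : H →L[ℂ] H) : 0 ≤ dualNorm X := by
  unfold dualNorm
  split_ifs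
  exacts [norm_nonneg _, le_rfl]

theorem eventually_dualNorm_le {α : Type*} {l : Filter α} {f : α → (H →L[ℂ] H)}
    {X : H →L[ℂ] H} (hf : ∀ r, IsTraceClass (f r)) (hX : IsTraceClass X)
    (h : Tendsto (fun r => traceNorm (f r - X)) l (𝓝 0)) :
    ∀ᶠ r in l, dualNorm (f r) ≤ dualNorm X + 1 := by
  filter_upwards [h.eventually (gt_mem_nhds ENNReal.zero_lt_top),
    (tendsto_toReal_traceNorm h).eventually (gt_mem_nhds one_pos)] with r hr h1
  refine dualNorm_le (hf r) (by linarith [dualNorm_nonneg X]) fun a => ?_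
  have h2 := (hf r).norm_trace_mul_sub_le hX hr a
  have h3 := hX.norm_trace_mul_le_dualNorm a
  have h4 := norm_le_norm_add_norm_sub' (trace (a * f r)) (trace (a * X))
  have h5 : ‖a‖ * (traceNorm (f r - X)).toReal ≤ ‖a‖ * 1 := by gcongr
  linarith

/-- Trace class valued paths, right continuous with left limits in trace norm. -/
structure IsCadlagPath (x : ℝ≥0 → (H →L[ℂ] H)) : Prop where
  traceClass : ∀ t, IsTraceClass (x t)
  rightCont : ∀ t, Tendsto (fun r => traceNorm (x r - x t)) (𝓝[>] t) (𝓝 0)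
  leftLim : ∀ t, ∃ l, IsTraceClass l ∧ Tendsto (fun r => traceNorm (x r - l)) (𝓝[<] t) (𝓝 0)

variable {x : ℝ≥0 → (H →L[ℂ] H)}

theorem nhdsLT_neBot {t : ℝ≥0} (ht : 0 < t) : (𝓝[<] t).NeBot :=
  nhdsLT_neBot_of_exists_lt ⟨0, ht⟩

theorem leftLim_zero (x : ℝ≥0 → (H →L[ℂ] H)) : Function.leftLim x 0 = x 0 :=
  leftLim_eq_of_isBot fun _ => zero_le

theorem IsCadlagPath.leftLim_spec (h : IsCadlagPath x) {t : ℝ≥0} (ht : 0 < t) :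
    IsTraceClass (Function.leftLim x t) ∧
      Tendsto (fun r => traceNorm (x r - Function.leftLim x t)) (𝓝[<] t) (𝓝 0) := by
  obtain ⟨l, h1, h2⟩ := h.leftLim t
  have := nhdsLT_neBot ht
  rw [leftLim_eq_of_tendsto (tendsto_of_traceNorm h2)]
  exact ⟨h1, h2⟩

theorem IsCadlagPath.traceClass_leftLim (h : IsCadlagPath x) (t : ℝ≥0) :
    IsTraceClass (Function.leftLim x t) := by
  rcases eq_or_lt_of_le (zero_le : 0 ≤ t) with rfl | ht
  · rw [leftLim_zero]
    exact h.traceClass 0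
  · exact (h.leftLim_spec ht).1

theorem IsCadlagPath.tendsto_leftLim (h : IsCadlagPath x) {t : ℝ≥0} (ht : 0 < t)
    (a : H →L[ℂ] H) :
    Tendsto (fun r => trace (a * x r)) (𝓝[<] t) (𝓝 (trace (a * Function.leftLim x t))) :=
  tendsto_trace_mul h.traceClass (h.leftLim_spec ht).1 (h.leftLim_spec ht).2 a

/-- Near each time the path is controlled by its left limit on one side, by its value on the other,
and by itself at the point; compactness makes the local bounds uniform. -/
theorem IsCadlagPath.bdd (h : IsCadlagPath x) (T : ℝ≥0) : ∃ B : ℝ, 0 ≤ B ∧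
    ∀ t ≤ T, dualNorm (x t) ≤ B := by
  have hc : IsCompact (Icc 0 T) := isCompact_Icc
  have hloc : ∀ t ∈ Icc 0 T, ∃ s ∈ 𝓝[Icc 0 T] t, ∃ B : ℝ, ∀ r ∈ s, dualNorm (x r) ≤ B := by
    intro t _
    have h1 := eventually_dualNorm_le h.traceClass (h.traceClass t) (h.rightCont t)
    obtain ⟨l, hl, hl'⟩ := h.leftLim t
    have h2 := eventually_dualNorm_le h.traceClass hl hl'
    set B := max (max (dualNorm (x t) + 1) (dualNorm l + 1)) (dualNorm (x t))
    refine ⟨{r | dualNorm (x r) ≤ B}, ?_, B, fun r hr => hr⟩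
    refine mem_nhdsWithin_of_mem_nhds ?_
    rw [← nhdsWithin_univ t, ← Iio_union_Ici, nhdsWithin_union, ← Ioi_insert,
      nhdsWithin_insert]
    refine mem_sup.2 ⟨?_, mem_sup.2 ⟨?_, ?_⟩⟩
    · exact h2.mono fun r hr => hr.trans ((le_max_right _ _).trans (le_max_left _ _))
    · exact mem_pure.2 (show dualNorm (x t) ≤ B from le_max_right _ _)
    · exact h1.mono fun r hr => hr.trans ((le_max_left _ _).trans (le_max_left _ _))
  obtain ⟨B, hB⟩ := hc.induction_on (p := fun s => ∃ B : ℝ, ∀ t ∈ s, dualNorm (x t) ≤ B)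
    ⟨0, by simp⟩ (fun s t hst ⟨B, hB⟩ => ⟨B, fun r hr => hB r (hst hr)⟩)
    (fun s t ⟨B, hB⟩ ⟨B', hB'⟩ => ⟨max B B', fun r hr => hr.elim
      (fun hr => (hB r hr).trans (le_max_left _ _))
      (fun hr => (hB' r hr).trans (le_max_right _ _))⟩) hloc
  exact ⟨max B 0, le_max_right _ _, fun t ht => (hB t ⟨zero_le, ht⟩).trans (le_max_left _ _)⟩

theorem IsCadlagPath.bdd_leftLim (h : IsCadlagPath x) {T : ℝ≥0} {B : ℝ} (hB : 0 ≤ B)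
    (hb : ∀ t ≤ T, dualNorm (x t) ≤ B) {t : ℝ≥0} (ht : t ≤ T) :
    dualNorm (Function.leftLim x t) ≤ B := by
  rcases eq_or_lt_of_le (zero_le : 0 ≤ t) with rfl | h0
  · rw [leftLim_zero]
    exact hb 0 ht
  refine dualNorm_le (h.traceClass_leftLim t) hB fun a => ?_
  have := nhdsLT_neBot h0
  refine le_of_tendsto (h.tendsto_leftLim h0 a).norm ?_
  filter_upwards [self_mem_nhdsWithin] with r hr
  refine ((h.traceClass r).norm_trace_mul_le_dualNorm a).trans ?_
  gcongr
  exact hb r ((le_of_lt hr).trans ht)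

theorem isPositive_of_trace {X : H →L[ℂ] H}
    (h : ∀ v, ∃ r : ℝ, trace (InnerProductSpace.rankOne ℂ v v * X) = r ∧ 0 ≤ r) :
    X.IsPositive :=
  isPositive_of_inner fun v => by
    rw [← trace_rankOne_mul]
    exact h v

theorem isPositive_of_tendsto {α : Type*} {l : Filter α} [l.NeBot] {f : α → (H →L[ℂ] H)}
    {X : H →L[ℂ] H} (hf : ∀ᶠ r in l, (f r).IsPositive) (h : Tendsto f l (𝓝 X)) :
    X.IsPositive := by
  refine isPositive_of_inner fun v => ⟨(inner ℂ v (X v) : ℂ).re, ?_, ?_⟩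
  · have h1 : Tendsto (fun r => (inner ℂ v (f r v) : ℂ)) l (𝓝 (inner ℂ v (X v))) :=
      tendsto_const_nhds.inner (((ContinuousLinearMap.apply ℂ H v).continuous.tendsto X).comp h)
    refine tendsto_nhds_unique h1 ?_
    refine ((Complex.continuous_ofReal.comp Complex.continuous_re).tendsto _ |>.comp h1).congr' ?_
    filter_upwards [hf] with r hr
    exact ((hr.inner_eq_re v).1).symm
  · have h1 : Tendsto (fun r => (inner ℂ v (f r v) : ℂ).re) l (𝓝 (inner ℂ v (X v) : ℂ).re) :=
      (Complex.continuous_re.tendsto _).comp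
      (tendsto_const_nhds.inner (((ContinuousLinearMap.apply ℂ H v).continuous.tendsto X).comp h))
    exact ge_of_tendsto h1 (hf.mono fun r hr => (hr.inner_eq_re v).2)

theorem IsCadlagPath.leftLim_isPositive (h : IsCadlagPath x) {t : ℝ≥0} (ht : 0 < t)
    (hp : ∀ r < t, (x r).IsPositive) : (Function.leftLim x t).IsPositive := by
  have := nhdsLT_neBot ht
  exact isPositive_of_tendsto (by filter_upwards [self_mem_nhdsWithin] with r hr using hp r hr)
    (tendsto_of_traceNorm (h.leftLim_spec ht).2)

theorem IsTraceClass.trace_adjoint_mul {X : H →L[ℂ] H} (h : IsTraceClass X)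
    (hp : X.IsPositive) (a : H →L[ℂ] H) :
    trace (a.adjoint * X) = starRingEnd ℂ (trace (a * X)) := by
  obtain ⟨x, hr⟩ := h.exists_isRep_self hp
  rw [hr.trace_mul, hr.trace_mul, Complex.conj_tsum]
  exact tsum_congr fun n => by
    rw [ContinuousLinearMap.adjoint_inner_right, inner_conj_symm]

end Paths

/-! ### Trajectories near a time -/

section TrajectoryNear

variable {U : Type*} [MeasurableSpace U]

theorem Trajectory.eq_zero_of_lt_one (π : Trajectory U) {B : Set (ℝ≥0 × U)}
    (hB : MeasurableSet B) (h : π.meas B < 1) : π.meas B = 0 := by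
  obtain ⟨n, hn⟩ := π.exists_meas_eq hB
  rw [hn] at h ⊢
  have h1 : n < 1 := by exact_mod_cast h
  rw [Order.lt_one_iff.1 h1]
  simp

/-- The numbers of jumps in intervals shrinking to `t` from the right decrease to zero, and an
integer below one is zero. -/
theorem Trajectory.exists_noJump_right (π : Trajectory U) {t T : ℝ≥0} (hT : t < T) :
    ∃ t' ∈ Ioc t T, π.meas (Ioc t t' ×ˢ univ) = 0 := by
  obtain ⟨u, hu, hut, hlim⟩ := exists_seq_strictAnti_tendsto' hT
  have hanti : Antitone fun n => Ioc t (u n) ×ˢ (univ : Set U) := fun a b hab =>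
    prod_mono_left (Ioc_subset_Ioc_right (hu.antitone hab))
  have h1 := tendsto_measure_iInter_atTop (μ := π.meas)
    (fun n => (measurableSet_Ioc (a := t) (b := u n)).prod
      (MeasurableSet.univ (α := U)) |>.nullMeasurableSet) hanti
    ⟨0, (π.meas_Ioc_lt_top _ _).ne⟩
  have e : ⋂ n, Ioc t (u n) ×ˢ (univ : Set U) = ∅ := by
    rw [eq_empty_iff_forall_notMem]
    intro q hq
    rw [mem_iInter] at hq
    exact absurd (ge_of_tendsto' hlim fun n => (hq n).1.2) (not_le.2 (hq 0).1.1)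
  rw [e, measure_empty] at h1
  obtain ⟨n, hn⟩ := (h1.eventually (gt_mem_nhds one_pos)).exists
  exact ⟨u n, ⟨(hut n).1, (hut n).2.le⟩,
    π.eq_zero_of_lt_one (measurableSet_Ioc.prod .univ) hn⟩

end TrajectoryNear

/-! ### Paths of the linear stochastic master equation -/

section PathSolutions

variable {U E H ι₁ ι₂ : Type*} [MeasurableSpace U] [MeasurableSpace E] [NormedAddCommGroup H]
  [InnerProductSpace ℂ H] [CompleteSpace H] [TopologicalSpace.SeparableSpace H] [Countable ι₁]
  [Countable ι₂] {C : Coefficients U E H ι₁ ι₂} {ν : Measure U} [IsFiniteMeasure ν]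
  {e : E} {π : Trajectory U} {x : ℝ≥0 → (H →L[ℂ] H)} {ρ₀ : H →L[ℂ] H}

/-- The increment produced by a jump of type `u` at time `t`. -/
noncomputable def Coefficients.kick (C : Coefficients U E H ι₁ ι₂) (e : E) (π : Trajectory U)
    (x : ℝ≥0 → (H →L[ℂ] H)) (a : H →L[ℂ] H) (q : ℝ≥0 × U) : ℂ :=
  trace (a * C.jumpMap q.2 q.1 e π (Function.leftLim x q.1)) - trace (a * Function.leftLim x q.1)

/-- The drift of the linear stochastic master equation. -/
noncomputable def Coefficients.drift (C : Coefficients U E H ι₁ ι₂) (ν : Measure U) (e : E)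
    (π : Trajectory U) (x : ℝ≥0 → (H →L[ℂ] H)) (a : H →L[ℂ] H) (s : ℝ≥0) : ℂ :=
  trace (C.noJumpDual s e π a * Function.leftLim x s)
    + (ν.real univ : ℂ) * trace (a * Function.leftLim x s)

/-- The path `x` solves the linear stochastic master equation for the trajectory `π`. -/
structure IsPathSol (C : Coefficients U E H ι₁ ι₂) (ν : Measure U) (e : E) (π : Trajectory U)
    (ρ₀ : H →L[ℂ] H) (x : ℝ≥0 → (H →L[ℂ] H)) : Prop extends IsCadlagPath x where
  integrable_drift : ∀ t a, IntegrableOn (C.drift ν e π x a) (Ioc 0 t) leb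
  integrable_kick : ∀ t a, IntegrableOn (C.kick e π x a) (Ioc 0 t ×ˢ univ) π.meas
  equation : ∀ t a, trace (a * x t) = trace (a * ρ₀) + ∫ s in Ioc 0 t, C.drift ν e π x a s ∂leb
      + ∫ q in Ioc 0 t ×ˢ univ, C.kick e π x a q ∂π.meas

theorem IsSolution.ae_isPathSol {Ω : Type*} [mΩ : MeasurableSpace Ω] {Q : Measure Ω}
    {𝓕 : Filtration ℝ≥0 mΩ} {ξ : Ω → E} {Pi : Ω → Trajectory U}
    {σ : ℝ≥0 → Ω → (H →L[ℂ] H)} (hC : C.Regular ν) (hσ : IsSolution C Q 𝓕 ν ξ Pi ρ₀ σ) :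
    ∀ᵐ ω ∂Q, IsPathSol C ν (ξ ω) (Pi ω) ρ₀ fun t => σ t ω := by
  filter_upwards [hσ.equation] with ω h
  have hc : IsCadlagPath fun t => σ t ω :=
    ⟨fun t => hσ.traceClass t ω, fun t => hσ.rightCont t ω, fun t => hσ.leftLim t ω⟩
  have e1 : ∀ a s, trace (a * (C.noJumpGen s (ξ ω) (Pi ω) (Function.leftLim (fun r => σ r ω) s)
      + (ν.real univ) • Function.leftLim (fun r => σ r ω) s))
      = C.drift ν (ξ ω) (Pi ω) (fun t => σ t ω) a s := fun a s =>
    hC.trace_mul_noJumpGen_add s (ξ ω) (Pi ω) (hc.traceClass_leftLim s) a _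
  simp only [e1] at h
  exact ⟨hc, fun t a => (h t a).1, fun t a => (h t a).2.1, fun t a => (h t a).2.2⟩

theorem IsPathSol.initial (h : IsPathSol C ν e π ρ₀ x) : x 0 = ρ₀ := by
  refine eq_of_trace_rankOne_mul_eq fun v w => ?_
  simpa using h.equation 0 (InnerProductSpace.rankOne ℂ w v)

theorem Ioc_prod_union {s t : ℝ≥0} (hst : s ≤ t) :
    Ioc 0 t ×ˢ (univ : Set U) = Ioc 0 s ×ˢ univ ∪ Ioc s t ×ˢ univ := by
  rw [← union_prod, Ioc_union_Ioc_eq_Ioc zero_le hst]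

theorem Ioc_prod_disjoint (s t : ℝ≥0) :
    Disjoint (Ioc 0 s ×ˢ (univ : Set U)) (Ioc s t ×ˢ univ) :=
  disjoint_left.2 fun _ h1 h2 => absurd h1.1.2 (not_le.2 h2.1.1)

theorem IsPathSol.equation_sub (h : IsPathSol C ν e π ρ₀ x) {s t : ℝ≥0} (hst : s ≤ t)
    (a : H →L[ℂ] H) :
    trace (a * x t) = trace (a * x s) + ∫ r in Ioc s t, C.drift ν e π x a r ∂leb
      + ∫ q in Ioc s t ×ˢ univ, C.kick e π x a q ∂π.meas := by
  have h1 := setIntegral_Ioc_add (zero_le : 0 ≤ s) hst (h.integrable_drift t a)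
  have hk := h.integrable_kick t a
  have h2 : ∫ q in Ioc 0 t ×ˢ univ, C.kick e π x a q ∂π.meas
      = ∫ q in Ioc 0 s ×ˢ univ, C.kick e π x a q ∂π.meas
        + ∫ q in Ioc s t ×ˢ univ, C.kick e π x a q ∂π.meas := by
    rw [Ioc_prod_union hst] at hk ⊢
    exact setIntegral_union (Ioc_prod_disjoint s t) (measurableSet_Ioc.prod .univ)
      hk.left_of_union hk.right_of_union
  rw [h.equation t a, h.equation s a, h1, h2]
  ring

theorem iInter_Ioc_of_tendsto {t : ℝ≥0} {u : ℕ → ℝ≥0} (hut : ∀ n, u n < t)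
    (hlim : Tendsto u atTop (𝓝 t)) : ⋂ n, Ioc (u n) t = {t} := by
  ext r
  simp only [mem_iInter, mem_Ioc, mem_singleton_iff]
  constructor
  · intro hr
    exact le_antisymm (hr 0).2 (le_of_tendsto' hlim fun n => (hr n).1.le)
  · rintro rfl n
    exact ⟨hut n, le_rfl⟩

/-- The jump of the solution at time `t`. -/
theorem IsPathSol.jump (h : IsPathSol C ν e π ρ₀ x) {t : ℝ≥0} (ht : 0 < t) (a : H →L[ℂ] H) :
    trace (a * x t) = trace (a * Function.leftLim x t)
      + ∫ q in {t} ×ˢ univ, C.kick e π x a q ∂π.meas := by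
  obtain ⟨u, hu, hut, hlim⟩ := exists_seq_strictMono_tendsto' ht
  have hanti : Antitone fun n => Ioc (u n) t := fun a b hab =>
    Ioc_subset_Ioc_left (hu.monotone hab)
  have h1 := tendsto_setIntegral_of_antitone (fun n => measurableSet_Ioc) hanti
    ⟨0, (h.integrable_drift t a).mono_set (Ioc_subset_Ioc_left zero_le)⟩
  have hanti' : Antitone fun n => Ioc (u n) t ×ˢ (univ : Set U) := fun a b hab =>
    prod_mono_left (hanti hab)
  have h2 := tendsto_setIntegral_of_antitone
    (fun n => (measurableSet_Ioc (a := u n) (b := t)).prod (MeasurableSet.univ (α := U))) hanti'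
    ⟨0, (h.integrable_kick t a).mono_set (prod_mono_left (Ioc_subset_Ioc_left zero_le))⟩
  have hset := iInter_Ioc_of_tendsto (fun n => (hut n).2) hlim
  rw [hset, setIntegral_measure_zero _ (leb_singleton t)] at h1
  have hset' : ⋂ n, Ioc (u n) t ×ˢ (univ : Set U) = {t} ×ˢ univ := by
    rw [← hset]
    ext q
    simp
  rw [hset'] at h2
  have h3 : Tendsto (fun n => trace (a * x (u n))) atTop
      (𝓝 (trace (a * Function.leftLim x t))) :=
    (h.tendsto_leftLim ht a).comp (tendsto_nhdsWithin_iff.2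
      ⟨hlim, Eventually.of_forall fun n => (hut n).2⟩)
  have h4 := (h3.add h1).add h2
  rw [add_zero] at h4
  refine tendsto_nhds_unique (tendsto_const_nhds.congr fun n => ?_) h4
  exact h.equation_sub (hut n).2.le a

theorem IsPathSol.leftLim_eq (h : IsPathSol C ν e π ρ₀ x) {t : ℝ≥0}
    (hπ : π.meas ({t} ×ˢ univ) = 0) : Function.leftLim x t = x t := by
  rcases eq_or_lt_of_le (zero_le : 0 ≤ t) with rfl | ht
  · exact leftLim_zero x
  refine eq_of_trace_rankOne_mul_eq fun v w => ?_
  rw [h.jump ht, setIntegral_measure_zero _ hπ, add_zero]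

/-- Between jumps the solution satisfies the no-jump equation, up to an exponential factor. -/
theorem IsPathSol.isWeakSol (h : IsPathSol C ν e π ρ₀ x) {s t : ℝ≥0}
    (hπ : π.meas (Ioc s t ×ˢ univ) = 0) :
    IsWeakSol C e π s t (fun r => (Real.exp (-(ν.real univ * (r - s))) : ℂ) •
      traceFunctional (x r) (h.traceClass r)) := by
  have hdr : ∀ a, ∀ r ∈ Ioc s t, C.drift ν e π x a r
      = traceFunctional (x r) (h.traceClass r) (C.noJumpDual r e π a)
        + (ν.real univ : ℂ) * traceFunctional (x r) (h.traceClass r) a := fun a r hr => by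
    have h0 : π.meas ({r} ×ˢ univ) = 0 :=
      measure_mono_null (prod_mono_left (singleton_subset_iff.2 hr)) hπ
    simp only [Coefficients.drift, h.leftLim_eq h0, traceFunctional_apply]
  have hint : ∀ a, IntegrableOn (C.drift ν e π x a) (Ioc s t) leb := fun a =>
    (h.integrable_drift t a).mono_set (Ioc_subset_Ioc_left zero_le)
  refine IsWeakSol.of_rescaled ?_ (fun a => ?_) fun r hr a => ?_
  · obtain ⟨B, -, hB⟩ := h.bdd t
    exact ⟨B, fun r hr => by rw [← (h.traceClass r).dualNorm_eq]; exact hB r hr.2⟩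
  · exact (hint a).congr_fun (hdr a) measurableSet_Ioc
  · simp only [traceFunctional_apply]
    rw [h.equation_sub hr.1, setIntegral_measure_zero (s := Ioc s r ×ˢ univ) _
      (measure_mono_null (prod_mono_left (Ioc_subset_Ioc_right hr.2)) hπ), add_zero]
    congr 1
    exact setIntegral_congr_fun measurableSet_Ioc fun q hq => hdr a q ⟨hq.1, hq.2.trans hr.2⟩

/-- Testing with `|v⟩⟨v|`, hermiticity of the functional makes the matrix element real and
positivity makes it nonnegative. -/
theorem isPositive_of_weakSol (hC : C.Regular ν) {y : ℝ≥0 → ((H →L[ℂ] H) →L[ℂ] ℂ)} {s t : ℝ≥0}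
    (h : IsWeakSol C e π s t y) (hst : s ≤ t)
    (hκ : IntegrableOn (fun r => C.genRate r e π) (Ioc s t) leb) {X Y : H →L[ℂ] H}
    (hX : IsTraceClass X) (hXp : X.IsPositive) (hs : ∀ a, y s a = trace (a * X))
    (ht : ∀ a, y t a = trace (a * Y)) : Y.IsPositive := by
  refine isPositive_of_trace fun v =>
    ⟨(trace (InnerProductSpace.rankOne ℂ v v * Y)).re, ?_, ?_⟩
  · have h1 := h.adjoint hC hκ hX hs
      (fun a => by rw [hs, hs, hX.trace_adjoint_mul hXp]) ⟨hst, le_rfl⟩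
      (InnerProductSpace.rankOne ℂ v v)
    rw [show (InnerProductSpace.rankOne ℂ v v : H →L[ℂ] H).adjoint
      = InnerProductSpace.rankOne ℂ v v from (rankOne_self_isPositive v).isSelfAdjoint, ht] at h1
    exact (Complex.conj_eq_iff_re.1 h1.symm).symm
  · rw [← ht]
    exact h.nonneg hC hκ (fun a ha => by rw [hs]; exact (hX.trace_mul_nonneg hXp ha).2)
      ⟨hst, le_rfl⟩ (rankOne_self_isPositive v)

theorem Coefficients.jumpMap_isPositive (C : Coefficients U E H ι₁ ι₂) (u : U) (t : ℝ≥0) (e : E)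
    (π : Trajectory U) {X : H →L[ℂ] H} (hX : X.IsPositive) :
    (C.jumpMap u t e π X).IsPositive := by
  unfold Coefficients.jumpMap
  have h1 : ∀ j, (C.jump j u t e π * X * (C.jump j u t e π).adjoint).IsPositive := fun j =>
    hX.conj_adjoint (C.jump j u t e π)
  by_cases hs : Summable fun j => C.jump j u t e π * X * (C.jump j u t e π).adjoint
  · exact isPositive_of_tendsto (Eventually.of_forall fun s =>
      Finset.sum_induction _ _ (fun _ _ ha hb => ha.add hb) ContinuousLinearMap.isPositive_zero
        fun j _ => h1 j) hs.hasSum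
  -- If the series diverges in norm, its default value `0` is still positive, so no convergence
  -- hypothesis is needed.
  · rw [tsum_eq_zero_of_not_summable hs]
    exact ContinuousLinearMap.isPositive_zero

theorem Trajectory.meas_singleton_lt_top (π : Trajectory U) (t : ℝ≥0) :
    π.meas ({t} ×ˢ univ) < ∞ :=
  (measure_mono (prod_mono_left (by simp))).trans_lt (π.meas_Iic_lt_top t)

/-- Tested with `|v⟩⟨v|`, the new value is `(1 - Π{t})` times the old one plus a nonnegative jump
contribution. The first factor is nonnegative only because at most one jump occurs at a time. -/
theorem IsPathSol.isPositive_of_leftLim (h : IsPathSol C ν e π ρ₀ x) {t : ℝ≥0} (ht : 0 < t)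
    (hπ : π.meas ({t} ×ˢ univ) ≤ 1) (hp : (Function.leftLim x t).IsPositive) :
    (x t).IsPositive := by
  set X := Function.leftLim x t with hX
  refine isPositive_of_trace fun v => ?_
  set a := (InnerProductSpace.rankOne ℂ v v : H →L[ℂ] H) with ha
  have hms : MeasurableSet (({t} : Set ℝ≥0) ×ˢ (univ : Set U)) :=
    (measurableSet_singleton t).prod .univ
  have hfin : IsFiniteMeasure (π.meas.restrict ({t} ×ˢ univ)) :=
    ⟨by rw [Measure.restrict_apply_univ]; exact π.meas_singleton_lt_top t⟩
  have hk : ∀ q ∈ ({t} : Set ℝ≥0) ×ˢ (univ : Set U), C.kick e π x a q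
      = trace (a * C.jumpMap q.2 t e π X) - trace (a * X) := by
    rintro ⟨s, u⟩ ⟨hs, -⟩
    rw [mem_singleton_iff] at hs
    subst hs
    rfl
  have hJ : ∀ u, ∃ r : ℝ, trace (a * C.jumpMap u t e π X) = r ∧ 0 ≤ r := fun u => by
    rw [ha, trace_rankOne_mul]
    exact ⟨_, (C.jumpMap_isPositive u t e π hp).inner_eq_re v⟩
  choose J hJ1 hJ0 using hJ
  have hX1 : trace (a * X) = ((trace (a * X)).re : ℂ) ∧ 0 ≤ (trace (a * X)).re := by
    rw [ha, trace_rankOne_mul]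
    exact hp.inner_eq_re v
  set w := (trace (a * X)).re with hw
  have hki := ((h.integrable_kick t a).mono_set (prod_mono_left (singleton_subset_iff.2
    (right_mem_Ioc.2 ht)))).congr_fun hk hms
  simp only [hJ1, hX1.1] at hki
  have hJi : IntegrableOn (fun q : ℝ≥0 × U => (J q.2 : ℂ)) ({t} ×ˢ univ) π.meas := by
    have := hki.add (integrable_const (w : ℂ))
    refine this.congr (ae_of_all _ fun q => ?_)
    simp
  have hint : ∫ q in {t} ×ˢ univ, C.kick e π x a q ∂π.meas
      = ((∫ q in {t} ×ˢ univ, J q.2 ∂π.meas : ℝ) : ℂ)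
        - (((π.meas ({t} ×ˢ univ)).toReal * w : ℝ) : ℂ) := by
    rw [setIntegral_congr_fun hms hk]
    simp only [hJ1, hX1.1]
    rw [integral_sub hJi (integrable_const _), setIntegral_const]
    congr 1
    · exact integral_ofReal
    · simp [measureReal_def]
  refine ⟨w + (∫ q in {t} ×ˢ univ, J q.2 ∂π.meas - (π.meas ({t} ×ˢ univ)).toReal * w), ?_, ?_⟩
  · rw [h.jump ht, hint, hX1.1]
    push_cast
    rfl
  · have h1 : (π.meas ({t} ×ˢ univ)).toReal ≤ 1 :=
      ENNReal.toReal_le_of_le_ofReal one_pos.le (by simpa using hπ)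
    have h2 : 0 ≤ ∫ q in {t} ×ˢ univ, J q.2 ∂π.meas := integral_nonneg fun q => hJ0 q.2
    nlinarith [hX1.2]

/-- Positivity of the solution. -/
theorem IsPathSol.isPositive (hC : C.Regular ν) (h : IsPathSol C ν e π ρ₀ x)
    (hκ : ∀ T, IntegrableOn (fun r => C.genRate r e π) (Ioc 0 T) leb)
    (hπ : ∀ t, π.meas ({t} ×ˢ univ) ≤ 1) (hρ₀ : ρ₀.IsPositive) (t : ℝ≥0) :
    (x t).IsPositive := by
  -- Continuous induction on the time up to which positivity holds: closedness is the passage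
  -- through a left limit and a possible jump, and the step to the right uses a short interval
  -- without jumps, where the no-jump equation preserves positivity.
  have key : Icc 0 t ⊆ {t | ∀ r ≤ t, (x r).IsPositive} := by
    refine IsClosed.Icc_subset_of_forall_exists_gt ?_ ?_ ?_
    · refine isClosed_of_closure_subset fun s hs => ?_
      have hsI : s ∈ Icc 0 t := closure_minimal inter_subset_right isClosed_Icc hs
      have hlt : ∀ r < s, (x r).IsPositive := fun r hr => by
        obtain ⟨q, hq1, hq2⟩ := mem_closure_iff.1 hs (Ioi r) isOpen_Ioi hr
        exact hq2.1 r (le_of_lt hq1)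
      refine ⟨fun r hr => ?_, hsI⟩
      rcases hr.lt_or_eq with hr | rfl
      · exact hlt r hr
      rcases eq_or_lt_of_le (zero_le : 0 ≤ r) with rfl | h0
      · rwa [h.initial]
      · exact h.isPositive_of_leftLim h0 (hπ r) (h.leftLim_isPositive h0 hlt)
    · intro r hr
      rw [nonpos_iff_eq_zero.1 hr, h.initial]
      exact hρ₀
    · rintro s ⟨hs, hsI⟩ y hy
      obtain ⟨t', ht', h0⟩ := π.exists_noJump_right (show s < y from hy)
      refine ⟨t', fun r hr => ?_, ht'⟩
      rcases le_or_gt r s with hrs | hrs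
      · exact hs r hrs
      have hw := h.isWeakSol
        (measure_mono_null (prod_mono_left (Ioc_subset_Ioc_right hr)) h0)
      have hpos := isPositive_of_weakSol hC hw hrs.le
        ((hκ r).mono_set (Ioc_subset_Ioc_left zero_le)) (h.traceClass s) (hs s le_rfl)
        (Y := (Real.exp (-(ν.real univ * (r - s))) : ℂ) • x r) (fun a => by simp) (fun a => by
          rw [mul_smul_comm, trace_smul]
          rfl)
      refine isPositive_of_inner fun v => ?_
      have h1 := hpos.inner_eq_re v
      rw [smul_apply, inner_smul_right] at h1
      set c := Real.exp (-(ν.real univ * (r - s))) with hc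
      have hc0 : 0 < c := Real.exp_pos _
      refine ⟨(inner ℂ v (x r v) : ℂ).re, ?_, ?_⟩
      · rw [Complex.re_ofReal_mul, Complex.ofReal_mul] at h1
        exact mul_left_cancel₀ (Complex.ofReal_ne_zero.2 hc0.ne') h1.1
      · rw [Complex.re_ofReal_mul] at h1
        exact nonneg_of_mul_nonneg_right h1.2 hc0
  exact key ⟨zero_le, le_rfl⟩ t le_rfl

end PathSolutions

/-! ### The rates of the jumps -/

section JumpRate

variable {U E H ι₁ ι₂ : Type*} [MeasurableSpace U] [MeasurableSpace E] [NormedAddCommGroup H]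
  [InnerProductSpace ℂ H] [CompleteSpace H] [TopologicalSpace.SeparableSpace H] [Countable ι₁]
  [Countable ι₂] {C : Coefficients U E H ι₁ ι₂} {ν : Measure U} [IsFiniteMeasure ν]

/-- The trace of `∑ Jⱼ X Jⱼ†`, with values in `[0, ∞]`. -/
noncomputable def Coefficients.jumpRate (C : Coefficients U E H ι₁ ι₂) (u : U) (t : ℝ≥0) (e : E)
    (π : Trajectory U) (X : H →L[ℂ] H) : ℝ≥0∞ :=
  ∑' j, ENNReal.ofReal (trace ((C.jump j u t e π).adjoint * C.jump j u t e π * X)).re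

theorem IsRep.hasSum_re_trace {κ : Type*} {x : κ → H} {X : H →L[ℂ] H} (h : IsRep x x X)
    (a : H →L[ℂ] H) : HasSum (fun n => (inner ℂ (x n) (a (x n)) : ℂ).re) (trace (a * X)).re := by
  rw [h.trace_mul]
  exact Complex.hasSum_re (h.summable_inner a).hasSum

theorem IsRep.ofReal_trace_adjoint_mul {κ : Type*} {x : κ → H} {X : H →L[ℂ] H}
    (h : IsRep x x X) (T : H →L[ℂ] H) :
    ENNReal.ofReal (trace (T.adjoint * T * X)).re
      = ∑' n, ENNReal.ofReal (‖T (x n)‖ ^ 2) := by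
  have h1 : HasSum (fun n => ‖T (x n)‖ ^ 2) (trace (T.adjoint * T * X)).re := by
    refine (h.hasSum_re_trace (T.adjoint * T)).congr_fun fun n => ?_
    rw [mul_apply_eq_comp, ContinuousLinearMap.adjoint_inner_right,
      inner_self_eq_norm_sq_to_K]
    simp [← Complex.ofReal_pow]
  rw [← h1.tsum_eq, ENNReal.ofReal_tsum_of_nonneg (fun n => by positivity) h1.summable]

theorem Coefficients.Regular.integrable_norm_sq_jump (hC : C.Regular ν) (j : ι₁) (t : ℝ≥0) (e : E)
    (π : Trajectory U) (x : H) : Integrable (fun u => ‖C.jump j u t e π x‖ ^ 2) ν := by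
  obtain ⟨M, hM⟩ := hC.jump_bdd t
  have hm : SOTMeasurable fun u => C.jump j u t e π :=
    (hC.sotMeasurable_jump j).comp (g := fun u => (u, t, e, π)) measurable_prodMk_right
  refine Integrable.of_bound ((hm x).norm.pow 2).aestronglyMeasurable ((M * ‖x‖) ^ 2)
    (ae_of_all _ fun u => ?_)
  rw [norm_pow, norm_norm]
  gcongr
  exact (C.jump j u t e π).le_of_opNorm_le (hM j u t e π le_rfl) x

theorem Coefficients.Regular.hasSum_integral_norm_sq (hC : C.Regular ν) (t : ℝ≥0) (e : E)
    (π : Trajectory U) (x : H) :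
    HasSum (fun j => ∫ u, ‖C.jump j u t e π x‖ ^ 2 ∂ν) (inner ℂ x (C.R t e π x) : ℂ).re := by
  refine (Complex.hasSum_re (hC.hasSum_inner_R t e π x x)).congr_fun fun j => ?_
  have e1 : ∫ u, (inner ℂ (C.jump j u t e π x) (C.jump j u t e π x) : ℂ) ∂ν
      = ((∫ u, ‖C.jump j u t e π x‖ ^ 2 ∂ν : ℝ) : ℂ) := by
    refine (integral_congr_ae (ae_of_all _ fun u => ?_)).trans integral_ofReal
    simp [inner_self_eq_norm_sq_to_K]
  rw [e1, Complex.ofReal_re]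

/-- `∫ ν(du) Tr 𝒥(u)[X] = Tr (R X)`. -/
theorem Coefficients.Regular.lintegral_jumpRate (hC : C.Regular ν) (t : ℝ≥0) (e : E)
    (π : Trajectory U) {X : H →L[ℂ] H} (hX : IsTraceClass X) (hp : X.IsPositive) :
    ∫⁻ u, C.jumpRate u t e π X ∂ν = ENNReal.ofReal (trace (C.R t e π * X)).re := by
  obtain ⟨x, hr⟩ := hX.exists_isRep_self hp
  have hm : ∀ j n, Measurable fun u => ENNReal.ofReal (‖C.jump j u t e π (x n)‖ ^ 2) :=
    fun j n => by
      have hm : SOTMeasurable fun u => C.jump j u t e π :=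
        (hC.sotMeasurable_jump j).comp (g := fun u => (u, t, e, π)) measurable_prodMk_right
      exact ((hm (x n)).norm.pow 2).measurable.ennreal_ofReal
  have hR0 : ∀ n, 0 ≤ (inner ℂ (x n) (C.R t e π (x n)) : ℂ).re := fun n =>
    ((hC.R_isPositive t e π).inner_eq_re (x n)).2
  calc ∫⁻ u, C.jumpRate u t e π X ∂ν
      = ∫⁻ u, ∑' j, ∑' n, ENNReal.ofReal (‖C.jump j u t e π (x n)‖ ^ 2) ∂ν :=
        lintegral_congr fun u => tsum_congr fun j => hr.ofReal_trace_adjoint_mul _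
    _ = ∑' j, ∑' n, ∫⁻ u, ENNReal.ofReal (‖C.jump j u t e π (x n)‖ ^ 2) ∂ν := by
        rw [lintegral_tsum fun j => (Measurable.tsum (hm j)).aemeasurable]
        exact tsum_congr fun j => lintegral_tsum fun n => (hm j n).aemeasurable
    _ = ∑' n, ∑' j, ENNReal.ofReal (∫ u, ‖C.jump j u t e π (x n)‖ ^ 2 ∂ν) := by
        rw [ENNReal.tsum_comm]
        refine tsum_congr fun n => tsum_congr fun j => ?_
        exact (ofReal_integral_eq_lintegral_ofReal (hC.integrable_norm_sq_jump j t e π (x n))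
          (ae_of_all _ fun u => by positivity)).symm
    _ = ∑' n, ENNReal.ofReal (inner ℂ (x n) (C.R t e π (x n)) : ℂ).re := by
        refine tsum_congr fun n => ?_
        have h := hC.hasSum_integral_norm_sq t e π (x n)
        rw [← h.tsum_eq, ENNReal.ofReal_tsum_of_nonneg
          (fun j => integral_nonneg fun u => by positivity) h.summable]
    _ = ENNReal.ofReal (trace (C.R t e π * X)).re := by
        have h := hr.hasSum_re_trace (C.R t e π)
        rw [← h.tsum_eq, ENNReal.ofReal_tsum_of_nonneg hR0 h.summable]

/-- Only the `ν`-integrated sum `R` is known to converge, so for an individual `u` the rate may be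
infinite. Where it is finite, the vectors `Jⱼ xₙ` are square summable and represent the image of the
jump map. -/
theorem Coefficients.trace_jumpMap (C : Coefficients U E H ι₁ ι₂) (u : U) (t : ℝ≥0) (e : E)
    (π : Trajectory U) {X : H →L[ℂ] H} (hX : IsTraceClass X) (hp : X.IsPositive)
    (h : C.jumpRate u t e π X ≠ ∞) :
    trace (C.jumpMap u t e π X) = ((C.jumpRate u t e π X).toReal : ℂ) := by
  obtain ⟨x, hr⟩ := hX.exists_isRep_self hp
  set T := fun j => C.jump j u t e π with hT
  have e1 : C.jumpRate u t e π X
      = ∑' p : ι₁ × (exists_hilbertBasis ℂ H).choose, ENNReal.ofReal (‖T p.1 (x p.2)‖ ^ 2) := by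
    rw [ENNReal.tsum_prod']
    exact tsum_congr fun j => hr.ofReal_trace_adjoint_mul _
  have hs : Summable fun p : ι₁ × (exists_hilbertBasis ℂ H).choose => ‖T p.1 (x p.2)‖ ^ 2 := by
    rw [e1] at h
    refine (ENNReal.summable_toReal h).congr fun p => ?_
    rw [ENNReal.toReal_ofReal (by positivity)]
  have h1 := (hr.tsum_conj (T := T) (by simpa only [sq] using hs)).2.trace_mul 1
  rw [one_mul] at h1
  rw [Coefficients.jumpMap, h1, e1, ← ENNReal.ofReal_tsum_of_nonneg (fun p => by positivity) hs,
    ENNReal.toReal_ofReal (tsum_nonneg fun p => by positivity), Complex.ofReal_tsum]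
  refine tsum_congr fun p => ?_
  rw [one_apply_eq_self, inner_self_eq_norm_sq_to_K]
  simp

theorem Coefficients.Regular.trace_R_mul_le (hC : C.Regular ν) (t : ℝ≥0) (e : E)
    (π : Trajectory U) {X : H →L[ℂ] H} (hX : IsTraceClass X) (hp : X.IsPositive) :
    (trace (C.R t e π * X)).re ≤ ‖C.R t e π‖ * (trace X).re := by
  have := hX.trace_mul_le hp (isPositive_opNorm_sub (hC.R_isPositive t e π) le_rfl)
  rwa [IsTraceClass.trace_smul_mul, one_mul, Complex.re_ofReal_mul] at this

end JumpRate

/-! ### Predictability of the coefficients and of the left limits -/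

section PredictableCoefficients

variable {Ω U E H ι₁ ι₂ : Type*} [mΩ : MeasurableSpace Ω] [MeasurableSpace U] [MeasurableSpace E]
  [NormedAddCommGroup H]
  [InnerProductSpace ℂ H] [CompleteSpace H] [TopologicalSpace.SeparableSpace H] [Countable ι₁]
  [Countable ι₂] {C : Coefficients U E H ι₁ ι₂} {ν : Measure U} [IsFiniteMeasure ν]
  {Q : Measure Ω} {𝓕 𝓖 : Filtration ℝ≥0 mΩ} {ξ : Ω → E} {Pi : Ω → Trajectory U}
  {σ : ℝ≥0 → Ω → (H →L[ℂ] H)}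

/-- The strict past is exhausted by the past up to rational times `q < s`. Each piece is known at
time `q` and is switched on after `q`, which is the form of a predictable process. -/
theorem Trajectory.before_meas_eq_iSup (π : Trajectory U) (s : ℝ≥0) {B : Set (ℝ≥0 × U)}
    (hB : MeasurableSet B) : (π.before s).meas B
      = ⨆ q : ℚ≥0, (Ioi (q : ℝ≥0)).indicator (fun _ => (π.upTo q).meas B) s := by
  have e1 : ∀ q : ℚ≥0, (Ioi (q : ℝ≥0)).indicator (fun _ => (π.upTo q).meas B) s
      = π.meas (if (q : ℝ≥0) < s then B ∩ Iic (q : ℝ≥0) ×ˢ univ else ∅) := fun q => by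
    by_cases h : (q : ℝ≥0) < s
    · simp [h, Trajectory.upTo, Trajectory.restrictTime_meas _ _ _ hB]
    · simp [h]
  simp only [e1]
  rw [Trajectory.before, Trajectory.restrictTime_meas _ _ _ hB, ← Directed.measure_iUnion]
  · congr 1
    ext p
    simp only [mem_inter_iff, mem_prod, mem_Iio, mem_univ, and_true, mem_iUnion]
    constructor
    · rintro ⟨h1, h2⟩
      obtain ⟨q, hq1, hq2⟩ := NNReal.lt_iff_exists_rat_btwn p.1 s |>.1 h2
      lift q to ℚ≥0 using hq1
      have e2 : (q : ℝ≥0) = Real.toNNReal ((q : ℚ) : ℝ) := by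
        ext
        rw [Real.coe_toNNReal _ (by positivity)]
        norm_cast
      rw [← e2] at hq2
      refine ⟨q, ?_⟩
      rw [if_pos hq2.2]
      exact ⟨h1, hq2.1.le, trivial⟩
    · rintro ⟨q, hq⟩
      split_ifs at hq with h
      · exact ⟨hq.1, lt_of_le_of_lt hq.2.1 h⟩
      · exact hq.elim
  · intro q q'
    by_cases h : (q : ℝ≥0) < s
    · by_cases h' : (q' : ℝ≥0) < s
      · have h'' : ((max q q' : ℚ≥0) : ℝ≥0) < s := by
          rcases le_total q q' with hqq | hqq
          · rwa [max_eq_right hqq]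
          · rwa [max_eq_left hqq]
        refine ⟨max q q', ?_, ?_⟩ <;> simp only [h, h', h'', if_true] <;>
          refine inter_subset_inter_right _ (prod_mono_left (Iic_subset_Iic.2 ?_)) <;>
          exact_mod_cast (by simp)
      · exact ⟨q, le_rfl, by simp [h']⟩
    · exact ⟨q', by simp [h], le_rfl⟩

theorem measurable_before_pred (h : ∀ t, Measurable[𝓖 t] fun ω => (Pi ω).upTo t) :
    Measurable fun x : PredSpace 𝓖 => (Pi x.outcome).before x.time :=
  measurable_trajectory fun B hB => by
    simp only [Trajectory.before_meas_eq_iSup _ _ hB]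
    exact .iSup fun q => PredSpace.measurable_indicator_Ioi ((measurable_meas hB).comp (h q))

/-- The left limits of `σ`, as a function on `PredSpace`. -/
noncomputable def leftState (𝓖 : Filtration ℝ≥0 mΩ) (σ : ℝ≥0 → Ω → (H →L[ℂ] H))
    (x : PredSpace 𝓖) : H →L[ℂ] H :=
  Function.leftLim (fun r => σ r x.outcome) x.time

/-- Left limits are limits along the left grid, and the process sampled on that grid is predictable.
-/
theorem sotMeasurable_leftState (hc : ∀ ω, IsCadlagPath fun t => σ t ω)
    (h : ∀ t a, Measurable[𝓖 t] fun ω => trace (a * σ t ω)) :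
    SOTMeasurable (leftState 𝓖 σ) := by
  refine .of_inner fun v w => ?_
  simp only [← trace_rankOne_mul]
  refine measurable_of_tendsto_metrizable
    (f := fun n (x : PredSpace 𝓖) =>
      trace (InnerProductSpace.rankOne ℂ w v * σ (leftGrid n x.time) x.outcome))
    (fun n => measurable_comp_leftGrid
      (h := fun t ω => trace (InnerProductSpace.rankOne ℂ w v * σ t ω))
      (fun t => h t _) n) ?_
  rw [tendsto_pi_nhds]
  intro x
  rcases eq_or_lt_of_le (zero_le : 0 ≤ x.time) with h0 | h0
  · simp only [leftState, ← h0, leftGrid_zero, leftLim_zero]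
    exact tendsto_const_nhds
  · exact ((hc x.outcome).tendsto_leftLim h0 _).comp (tendsto_leftGrid h0)

theorem Coefficients.Regular.jumpRate_past (hC : C.Regular ν) (u : U) (t : ℝ≥0) (e : E)
    (π : Trajectory U) (X : H →L[ℂ] H) :
    C.jumpRate u t e π X = C.jumpRate u t e (π.before t) X := by
  unfold Coefficients.jumpRate
  simp only [← hC.jump_past]

theorem Coefficients.Regular.measurable_jumpRate {Y : Type*} [MeasurableSpace Y]
    (hC : C.Regular ν) {u : Y → U} {s : Y → ℝ≥0}
    {e : Y → E} {π : Y → Trajectory U} {X : Y → (H →L[ℂ] H)} (hu : Measurable u)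
    (hs : Measurable s) (he : Measurable e) (hπ : Measurable π) (hX : SOTMeasurable X)
    (hT : ∀ y, IsTraceClass (X y)) :
    Measurable fun y => C.jumpRate (u y) (s y) (e y) (π y) (X y) := by
  have hJ : ∀ j, SOTMeasurable fun y => C.jump j (u y) (s y) (e y) (π y) := fun j =>
    (hC.sotMeasurable_jump j).comp (hu.prodMk (hs.prodMk (he.prodMk hπ)))
  exact Measurable.tsum fun j => (Complex.measurable_re.comp
    (((hJ j).adjoint.mul (hJ j)).measurable_trace_mul hX hT)).ennreal_ofReal

end PredictableCoefficients

/-! ### The mass of the solution -/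

section MassEquation

variable {U E H ι₁ ι₂ : Type*} [MeasurableSpace U] [MeasurableSpace E] [NormedAddCommGroup H]
  [InnerProductSpace ℂ H] [CompleteSpace H] [TopologicalSpace.SeparableSpace H] [Countable ι₁]
  [Countable ι₂] {C : Coefficients U E H ι₁ ι₂} {ν : Measure U} [IsFiniteMeasure ν]
  {e : E} {π : Trajectory U} {x : ℝ≥0 → (H →L[ℂ] H)} {ρ₀ : H →L[ℂ] H}

theorem IsTraceClass.trace_re_nonneg {X : H →L[ℂ] H} (h : IsTraceClass X) (hp : X.IsPositive) :
    trace X = ((trace X).re : ℂ) ∧ 0 ≤ (trace X).re := by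
  simpa using h.trace_mul_nonneg hp ContinuousLinearMap.isPositive_one

theorem IsTraceClass.norm_trace_le_dualNorm {X : H →L[ℂ] H} (h : IsTraceClass X) :
    ‖trace X‖ ≤ dualNorm X := by
  have h1 := h.norm_trace_mul_le_dualNorm 1
  rw [one_mul] at h1
  refine h1.trans (mul_le_of_le_one_right (dualNorm_nonneg X) ?_)
  exact ContinuousLinearMap.norm_id_le

theorem IsCadlagPath.leftLim_isPositive' (h : IsCadlagPath x) (hp : ∀ t, (x t).IsPositive)
    (t : ℝ≥0) : (Function.leftLim x t).IsPositive := by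
  rcases eq_or_lt_of_le (zero_le : 0 ≤ t) with rfl | ht
  · rw [leftLim_zero]
    exact hp 0
  · exact h.leftLim_isPositive ht fun r _ => hp r

/-- The equation for the mass of a positive solution. -/
theorem IsPathSol.mass_equation (hC : C.Regular ν) (h : IsPathSol C ν e π ρ₀ x)
    (hp : ∀ t, (x t).IsPositive) (hm : Measurable fun s => (trace (Function.leftLim x s)).re)
    (hj : ∀ t, ∀ᵐ q ∂π.meas.restrict (Ioc 0 t ×ˢ univ),
      C.jumpRate q.2 q.1 e π (Function.leftLim x q.1) ≠ ∞) {s t : ℝ≥0} (hst : s ≤ t) :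
    ENNReal.ofReal (trace (x t)).re
      + (∫⁻ v in Ioc s t, ENNReal.ofReal (trace (C.R v e π * Function.leftLim x v)).re ∂leb
        + ∫⁻ q in Ioc s t ×ˢ univ, ENNReal.ofReal (trace (Function.leftLim x q.1)).re ∂π.meas)
    = ENNReal.ofReal (trace (x s)).re
      + (∫⁻ v in Ioc s t, ν univ * ENNReal.ofReal (trace (Function.leftLim x v)).re ∂leb
        + ∫⁻ q in Ioc s t ×ˢ univ, C.jumpRate q.2 q.1 e π (Function.leftLim x q.1) ∂π.meas) := by
  set m : ℝ≥0 → ℝ := fun s => (trace (Function.leftLim x s)).re with hmdef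
  set r : ℝ≥0 → ℝ := fun s => (trace (C.R s e π * Function.leftLim x s)).re with hrdef
  set j : ℝ≥0 × U → ℝ := fun q =>
    (C.jumpRate q.2 q.1 e π (Function.leftLim x q.1)).toReal with hjdef
  have hlp := h.leftLim_isPositive' hp
  have hm0 : ∀ s, trace (Function.leftLim x s) = (m s : ℂ) ∧ 0 ≤ m s := fun s =>
    (h.traceClass_leftLim s).trace_re_nonneg (hlp s)
  have hr0 : ∀ s, trace (C.R s e π * Function.leftLim x s) = (r s : ℂ) ∧ 0 ≤ r s := fun s =>
    (h.traceClass_leftLim s).trace_mul_nonneg (hlp s) (hC.R_isPositive s e π)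
  obtain ⟨B, hB0, hB⟩ := h.bdd t
  have hmB : ∀ s ≤ t, ‖m s‖ ≤ B := fun s hs => by
    have h1 := (h.traceClass_leftLim s).norm_trace_le_dualNorm.trans (h.bdd_leftLim hB0 hB hs)
    rwa [(hm0 s).1, Complex.norm_real] at h1
  have hms : MeasurableSet (Ioc s t ×ˢ (univ : Set U)) := measurableSet_Ioc.prod .univ
  have hfin : IsFiniteMeasure (π.meas.restrict (Ioc s t ×ˢ univ)) :=
    ⟨by rw [Measure.restrict_apply_univ]; exact π.meas_Ioc_lt_top s t⟩
  have hfin' : IsFiniteMeasure (leb.restrict (Ioc s t)) :=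
    ⟨by rw [Measure.restrict_apply_univ, leb_Ioc]; exact ENNReal.ofReal_lt_top⟩
  have hmi : IntegrableOn m (Ioc s t) leb :=
    Integrable.of_bound hm.aestronglyMeasurable B
      ((ae_restrict_iff' measurableSet_Ioc).2 (ae_of_all _ fun v hv => hmB v hv.2))
  have hmi' : IntegrableOn (fun q : ℝ≥0 × U => m q.1) (Ioc s t ×ˢ univ) π.meas :=
    Integrable.of_bound (hm.comp measurable_fst).aestronglyMeasurable B
      ((ae_restrict_iff' hms).2 (ae_of_all _ fun v hv => hmB v.1 hv.1.2))
  have hd : ∀ v, C.drift ν e π x 1 v = ((ν.real univ * m v - r v : ℝ) : ℂ) := fun v => by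
    rw [Coefficients.drift, hC.noJumpDual_one, one_mul, neg_mul, ← neg_one_smul ℂ,
      ← smul_mul_assoc, IsTraceClass.trace_smul_mul, (hm0 v).1, (hr0 v).1]
    push_cast
    ring
  have hj' : ∀ᵐ q ∂π.meas.restrict (Ioc s t ×ˢ univ),
      C.jumpRate q.2 q.1 e π (Function.leftLim x q.1) ≠ ∞ :=
    ae_mono (Measure.restrict_mono (prod_mono_left (Ioc_subset_Ioc_left zero_le)) le_rfl) (hj t)
  have hk : ∀ᵐ q ∂π.meas.restrict (Ioc s t ×ˢ univ),
      C.kick e π x 1 q = ((j q - m q.1 : ℝ) : ℂ) := by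
    filter_upwards [hj'] with q hq
    rw [Coefficients.kick, one_mul, one_mul,
      C.trace_jumpMap q.2 q.1 e π (h.traceClass_leftLim q.1) (hlp q.1) hq, (hm0 q.1).1]
    push_cast
    rfl
  have hdi : IntegrableOn (fun v => ν.real univ * m v - r v) (Ioc s t) leb := by
    have := ((h.integrable_drift t 1).mono_set (Ioc_subset_Ioc_left (zero_le (a := s)))).re
    simp only [hd, RCLike.re_to_complex, Complex.ofReal_re] at this
    exact this
  have hri : IntegrableOn r (Ioc s t) leb := by
    have := (hmi.const_mul (ν.real univ)).sub hdi
    refine this.congr (ae_of_all _ fun v => ?_)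
    simp
  have hki : IntegrableOn (fun q => j q - m q.1) (Ioc s t ×ˢ univ) π.meas := by
    have := (((h.integrable_kick t 1).mono_set
      (prod_mono_left (Ioc_subset_Ioc_left (zero_le (a := s))))).congr hk).re
    simp only [RCLike.re_to_complex, Complex.ofReal_re] at this
    exact this
  have hji : IntegrableOn j (Ioc s t ×ˢ univ) π.meas := by
    have := hki.add hmi'
    refine this.congr (ae_of_all _ fun v => ?_)
    simp
  have heq := congrArg Complex.re (h.equation_sub hst 1)
  have e1 : ∫ v in Ioc s t, C.drift ν e π x 1 v ∂leb
      = ((∫ v in Ioc s t, (ν.real univ * m v - r v) ∂leb : ℝ) : ℂ) := by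
    simp only [hd]
    exact integral_ofReal
  have e2 : ∫ q in Ioc s t ×ˢ univ, C.kick e π x 1 q ∂π.meas
      = ((∫ q in Ioc s t ×ˢ univ, (j q - m q.1) ∂π.meas : ℝ) : ℂ) := by
    rw [integral_congr_ae hk]
    exact integral_ofReal
  rw [e1, e2, integral_sub (hmi.const_mul _) hri, integral_sub hji hmi', one_mul, one_mul,
    Complex.add_re, Complex.add_re, Complex.ofReal_re, Complex.ofReal_re] at heq
  have hlt : ∀ t, 0 ≤ (trace (x t)).re := fun t => ((h.traceClass t).trace_re_nonneg (hp t)).2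
  have hnr : 0 ≤ ∫ v in Ioc s t, r v ∂leb := integral_nonneg fun v => (hr0 v).2
  have hnm : 0 ≤ ∫ q in Ioc s t ×ˢ univ, m q.1 ∂π.meas := integral_nonneg fun q => (hm0 q.1).2
  have hnm' : 0 ≤ ∫ v in Ioc s t, ν.real univ * m v ∂leb := integral_nonneg fun v =>
    mul_nonneg measureReal_nonneg (hm0 v).2
  have hnj : 0 ≤ ∫ q in Ioc s t ×ˢ univ, j q ∂π.meas :=
    integral_nonneg fun q => ENNReal.toReal_nonneg
  have l1 : ∫⁻ v in Ioc s t, ENNReal.ofReal (r v) ∂leb = ENNReal.ofReal (∫ v in Ioc s t, r v ∂leb) :=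
    (ofReal_integral_eq_lintegral_ofReal hri (ae_of_all _ fun v => (hr0 v).2)).symm
  have l2 : ∫⁻ q in Ioc s t ×ˢ univ, ENNReal.ofReal (m q.1) ∂π.meas
      = ENNReal.ofReal (∫ q in Ioc s t ×ˢ univ, m q.1 ∂π.meas) :=
    (ofReal_integral_eq_lintegral_ofReal hmi' (ae_of_all _ fun q => (hm0 q.1).2)).symm
  have l3 : ∫⁻ v in Ioc s t, ν univ * ENNReal.ofReal (m v) ∂leb
      = ENNReal.ofReal (∫ v in Ioc s t, ν.real univ * m v ∂leb) := by
    rw [ofReal_integral_eq_lintegral_ofReal (hmi.const_mul _)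
      (ae_of_all _ fun v => mul_nonneg measureReal_nonneg (hm0 v).2)]
    refine lintegral_congr fun v => ?_
    rw [ENNReal.ofReal_mul measureReal_nonneg, ofReal_measureReal]
  have l4 : ∫⁻ q in Ioc s t ×ˢ univ, C.jumpRate q.2 q.1 e π (Function.leftLim x q.1) ∂π.meas
      = ENNReal.ofReal (∫ q in Ioc s t ×ˢ univ, j q ∂π.meas) := by
    rw [ofReal_integral_eq_lintegral_ofReal hji (ae_of_all _ fun q => ENNReal.toReal_nonneg)]
    refine lintegral_congr_ae ?_
    filter_upwards [hj'] with q hq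
    rw [ENNReal.ofReal_toReal hq]
  rw [l1, l2, l3, l4, ← ENNReal.ofReal_add hnr hnm, ← ENNReal.ofReal_add hnm' hnj,
    ← ENNReal.ofReal_add (hlt t) (add_nonneg hnr hnm),
    ← ENNReal.ofReal_add (hlt s) (add_nonneg hnm' hnj)]
  congr 1
  linarith

end MassEquation

/-! ### The trace of the solution as a mass process -/

section MassProcess

variable {Ω U E H ι₁ ι₂ : Type*} [mΩ : MeasurableSpace Ω] [MeasurableSpace U] [MeasurableSpace E]
  [NormedAddCommGroup H]
  [InnerProductSpace ℂ H] [CompleteSpace H] [TopologicalSpace.SeparableSpace H] [Countable ι₁]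
  [Countable ι₂] {C : Coefficients U E H ι₁ ι₂} {ν : Measure U} [IsFiniteMeasure ν]
  {Q : Measure Ω} [IsProbabilityMeasure Q] {𝓕 : Filtration ℝ≥0 mΩ} {ξ : Ω → E}
  {Pi : Ω → Trajectory U} {σ : ℝ≥0 → Ω → (H →L[ℂ] H)} {ρ₀ : H →L[ℂ] H}

theorem Coefficients.Admissible.ae_integrableOn_genRate (hC : C.Regular ν)
    (hC' : C.Admissible Q 𝓕 ξ Pi) :
    ∀ᵐ ω ∂Q, ∀ T, IntegrableOn (fun s => C.genRate s (ξ ω) (Pi ω)) (Ioc 0 T) leb := by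
  have h1 := fun n : ℕ => (hC'.R_bdd n).choose_spec
  have h2 := fun n : ℕ => (hC'.R₀_bdd n).choose_spec
  have h3 := fun n : ℕ => (hC'.ham_bdd n).choose_spec
  filter_upwards [ae_all_iff.2 h1, ae_all_iff.2 h2, ae_all_iff.2 h3] with ω h1 h2 h3 T
  obtain ⟨n, hn⟩ := exists_nat_ge T
  have hg : Measurable fun s : ℝ≥0 => (s, ξ ω, Pi ω) := measurable_prodMk_right
  have key : ∀ (A : ℝ≥0 → (H →L[ℂ] H)) (M : ℝ≥0), SOTMeasurable A →
      ∫⁻ s in Iic (n : ℝ≥0), ‖A s‖ₑ ∂leb ≤ M → IntegrableOn (fun s => ‖A s‖) (Ioc 0 T) leb := by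
    intro A M hA hM
    refine ⟨hA.measurable_norm.aestronglyMeasurable, ?_⟩
    rw [hasFiniteIntegral_iff_enorm]
    simp only [enorm_norm]
    exact ((lintegral_mono_set fun s hs => hs.2.trans hn).trans hM).trans_lt ENNReal.coe_lt_top
  have i1 := key _ _ (hC.sotMeasurable_R.comp hg) (h1 n)
  have i2 := key _ _ (hC.sotMeasurable_R₀.comp hg) (h2 n)
  have i3 := key _ _ (hC.sotMeasurable_ham.comp hg) (h3 n)
  have i0 : IntegrableOn (fun _ : ℝ≥0 => (1 : ℝ)) (Ioc 0 T) leb :=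
    integrableOn_const (by rw [leb_Ioc]; exact ENNReal.ofReal_ne_top)
  exact ((i0.add (i3.const_mul 2)).add (i2.const_mul 2)).add i1

theorem IsSolution.isCadlagPath (hσ : IsSolution C Q 𝓕 ν ξ Pi ρ₀ σ) (ω : Ω) :
    IsCadlagPath fun t => σ t ω :=
  ⟨fun t => hσ.traceClass t ω, fun t => hσ.rightCont t ω, fun t => hσ.leftLim t ω⟩

theorem IsSolution.ae_isPositive (hC : C.Regular ν) (hC' : C.Admissible Q 𝓕 ξ Pi)
    (hPi : IsPoissonPointProcess Q 𝓕 ν ξ Pi) (hσ : IsSolution C Q 𝓕 ν ξ Pi ρ₀ σ)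
    (hρ₀ : ρ₀.IsPositive) : ∀ᵐ ω ∂Q, ∀ t, (σ t ω).IsPositive := by
  filter_upwards [hσ.ae_isPathSol hC, hC'.ae_integrableOn_genRate hC, hPi.ae_simple]
    with ω h1 h2 h3 t
  exact h1.isPositive hC h2 h3 hρ₀ t

/-- The compensation formula is applied to the indicator of `{j = ∞}`: this set of marks is `ν`-null
at every time, so the expected number of jumps falling into it is zero. -/
theorem IsPoissonPointProcess.ae_jump_ne_top (hPi : IsPoissonPointProcess Q 𝓕 ν ξ Pi)
    (hξ : Measurable ξ) {j : U × PredSpace (enlarge 𝓕 ξ hξ) → ℝ≥0∞} (hj : Measurable j)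
    (h : ∀ᵐ ω ∂Q, ∀ s, ∫⁻ u, j (u, .mk _ s ω) ∂ν ≠ ∞) :
    ∀ᵐ ω ∂Q, ∀ t, ∀ᵐ q ∂(Pi ω).meas.restrict (Ioc 0 t ×ˢ univ),
      j (q.2, .mk _ q.1 ω) ≠ ∞ := by
  have hDm : MeasurableSet {q | j q = ∞} := hj (measurableSet_singleton ∞)
  set g : U × PredSpace (enlarge 𝓕 ξ hξ) → ℝ≥0∞ := {q | j q = ∞}.indicator fun _ => 1 with hg
  have hgm : Measurable g := measurable_const.indicator hDm
  have hn : ∀ n : ℕ, ∀ᵐ ω ∂Q, ∫⁻ q in Ioc 0 (n : ℝ≥0) ×ˢ univ,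
      g (q.2, .mk _ q.1 ω) ∂(Pi ω).meas = 0 := fun n => by
    refine (lintegral_eq_zero_iff (measurable_lintegral_jump hPi.measurable hgm 0 n)).1 ?_
    have h1 := hPi.lintegral_jump hξ (s := 0) (t := n) (X := fun _ => 1) measurable_const hgm
    simp only [one_mul] at h1
    rw [h1]
    refine (lintegral_congr_ae ?_).trans lintegral_zero
    filter_upwards [h] with ω hω
    refine (lintegral_congr fun s => ?_).trans lintegral_zero
    refine (lintegral_congr_ae ?_).trans lintegral_zero
    have hms : Measurable fun u => j (u, .mk _ s ω) := hj.comp measurable_prodMk_right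
    filter_upwards [ae_lt_top hms (hω s)] with u hu
    exact indicator_of_notMem (s := {q | j q = ∞}) (fun h => hu.ne h) fun _ => (1 : ℝ≥0∞)
  filter_upwards [ae_all_iff.2 hn] with ω hω t
  obtain ⟨n, hn⟩ := exists_nat_ge t
  refine ae_mono (Measure.restrict_mono (prod_mono_left (Ioc_subset_Ioc_right hn)) le_rfl) ?_
  have hm : Measurable fun q : ℝ≥0 × U => g (q.2, .mk _ q.1 ω) :=
    hgm.comp ((measurable_mark_mk _).comp measurable_prodMk_left)
  filter_upwards [(lintegral_eq_zero_iff hm).1 (hω n)] with q hq h3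
  have h4 : g (q.2, .mk _ q.1 ω) = 1 :=
    indicator_of_mem (s := {q | j q = ∞}) h3 fun _ => (1 : ℝ≥0∞)
  exact (one_ne_zero : (1 : ℝ≥0∞) ≠ 0) (h4.symm.trans hq)

/-- The mass of the solution is a mass process. -/
theorem IsSolution.exists_isMassProcess (hC : C.Regular ν) (hC' : C.Admissible Q 𝓕 ξ Pi)
    (hPi : IsPoissonPointProcess Q 𝓕 ν ξ Pi) (hξ : Measurable ξ)
    (hσ : IsSolution C Q 𝓕 ν ξ Pi ρ₀ σ) (hρ₀ : IsStatOp ρ₀) :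
    ∃ (m r K : PredSpace (enlarge 𝓕 ξ hξ) → ℝ≥0∞) (j : U × PredSpace (enlarge 𝓕 ξ hξ) → ℝ≥0∞)
      (M : ℝ≥0 → ℝ≥0), IsMassProcess Q (enlarge 𝓕 ξ hξ) ν Pi
        (fun t ω => ENNReal.ofReal (density σ t ω)) m r K j M := by
  have hadapt : ∀ t a, Measurable[enlarge 𝓕 ξ hξ t] fun ω => trace (a * σ t ω) := fun t a =>
    (hσ.adapted t a).measurable.mono (le_enlarge hξ t) le_rfl
  have hc := hσ.isCadlagPath
  have hX := sotMeasurable_leftState (𝓖 := enlarge 𝓕 ξ hξ) hc hadapt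
  have hXt : ∀ x, IsTraceClass (leftState (enlarge 𝓕 ξ hξ) σ x) := fun x =>
    (hc x.outcome).traceClass_leftLim x.time
  have hbefore : Measurable fun x : PredSpace (enlarge 𝓕 ξ hξ) =>
      (Pi x.outcome).before x.time :=
    measurable_before_pred fun t => (hPi.adapted t).mono (le_enlarge hξ t) le_rfl
  have hnoise : Measurable fun x : PredSpace (enlarge 𝓕 ξ hξ) => ξ x.outcome :=
    PredSpace.measurable_initial (measurable_noise_enlarge hξ 0)
  have hRm : SOTMeasurable fun x : PredSpace (enlarge 𝓕 ξ hξ) =>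
      C.R x.time (ξ x.outcome) (Pi x.outcome) := by
    -- Replacing the trajectory by its strict past makes the coefficient a function of predictable
    -- data.
    simp only [hC.R_past _ _ (Pi _)]
    exact hC.sotMeasurable_R.comp (PredSpace.measurable_time.prodMk (hnoise.prodMk hbefore))
  have hjm : Measurable fun q : U × PredSpace (enlarge 𝓕 ξ hξ) =>
      C.jumpRate q.1 q.2.time (ξ q.2.outcome) (Pi q.2.outcome) (leftState _ σ q.2) := by
    simp only [hC.jumpRate_past _ _ _ (Pi _)]
    exact hC.measurable_jumpRate measurable_fst (PredSpace.measurable_time.comp measurable_snd)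
      (hnoise.comp measurable_snd) (hbefore.comp measurable_snd) (hX.comp measurable_snd)
      fun q => hXt q.2
  have hmm : Measurable fun x => (trace (leftState (enlarge 𝓕 ξ hξ) σ x)).re := by
    have := Complex.measurable_re.comp ((SOTMeasurable.const (1 : H →L[ℂ] H)).measurable_trace_mul
      hX hXt)
    simpa only [one_mul, Function.comp_def] using this
  have hpos := hσ.ae_isPositive hC hC' hPi hρ₀.1
  have hlj : ∀ᵐ ω ∂Q, ∀ s, ∫⁻ u, C.jumpRate u s (ξ ω) (Pi ω)
      (Function.leftLim (fun r => σ r ω) s) ∂ν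
      = ENNReal.ofReal (trace (C.R s (ξ ω) (Pi ω) * Function.leftLim (fun r => σ r ω) s)).re := by
    filter_upwards [hpos] with ω h s
    exact hC.lintegral_jumpRate s _ _ ((hc ω).traceClass_leftLim s)
      ((hc ω).leftLim_isPositive' h s)
  have hfinite : ∀ᵐ ω ∂Q, ∀ t, ∀ᵐ q ∂(Pi ω).meas.restrict (Ioc 0 t ×ˢ univ),
      C.jumpRate q.2 q.1 (ξ ω) (Pi ω) (Function.leftLim (fun r => σ r ω) q.1) ≠ ∞ :=
    hPi.ae_jump_ne_top hξ hjm (by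
      filter_upwards [hlj] with ω h s
      exact (h s).trans_ne ENNReal.ofReal_ne_top)
  refine ⟨fun x => ENNReal.ofReal (trace (leftState (enlarge 𝓕 ξ hξ) σ x)).re,
    fun x => ENNReal.ofReal (trace (C.R x.time (ξ x.outcome) (Pi x.outcome)
      * leftState (enlarge 𝓕 ξ hξ) σ x)).re,
    fun x => ENNReal.ofReal ‖C.R x.time (ξ x.outcome) (Pi x.outcome)‖,
    fun q => C.jumpRate q.1 q.2.time (ξ q.2.outcome) (Pi q.2.outcome) (leftState _ σ q.2),
    fun t => (hC'.R_bdd t).choose,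
    { adapted := fun t => ?_
      measurable_left := hmm.ennreal_ofReal
      measurable_rate := (Complex.measurable_re.comp
        (hRm.measurable_trace_mul hX hXt)).ennreal_ofReal
      measurable_bound := hRm.measurable_norm.ennreal_ofReal
      measurable_jump := hjm
      lintegral_jump := hlj
      rate_le := ?_
      bound_le := fun t => ?_
      initial := ?_
      equation := ?_
      bdd := fun ω t => ?_
      left_le := fun ω s c hs h => ?_
      left_eq := ?_ }⟩
  · have := hadapt t 1
    simp only [one_mul] at this
    exact (Complex.measurable_re.comp this).ennreal_ofReal
  · filter_upwards [hpos] with ω h s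
    rw [← ENNReal.ofReal_mul (norm_nonneg _)]
    exact ENNReal.ofReal_le_ofReal (hC.trace_R_mul_le s _ _ ((hc ω).traceClass_leftLim s)
      ((hc ω).leftLim_isPositive' h s))
  · filter_upwards [(hC'.R_bdd t).choose_spec] with ω h
    simp only [ofReal_norm]
    exact (lintegral_mono_set fun s hs => hs.2).trans h
  · filter_upwards [hσ.ae_isPathSol hC] with ω h
    rw [density, h.initial, hρ₀.2.2]
    simp
  · filter_upwards [hσ.ae_isPathSol hC, hpos, hfinite] with ω h1 h2 h3 s t hst
    exact h1.mass_equation hC h2 (hmm.comp (PredSpace.measurable_mk.comp measurable_prodMk_right))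
      h3 hst
  · obtain ⟨B, hB0, hB⟩ := (hc ω).bdd t
    refine ⟨B.toNNReal, fun s hs => ENNReal.ofReal_le_ofReal ?_⟩
    exact (Complex.re_le_norm _).trans (((hc ω).traceClass s).norm_trace_le_dualNorm.trans
      (hB s hs))
  · have h1 := ((hc ω).tendsto_leftLim hs 1).comp (tendsto_leftGrid hs)
    simp only [one_mul, Function.comp_def] at h1
    have h2 := ENNReal.tendsto_ofReal ((Complex.continuous_re.tendsto _).comp h1)
    refine le_of_tendsto' h2 fun n => ?_
    -- The left grid consists of rational points, so a bound at rational times before `s` passes to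
    -- the left limit.
    have e1 : ((((⌈((n : ℝ≥0) + 1) * s⌉₊ - 1 : ℕ) : ℚ≥0) / ((n : ℚ≥0) + 1) : ℚ≥0) : ℝ≥0)
        = leftGrid n s := by
      rw [leftGrid]
      generalize ⌈((n : ℝ≥0) + 1) * s⌉₊ - 1 = k
      push_cast
      rfl
    have h3 := h _ (e1.symm ▸ leftGrid_lt n hs)
    rwa [e1] at h3
  · filter_upwards [hσ.ae_isPathSol hC] with ω h s hs
    have := h.leftLim_eq hs
    simp only [leftState, density, PredSpace.time_mk, PredSpace.outcome_mk, this]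

end MassProcess

/-! ### The no-jump propagator -/

section Flow

variable {U E H ι₁ ι₂ : Type*} [MeasurableSpace U] [MeasurableSpace E] [NormedAddCommGroup H]
  [InnerProductSpace ℂ H] [CompleteSpace H] [TopologicalSpace.SeparableSpace H] [Countable ι₁]
  [Countable ι₂] {C : Coefficients U E H ι₁ ι₂} {ν : Measure U} [IsFiniteMeasure ν]
  {e : E} {π : Trajectory U} {t₀ : ℝ≥0} {s : ℝ≥0 → (H →L[ℂ] H) → (H →L[ℂ] H)}

/-- The functional `a ↦ Tr (a X)`, or zero if `X` is not of trace class. -/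
noncomputable def dualFunctional (X : H →L[ℂ] H) : (H →L[ℂ] H) →L[ℂ] ℂ :=
  open Classical in if h : IsTraceClass X then traceFunctional X h else 0

theorem IsTraceClass.dualFunctional_apply {X : H →L[ℂ] H} (h : IsTraceClass X)
    (a : H →L[ℂ] H) : dualFunctional X a = trace (a * X) := by
  rw [dualFunctional, dif_pos h, traceFunctional_apply]

theorem IsTraceClass.norm_dualFunctional {X : H →L[ℂ] H} (h : IsTraceClass X) :
    ‖dualFunctional X‖ = dualNorm X := by
  rw [dualFunctional, dif_pos h, h.dualNorm_eq]

/-- The maps `s t`, `t ≥ t₀`, propagate the no-jump equation along the trajectory `π`. -/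
def IsNoJumpFlow (C : Coefficients U E H ι₁ ι₂) (e : E) (π : Trajectory U) (t₀ : ℝ≥0)
    (s : ℝ≥0 → (H →L[ℂ] H) → (H →L[ℂ] H)) : Prop :=
  ∀ ρ, IsTraceClass ρ → ∀ t, t₀ ≤ t →
    IsTraceClass (s t ρ) ∧
    Tendsto (fun r => traceNorm (s r ρ - s t ρ)) (𝓝[Ici t₀] t) (𝓝 0) ∧
    ∀ a : H →L[ℂ] H,
      IntegrableOn (fun r => trace (a * C.noJumpGen r e π (s r ρ))) (Ioc t₀ t) leb ∧
      trace (a * s t ρ) = trace (a * ρ) + ∫ r in Ioc t₀ t, trace (a *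
        C.noJumpGen r e π (s r ρ)) ∂leb

theorem IsWeakSol.smul {T : ℝ≥0} {y : ℝ≥0 → ((H →L[ℂ] H) →L[ℂ] ℂ)}
    (h : IsWeakSol C e π t₀ T y) (c : ℂ) : IsWeakSol C e π t₀ T (fun t => c • y t) where
  bdd := by
    obtain ⟨B, hB⟩ := h.bdd
    refine ⟨‖c‖ * B, fun t ht => ?_⟩
    have := hB t ht
    rw [norm_smul]
    gcongr
  integrable a := (h.integrable a).const_mul c
  equation t ht a := by
    simp only [smul_apply, smul_eq_mul]
    rw [integral_const_mul, ← mul_add, ← h.equation t ht a]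

theorem IsWeakSol.congr_trajectory {T : ℝ≥0} {y : ℝ≥0 → ((H →L[ℂ] H) →L[ℂ] ℂ)}
    (hC : C.Regular ν) (h : IsWeakSol C e π t₀ T y) {π' : Trajectory U}
    (hπ : ∀ r ≤ T, π.before r = π'.before r) : IsWeakSol C e π' t₀ T y where
  bdd := h.bdd
  integrable a := (h.integrable a).congr_fun
    (fun r hr => by simp only [hC.noJumpDual_congr e (hπ r hr.2)]) measurableSet_Ioc
  equation t ht a := by
    rw [h.equation t ht a]
    congr 1
    exact setIntegral_congr_fun measurableSet_Ioc fun r hr => by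
      simp only [hC.noJumpDual_congr e (hπ r (hr.2.trans ht.2))]

namespace IsNoJumpFlow

variable (hs : IsNoJumpFlow C e π t₀ s) {ρ : H →L[ℂ] H} (hρ : IsTraceClass ρ) (hC : C.Regular ν)
  (hκ : ∀ T, IntegrableOn (fun r => C.genRate r e π) (Ioc t₀ T) leb)

include hs hρ

theorem traceClass {t : ℝ≥0} (ht : t₀ ≤ t) : IsTraceClass (s t ρ) := (hs ρ hρ t ht).1

theorem initial : s t₀ ρ = ρ := by
  refine eq_of_trace_rankOne_mul_eq fun v w => ?_
  simpa using ((hs ρ hρ t₀ le_rfl).2.2 (InnerProductSpace.rankOne ℂ w v)).2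

theorem bdd (T : ℝ≥0) : ∃ B : ℝ, ∀ t ∈ Icc t₀ T, dualNorm (s t ρ) ≤ B := by
  refine isCompact_Icc.induction_on (p := fun K => ∃ B : ℝ, ∀ t ∈ K, dualNorm (s t ρ) ≤ B)
    ⟨0, by simp⟩ (fun K L h ⟨B, hB⟩ => ⟨B, fun r hr => hB r (h hr)⟩)
    (fun K L ⟨B, hB⟩ ⟨B', hB'⟩ => ⟨max B B', fun r hr => hr.elim
      (fun hr => (hB r hr).trans (le_max_left _ _))
      (fun hr => (hB' r hr).trans (le_max_right _ _))⟩) fun t ht => ?_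
  -- The maps are known to be of trace class only from `t₀` on; the truncated time makes the family
  -- of trace class everywhere.
  have h1 : Tendsto (fun r => traceNorm (s (max t₀ r) ρ - s t ρ)) (𝓝[Ici t₀] t) (𝓝 0) := by
    refine (hs ρ hρ t ht.1).2.1.congr' ?_
    filter_upwards [self_mem_nhdsWithin] with r hr
    rw [max_eq_right hr]
  have h2 := eventually_dualNorm_le (fun r => traceClass hs hρ (le_max_left t₀ r))
    (traceClass hs hρ ht.1) h1
  refine ⟨_, nhdsWithin_mono t (fun r hr => hr.1) (h2.and self_mem_nhdsWithin),
    dualNorm (s t ρ) + 1, fun r hr => ?_⟩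
  have h3 := hr.1
  rwa [max_eq_right hr.2] at h3

include hC

theorem isWeakSol (T : ℝ≥0) : IsWeakSol C e π t₀ T (fun t => dualFunctional (s t ρ)) := by
  have e1 : ∀ a, ∀ r, t₀ ≤ r → trace (a * C.noJumpGen r e π (s r ρ))
      = dualFunctional (s r ρ) (C.noJumpDual r e π a) := fun a r hr => by
    rw [(traceClass hs hρ hr).dualFunctional_apply,
      hC.trace_mul_noJumpGen r e π (traceClass hs hρ hr)]
  refine ⟨?_, fun a => ?_, fun t ht a => ?_⟩
  · obtain ⟨B, hB⟩ := bdd hs hρ T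
    exact ⟨B, fun t ht => (traceClass hs hρ ht.1).norm_dualFunctional.trans_le (hB t ht)⟩
  · rcases le_or_gt t₀ T with hT | hT
    · exact ((hs ρ hρ T hT).2.2 a).1.congr_fun (fun r hr => e1 a r hr.1.le) measurableSet_Ioc
    · rw [Ioc_eq_empty (not_lt.2 hT.le)]
      exact integrableOn_empty
  · rw [(traceClass hs hρ ht.1).dualFunctional_apply, initial hs hρ, hρ.dualFunctional_apply,
      ((hs ρ hρ t ht.1).2.2 a).2]
    congr 1
    exact setIntegral_congr_fun measurableSet_Ioc fun r hr => e1 a r hr.1.le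

include hκ

theorem tendsto_picard {t : ℝ≥0} (ht : t₀ ≤ t) (a : H →L[ℂ] H) :
    Tendsto (fun n => picard C e π t₀ (fun b => trace (b * ρ)) n t a) atTop
      (𝓝 (trace (a * s t ρ))) := by
  rw [← (traceClass hs hρ ht).dualFunctional_apply]
  refine (isWeakSol hs hρ hC t).tendsto_picard hC (hκ t) hρ (fun b => ?_) ⟨ht, le_rfl⟩ a
  rw [initial hs hρ, hρ.dualFunctional_apply]

/-- The `limsup` is defined and measurable for all data, also where the iterates fail to converge;
this is how measurability of the propagator is obtained without assuming it. -/
theorem ofReal_trace {t : ℝ≥0} (ht : t₀ ≤ t) (a : H →L[ℂ] H) :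
    ENNReal.ofReal (trace (a * s t ρ)).re = limsup (fun n => ENNReal.ofReal
      (picard C e π t₀ (fun b => trace (b * ρ)) n t a).re) atTop :=
  (ENNReal.tendsto_ofReal ((Complex.continuous_re.tendsto _).comp
    (tendsto_picard hs hρ hC hκ ht a))).limsup_eq.symm

/-- Weak solutions are given by the propagator. -/
theorem apply_eq {T : ℝ≥0} {y : ℝ≥0 → ((H →L[ℂ] H) →L[ℂ] ℂ)} (hy : IsWeakSol C e π t₀ T y)
    (h₀ : ∀ a, y t₀ a = trace (a * ρ)) {t : ℝ≥0} (ht : t ∈ Icc t₀ T) (a : H →L[ℂ] H) :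
    y t a = trace (a * s t ρ) :=
  tendsto_nhds_unique (hy.tendsto_picard hC (hκ T) hρ h₀ ht a)
    (tendsto_picard hs hρ hC hκ ht.1 a)

/-- Linearity of the propagator is not part of its definition; homogeneity follows from uniqueness
of weak solutions. -/
theorem map_smul (c : ℂ) {t : ℝ≥0} (ht : t₀ ≤ t) : s t (c • ρ) = c • s t ρ := by
  refine eq_of_trace_rankOne_mul_eq fun v w => ?_
  rw [← apply_eq hs (hρ.smul c) hC hκ ((isWeakSol hs hρ hC t).smul c) (fun a => ?_) ⟨ht, le_rfl⟩]
  · rw [smul_apply, (traceClass hs hρ ht).dualFunctional_apply, mul_smul_comm, trace_smul]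
    rfl
  · rw [smul_apply, initial hs hρ, hρ.dualFunctional_apply, mul_smul_comm, trace_smul]
    rfl

theorem isPositive (hp : ρ.IsPositive) {t : ℝ≥0} (ht : t₀ ≤ t) : (s t ρ).IsPositive :=
  isPositive_of_weakSol hC (isWeakSol hs hρ hC t) ht (hκ t) hρ hp
    (fun a => by rw [initial hs hρ, hρ.dualFunctional_apply])
    fun a => (traceClass hs hρ ht).dualFunctional_apply a

omit hκ in
theorem trace_eq {t : ℝ≥0} (ht : t₀ ≤ t) :
    IntegrableOn (fun r => (trace (C.R r e π * s r ρ)).re) (Ioc t₀ t) leb ∧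
    (trace (s t ρ)).re = (trace ρ).re - ∫ r in Ioc t₀ t, (trace (C.R r e π * s r ρ)).re ∂leb := by
  obtain ⟨h1, h2⟩ := (isWeakSol hs hρ hC t).mass hC le_rfl ht le_rfl
  have e1 : ∀ r ∈ Ioc t₀ t, dualFunctional (s r ρ) (C.R r e π) = trace (C.R r e π * s r ρ) :=
    fun r hr => (traceClass hs hρ hr.1.le).dualFunctional_apply _
  rw [setIntegral_congr_fun measurableSet_Ioc e1, initial hs hρ, hρ.dualFunctional_apply,
    (traceClass hs hρ ht).dualFunctional_apply, one_mul, one_mul] at h2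
  have h1' := h1.congr_fun e1 measurableSet_Ioc
  have e2 : ∫ r in Ioc t₀ t, (trace (C.R r e π * s r ρ)).re ∂leb
      = (∫ r in Ioc t₀ t, trace (C.R r e π * s r ρ) ∂leb).re := integral_re h1'
  refine ⟨h1'.re, ?_⟩
  rw [e2, h2, Complex.sub_re]

theorem trace_le (hp : ρ.IsPositive) {t : ℝ≥0} (ht : t₀ ≤ t) :
    (trace (s t ρ)).re ≤ (trace ρ).re := by
  rw [(trace_eq hs hρ hC ht).2, sub_le_self_iff]
  exact setIntegral_nonneg measurableSet_Ioc fun r hr =>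
    ((traceClass hs hρ hr.1.le).trace_mul_nonneg (isPositive hs hρ hC hκ hp hr.1.le)
      (hC.R_isPositive r e π)).2

theorem trace_pos (hp : ρ.IsPositive) (h : 0 < (trace ρ).re) {t : ℝ≥0} (ht : t₀ ≤ t) :
    0 < (trace (s t ρ)).re := by
  have := (isWeakSol hs hρ hC t).mass_pos hC (hκ t)
    (fun a ha => by
      rw [initial hs hρ, hρ.dualFunctional_apply]
      exact (hρ.trace_mul_nonneg hp ha).2)
    (by rwa [initial hs hρ, hρ.dualFunctional_apply, one_mul]) (t := t) ⟨ht, le_rfl⟩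
  rwa [(traceClass hs hρ ht).dualFunctional_apply, one_mul] at this

end IsNoJumpFlow

/-- Between jumps the solution of the stochastic master equation is given by the propagator. -/
theorem IsPathSol.eq_flow (hC : C.Regular ν) {x : ℝ≥0 → (H →L[ℂ] H)} {ρ₀ : H →L[ℂ] H}
    (h : IsPathSol C ν e π ρ₀ x) (hs : IsNoJumpFlow C e (π.upTo t₀) t₀ s)
    (hκ : ∀ T, IntegrableOn (fun r => C.genRate r e (π.upTo t₀)) (Ioc t₀ T) leb) {t : ℝ≥0}
    (ht : t₀ ≤ t) (hπ : π.meas (Ioc t₀ t ×ˢ univ) = 0) :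
    s t (x t₀) = (Real.exp (-(ν.real univ * (t - t₀))) : ℂ) • x t := by
  have h1 := (h.isWeakSol hπ).congr_trajectory hC (π' := π.upTo t₀)
    fun r hr => (π.before_upTo_of_null hπ hr).symm
  refine eq_of_trace_rankOne_mul_eq fun v w => ?_
  rw [← hs.apply_eq (h.traceClass t₀) hC hκ h1 (fun a => by simp) ⟨ht, le_rfl⟩, smul_apply,
    traceFunctional_apply, mul_smul_comm, trace_smul]
  rfl

theorem tendsto_normalize {α : Type*} {l : Filter α} {f : α → (H →L[ℂ] H)} {X σv : H →L[ℂ] H}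
    (hf : Tendsto f l (𝓝 X)) (ht : Tendsto (fun r => (trace (f r)).re) l (𝓝 (trace X).re))
    (h : (trace X).re ≠ 0) : Tendsto (fun r => normalize σv (f r)) l (𝓝 (normalize σv X)) := by
  rw [normalize, if_pos h]
  refine ((ht.inv₀ h).smul hf).congr' ?_
  filter_upwards [ht.eventually_ne h] with r hr
  rw [normalize, if_pos hr]

theorem normalize_smul {c : ℝ} (hc : c ≠ 0) {σv X : H →L[ℂ] H} (h : (trace X).re ≠ 0) :
    normalize σv ((c : ℂ) • X) = normalize σv X := by
  have h1 : (trace ((c : ℂ) • X)).re = c * (trace X).re := by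
    rw [trace_smul, Complex.re_ofReal_mul]
  rw [normalize, normalize, if_pos h, if_pos (by rw [h1]; exact mul_ne_zero hc h), h1, mul_inv]
  ext v
  simp only [smul_apply]
  rw [← Complex.coe_smul, ← Complex.coe_smul, smul_smul]
  congr 1
  have h' : ((trace X).re : ℂ) ≠ 0 := Complex.ofReal_ne_zero.2 h
  have hc' : (c : ℂ) ≠ 0 := Complex.ofReal_ne_zero.2 hc
  push_cast
  field_simp

theorem trace_mul_normalize {σv X a : H →L[ℂ] H} (h : (trace X).re ≠ 0) :
    (trace (a * normalize σv X)).re * (trace X).re = (trace (a * X)).re := by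
  rw [normalize, if_pos h, ← Complex.coe_smul, mul_smul_comm, trace_smul, Complex.re_ofReal_mul,
    mul_right_comm, inv_mul_cancel₀ h, one_mul]

/-- As long as no jump occurs, the left limits of the normalized solution are given by the
propagator. -/
theorem IsPathSol.leftLim_normalize (hC : C.Regular ν) {x : ℝ≥0 → (H →L[ℂ] H)} {ρ₀ σv : H →L[ℂ] H}
    (h : IsPathSol C ν e π ρ₀ x) (hs : IsNoJumpFlow C e (π.upTo 0) 0 s)
    (hκ : ∀ T, IntegrableOn (fun r => C.genRate r e (π.upTo 0)) (Ioc 0 T) leb)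
    (hρ₀ : IsStatOp ρ₀) {t : ℝ≥0} (hπ : π.meas (Ioc 0 t ×ˢ univ) = 0) :
    Function.leftLim (fun r => normalize σv (x r)) t = normalize σv (s t ρ₀) := by
  have hpos : ∀ r, (trace (s r ρ₀)).re ≠ 0 := fun r =>
    (hs.trace_pos hρ₀.2.1 hC hκ hρ₀.1 (by simp [hρ₀.2.2]) zero_le).ne'
  -- Normalization removes the exponential factor between the solution and the propagator; neither
  -- trace vanishes, so `σv` does not enter.
  have h1 : ∀ r ≤ t, normalize σv (x r) = normalize σv (s r ρ₀) := fun r hr => by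
    have h2 := h.eq_flow hC hs hκ (zero_le : 0 ≤ r)
      (measure_mono_null (prod_mono_left (Ioc_subset_Ioc_right hr)) hπ)
    rw [h.initial] at h2
    have h3 := hpos r
    rw [h2, trace_smul, Complex.re_ofReal_mul] at h3
    rw [h2]
    exact (normalize_smul (Real.exp_ne_zero _) fun h4 => h3 (by rw [h4, mul_zero])).symm
  rcases eq_or_lt_of_le (zero_le : 0 ≤ t) with rfl | ht
  · rw [leftLim_zero, h1 0 le_rfl]
  have := nhdsLT_neBot ht
  refine leftLim_eq_of_tendsto ?_
  have h2 : Tendsto (fun r => traceNorm (s r ρ₀ - s t ρ₀)) (𝓝[<] t) (𝓝 0) := by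
    refine (hs ρ₀ hρ₀.2.1 t zero_le).2.1.mono_left (nhdsWithin_mono t fun r _ => mem_Ici.2 zero_le)
  have h3 := tendsto_trace_mul (fun r => hs.traceClass hρ₀.2.1 zero_le)
    (hs.traceClass hρ₀.2.1 zero_le) h2 1
  simp only [one_mul] at h3
  refine (tendsto_normalize (tendsto_of_traceNorm h2)
    ((Complex.continuous_re.tendsto _).comp h3) (hpos t)).congr' ?_
  filter_upwards [self_mem_nhdsWithin] with r hr
  exact (h1 r (le_of_lt hr)).symm

end Flow

/-! ### The random propagator -/

section RandomFlow

variable {Ω U E H ι₁ ι₂ : Type*} [mΩ : MeasurableSpace Ω] [MeasurableSpace U] [MeasurableSpace E]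
  [NormedAddCommGroup H]
  [InnerProductSpace ℂ H] [CompleteSpace H] [TopologicalSpace.SeparableSpace H] [Countable ι₁]
  [Countable ι₂] {C : Coefficients U E H ι₁ ι₂} {ν : Measure U} [IsFiniteMeasure ν]
  {Q : Measure Ω} [IsProbabilityMeasure Q] {𝓕 : Filtration ℝ≥0 mΩ} {ξ : Ω → E}
  {Pi : Ω → Trajectory U} {σ : ℝ≥0 → Ω → (H →L[ℂ] H)} {ρ₀ σv : H →L[ℂ] H}
  {S : ℝ≥0 → ℝ≥0 → Ω → (H →L[ℂ] H) → (H →L[ℂ] H)}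

theorem IsPoissonPointProcess.measurable_upTo_enlarge (hPi : IsPoissonPointProcess Q 𝓕 ν ξ Pi)
    (hξ : Measurable ξ) (t : ℝ≥0) : Measurable[enlarge 𝓕 ξ hξ t] fun ω => (Pi ω).upTo t :=
  (hPi.adapted t).mono (le_enlarge hξ t) le_rfl

theorem IsPoissonPointProcess.measurableSet_noJump_enlarge
    (hPi : IsPoissonPointProcess Q 𝓕 ν ξ Pi) (hξ : Measurable ξ) (s t : ℝ≥0) :
    MeasurableSet[enlarge 𝓕 ξ hξ t] {ω | (Pi ω).meas (Ioc s t ×ˢ univ) = 0} := by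
  have hm : MeasurableSet (Ioc s t ×ˢ (univ : Set U)) := measurableSet_Ioc.prod .univ
  have e : ∀ ω, (Pi ω).meas (Ioc s t ×ˢ univ) = ((Pi ω).upTo t).meas (Ioc s t ×ˢ univ) := by
    intro ω
    rw [Trajectory.upTo, Trajectory.restrictTime_meas _ _ _ hm, prod_inter_prod, univ_inter,
      inter_eq_left.2 Ioc_subset_Iic_self]
  simp only [e]
  exact ((measurable_meas hm).comp (hPi.measurable_upTo_enlarge hξ t))
    (measurableSet_singleton 0)

/-- The bounds are assumed for the true trajectory, not for the one frozen at `t₀`. On the event of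
no jump in `(t₀, t₀ + n]` the two have the same strict past, so there the integral is finite almost
surely. Infiniteness of the frozen integral is an event of the past at `t₀`, hence independent of
that no-jump event, which has positive probability; so it is null. -/
theorem Coefficients.Admissible.ae_integrableOn_genRate_upTo (hC : C.Regular ν)
    (hC' : C.Admissible Q 𝓕 ξ Pi) (hPi : IsPoissonPointProcess Q 𝓕 ν ξ Pi) (hξ : Measurable ξ)
    (t₀ : ℝ≥0) :
    ∀ᵐ ω ∂Q, ∀ T, IntegrableOn (fun s => C.genRate s (ξ ω) ((Pi ω).upTo t₀)) (Ioc t₀ T) leb := by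
  have hgm : Measurable fun q : ℝ≥0 × E × Trajectory U => ENNReal.ofReal
      (C.genRate q.1 q.2.1 q.2.2) :=
    (hC.measurable_genRate measurable_fst (measurable_fst.comp measurable_snd)
      (measurable_snd.comp measurable_snd)).ennreal_ofReal
  have hφ : Measurable[enlarge 𝓕 ξ hξ t₀] fun ω => (ξ ω, (Pi ω).upTo t₀) :=
    (measurable_noise_enlarge hξ t₀).prodMk (hPi.measurable_upTo_enlarge hξ t₀)
  have hn : ∀ n : ℕ, ∀ᵐ ω ∂Q, ∫⁻ s in Ioc t₀ (t₀ + n),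
      ENNReal.ofReal (C.genRate s (ξ ω) ((Pi ω).upTo t₀)) ∂leb ≠ ∞ := fun n => by
    have hI : Measurable fun y : E × Trajectory U =>
        ∫⁻ s in Ioc t₀ (t₀ + n), ENNReal.ofReal (C.genRate s y.1 y.2) ∂leb :=
      hgm.lintegral_prod_left'
    have hA := hI.comp hφ (measurableSet_singleton ∞)
    rw [ae_iff]
    simp only [not_not]
    refine hPi.measure_eq_zero_of_noJump hξ (le_add_of_nonneg_right zero_le : t₀ ≤ t₀ + n) hA ?_
    rw [measure_eq_zero_iff_ae_notMem]
    filter_upwards [hC'.ae_integrableOn_genRate hC] with ω hω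
    rintro ⟨h1, h2⟩
    have h3 : ∫⁻ s in Ioc t₀ (t₀ + n), ENNReal.ofReal
        (C.genRate s (ξ ω) ((Pi ω).upTo t₀)) ∂leb = ∞ := h1
    have h4 := Integrable.lintegral_lt_top
      ((hω (t₀ + n)).mono_set (Ioc_subset_Ioc_left (zero_le (a := t₀))))
    rw [setLIntegral_congr_fun measurableSet_Ioc fun s hs => by
      rw [hC.genRate_congr (ξ ω) ((Pi ω).before_upTo_of_null h2 hs.2)]] at h3
    exact h4.ne h3
  filter_upwards [ae_all_iff.2 hn] with ω hω T
  obtain ⟨n, hn⟩ := exists_nat_ge T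
  have hm : Measurable fun s => C.genRate s (ξ ω) ((Pi ω).upTo t₀) :=
    hC.measurable_genRate measurable_id measurable_const measurable_const
  have h1 : IntegrableOn (fun s => C.genRate s (ξ ω) ((Pi ω).upTo t₀)) (Ioc t₀ (t₀ + n)) leb := by
    refine ⟨hm.aestronglyMeasurable, ?_⟩
    rw [hasFiniteIntegral_iff_ofReal (ae_of_all _ fun s => C.genRate_nonneg s _ _)]
    exact (hω n).lt_top
  exact h1.mono_set (Ioc_subset_Ioc_right (hn.trans (le_add_of_nonneg_left zero_le)))

theorem Coefficients.Regular.measurable_limsup_picard (hC : C.Regular ν) (t₀ : ℝ≥0) {Y : Type*}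
    [MeasurableSpace Y] {s : Y → ℝ≥0} {e : Y → E} {π : Y → Trajectory U}
    {ρ a : Y → (H →L[ℂ] H)} (hs : Measurable s) (he : Measurable e) (hπ : Measurable π)
    (hρ : SOTMeasurable ρ) (hT : ∀ y, IsTraceClass (ρ y)) (ha : SOTMeasurable a) :
    Measurable fun y => limsup (fun n => ENNReal.ofReal
      (picard C (e y) (π y) t₀ (fun b => trace (b * ρ y)) n (s y) (a y)).re) atTop :=
  Measurable.limsup fun n =>
    (Complex.measurable_re.comp (hC.measurable_picard t₀ n hs he hπ hρ hT ha)).ennreal_ofReal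

theorem IsNoJumpPropagator.ae_isNoJumpFlow (hS : IsNoJumpPropagator C Q ξ Pi S) (t₀ : ℝ≥0) :
    ∀ᵐ ω ∂Q, IsNoJumpFlow C (ξ ω) ((Pi ω).upTo t₀) t₀ (fun t => S t t₀ ω) := hS t₀

theorem IsNoJumpPropagator.exists_measurable (hC : C.Regular ν)
    (hC' : C.Admissible Q 𝓕 ξ Pi) (hPi : IsPoissonPointProcess Q 𝓕 ν ξ Pi) (hξ : Measurable ξ)
    (hS : IsNoJumpPropagator C Q ξ Pi S) {t₀ t : ℝ≥0} (ht : t₀ ≤ t) {ρ : Ω → (H →L[ℂ] H)}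
    (hρ : ∀ w, StronglyMeasurable[enlarge 𝓕 ξ hξ t₀] fun ω => ρ ω w)
    (hT : ∀ ω, IsTraceClass (ρ ω)) :
    ∃ G : Ω → ℝ≥0∞, Measurable[enlarge 𝓕 ξ hξ t₀] G ∧
      ∀ᵐ ω ∂Q, ENNReal.ofReal (trace (S t t₀ ω (ρ ω))).re = G ω := by
  refine ⟨_, @Coefficients.Regular.measurable_limsup_picard U E H ι₁ ι₂ _ _ _ _ _ _ _ _ C ν _ hC
    t₀ Ω (enlarge 𝓕 ξ hξ t₀) (fun _ => t) ξ (fun ω => (Pi ω).upTo t₀) ρ (fun _ => 1)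
    measurable_const (measurable_noise_enlarge hξ t₀) (hPi.measurable_upTo_enlarge hξ t₀) hρ hT
    (fun w => stronglyMeasurable_const), ?_⟩
  filter_upwards [hS.ae_isNoJumpFlow t₀, hC'.ae_integrableOn_genRate_upTo hC hPi hξ t₀] with ω h1 h2
  rw [← h1.ofReal_trace (hT ω) hC h2 ht 1, one_mul]

theorem IsSolution.measurable_inner (hσ : IsSolution C Q 𝓕 ν ξ Pi ρ₀ σ) (t : ℝ≥0) (v w : H) :
    Measurable[𝓕 t] fun ω => (inner ℂ v (σ t ω w) : ℂ) := by
  simp only [← trace_rankOne_mul]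
  exact (hσ.adapted t _).measurable

theorem IsSolution.measurable_density (hσ : IsSolution C Q 𝓕 ν ξ Pi ρ₀ σ) (t : ℝ≥0) :
    Measurable[𝓕 t] (density σ t) := by
  have := (hσ.adapted t 1).measurable
  simp only [one_mul] at this
  exact Complex.measurable_re.comp this

theorem IsSolution.stronglyMeasurable_apply (hσ : IsSolution C Q 𝓕 ν ξ Pi ρ₀ σ) (t : ℝ≥0) (w : H) :
    StronglyMeasurable[𝓕 t] fun ω => σ t ω w :=
  @stronglyMeasurable_of_inner H _ _ _ _ Ω (𝓕 t) _ fun v => hσ.measurable_inner t v w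

theorem IsSolution.stronglyMeasurable_condState (hσ : IsSolution C Q 𝓕 ν ξ Pi ρ₀ σ) (t : ℝ≥0)
    (w : H) : StronglyMeasurable[𝓕 t] fun ω => condState σv σ t ω w := by
  classical
  have e : ∀ ω, condState σv σ t ω w = if density σ t ω ≠ 0
      then (density σ t ω)⁻¹ • σ t ω w else σv w := fun ω => by
    unfold condState normalize
    rw [density]
    split_ifs <;> rfl
  simp only [e]
  refine StronglyMeasurable.ite ?_ ?_ stronglyMeasurable_const
  · exact (hσ.measurable_density t (measurableSet_singleton 0)).compl
  · exact (hσ.measurable_density t).inv.stronglyMeasurable.smul (hσ.stronglyMeasurable_apply t w)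

theorem normalize_isStatOp {X : H →L[ℂ] H} (hX : IsTraceClass X) (hp : X.IsPositive)
    (hσv : IsStatOp σv) : IsStatOp (normalize σv X) := by
  rw [normalize]
  split_ifs with h
  · have h0 := hX.trace_re_nonneg hp
    rw [← Complex.coe_smul]
    refine ⟨hp.smul_of_nonneg ?_, hX.smul _, ?_⟩
    · exact_mod_cast inv_nonneg.2 h0.2
    · rw [trace_smul]
      nth_rw 2 [h0.1]
      rw [← Complex.ofReal_mul, inv_mul_cancel₀ h, Complex.ofReal_one]
  · exact hσv

theorem isTraceClass_normalize {X : H →L[ℂ] H} (hX : IsTraceClass X) (hσv : IsStatOp σv) :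
    IsTraceClass (normalize σv X) := by
  rw [normalize]
  split_ifs
  exacts [by rw [← Complex.coe_smul]; exact hX.smul _, hσv.2.1]

/-- When the trace vanishes, `Tr(|v⟩⟨v| X)` is squeezed between zero and a multiple of `Tr X`, so `X
= 0` and the default state is multiplied by zero. -/
theorem IsTraceClass.eq_smul_normalize {X : H →L[ℂ] H} (hX : IsTraceClass X) (hp : X.IsPositive) :
    X = ((trace X).re : ℂ) • normalize σv X := by
  by_cases h : (trace X).re = 0
  · rw [h, Complex.ofReal_zero, zero_smul]
    refine ContinuousLinearMap.coe_inj.1 ((inner_map_self_eq_zero _).1 fun v => ?_)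
    have h1 := hX.trace_mul_nonneg hp (rankOne_self_isPositive v)
    have h2 := hX.trace_mul_le hp (isPositive_opNorm_sub (rankOne_self_isPositive v) le_rfl)
    rw [IsTraceClass.trace_smul_mul, one_mul, Complex.re_ofReal_mul, h, mul_zero] at h2
    rw [le_antisymm h2 h1.2, trace_rankOne_mul] at h1
    rw [ContinuousLinearMap.coe_coe, ← inner_conj_symm, h1.1]
    simp
  · rw [normalize, if_pos h, ← Complex.coe_smul, smul_smul, ← Complex.ofReal_mul,
      mul_inv_cancel₀ h, Complex.ofReal_one, one_smul]

end RandomFlow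

/-! ### No-jump probabilities -/

section NoJumpProbability

variable {Ω U E H ι₁ ι₂ : Type*} [mΩ : MeasurableSpace Ω] [MeasurableSpace U] [MeasurableSpace E]
  [NormedAddCommGroup H]
  [InnerProductSpace ℂ H] [CompleteSpace H] [TopologicalSpace.SeparableSpace H] [Countable ι₁]
  [Countable ι₂] {C : Coefficients U E H ι₁ ι₂} {ν : Measure U} [IsFiniteMeasure ν]
  {Q : Measure Ω} [IsProbabilityMeasure Q] {𝓕 : Filtration ℝ≥0 mΩ} {ξ : Ω → E}
  {Pi : Ω → Trajectory U} {σ : ℝ≥0 → Ω → (H →L[ℂ] H)} {ρ₀ σv : H →L[ℂ] H}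
  {S : ℝ≥0 → ℝ≥0 → Ω → (H →L[ℂ] H) → (H →L[ℂ] H)}

variable (hC : C.Regular ν) (hC' : C.Admissible Q 𝓕 ξ Pi)
  (hPi : IsPoissonPointProcess Q 𝓕 ν ξ Pi) (hξ : Measurable ξ)
  (hσ : IsSolution C Q 𝓕 ν ξ Pi ρ₀ σ) (hρ₀ : IsStatOp ρ₀) (hσv : IsStatOp σv)
  (hS : IsNoJumpPropagator C Q ξ Pi S)

/-! ### The physical probability -/

section PhysProb

include hσ

theorem IsSolution.measurable_ofReal_density (t : ℝ≥0) :
    Measurable fun ω => ENNReal.ofReal (density σ t ω) :=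
  ((hσ.measurable_density t).mono (𝓕.le t) le_rfl).ennreal_ofReal

include hC hC' hPi hξ hρ₀

theorem IsSolution.setLIntegral_density {s t : ℝ≥0} (hst : s ≤ t) {F : Set Ω}
    (hF : MeasurableSet[enlarge 𝓕 ξ hξ s] F) :
    ∫⁻ ω in F, ENNReal.ofReal (density σ t ω) ∂Q = ∫⁻ ω in F, ENNReal.ofReal (density σ s ω) ∂Q := by
  obtain ⟨m, r, K, j, M, hp⟩ := hσ.exists_isMassProcess hC hC' hPi hξ hρ₀
  exact hp.setLIntegral_eq_of_le hPi hst hF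

theorem IsSolution.physProb_eq {t T : ℝ≥0} (ht : t ≤ T) {F : Set Ω}
    (hF : MeasurableSet[enlarge 𝓕 ξ hξ t] F) :
    physProb Q σ T F = ∫⁻ ω in F, ENNReal.ofReal (density σ t ω) ∂Q := by
  rw [physProb, withDensity_apply _ ((enlarge 𝓕 ξ hξ).le t F hF),
    hσ.setLIntegral_density hC hC' hPi hξ hρ₀ ht hF]

theorem IsSolution.isProbabilityMeasure_physProb (T : ℝ≥0) :
    IsProbabilityMeasure (physProb Q σ T) := by
  obtain ⟨m, r, K, j, M, hp⟩ := hσ.exists_isMassProcess hC hC' hPi hξ hρ₀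
  exact ⟨by rw [physProb, withDensity_apply _ .univ, setLIntegral_univ, hp.lintegral_eq_one hPi]⟩

end PhysProb

include hC hC' hPi hξ hσ hS

theorem IsSolution.exists_measurable_flow {t₀ t : ℝ≥0} (ht : t₀ ≤ t) :
    ∃ G : Ω → ℝ≥0∞, Measurable[enlarge 𝓕 ξ hξ t₀] G ∧
      ∀ᵐ ω ∂Q, ENNReal.ofReal (trace (S t t₀ ω (σ t₀ ω))).re = G ω :=
  hS.exists_measurable hC hC' hPi hξ ht
    (fun w => (hσ.stronglyMeasurable_apply t₀ w).mono (le_enlarge hξ t₀))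
    fun ω => hσ.traceClass t₀ ω

/-- On the no-jump event `p(t) = e^c Tr S(t,t₀)[σ(t₀)]` with `c = ν(U)(t - t₀)`. The right side is,
up to a null set, a function of the past at `t₀`, and the event is independent of it with
probability `e^{-c}`, so the exponentials cancel. -/
theorem IsSolution.setLIntegral_density_noJump {t₀ t : ℝ≥0} (ht : t₀ ≤ t) {F : Set Ω}
    (hF : MeasurableSet[enlarge 𝓕 ξ hξ t₀] F) :
    ∫⁻ ω in F ∩ {ω | (Pi ω).meas (Ioc t₀ t ×ˢ univ) = 0}, ENNReal.ofReal (density σ t ω) ∂Q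
      = ∫⁻ ω in F, ENNReal.ofReal (trace (S t t₀ ω (σ t₀ ω))).re ∂Q := by
  obtain ⟨G, hG, hGe⟩ := hσ.exists_measurable_flow hC hC' hPi hξ hS ht
  set c := ν.real univ * ((t : ℝ) - t₀) with hc
  have hNJ := hPi.measurableSet_noJump t₀ t
  have hF' := (enlarge 𝓕 ξ hξ).le t₀ F hF
  have h1 : ∀ᵐ ω ∂Q, ω ∈ {ω | (Pi ω).meas (Ioc t₀ t ×ˢ univ) = 0} →
      F.indicator (fun ω => ENNReal.ofReal (density σ t ω)) ω
        = F.indicator (fun ω => ENNReal.ofReal (Real.exp c) * G ω) ω := by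
    filter_upwards [hσ.ae_isPathSol hC, hS.ae_isNoJumpFlow t₀,
      hC'.ae_integrableOn_genRate_upTo hC hPi hξ t₀, hGe] with ω h1 h2 h3 h4 h5
    by_cases hω : ω ∈ F
    · rw [indicator_of_mem hω, indicator_of_mem hω, ← h4, h1.eq_flow hC h2 h3 ht h5, trace_smul,
        Complex.re_ofReal_mul, ENNReal.ofReal_mul (Real.exp_pos _).le, ← mul_assoc,
        ← ENNReal.ofReal_mul (Real.exp_pos _).le, ← Real.exp_add, add_neg_cancel, Real.exp_zero,
        ENNReal.ofReal_one, one_mul, density]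
    · rw [indicator_of_notMem hω, indicator_of_notMem hω]
  rw [← setLIntegral_indicator hF',
    setLIntegral_congr_fun_ae hNJ h1,
    hPi.lintegral_mul_noJump hξ ht (X := F.indicator fun ω => ENNReal.ofReal (Real.exp c) * G ω)
      ((measurable_const.mul hG).indicator hF),
    lintegral_indicator hF', lintegral_const_mul _ (hG.mono ((enlarge 𝓕 ξ hξ).le t₀) le_rfl),
    mul_comm, ← mul_assoc, ← ENNReal.ofReal_mul (Real.exp_pos _).le, ← Real.exp_add,
    neg_add_cancel, Real.exp_zero, ENNReal.ofReal_one, one_mul]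
  exact lintegral_congr_ae (ae_restrict_of_ae (hGe.mono fun ω h => h.symm))

include hρ₀

theorem IsSolution.physProb_noJump {t₀ t T : ℝ≥0} (ht : t₀ ≤ t) (hT : t ≤ T) {F : Set Ω}
    (hF : MeasurableSet[enlarge 𝓕 ξ hξ t₀] F) :
    physProb Q σ T (F ∩ {ω | (Pi ω).meas (Ioc t₀ t ×ˢ univ) = 0})
      = ∫⁻ ω in F, ENNReal.ofReal (trace (S t t₀ ω (σ t₀ ω))).re ∂Q := by
  rw [hσ.physProb_eq hC hC' hPi hξ hρ₀ hT, hσ.setLIntegral_density_noJump hC hC' hPi hξ hS ht hF]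
  exact ((enlarge 𝓕 ξ hξ).mono ht F hF).inter (hPi.measurableSet_noJump_enlarge hξ t₀ t)

include hσv

theorem IsSolution.ae_trace_flow_condState {t₀ t : ℝ≥0} (ht : t₀ ≤ t) :
    ∀ᵐ ω ∂Q, 0 ≤ (trace (S t t₀ ω (condState σv σ t₀ ω))).re ∧
      (trace (S t t₀ ω (condState σv σ t₀ ω))).re ≤ 1 ∧
      ENNReal.ofReal (trace (S t t₀ ω (σ t₀ ω))).re = ENNReal.ofReal (density σ t₀ ω)
        * ENNReal.ofReal (trace (S t t₀ ω (condState σv σ t₀ ω))).re := by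
  filter_upwards [hσ.ae_isPositive hC hC' hPi hρ₀.1, hS.ae_isNoJumpFlow t₀,
      hC'.ae_integrableOn_genRate_upTo hC hPi hξ t₀] with ω h1 h2 h3
  have hX := hσ.traceClass t₀ ω
  have hρ : IsStatOp (condState σv σ t₀ ω) := normalize_isStatOp hX (h1 t₀) hσv
  refine ⟨?_, ?_, ?_⟩
  · exact ((h2.traceClass hρ.2.1 ht).trace_re_nonneg (h2.isPositive hρ.2.1 hC h3 hρ.1 ht)).2
  · have := h2.trace_le hρ.2.1 hC h3 hρ.1 ht
    rwa [hρ.2.2, Complex.one_re] at this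
  · have h4 : σ t₀ ω = (density σ t₀ ω : ℂ) • condState σv σ t₀ ω :=
      hX.eq_smul_normalize (h1 t₀)
    conv_lhs => rw [h4, h2.map_smul hρ.2.1 hC h3 _ ht, trace_smul, Complex.re_ofReal_mul]
    exact ENNReal.ofReal_mul (hX.trace_re_nonneg (h1 t₀)).2

theorem IsSolution.integrable_flow {t₀ t : ℝ≥0} (ht : t₀ ≤ t) :
    Integrable (fun ω => (trace (S t t₀ ω (condState σv σ t₀ ω))).re) Q := by
  have h := hσ.ae_trace_flow_condState hC hC' hPi hξ hρ₀ hσv hS ht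
  obtain ⟨G, hG, hGe⟩ := hS.exists_measurable hC hC' hPi hξ ht (ρ := condState σv σ t₀)
    (fun w => (hσ.stronglyMeasurable_condState t₀ w).mono (le_enlarge hξ t₀))
    fun ω => isTraceClass_normalize (hσ.traceClass t₀ ω) hσv
  refine Integrable.of_bound ⟨fun ω => (G ω).toReal,
    (hG.mono ((enlarge 𝓕 ξ hξ).le t₀) le_rfl).ennreal_toReal.stronglyMeasurable, ?_⟩ 1 ?_
  · filter_upwards [h, hGe] with ω h1 h2
    rw [← h2, ENNReal.toReal_ofReal h1.1]
  · filter_upwards [h] with ω h1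
    rw [Real.norm_of_nonneg h1.1]
    exact h1.2.1

/-- The conditional probability of having no jump. -/
theorem IsSolution.condExp_noJump {t₀ t T : ℝ≥0} (ht : t₀ ≤ t) (hT : t ≤ T) :
    (physProb Q σ T)⟦{ω | (Pi ω).meas (Ioc t₀ t ×ˢ univ) = 0}|𝓕 t₀⟧ =ᵐ[physProb Q σ T]
      Q[fun ω => (trace (S t t₀ ω (condState σv σ t₀ ω))).re|𝓕 t₀] := by
  have := hσ.isProbabilityMeasure_physProb hC hC' hPi hξ hρ₀ T
  have hX := hσ.integrable_flow hC hC' hPi hξ hρ₀ hσv hS ht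
  have hX1 := hσ.ae_trace_flow_condState hC hC' hPi hξ hρ₀ hσv hS ht
  set X : Ω → ℝ := fun ω => (trace (S t t₀ ω (condState σv σ t₀ ω))).re with hXdef
  set g : Ω → ℝ := Q[X|𝓕 t₀] with hg
  have hm := 𝓕.le t₀
  have hgm : StronglyMeasurable[𝓕 t₀] g := stronglyMeasurable_condExp
  have hgm' : Measurable[𝓕 t₀] fun ω => ENNReal.ofReal (g ω) := hgm.measurable.ennreal_ofReal
  have hg0 : 0 ≤ᵐ[Q] g := condExp_nonneg (hX1.mono fun ω h => h.1)
  have hg1 : g ≤ᵐ[Q] fun _ => 1 := by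
    have h := condExp_mono (m := 𝓕 t₀) hX (integrable_const (1 : ℝ)) (hX1.mono fun ω h => h.2.1)
    rwa [condExp_const hm] at h
  have hac : physProb Q σ T ≪ Q := withDensity_absolutelyContinuous _ _
  have hNJ := hPi.measurableSet_noJump t₀ t
  have hdm : ∀ s, Measurable[𝓕 s] fun ω => ENNReal.ofReal (density σ s ω) := fun s =>
    (hσ.measurable_density s).ennreal_ofReal
  have hgX : ∀ F, MeasurableSet[𝓕 t₀] F →
      ∫⁻ ω in F, ENNReal.ofReal (g ω) ∂Q = ∫⁻ ω in F, ENNReal.ofReal (X ω) ∂Q := fun F hF => by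
    rw [← ofReal_integral_eq_lintegral_ofReal integrable_condExp.integrableOn
        (ae_restrict_of_ae hg0),
      ← ofReal_integral_eq_lintegral_ofReal hX.integrableOn
        (ae_restrict_of_ae (hX1.mono fun ω h => h.1)), setIntegral_condExp hm hX hF]
  have hgi : Integrable g (physProb Q σ T) := by
    refine Integrable.of_bound (hgm.mono hm).aestronglyMeasurable 1 (hac.ae_le ?_)
    filter_upwards [hg0, hg1] with ω h0 h1
    rwa [Real.norm_of_nonneg h0]
  -- The density is pulled back from `T` to `t₀` by the martingale property; the weight `p(t₀) 1_F`
  -- is known at `t₀`, so `g` may be replaced by `X`; and `p(t₀) X = Tr S(t,t₀)[σ(t₀)]` by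
  -- homogeneity.
  have key : ∀ F, MeasurableSet[𝓕 t₀] F → ∫⁻ ω in F, ENNReal.ofReal (g ω) ∂physProb Q σ T
      = physProb Q σ T (F ∩ {ω | (Pi ω).meas (Ioc t₀ t ×ˢ univ) = 0}) := fun F hF => by
    have hF' := hm F hF
    have hFe := le_enlarge (𝓕 := 𝓕) hξ t₀ F hF
    have hgF : Measurable[𝓕 t₀] (F.indicator fun ω => ENNReal.ofReal (g ω)) := hgm'.indicator hF
    calc ∫⁻ ω in F, ENNReal.ofReal (g ω) ∂physProb Q σ T
        = ∫⁻ ω, F.indicator (fun ω => ENNReal.ofReal (g ω)) ω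
            * ENNReal.ofReal (density σ T ω) ∂Q := by
          rw [← lintegral_indicator hF', physProb, lintegral_withDensity_eq_lintegral_mul _
            (hσ.measurable_ofReal_density T) (hgF.mono hm le_rfl)]
          exact lintegral_congr fun ω => mul_comm _ _
      _ = ∫⁻ ω, F.indicator (fun ω => ENNReal.ofReal (g ω)) ω
            * ENNReal.ofReal (density σ t₀ ω) ∂Q :=
          lintegral_mul_eq_of_setLIntegral_eq hm (hσ.measurable_ofReal_density T).aemeasurable
            (hσ.measurable_ofReal_density t₀).aemeasurable
            (fun A hA => hσ.setLIntegral_density hC hC' hPi hξ hρ₀ (ht.trans hT)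
              (le_enlarge hξ t₀ A hA)) hgF
      _ = ∫⁻ ω, F.indicator (fun ω => ENNReal.ofReal (density σ t₀ ω)) ω
            * ENNReal.ofReal (g ω) ∂Q := by
          refine lintegral_congr fun ω => ?_
          by_cases h : ω ∈ F
          · simp only [indicator_of_mem h, mul_comm]
          · simp only [indicator_of_notMem h, zero_mul]
      _ = ∫⁻ ω, F.indicator (fun ω => ENNReal.ofReal (density σ t₀ ω)) ω
            * ENNReal.ofReal (X ω) ∂Q :=
          lintegral_mul_eq_of_setLIntegral_eq hm (hgm'.mono hm le_rfl).aemeasurable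
            hX.aemeasurable.ennreal_ofReal hgX ((hdm t₀).indicator hF)
      _ = ∫⁻ ω in F, ENNReal.ofReal (trace (S t t₀ ω (σ t₀ ω))).re ∂Q := by
          rw [← lintegral_indicator hF']
          refine lintegral_congr_ae ?_
          filter_upwards [hX1] with ω h1
          by_cases h : ω ∈ F
          · simp only [indicator_of_mem h]
            exact h1.2.2.symm
          · simp only [indicator_of_notMem h, zero_mul]
      _ = _ := (hσ.physProb_noJump hC hC' hPi hξ hρ₀ hS ht hT hFe).symm
  refine (ae_eq_condExp_of_forall_setIntegral_eq hm ((integrable_const 1).indicator hNJ)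
    (fun F _ _ => hgi.integrableOn) (fun F hF _ => ?_) hgm.aestronglyMeasurable).symm
  rw [setIntegral_indicator hNJ, setIntegral_const, smul_eq_mul, mul_one,
    integral_eq_lintegral_of_nonneg_ae (ae_restrict_of_ae (hac.ae_le hg0))
      (hgm.mono hm).aestronglyMeasurable, key F hF, measureReal_def]

end NoJumpProbability

/-! ### The waiting time -/

section FirstJump

variable {U : Type*} [MeasurableSpace U]

theorem Trajectory.count_eq_zero_iff (π : Trajectory U) (t : ℝ≥0) :
    π.count t = 0 ↔ π.meas (Iic t ×ˢ univ) = 0 := by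
  rw [Trajectory.count, ENNReal.toReal_eq_zero_iff, or_iff_left (π.meas_Iic_lt_top t).ne]

theorem Trajectory.Iic_prod_eq {s t : ℝ≥0} (hst : s ≤ t) :
    Iic t ×ˢ (univ : Set U) = Iic s ×ˢ univ ∪ Ioc s t ×ˢ univ := by
  rw [← union_prod, Iic_union_Ioc_eq_Iic hst]

theorem Trajectory.count_sub_eq_zero_iff (π : Trajectory U) {s t : ℝ≥0} (hst : s ≤ t) :
    π.count t - π.count s = 0 ↔ π.meas (Ioc s t ×ˢ univ) = 0 := by
  have h : π.meas (Iic t ×ˢ univ) = π.meas (Iic s ×ˢ univ) + π.meas (Ioc s t ×ˢ univ) := by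
    rw [Trajectory.Iic_prod_eq hst, measure_union _ (measurableSet_Ioc.prod .univ)]
    exact disjoint_left.2 fun _ h1 h2 => absurd h1.1 (not_le.2 h2.1.1)
  rw [Trajectory.count, Trajectory.count, h,
    ENNReal.toReal_add (π.meas_Iic_lt_top s).ne (π.meas_Ioc_lt_top s t).ne, add_sub_cancel_left,
    ENNReal.toReal_eq_zero_iff, or_iff_left (π.meas_Ioc_lt_top s t).ne]

/-- Without a jump up to `t` there is none up to some strictly later time either, so the infimum
lies strictly beyond `t`. -/
theorem Trajectory.firstJump_le_iff (π : Trajectory U) (t : ℝ≥0) :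
    π.firstJump ≤ t ↔ π.count t ≠ 0 := by
  refine ⟨fun h h0 => ?_, fun h => iInf₂_le t h⟩
  obtain ⟨t', ht', h1⟩ := π.exists_noJump_right (show t < t + 1 from lt_add_one t)
  have h2 : π.meas (Iic t' ×ˢ univ) = 0 := by
    rw [Trajectory.Iic_prod_eq ht'.1.le]
    exact measure_union_null ((π.count_eq_zero_iff t).1 h0) h1
  have h3 : (t' : ℝ≥0∞) ≤ π.firstJump := le_iInf₂ fun r hr => by
    by_contra! h4
    exact hr ((π.count_eq_zero_iff r).2 (measure_mono_null
      (prod_mono_left (Iic_subset_Iic.2 (by exact_mod_cast h4.le))) h2))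
  exact absurd (h3.trans h) (not_le.2 (by exact_mod_cast ht'.1))

end FirstJump

/-- The Lebesgue differentiation theorem on the time half line. -/
theorem ae_hasDerivAt_of_setIntegral_leb {f : ℝ≥0 → ℝ} {T : ℝ≥0}
    (hf : IntegrableOn f (Ioc 0 T) leb) {g : ℝ → ℝ}
    (hg : ∀ r : ℝ≥0, r ≤ T → g r = ∫ s in Ioc 0 r, f s ∂leb) :
    ∀ᵐ t : ℝ, 0 < t → t < T → HasDerivAt g (f t.toNNReal) t := by
  have hT : (0 : ℝ) ≤ T := T.2
  have hint : IntervalIntegrable (fun x : ℝ => f x.toNNReal) volume 0 T := by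
    rw [intervalIntegrable_iff_integrableOn_Ioc_of_le hT]
    have h := measurableEmbedding_nnreal_coe.integrableOn_map_iff (μ := leb)
      (f := fun x : ℝ => f x.toNNReal) (s := Ioc 0 (T : ℝ))
    have e : ((↑) : ℝ≥0 → ℝ) ⁻¹' Ioc 0 (T : ℝ) = Ioc 0 T := by ext; simp
    have e' : (fun x : ℝ => f x.toNNReal) ∘ ((↑) : ℝ≥0 → ℝ) = f := by ext; simp
    rw [e, e', map_coe_leb, IntegrableOn, Measure.restrict_restrict measurableSet_Ioc,
      inter_eq_left.2 (show Ioc 0 (T : ℝ) ⊆ Ici 0 from fun x hx => le_of_lt hx.1)] at h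
    exact h.2 hf
  filter_upwards [hint.ae_hasDerivAt_integral] with t ht h0 h1
  have htI : t ∈ uIcc 0 (T : ℝ) := by
    rw [uIcc_of_le hT]
    exact ⟨h0.le, h1.le⟩
  refine (ht htI 0 left_mem_uIcc).congr_of_eventuallyEq ?_
  filter_upwards [Ioo_mem_nhds h0 h1] with r hr
  lift r to ℝ≥0 using hr.1.le
  rw [hg r (by exact_mod_cast hr.2.le), intervalIntegral.integral_of_le (NNReal.coe_nonneg r),
    ← NNReal.coe_zero, ← setIntegral_leb (fun x : ℝ => f x.toNNReal) 0 r]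
  simp

/-! ### Survival probability and density of the waiting time -/

section WaitingTime

variable {Ω U E H ι₁ ι₂ : Type*} [mΩ : MeasurableSpace Ω] [MeasurableSpace U] [MeasurableSpace E]
  [NormedAddCommGroup H]
  [InnerProductSpace ℂ H] [CompleteSpace H] [TopologicalSpace.SeparableSpace H] [Countable ι₁]
  [Countable ι₂] {C : Coefficients U E H ι₁ ι₂} {ν : Measure U} [IsFiniteMeasure ν]
  {Q : Measure Ω} [IsProbabilityMeasure Q] {𝓕 : Filtration ℝ≥0 mΩ} {ξ : Ω → E}
  {Pi : Ω → Trajectory U} {σ : ℝ≥0 → Ω → (H →L[ℂ] H)} {ρ₀ σv : H →L[ℂ] H}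
  {S : ℝ≥0 → ℝ≥0 → Ω → (H →L[ℂ] H) → (H →L[ℂ] H)}

variable (hC : C.Regular ν) (hC' : C.Admissible Q 𝓕 ξ Pi)
  (hPi : IsPoissonPointProcess Q 𝓕 ν ξ Pi) (hξ : Measurable ξ)
  (hσ : IsSolution C Q 𝓕 ν ξ Pi ρ₀ σ) (hρ₀ : IsStatOp ρ₀) (hσv : IsStatOp σv)
  (hS : IsNoJumpPropagator C Q ξ Pi S)

include hC hC' hPi hξ hρ₀ hS

theorem IsNoJumpPropagator.ae_survival (t : ℝ≥0) :
    ∀ᵐ ω ∂Q, 0 ≤ (trace (S t 0 ω ρ₀)).re ∧ (trace (S t 0 ω ρ₀)).re ≤ 1 := by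
  filter_upwards [hS.ae_isNoJumpFlow 0, hC'.ae_integrableOn_genRate_upTo hC hPi hξ 0] with ω h2 h3
  have h1 := h2.trace_pos hρ₀.2.1 hC h3 hρ₀.1 (by simp [hρ₀.2.2]) (zero_le : 0 ≤ t)
  have h4 := h2.trace_le hρ₀.2.1 hC h3 hρ₀.1 (zero_le : 0 ≤ t)
  rw [hρ₀.2.2, Complex.one_re] at h4
  exact ⟨h1.le, h4⟩

theorem IsNoJumpPropagator.integrable_survival (t : ℝ≥0) :
    Integrable (fun ω => (trace (S t 0 ω ρ₀)).re) Q := by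
  have h := hS.ae_survival hC hC' hPi hξ hρ₀ t
  obtain ⟨G, hG, hGe⟩ := hS.exists_measurable hC hC' hPi hξ (zero_le : 0 ≤ t) (ρ := fun _ => ρ₀)
    (fun w => stronglyMeasurable_const) fun _ => hρ₀.2.1
  refine Integrable.of_bound ⟨fun ω => (G ω).toReal,
    (hG.mono ((enlarge 𝓕 ξ hξ).le 0) le_rfl).ennreal_toReal.stronglyMeasurable, ?_⟩ 1 ?_
  · filter_upwards [h, hGe] with ω h1 h2
    rw [← h2, ENNReal.toReal_ofReal h1.1]
  · filter_upwards [h] with ω h1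
    rw [Real.norm_of_nonneg h1.1]
    exact h1.2

include hσ in
theorem IsSolution.physProb_survival {t T : ℝ≥0} (hT : t ≤ T) :
    (physProb Q σ T).real {ω | (Pi ω).count t = 0} = ∫ ω, (trace (S t 0 ω ρ₀)).re ∂Q := by
  -- Counting includes time zero while the no-jump event concerns `(0, t]`; a jump at time zero has
  -- probability zero under `Q`, hence also under the physical probability.
  have h1 : (physProb Q σ T) {ω | (Pi ω).count t = 0}
      = physProb Q σ T (univ ∩ {ω | (Pi ω).meas (Ioc 0 t ×ˢ univ) = 0}) := by
    refine (withDensity_absolutelyContinuous _ _).ae_eq ?_ |> measure_congr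
    rw [univ_inter]
    filter_upwards [hPi.ae_meas_zero] with ω hω
    refine propext ?_
    change (Pi ω).count t = 0 ↔ (Pi ω).meas (Ioc 0 t ×ˢ univ) = 0
    rw [← (Pi ω).count_sub_eq_zero_iff (zero_le : 0 ≤ t), (Pi ω).count_eq_zero_iff 0 |>.2, sub_zero]
    rwa [show Iic (0 : ℝ≥0) = {0} from Iic_bot]
  rw [measureReal_def, h1, hσ.physProb_noJump hC hC' hPi hξ hρ₀ hS zero_le hT MeasurableSet.univ,
    setLIntegral_univ, integral_eq_lintegral_of_nonneg_ae
      ((hS.ae_survival hC hC' hPi hξ hρ₀ t).mono fun ω h => h.1)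
      (hS.integrable_survival hC hC' hPi hξ hρ₀ t).aestronglyMeasurable]
  congr 1
  refine lintegral_congr_ae ?_
  filter_upwards [hσ.ae_isPathSol hC] with ω h
  rw [h.initial]

include hσ in
theorem IsSolution.ae_intensity_eq (t : ℝ≥0) :
    ∀ᵐ ω ∂Q, (Pi ω).count t = 0 →
      intensity C ξ Pi σv σ t ω = noJumpIntensity C ξ Pi S σv ρ₀ t ω := by
  filter_upwards [hσ.ae_isPathSol hC, hS.ae_isNoJumpFlow 0,
    hC'.ae_integrableOn_genRate_upTo hC hPi hξ 0] with ω h1 h2 h3 h4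
  have h5 : (Pi ω).meas (Ioc 0 t ×ˢ univ) = 0 :=
    measure_mono_null (prod_mono_left Ioc_subset_Iic_self) (((Pi ω).count_eq_zero_iff t).1 h4)
  rw [intensity, noJumpIntensity]
  simp only [condState]
  rw [h1.leftLim_normalize hC h2 h3 hρ₀ h5,
    hC.R_congr (ξ ω) ((Pi ω).before_upTo_of_null h5 le_rfl)]

omit hξ in
/-- The joint law of the intensity and of the survival probability. -/
theorem IsNoJumpPropagator.exists_measurable_rate (hξ : Measurable ξ) :
    ∃ G : ℝ≥0 × Ω → ℝ≥0∞, Measurable G ∧ ∀ᵐ ω ∂Q,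
      (∀ t, 0 ≤ noJumpIntensity C ξ Pi S σv ρ₀ t ω * (trace (S t 0 ω ρ₀)).re ∧
        ENNReal.ofReal (noJumpIntensity C ξ Pi S σv ρ₀ t ω * (trace (S t 0 ω ρ₀)).re) = G (t, ω)) ∧
      ∀ t, ∫⁻ s in Ioc 0 t, G (s, ω) ∂leb = ENNReal.ofReal (1 - (trace (S t 0 ω ρ₀)).re) := by
  have hπ : Measurable fun q : ℝ≥0 × Ω => (Pi q.2).upTo 0 :=
    ((hPi.adapted 0).mono (𝓕.le 0) le_rfl).comp measurable_snd
  have hξ' : Measurable fun q : ℝ≥0 × Ω => ξ q.2 := hξ.comp measurable_snd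
  have hR : SOTMeasurable fun q : ℝ≥0 × Ω => C.R q.1 (ξ q.2) ((Pi q.2).upTo 0) :=
    hC.sotMeasurable_R.comp (measurable_fst.prodMk (hξ'.prodMk hπ))
  -- The product of intensity and survival trace is `Tr(R S)`, so the iterates are tested with `R`
  -- itself; this version is jointly measurable in time and `ω`, as Tonelli requires.
  refine ⟨_, hC.measurable_limsup_picard 0 (s := fun q : ℝ≥0 × Ω => q.1) measurable_fst hξ' hπ
    (SOTMeasurable.const ρ₀) (fun _ => hρ₀.2.1) hR, ?_⟩
  filter_upwards [hS.ae_isNoJumpFlow 0, hC'.ae_integrableOn_genRate_upTo hC hPi hξ 0] with ω h2 h3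
  have hr0 : ∀ t, 0 ≤ (trace (C.R t (ξ ω) ((Pi ω).upTo 0) * S t 0 ω ρ₀)).re := fun t =>
    ((h2.traceClass hρ₀.2.1 zero_le).trace_mul_nonneg (h2.isPositive hρ₀.2.1 hC h3 hρ₀.1 zero_le)
      (hC.R_isPositive t _ _)).2
  have e1 : ∀ t, noJumpIntensity C ξ Pi S σv ρ₀ t ω * (trace (S t 0 ω ρ₀)).re
      = (trace (C.R t (ξ ω) ((Pi ω).upTo 0) * S t 0 ω ρ₀)).re := fun t =>
    trace_mul_normalize
      (h2.trace_pos hρ₀.2.1 hC h3 hρ₀.1 (by simp [hρ₀.2.2]) (zero_le : 0 ≤ t)).ne'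
  have e2 := fun t : ℝ≥0 => h2.ofReal_trace hρ₀.2.1 hC h3 (zero_le : 0 ≤ t)
    (C.R t (ξ ω) ((Pi ω).upTo 0))
  refine ⟨fun t => ⟨(hr0 t).trans_eq (e1 t).symm, ?_⟩, fun t => ?_⟩
  · rw [e1]
    exact e2 t
  · simp only [← e2]
    obtain ⟨h4, h5⟩ := h2.trace_eq hρ₀.2.1 hC (zero_le : 0 ≤ t)
    rw [← ofReal_integral_eq_lintegral_ofReal h4 (ae_of_all _ hr0), h5, hρ₀.2.2, Complex.one_re,
      sub_sub_cancel]

/-- The density of the waiting time. -/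
theorem IsNoJumpPropagator.waitingTime :
    (∀ᵐ t ∂leb, Integrable (fun ω => noJumpIntensity C ξ Pi S σv ρ₀ t ω
      * (trace (S t 0 ω ρ₀)).re) Q) ∧
    ∀ t, IntegrableOn (fun s => ∫ ω, noJumpIntensity C ξ Pi S σv ρ₀ s ω
        * (trace (S s 0 ω ρ₀)).re ∂Q) (Ioc 0 t) leb ∧
      ∫ s in Ioc 0 t, (∫ ω, noJumpIntensity C ξ Pi S σv ρ₀ s ω
        * (trace (S s 0 ω ρ₀)).re ∂Q) ∂leb = 1 - ∫ ω, (trace (S t 0 ω ρ₀)).re ∂Q := by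
  obtain ⟨G, hG, hGe⟩ := hS.exists_measurable_rate hC hC' hPi hρ₀ hξ (σv := σv)
  set r : ℝ≥0 → Ω → ℝ := fun t ω =>
    noJumpIntensity C ξ Pi S σv ρ₀ t ω * (trace (S t 0 ω ρ₀)).re with hr
  have hrG : ∀ t, (fun ω => (G (t, ω)).toReal) =ᵐ[Q] r t := fun t => by
    filter_upwards [hGe] with ω h
    rw [← (h.1 t).2, ENNReal.toReal_ofReal (h.1 t).1]
  have hGt : ∀ t, Measurable fun ω => G (t, ω) := fun t => hG.comp measurable_prodMk_left
  set F : ℝ≥0 → ℝ≥0∞ := fun t => ∫⁻ ω, G (t, ω) ∂Q with hF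
  have hFm : Measurable F := hG.lintegral_prod_right'
  have hFr : ∀ t, ∫ ω, r t ω ∂Q = (F t).toReal := fun t => by
    rw [integral_eq_lintegral_of_nonneg_ae (hGe.mono fun ω h => (h.1 t).1)
      ((hGt t).ennreal_toReal.aestronglyMeasurable.congr (hrG t))]
    congr 1
    exact lintegral_congr_ae (hGe.mono fun ω h => (h.1 t).2)
  -- Tonelli reduces the claim to the pathwise balance, in which the integrated rate is the mass
  -- lost since time zero.
  have hFi : ∀ t, ∫⁻ s in Ioc 0 t, F s ∂leb
      = ∫⁻ ω, ENNReal.ofReal (1 - (trace (S t 0 ω ρ₀)).re) ∂Q := fun t => by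
    rw [hF, lintegral_lintegral_swap (f := fun s ω => G (s, ω)) hG.aemeasurable]
    exact lintegral_congr_ae (hGe.mono fun ω h => h.2 t)
  have hs := hS.ae_survival hC hC' hPi hξ hρ₀
  have hsi := hS.integrable_survival hC hC' hPi hξ hρ₀
  have hFi' : ∀ t, ∫⁻ s in Ioc 0 t, F s ∂leb
      = ENNReal.ofReal (1 - ∫ ω, (trace (S t 0 ω ρ₀)).re ∂Q) := fun t => by
    have h1 : Integrable (fun ω => 1 - (trace (S t 0 ω ρ₀)).re) Q :=
      (integrable_const 1).sub (hsi t)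
    rw [hFi, ← ofReal_integral_eq_lintegral_ofReal h1
      ((hs t).mono fun ω h => sub_nonneg.2 h.2), integral_sub (integrable_const 1) (hsi t)]
    simp
  have hFt : ∀ t, ∫⁻ s in Ioc 0 t, F s ∂leb ≠ ∞ := fun t => by
    rw [hFi']
    exact ENNReal.ofReal_ne_top
  have hFa : ∀ t, ∀ᵐ s ∂leb.restrict (Ioc 0 t), F s < ∞ := fun t => ae_lt_top hFm (hFt t)
  refine ⟨?_, fun t => ?_⟩
  · have h1 : ∀ᵐ s ∂leb, ∀ n : ℕ, s ∈ Ioc 0 (n : ℝ≥0) → F s < ∞ :=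
      ae_all_iff.2 fun n => (ae_restrict_iff' measurableSet_Ioc).1 (hFa n)
    have h0 : ∀ᵐ s ∂leb, s ≠ 0 := by
      rw [ae_iff]
      simp
    filter_upwards [h1, h0] with s h1 h0
    obtain ⟨n, hn⟩ := exists_nat_ge s
    exact (integrable_toReal_of_lintegral_ne_top (hGt s).aemeasurable
      (h1 n ⟨pos_iff_ne_zero.2 h0, hn⟩).ne).congr (hrG s)
  · change IntegrableOn (fun s => ∫ ω, r s ω ∂Q) _ _ ∧ ∫ s in Ioc 0 t, (∫ ω, r s ω ∂Q) ∂leb = _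
    simp only [hFr]
    refine ⟨integrable_toReal_of_lintegral_ne_top hFm.aemeasurable (hFt t), ?_⟩
    rw [integral_toReal hFm.aemeasurable (hFa t), hFi', ENNReal.toReal_ofReal]
    refine sub_nonneg.2 ((integral_mono_ae (hsi t) (integrable_const 1)
      ((hs t).mono fun ω h => h.2)).trans_eq ?_)
    simp

include hσ in
theorem IsSolution.physProb_firstJump_le (t T : ℝ≥0) :
    (physProb Q σ T).real {ω | (Pi ω).firstJump ≤ t}
      = 1 - (physProb Q σ T).real {ω | (Pi ω).count t = 0} := by
  have := hσ.isProbabilityMeasure_physProb hC hC' hPi hξ hρ₀ T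
  have hm : MeasurableSet {ω | (Pi ω).count t = 0} := by
    simp only [Trajectory.count_eq_zero_iff]
    exact ((measurable_meas (measurableSet_Iic.prod .univ)).comp hPi.measurable)
      (measurableSet_singleton 0)
  rw [← probReal_compl_eq_one_sub hm]
  congr 1
  ext ω
  exact (Pi ω).firstJump_le_iff t

end WaitingTime

end JumpSME

/-! ### Assembly of the theorem -/

theorem mainTheorem2
    {Ω U E H ι₁ ι₂ : Type*} [mΩ : MeasurableSpace Ω]
    [TopologicalSpace U] [T2Space U] [LocallyCompactSpace U] [SecondCountableTopology U]
    [MeasurableSpace U] [BorelSpace U] [MeasurableSpace E]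
    [NormedAddCommGroup H] [InnerProductSpace ℂ H] [CompleteSpace H]
    [TopologicalSpace.SeparableSpace H] [Countable ι₁] [Countable ι₂]
    (Q : Measure Ω) [IsProbabilityMeasure Q] (𝓕 : Filtration ℝ≥0 mΩ)
    (hQ : JumpSME.UsualHypotheses Q 𝓕)
    (ν : Measure U) [IsFiniteMeasure ν] (hν : 0 < ν univ)
    (ξ : Ω → E) (hξ : Measurable ξ) (Pi : Ω → JumpSME.Trajectory U)
    (hPi : JumpSME.IsPoissonPointProcess Q 𝓕 ν ξ Pi)
    (C : JumpSME.Coefficients U E H ι₁ ι₂) (hC : C.Regular ν) (hC' : C.Admissible Q 𝓕 ξ Pi)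
    (ρ₀ σv : H →L[ℂ] H) (hρ₀ : JumpSME.IsStatOp ρ₀) (hσv : JumpSME.IsStatOp σv)
    (σ : ℝ≥0 → Ω → (H →L[ℂ] H)) (hσ : JumpSME.IsSolution C Q 𝓕 ν ξ Pi ρ₀ σ)
    (S : ℝ≥0 → ℝ≥0 → Ω → (H →L[ℂ] H) → (H →L[ℂ] H))
    (hS : JumpSME.IsNoJumpPropagator C Q ξ Pi S) :
    let P : ℝ≥0 → Measure Ω := JumpSME.physProb Q σ
    let N : ℝ≥0 → Ω → ℝ := fun t ω => (Pi ω).count t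
    let ρ : ℝ≥0 → Ω → (H →L[ℂ] H) := JumpSME.condState σv σ
    let W : Ω → ℝ≥0∞ := fun ω => (Pi ω).firstJump
    let lam : ℝ≥0 → Ω → ℝ := JumpSME.noJumpIntensity C ξ Pi S σv ρ₀
    let surv : ℝ≥0 → Ω → ℝ := fun t ω => (JumpSME.trace (S t 0 ω ρ₀)).re
    let f : ℝ≥0 → ℝ := fun t => ∫ ω, lam t ω * surv t ω ∂Q
    -- `P T` is a probability measure, with `P T F = E_Q[p(t) 1_F]` for `F ∈ 𝓕 t`, `t ≤ T`
    (∀ T, IsProbabilityMeasure (P T) ∧ ∀ t, t ≤ T → ∀ F, MeasurableSet[𝓕 t] F →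
      P T F = ∫⁻ ω in F, ENNReal.ofReal (JumpSME.density σ t ω) ∂Q) ∧
    -- no-jump probability in `(0, t]`
    (∀ t T, t ≤ T → Integrable (surv t) Q ∧
      (P T).real {ω | N t ω = 0} = ∫ ω, surv t ω ∂Q) ∧
    -- conditional no-jump probability in `(t₀, t]`
    (∀ t₀ t T, t₀ ≤ t → t ≤ T →
      Integrable (fun ω => (JumpSME.trace (S t t₀ ω (ρ t₀ ω))).re) Q ∧
      (P T)⟦{ω | N t ω - N t₀ ω = 0}|𝓕 t₀⟧ =ᵐ[P T]
        Q[fun ω => (JumpSME.trace (S t t₀ ω (ρ t₀ ω))).re|𝓕 t₀]) ∧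
    -- the intensity used in the density is `λ(t)` as long as no jump has occurred
    (∀ t, ∀ᵐ ω ∂Q, N t ω = 0 → JumpSME.intensity C ξ Pi σv σ t ω = lam t ω) ∧
    -- law of the waiting time
    (∀ᵐ t ∂JumpSME.leb, Integrable (fun ω => lam t ω * surv t ω) Q) ∧
    (∀ t T, t ≤ T →
      (P T).real {ω | W ω ≤ t} = 1 - (P T).real {ω | N t ω = 0} ∧
      IntegrableOn f (Ioc 0 t) JumpSME.leb ∧
      (P T).real {ω | W ω ≤ t} = ∫ s in Ioc 0 t, f s ∂JumpSME.leb) ∧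
    (∀ T : ℝ≥0, ∀ᵐ t : ℝ, 0 < t → t < T →
      HasDerivAt (fun r : ℝ => (P T).real {ω | W ω ≤ ENNReal.ofReal r}) (f t.toNNReal) t) := by
  intro P N ρ W lam surv f
  have hfirst : ∀ t T, t ≤ T → (P T).real {ω | W ω ≤ t} = 1 - (P T).real {ω | N t ω = 0} ∧
      (P T).real {ω | W ω ≤ t} = ∫ s in Ioc 0 t, f s ∂JumpSME.leb := fun t T hT => by
    have h1 := hσ.physProb_firstJump_le hC hC' hPi hξ hρ₀ hS t T
    refine ⟨h1, h1.trans ?_⟩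
    rw [hσ.physProb_survival hC hC' hPi hξ hρ₀ hS hT]
    exact ((hS.waitingTime hC hC' hPi hξ hρ₀).2 t).2.symm
  have hfi : ∀ t, IntegrableOn f (Ioc 0 t) JumpSME.leb := fun t =>
    ((hS.waitingTime hC hC' hPi hξ hρ₀).2 t).1
  refine ⟨fun T => ⟨hσ.isProbabilityMeasure_physProb hC hC' hPi hξ hρ₀ T, fun t ht F hF =>
      hσ.physProb_eq hC hC' hPi hξ hρ₀ ht (JumpSME.le_enlarge hξ t F hF)⟩,
    fun t T hT => ⟨hS.integrable_survival hC hC' hPi hξ hρ₀ t,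
      hσ.physProb_survival hC hC' hPi hξ hρ₀ hS hT⟩,
    fun t₀ t T ht hT => ⟨hσ.integrable_flow hC hC' hPi hξ hρ₀ hσv hS ht, ?_⟩,
    hσ.ae_intensity_eq hC hC' hPi hξ hρ₀ hS,
    (hS.waitingTime hC hC' hPi hξ hρ₀).1,
    fun t T hT => ⟨(hfirst t T hT).1, hfi t, (hfirst t T hT).2⟩,
    fun T => JumpSME.ae_hasDerivAt_of_setIntegral_leb (hfi T) fun r hr => ?_⟩
  · have h := hσ.condExp_noJump hC hC' hPi hξ hρ₀ hσv hS ht hT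
    simp only [← JumpSME.Trajectory.count_sub_eq_zero_iff _ ht] at h
    exact h
  · rw [ENNReal.ofReal_coe_nnreal]
    exact (hfirst r T hr).2
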